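/- Setting. Let $K,n,m$ be natural numbers with $n\ge 1$, let $P_0$ be a probability measure on $\mathbb{R}^K$ with bounded support $S$ and second moment matrix $\rho=\mathbb{E}_{P_0}[W_0W_0^\intercal]$, let $P_A$ be a probability measure on $\mathbb{R}$, $\Delta>0$, and let $\varphi_{\rm out}:\mathbb{R}^K\times\mathbb{R}\to\mathbb{R}$ be bounded, measurable, and $\mathcal{C}^2$ in its first argument with bounded first and second derivatives in that argument. Put $P_{\rm out}(y|x)=\frac{1}{\sqrt{2\pi\Delta}}\int dP_A(a)\,e^{-\frac{1}{2\Delta}(y-\varphi_{\rm out}(x,a))^2}$. Let $\mathcal{M}$ be the set of real symmetric $K\times K$ matrices with all eigenvalues in $[1,2]$; integrals $d\epsilon$ are with respect to Lebesgue measure in the entries on and above the diagonal. For $s_n\in(0,1/2]$ and $\epsilon=(\epsilon_1,\epsilon_2)\in(s_n\mathcal{M})^2$ consider interpolation functions $r(\cdot,\epsilon),q(\cdot,\epsilon)$ on $[0,1]$, integrable in $t$, with $r(t,\epsilon)$, $q(t,\epsilon)$ and $\rho-q(t,\epsilon)$ symmetric positive semidefinite and with the entries of $r$ bounded in absolute value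 by a number $B$, and set $$R_1(t,\epsilon)=\epsilon_1+\int_0^t r(v,\epsilon)\,dv,\qquad R_2(t,\epsilon)=\epsilon_2+\int_0^t q(v,\epsilon)\,dv .$$ Let the rows $\underline W_i^*$ ($1\le i\le n$) be i.i.d. $\sim P_0$, let $X\in\mathbb{R}^{m\times n}$ and $\underline V_\mu,\underline U^*_\mu,\underline Z'_i\in\mathbb{R}^K$ have i.i.d. $\mathcal{N}(0,1)$ entries, all independent, and put $$\underline S_{t,\mu}=\sqrt{\tfrac{1-t}{n}}\sum_{i=1}^nX_{\mu i}\underline W_i^*+\sqrt{R_2(t,\epsilon)}\,\underline V_\mu+\sqrt{t\rho-R_2(t,\epsilon)+2s_nI}\;\underline U_\mu^* .$$ Observe $Y_{t,\mu}\sim P_{\rm out}(\cdot|\underline S_{t,\mu})$ for $1\le\mu\le m$, and $\underline Y'_{t,i}=\sqrt{R_1(t,\epsilon)}\,\underline W_i^*+\underline Z'_i$ for $1\le i\le n$. Let $\langle\cdot\rangle_{n,t,\epsilon}$ be the expectation over $(w,u)$ under the posterior given $(Y_t,Y_t',X,V)$, whose density with respect to $P_0^{\otimes n}(dw)\otimes\mathcal{N}(0,I)(du)$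 is proportional to $\prod_{i}e^{-\frac12\|\underline Y'_{t,i}-\sqrt{R_1}\,\underline w_i\|^2}\prod_{\mu}P_{\rm out}(Y_{t,\mu}|\underline s_{t,\mu})$, where $\underline s_{t,\mu}$ is $\underline S_{t,\mu}$ with $(W^*,U^*)$ replaced by $(w,u)$. The overlap is the $K\times K$ matrix $Q_{ll'}=\frac1n\sum_{i=1}^nW^*_{il}w_{il'}$. Proposition (Overlap concentration). Let $K$, $\varphi_{\rm out}$, a bounded set $S$ and $\alpha>0$ be given. There is a constant $C=C(\varphi_{\rm out},S,K,\alpha)>0$, depending only on these, such that for all $\Delta>0$ and $B$ there are a sequence $s_n\in(0,1/2]$ with $s_n\to0$ and a constant $\gamma>0$ with the following property. For all $P_0$ with support $S$, all $P_A$, all $n\ge1$ and $m\le\alpha n$ (in particular $m=\alpha n$), and all interpolation functions $r,q$ as above (with $r$ bounded by $B$) such that for every $t\in(0,1)$ the map $\epsilon\in(s_n\mathcal{M})^2\mapsto(R_1(t,\epsilon),R_2(t,\epsilon))$ is a $\mathcal{C}^1$ diffeomorphism onto its image with Jacobian determinant at least $1$, the function $(\epsilon,t)\mapsto\mathbb{E}\langle\|Q-\mathbb{E}\langle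 Q\rangle_{n,t,\epsilon}\|_{\rm F}^2\rangle_{n,t,\epsilon}$ is integrable on $(s_n\mathcal{M})^2\times[0,1]$ and $$\frac{1}{\mathrm{Vol}(s_n\mathcal{M})^2}\int_{(s_n\mathcal{M})^2}d\epsilon\int_0^1dt\;\mathbb{E}\big\langle\|Q-\mathbb{E}\langle Q\rangle_{n,t,\epsilon}\|_{\rm F}^2\big\rangle_{n,t,\epsilon}\le\frac{C}{n^{\gamma}} .$$ -/

import Mathlib

open MeasureTheory ProbabilityTheory Set Filter Topology
open scoped Matrix Pointwise

noncomputable section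

/-- The index set of the entries on and above the diagonal of a `K × K` matrix. -/
abbrev UpperIdx (K : ℕ) : Type := {p : Fin K × Fin K // p.1 ≤ p.2}

/-- The vector space of real symmetric `K × K` matrices, in the coordinates given by the entries on
and above the diagonal.  Its Lebesgue measure is the product of the Lebesgue measures of these
coordinates. -/
abbrev SymMat (K : ℕ) : Type := UpperIdx K → ℝ

/-- The symmetric matrix with the given entries on and above the diagonal. -/
def SymMat.toMatrix {K : ℕ} (v : SymMat K) : Matrix (Fin K) (Fin K) ℝ :=
  Matrix.of fun i j => if h : i ≤ j then v ⟨(i, j), h⟩ else v ⟨(j, i), le_of_not_ge h⟩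

/-- The symmetric matrices whose eigenvalues all lie in `[1, 2]`, that is `I ≤ A ≤ 2 I` in the
positive semidefinite order. -/
def spectralBox (K : ℕ) : Set (SymMat K) :=
  {v | (v.toMatrix - 1).PosSemidef ∧ ((2 : ℝ) • (1 : Matrix (Fin K) (Fin K) ℝ) - v.toMatrix).PosSemidef}

/-- The set `(s ℳ)²` of perturbations `ε = (ε₁, ε₂)`, where `ℳ` is `spectralBox K`. -/
def perturbationSet (K : ℕ) (s : ℝ) : Set (SymMat K × SymMat K) :=
  (s • spectralBox K) ×ˢ (s • spectralBox K)

/-- The square root of a positive semidefinite matrix (functional calculus). -/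
def psdSqrt {K : ℕ} (A : Matrix (Fin K) (Fin K) ℝ) : Matrix (Fin K) (Fin K) ℝ :=
  cfc Real.sqrt A

/-- The activation is measurable, bounded, and twice continuously differentiable in its first
argument with bounded first and second derivatives. -/
def RegularActivation {K : ℕ} (φ : (Fin K → ℝ) → ℝ → ℝ) : Prop :=
  Measurable (Function.uncurry φ) ∧
  (∀ a, ContDiff ℝ 2 (fun x => φ x a)) ∧
  ∃ L : ℝ, ∀ x a, |φ x a| ≤ L ∧ ‖fderiv ℝ (fun x => φ x a) x‖ ≤ L ∧
    ‖iteratedFDeriv ℝ 2 (fun x => φ x a) x‖ ≤ L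

/-- The density `P_out(y | x)` of `φ(x, A) + √Δ Z`, where `A ∼ PA` and `Z ∼ 𝒩(0,1)`. -/
def outputKernel {K : ℕ} (φ : (Fin K → ℝ) → ℝ → ℝ) (Δ : ℝ) (PA : Measure ℝ) (y : ℝ)
    (x : Fin K → ℝ) : ℝ :=
  (Real.sqrt (2 * Real.pi * Δ))⁻¹ * ∫ a, Real.exp (-(y - φ x a) ^ 2 / (2 * Δ)) ∂PA

/-- The second moment matrix `ρ = 𝔼[W₀ W₀ᵀ]` of the prior. -/
def secondMoment {K : ℕ} (P0 : Measure (Fin K → ℝ)) : Matrix (Fin K) (Fin K) ℝ :=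
  Matrix.of fun i j => ∫ w, w i * w j ∂P0

/-- Families of `N` vectors in `ℝᴷ`, i.e. `N × K` matrices given by their rows. -/
abbrev Rows (N K : ℕ) : Type := Fin N → Fin K → ℝ

/-- The law of a matrix with i.i.d. standard Gaussian entries. -/
def gaussianRows (N K : ℕ) : Measure (Rows N K) :=
  Measure.pi fun _ => Measure.pi fun _ => gaussianReal 0 1

/-- The vector `s_{t,μ}` (or `S_{t,μ}` when `w`, `u` are the hidden `W*`, `U*`):
`√((1-t)/n) ∑ᵢ X_{μ i} wᵢ + √R₂ V_μ + √(t ρ - R₂ + 2 s I) u_μ`. -/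
def preActivation {n m K : ℕ} (P0 : Measure (Fin K → ℝ)) (s t : ℝ) (R2 : SymMat K)
    (X : Rows m n) (V : Rows m K) (w : Rows n K) (u : Rows m K) (μ : Fin m) : Fin K → ℝ :=
  Real.sqrt ((1 - t) / n) • (∑ i, X μ i • w i)
    + psdSqrt R2.toMatrix *ᵥ V μ
    + psdSqrt (t • secondMoment P0 - R2.toMatrix + (2 * s) • (1 : Matrix (Fin K) (Fin K) ℝ)) *ᵥ u μ

/-- All the independent sources of randomness `(W*, U*, X, V, A, Z, Z')` of the interpolating
observation model. -/
abbrev Disorder (n m K : ℕ) : Type :=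
  Rows n K × Rows m K × Rows m n × Rows m K × (Fin m → ℝ) × (Fin m → ℝ) × Rows n K

namespace Disorder

variable {n m K : ℕ}

def Wstar (ω : Disorder n m K) : Rows n K := ω.1
def Ustar (ω : Disorder n m K) : Rows m K := ω.2.1
def X (ω : Disorder n m K) : Rows m n := ω.2.2.1
def V (ω : Disorder n m K) : Rows m K := ω.2.2.2.1
def A (ω : Disorder n m K) : Fin m → ℝ := ω.2.2.2.2.1
def Z (ω : Disorder n m K) : Fin m → ℝ := ω.2.2.2.2.2.1
def Z' (ω : Disorder n m K) : Rows n K := ω.2.2.2.2.2.2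

end Disorder

/-- The law of the disorder: the rows of `W*` are i.i.d. `P0`, the `A_μ` are i.i.d. `PA`, and
`U*`, `X`, `V`, `Z`, `Z'` have i.i.d. standard Gaussian entries, all independent. -/
def disorderLaw (n m K : ℕ) (P0 : Measure (Fin K → ℝ)) (PA : Measure ℝ) :
    Measure (Disorder n m K) :=
  (Measure.pi fun _ => P0).prod <| (gaussianRows m K).prod <| (gaussianRows m n).prod <|
    (gaussianRows m K).prod <| (Measure.pi fun _ => PA).prod <|
      (Measure.pi fun _ => gaussianReal 0 1).prod (gaussianRows n K)

/-- The first observation channel: `Y_{t,μ} = φ(S_{t,μ}, A_μ) + √Δ Z_μ ∼ P_out(· | S_{t,μ})`. -/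
def obsY {n m K : ℕ} (φ : (Fin K → ℝ) → ℝ → ℝ) (Δ : ℝ) (P0 : Measure (Fin K → ℝ))
    (s t : ℝ) (R2 : SymMat K) (ω : Disorder n m K) (μ : Fin m) : ℝ :=
  φ (preActivation P0 s t R2 ω.X ω.V ω.Wstar ω.Ustar μ) (ω.A μ) + Real.sqrt Δ * ω.Z μ

/-- The second observation channel: `Y'_{t,i} = √R₁ W*ᵢ + Z'ᵢ`. -/
def obsY' {n m K : ℕ} (R1 : SymMat K) (ω : Disorder n m K) (i : Fin n) : Fin K → ℝ :=
  psdSqrt R1.toMatrix *ᵥ ω.Wstar i + ω.Z' i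

/-- The unnormalized density of the interpolating posterior at `(w, u)`, with respect to the product
of the prior `P0` on the rows of `w` and of the standard Gaussian law of `u`. -/
def posteriorWeight {n m K : ℕ} (φ : (Fin K → ℝ) → ℝ → ℝ) (Δ : ℝ) (P0 : Measure (Fin K → ℝ))
    (PA : Measure ℝ) (s t : ℝ) (R : SymMat K × SymMat K) (ω : Disorder n m K)
    (p : Rows n K × Rows m K) : ℝ :=
  (∏ i, Real.exp (-(1 / 2) *
      ∑ l, (obsY' R.1 ω i l - (psdSqrt R.1.toMatrix *ᵥ p.1 i) l) ^ 2)) *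
  ∏ μ, outputKernel φ Δ PA (obsY φ Δ P0 s t R.2 ω μ)
    (preActivation P0 s t R.2 ω.X ω.V p.1 p.2 μ)

/-- The Gibbs bracket `⟨g⟩`: the mean of `g(w, u)` under the interpolating posterior. -/
def gibbs {n m K : ℕ} (φ : (Fin K → ℝ) → ℝ → ℝ) (Δ : ℝ) (P0 : Measure (Fin K → ℝ))
    (PA : Measure ℝ) (s t : ℝ) (R : SymMat K × SymMat K) (ω : Disorder n m K)
    (g : Rows n K × Rows m K → ℝ) : ℝ :=
  (∫ p, g p * posteriorWeight φ Δ P0 PA s t R ω p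
      ∂((Measure.pi fun _ => P0).prod (gaussianRows m K))) /
    ∫ p, posteriorWeight φ Δ P0 PA s t R ω p ∂((Measure.pi fun _ => P0).prod (gaussianRows m K))

/-- The overlap matrix `Q_{l l'} = (1/n) ∑ᵢ W*_{i l} w_{i l'}`. -/
def overlap {n K : ℕ} (Wstar w : Rows n K) (l l' : Fin K) : ℝ :=
  (1 / n) * ∑ i, Wstar i l * w i l'

/-- The matrix `𝔼⟨Q⟩`. -/
def meanOverlap (n m : ℕ) {K : ℕ} (φ : (Fin K → ℝ) → ℝ → ℝ) (Δ : ℝ) (P0 : Measure (Fin K → ℝ))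
    (PA : Measure ℝ) (s t : ℝ) (R : SymMat K × SymMat K) (l l' : Fin K) : ℝ :=
  ∫ ω, gibbs φ Δ P0 PA s t R ω (fun p => overlap ω.Wstar p.1 l l')
    ∂(disorderLaw n m K P0 PA)

/-- The overlap fluctuation `𝔼⟨‖Q - 𝔼⟨Q⟩‖_F²⟩`. -/
def overlapFluctuation (n m : ℕ) {K : ℕ} (φ : (Fin K → ℝ) → ℝ → ℝ) (Δ : ℝ)
    (P0 : Measure (Fin K → ℝ)) (PA : Measure ℝ) (s t : ℝ) (R : SymMat K × SymMat K) : ℝ :=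
  ∫ ω, gibbs φ Δ P0 PA s t R ω (fun p =>
      ∑ l, ∑ l', (overlap ω.Wstar p.1 l l' - meanOverlap n m φ Δ P0 PA s t R l l') ^ 2)
    ∂(disorderLaw n m K P0 PA)

/-- The map `ε ↦ (R₁(t,ε), R₂(t,ε)) = (ε₁ + ∫₀ᵗ r(v,ε) dv, ε₂ + ∫₀ᵗ q(v,ε) dv)`. -/
def interpolationMap {K : ℕ} (r q : ℝ → SymMat K × SymMat K → SymMat K) (t : ℝ)
    (ε : SymMat K × SymMat K) : SymMat K × SymMat K :=
  (ε.1 + ∫ v in (0 : ℝ)..t, r v ε, ε.2 + ∫ v in (0 : ℝ)..t, q v ε)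

/-- `(r, q)` are interpolation functions at perturbation level `s`, for the prior `P0`: for `t` in
`[0,1]` and `ε` in `(s ℳ)²`, `r(t,ε)` is positive semidefinite with entries bounded by `B`, both
`q(t,ε)` and `ρ - q(t,ε)` are positive semidefinite, and both functions are integrable in `t`. -/
structure IsInterpolation {K : ℕ} (P0 : Measure (Fin K → ℝ)) (s B : ℝ)
    (r q : ℝ → SymMat K × SymMat K → SymMat K) : Prop where
  r_posSemidef : ∀ t ∈ Icc (0 : ℝ) 1, ∀ ε ∈ perturbationSet K s, (r t ε).toMatrix.PosSemidef
  r_bounded : ∀ t ∈ Icc (0 : ℝ) 1, ∀ ε ∈ perturbationSet K s, ‖r t ε‖ ≤ B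
  q_posSemidef : ∀ t ∈ Icc (0 : ℝ) 1, ∀ ε ∈ perturbationSet K s, (q t ε).toMatrix.PosSemidef
  q_le : ∀ t ∈ Icc (0 : ℝ) 1, ∀ ε ∈ perturbationSet K s,
    (secondMoment P0 - (q t ε).toMatrix).PosSemidef
  r_integrable : ∀ ε ∈ perturbationSet K s, IntervalIntegrable (fun t => r t ε) volume 0 1
  q_integrable : ∀ ε ∈ perturbationSet K s, IntervalIntegrable (fun t => q t ε) volume 0 1

/-- `F` is a `C¹` diffeomorphism from `D` onto its image with Jacobian determinant at least `1`:
it is `C¹` and injective on `D` with Jacobian determinant at least `1` there, so that its inverse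
is `C¹` as well.  (Used for a compact convex `D` with nonempty interior, on which derivatives are
unique.) -/
structure IsExpandingDiffeo {K : ℕ} (F : SymMat K × SymMat K → SymMat K × SymMat K)
    (D : Set (SymMat K × SymMat K)) : Prop where
  contDiffOn : ContDiffOn ℝ 1 F D
  injOn : InjOn F D
  one_le_jacobian : ∀ ε ∈ D, 1 ≤ (fderivWithin ℝ F D ε).det

end

noncomputable section

section Tilted

variable {P : Type*} [MeasurableSpace P]

lemma integrable_of_ae_abs_le {π : Measure P} [IsFiniteMeasure π] {f : P → ℝ} {c : ℝ}
    (hf : Measurable f) (hc : ∀ᵐ p ∂π, |f p| ≤ c) : Integrable f π :=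
  Integrable.of_bound hf.aestronglyMeasurable c (by simpa [Real.norm_eq_abs] using hc)

lemma integrable_exp_of_ae_abs_le {π : Measure P} [IsFiniteMeasure π] {f : P → ℝ} {c : ℝ}
    (hf : Measurable f) (hc : ∀ᵐ p ∂π, |f p| ≤ c) : Integrable (fun p => Real.exp (f p)) π := by
  refine integrable_of_ae_abs_le (c := Real.exp c) hf.exp ?_
  filter_upwards [hc] with p hp
  rw [abs_of_pos (Real.exp_pos _)]
  exact Real.exp_le_exp.2 (le_trans (le_abs_self _) hp)

lemma abs_integral_le_of_ae_abs_le {π : Measure P} [IsProbabilityMeasure π] {f : P → ℝ} {c : ℝ}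
    (hc : ∀ᵐ p ∂π, |f p| ≤ c) : |∫ p, f p ∂π| ≤ c := by
  have := norm_integral_le_of_norm_le_const (μ := π) (f := f) (C := c)
    (by simpa [Real.norm_eq_abs] using hc)
  simpa [Real.norm_eq_abs] using this

lemma isProbabilityMeasure_tilted_of_bdd {π : Measure P} [IsProbabilityMeasure π] {f : P → ℝ}
    {c : ℝ} (hf : Measurable f) (hc : ∀ᵐ p ∂π, |f p| ≤ c) : IsProbabilityMeasure (π.tilted f) :=
  isProbabilityMeasure_tilted (integrable_exp_of_ae_abs_le hf hc)

lemma ae_tilted {π : Measure P} {f : P → ℝ} {q : P → Prop} (h : ∀ᵐ p ∂π, q p) :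
    ∀ᵐ p ∂(π.tilted f), q p :=
  (tilted_absolutelyContinuous π f).ae_le h

/-- The logarithm of the partition function. -/
def logZ (π : Measure P) (H : P → ℝ) : ℝ := Real.log (∫ p, Real.exp (H p) ∂π)

lemma integral_le_log_integral_exp {μ : Measure P} [IsProbabilityMeasure μ] {ψ : P → ℝ} {D : ℝ}
    (hψ : Measurable ψ) (hD : ∀ᵐ p ∂μ, |ψ p| ≤ D) :
    ∫ p, ψ p ∂μ ≤ Real.log (∫ p, Real.exp (ψ p) ∂μ) := by
  have hi := integrable_of_ae_abs_le hψ hD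
  have he := integrable_exp_of_ae_abs_le hψ hD
  have hpos : 0 < ∫ p, Real.exp (ψ p) ∂μ := integral_exp_pos he
  rw [Real.le_log_iff_exp_le hpos]
  set m := ∫ p, ψ p ∂μ
  have h1 : ∫ p, (Real.exp m * (1 + (ψ p - m))) ∂μ ≤ ∫ p, Real.exp (ψ p) ∂μ := by
    refine integral_mono ?_ he ?_
    · exact ((integrable_const _).add (hi.sub (integrable_const _))).const_mul _
    · intro p
      have := Real.add_one_le_exp (ψ p - m)
      have h2 : Real.exp (ψ p) = Real.exp m * Real.exp (ψ p - m) := by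
        rw [← Real.exp_add]; ring_nf
      dsimp only
      rw [h2]
      exact mul_le_mul_of_nonneg_left (by linarith) (Real.exp_pos _).le
  have hi' : Integrable (fun p => ψ p - m) μ := hi.sub (integrable_const _)
  rw [integral_const_mul, integral_add (integrable_const _) hi',
    integral_sub hi (integrable_const _)] at h1
  simpa [m] using h1

lemma log_integral_exp_le_of_le {μ : Measure P} [IsProbabilityMeasure μ] {ψ : P → ℝ} {D : ℝ}
    (hψ : Measurable ψ) (hD : ∀ᵐ p ∂μ, |ψ p| ≤ D) :
    Real.log (∫ p, Real.exp (ψ p) ∂μ) ≤ D := by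
  have he := integrable_exp_of_ae_abs_le hψ hD
  rw [Real.log_le_iff_le_exp (integral_exp_pos he)]
  calc ∫ p, Real.exp (ψ p) ∂μ ≤ ∫ _, Real.exp D ∂μ := by
        refine integral_mono_ae he (integrable_const _) ?_
        filter_upwards [hD] with p hp
        exact Real.exp_le_exp.2 (le_trans (le_abs_self _) hp)
    _ = Real.exp D := by simp

lemma log_integral_exp_le {μ : Measure P} [IsProbabilityMeasure μ] {ψ : P → ℝ} {D : ℝ}
    (hψ : Measurable ψ) (hD : ∀ᵐ p ∂μ, |ψ p| ≤ D) :
    Real.log (∫ p, Real.exp (ψ p) ∂μ) ≤ ∫ p, ψ p ∂μ + 2 * D ^ 2 := by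
  have hi := integrable_of_ae_abs_le hψ hD
  have he := integrable_exp_of_ae_abs_le hψ hD
  have hpos : 0 < ∫ p, Real.exp (ψ p) ∂μ := integral_exp_pos he
  rcases le_or_gt D 1 with h1 | h1
  · have h2 : ∫ p, Real.exp (ψ p) ∂μ ≤ ∫ p, (1 + ψ p + D ^ 2) ∂μ := by
      refine integral_mono_ae he (((integrable_const _).add hi).add (integrable_const _)) ?_
      filter_upwards [hD] with p hp
      have h3 := Real.abs_exp_sub_one_sub_id_le (hp.trans h1)
      have h4 : ψ p ^ 2 ≤ D ^ 2 := by
        rw [← sq_abs (ψ p)]; exact pow_le_pow_left₀ (abs_nonneg _) hp 2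
      have h5 := (abs_le.1 h3).2
      linarith
    have hi' : Integrable (fun p => 1 + ψ p) μ := (integrable_const _).add hi
    rw [integral_add hi' (integrable_const _), integral_add (integrable_const _) hi] at h2
    simp only [integral_const, probReal_univ, smul_eq_mul, one_mul] at h2
    have h6 := Real.log_le_sub_one_of_pos hpos
    nlinarith [sq_nonneg D]
  · have h2 := log_integral_exp_le_of_le hψ hD
    have h3 := (abs_le.1 (abs_integral_le_of_ae_abs_le hD)).1
    nlinarith

lemma logZ_sub {π : Measure P} [IsProbabilityMeasure π] {H H' : P → ℝ} {c c' : ℝ}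
    (hH : Measurable H) (hc : ∀ᵐ p ∂π, |H p| ≤ c)
    (hH' : Measurable H') (hc' : ∀ᵐ p ∂π, |H' p| ≤ c') :
    logZ π H' - logZ π H = Real.log (∫ p, Real.exp (H' p - H p) ∂(π.tilted H)) := by
  rw [integral_exp_tilted H (fun p => H' p - H p)]
  have h1 := integral_exp_pos (integrable_exp_of_ae_abs_le hH hc)
  have h2 := integral_exp_pos (integrable_exp_of_ae_abs_le hH' hc')
  simp only [Pi.add_apply, add_sub_cancel]
  rw [Real.log_div h2.ne' h1.ne']
  rfl

lemma integral_sub_le_logZ_sub {π : Measure P} [IsProbabilityMeasure π] {H H' : P → ℝ} {c c' : ℝ}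
    (hH : Measurable H) (hc : ∀ᵐ p ∂π, |H p| ≤ c)
    (hH' : Measurable H') (hc' : ∀ᵐ p ∂π, |H' p| ≤ c') :
    ∫ p, (H' p - H p) ∂(π.tilted H) ≤ logZ π H' - logZ π H := by
  rw [logZ_sub hH hc hH' hc']
  have := isProbabilityMeasure_tilted_of_bdd hH hc
  refine integral_le_log_integral_exp (D := c' + c) (hH'.sub hH) (ae_tilted ?_)
  filter_upwards [hc, hc'] with p h1 h2
  exact (abs_sub _ _).trans (add_le_add h2 h1)

lemma abs_logZ_sub_le {π : Measure P} [IsProbabilityMeasure π] {H H' : P → ℝ} {c D : ℝ}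
    (hH : Measurable H) (hc : ∀ᵐ p ∂π, |H p| ≤ c)
    (hH' : Measurable H') (hD : ∀ᵐ p ∂π, |H' p - H p| ≤ D) :
    |logZ π H' - logZ π H| ≤ D := by
  have hc' : ∀ᵐ p ∂π, |H' p| ≤ c + D := by
    filter_upwards [hc, hD] with p h1 h2
    have := abs_add_le (H p) (H' p - H p)
    rw [add_sub_cancel] at this
    linarith
  have := isProbabilityMeasure_tilted_of_bdd hH hc
  have hD' : ∀ᵐ p ∂(π.tilted H), |H' p - H p| ≤ D := ae_tilted hD
  rw [logZ_sub hH hc hH' hc', abs_le]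
  constructor
  · exact (abs_le.1 (abs_integral_le_of_ae_abs_le hD')).1.trans
      (integral_le_log_integral_exp (hH'.sub hH) hD')
  · exact log_integral_exp_le_of_le (hH'.sub hH) hD'

/-- A symmetric second difference of the log partition function is controlled by the second
difference and the square of the first difference of the energies. -/
lemma abs_logZ_second_diff_le {π : Measure P} [IsProbabilityMeasure π] {H H₁ H₂ : P → ℝ}
    {c D E : ℝ} (hH : Measurable H) (hc : ∀ᵐ p ∂π, |H p| ≤ c)
    (hH₁ : Measurable H₁) (hH₂ : Measurable H₂)
    (hD₁ : ∀ᵐ p ∂π, |H₁ p - H p| ≤ D) (hD₂ : ∀ᵐ p ∂π, |H₂ p - H p| ≤ D)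
    (hE : ∀ᵐ p ∂π, |H₁ p + H₂ p - 2 * H p| ≤ E) :
    |logZ π H₁ + logZ π H₂ - 2 * logZ π H| ≤ E + 4 * D ^ 2 := by
  have hb : ∀ G : P → ℝ, (∀ᵐ p ∂π, |G p - H p| ≤ D) → ∀ᵐ p ∂π, |G p| ≤ c + D := by
    intro G hG
    filter_upwards [hc, hG] with p h1 h2
    have := abs_add_le (H p) (G p - H p)
    rw [add_sub_cancel] at this
    linarith
  have := isProbabilityMeasure_tilted_of_bdd hH hc
  have hm₁ : Measurable (fun p => H₁ p - H p) := hH₁.sub hH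
  have hm₂ : Measurable (fun p => H₂ p - H p) := hH₂.sub hH
  have e₁ := logZ_sub hH hc hH₁ (hb _ hD₁)
  have e₂ := logZ_sub hH hc hH₂ (hb _ hD₂)
  have hE' : ∀ᵐ p ∂(π.tilted H), |(H₁ p - H p) + (H₂ p - H p)| ≤ E := by
    refine ae_tilted ?_
    filter_upwards [hE] with p hp
    convert! hp using 2; ring
  have hi := abs_integral_le_of_ae_abs_le hE'
  rw [integral_add (integrable_of_ae_abs_le hm₁ (ae_tilted hD₁))
    (integrable_of_ae_abs_le hm₂ (ae_tilted hD₂))] at hi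
  have l₁ := integral_le_log_integral_exp hm₁ (ae_tilted (f := H) hD₁)
  have l₂ := integral_le_log_integral_exp hm₂ (ae_tilted (f := H) hD₂)
  have u₁ := log_integral_exp_le hm₁ (ae_tilted (f := H) hD₁)
  have u₂ := log_integral_exp_le hm₂ (ae_tilted (f := H) hD₂)
  rw [abs_le] at hi ⊢
  constructor <;> nlinarith [hi.1, hi.2, sq_nonneg D]

lemma integral_tilted_eq_div (π : Measure P) (H g : P → ℝ) :
    ∫ p, g p ∂(π.tilted H) = (∫ p, g p * Real.exp (H p) ∂π) / ∫ p, Real.exp (H p) ∂π := by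
  rw [integral_tilted, ← integral_div]
  congr 1 with p
  simp only [smul_eq_mul]
  ring

lemma hasDerivAt_integral_mul_exp {π : Measure P} [IsProbabilityMeasure π] {θ θ' : ℝ → P → ℝ}
    {s : Set ℝ} {a : ℝ} (hs : s ∈ 𝓝 a) (hθ : ∀ x, Measurable (θ x)) (hθ' : Measurable (θ' a))
    {c c' M : ℝ} (hc : ∀ᵐ p ∂π, ∀ x ∈ s, |θ x p| ≤ c) (hc' : ∀ᵐ p ∂π, ∀ x ∈ s, |θ' x p| ≤ c')
    (hd : ∀ p, ∀ x ∈ s, HasDerivAt (fun x => θ x p) (θ' x p) x) {g : P → ℝ} (hg : Measurable g)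
    (hM : ∀ᵐ p ∂π, |g p| ≤ M) :
    HasDerivAt (fun x => ∫ p, g p * Real.exp (θ x p) ∂π)
      (∫ p, g p * (Real.exp (θ a p) * θ' a p) ∂π) a := by
  have ha : a ∈ s := mem_of_mem_nhds hs
  refine (hasDerivAt_integral_of_dominated_loc_of_deriv_le (μ := π)
    (F := fun x p => g p * Real.exp (θ x p))
    (F' := fun x p => g p * (Real.exp (θ x p) * θ' x p)) (bound := fun _ => |M| * (Real.exp c * |c'|))
    hs ?_ ?_ ?_ ?_ (integrable_const _) ?_).2
  · exact Eventually.of_forall fun x => (hg.mul (hθ x).exp).aestronglyMeasurable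
  · refine integrable_of_ae_abs_le (c := |M| * Real.exp c) (hg.mul (hθ a).exp) ?_
    filter_upwards [hc, hM] with p h1 h2
    rw [abs_mul, abs_of_pos (Real.exp_pos _)]
    exact mul_le_mul (h2.trans (le_abs_self _))
      (Real.exp_le_exp.2 ((le_abs_self _).trans (h1 a ha))) (Real.exp_pos _).le (abs_nonneg _)
  · exact (hg.mul ((hθ a).exp.mul hθ')).aestronglyMeasurable
  · filter_upwards [hc, hc', hM] with p h1 h2 h3 x hx
    rw [Real.norm_eq_abs, abs_mul, abs_mul, abs_of_pos (Real.exp_pos _)]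
    exact mul_le_mul (h3.trans (le_abs_self _)) (mul_le_mul
      (Real.exp_le_exp.2 ((le_abs_self _).trans (h1 x hx))) ((h2 x hx).trans (le_abs_self _))
      (abs_nonneg _) (Real.exp_pos _).le) (by positivity) (abs_nonneg _)
  · exact Eventually.of_forall fun p x hx => ((hd p x hx).exp).const_mul _

/-- The derivative of a Gibbs average along a one-parameter family of energies is a covariance. -/
lemma hasDerivAt_integral_tilted {π : Measure P} [IsProbabilityMeasure π] {θ θ' : ℝ → P → ℝ}
    {s : Set ℝ} {a : ℝ} (hs : s ∈ 𝓝 a) (hθ : ∀ x, Measurable (θ x)) (hθ' : Measurable (θ' a))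
    {c c' M : ℝ} (hc : ∀ᵐ p ∂π, ∀ x ∈ s, |θ x p| ≤ c) (hc' : ∀ᵐ p ∂π, ∀ x ∈ s, |θ' x p| ≤ c')
    (hd : ∀ p, ∀ x ∈ s, HasDerivAt (fun x => θ x p) (θ' x p) x) {g : P → ℝ} (hg : Measurable g)
    (hM : ∀ᵐ p ∂π, |g p| ≤ M) :
    HasDerivAt (fun x => ∫ p, g p ∂(π.tilted (θ x)))
      (∫ p, g p * θ' a p ∂(π.tilted (θ a))
        - (∫ p, g p ∂(π.tilted (θ a))) * ∫ p, θ' a p ∂(π.tilted (θ a))) a := by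
  have ha : a ∈ s := mem_of_mem_nhds hs
  have h1 := hasDerivAt_integral_mul_exp hs hθ hθ' hc hc' hd hg hM
  have h2 := hasDerivAt_integral_mul_exp hs hθ hθ' hc hc' hd (g := fun _ => 1) (M := 1)
    measurable_const (by simp)
  simp only [one_mul] at h2
  have hpos : 0 < ∫ p, Real.exp (θ a p) ∂π :=
    integral_exp_pos (integrable_exp_of_ae_abs_le (hθ a) (hc.mono fun p hp => hp a ha))
  have h3 := h1.div h2 hpos.ne'
  have e : (fun x => ∫ p, g p ∂(π.tilted (θ x))) =
      (fun x => ∫ p, g p * Real.exp (θ x p) ∂π) / fun x => ∫ p, Real.exp (θ x p) ∂π := by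
    ext x
    rw [integral_tilted_eq_div]; rfl
  rw [e]
  convert! h3 using 1
  simp only [integral_tilted_eq_div]
  have e1 : ∀ p, g p * θ' a p * Real.exp (θ a p) = g p * (Real.exp (θ a p) * θ' a p) := by
    intro p; ring
  have e2 : ∀ p, θ' a p * Real.exp (θ a p) = Real.exp (θ a p) * θ' a p := by
    intro p; ring
  simp only [e1, e2]
  field_simp

end Tilted

end

noncomputable section

section Variance

variable {α β : Type*} [MeasurableSpace α] [MeasurableSpace β]

lemma MeasureTheory.MemLp.integral_snd {μ : Measure α} {ν : Measure β} [IsProbabilityMeasure μ]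
    [IsProbabilityMeasure ν] {F : α × β → ℝ} (hF : Measurable F) (h2 : MemLp F 2 (μ.prod ν)) :
    MemLp (fun x => ∫ y, F (x, y) ∂ν) 2 μ := by
  have hg : StronglyMeasurable (fun x => ∫ y, F (x, y) ∂ν) :=
    hF.stronglyMeasurable.integral_prod_right'
  rw [memLp_two_iff_integrable_sq hg.aestronglyMeasurable]
  have hsq := h2.integrable_sq
  have hint := h2.integrable (by norm_num)
  refine Integrable.mono' hsq.integral_prod_left (hg.measurable.pow_const 2).aestronglyMeasurable ?_
  filter_upwards [hsq.prod_right_ae, hint.prod_right_ae] with x h1 h3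
  rw [Real.norm_eq_abs, abs_of_nonneg (sq_nonneg _)]
  have hm : MemLp (fun y => F (x, y)) 2 ν := by
    rw [memLp_two_iff_integrable_sq h3.aestronglyMeasurable]; exact h1
  have h4 := integral_mono (μ := ν) (f := fun _ => (0 : ℝ))
    (g := fun y => (F (x, y) - ∫ y, F (x, y) ∂ν) ^ 2) (by simp)
    ((hm.sub (memLp_const _)).integrable_sq) (fun y => sq_nonneg _)
  set m := ∫ y, F (x, y) ∂ν with hmdef
  have e : ∀ y, (F (x, y) - m) ^ 2 = F (x, y) ^ 2 - 2 * m * F (x, y) + m ^ 2 := by intro y; ring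
  simp only [e] at h4
  have i1 : Integrable (fun y => F (x, y) ^ 2 - 2 * m * F (x, y)) ν := h1.sub (h3.const_mul _)
  rw [integral_add i1 (integrable_const _), integral_sub h1 (h3.const_mul _),
    integral_const_mul, ← hmdef] at h4
  simp at h4
  nlinarith

lemma integral_sub_sq_eq {ν : Measure β} [IsProbabilityMeasure ν] {f : β → ℝ} (hf : MemLp f 2 ν)
    (m : ℝ) :
    ∫ y, (f y - m) ^ 2 ∂ν = ∫ y, (f y - ∫ y, f y ∂ν) ^ 2 ∂ν + (∫ y, f y ∂ν - m) ^ 2 := by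
  set a := ∫ y, f y ∂ν with ha
  have hi := hf.integrable (by norm_num)
  have e : ∀ y, (f y - m) ^ 2 = (f y - a) ^ 2 + (2 * (a - m) * (f y - a) + (a - m) ^ 2) := by
    intro y; ring
  have i1 : Integrable (fun y => (f y - a) ^ 2) ν := (hf.sub (memLp_const _)).integrable_sq
  have i0 : Integrable (fun y => f y - a) ν := hi.sub (integrable_const _)
  have i2 : Integrable (fun y => 2 * (a - m) * (f y - a)) ν := i0.const_mul _
  have i3 : Integrable (fun y => 2 * (a - m) * (f y - a) + (a - m) ^ 2) ν :=
    i2.add (integrable_const _)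
  simp only [e]
  rw [integral_add i1 i3, integral_add i2 (integrable_const _),
    integral_const_mul, integral_sub hi (integrable_const _), ← ha]
  simp

/-- The law of total variance, as an inequality. -/
lemma variance_prod_le {μ : Measure α} {ν : Measure β} [IsProbabilityMeasure μ]
    [IsProbabilityMeasure ν] {F : α × β → ℝ} (hF : Measurable F) (h2 : MemLp F 2 (μ.prod ν))
    {V₁ V₂ : ℝ} (h₁ : ∀ᵐ x ∂μ, ∫ y, (F (x, y) - ∫ y, F (x, y) ∂ν) ^ 2 ∂ν ≤ V₁)
    (h₂ : ∫ x, (∫ y, F (x, y) ∂ν - ∫ x, ∫ y, F (x, y) ∂ν ∂μ) ^ 2 ∂μ ≤ V₂) :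
    ∫ z, (F z - ∫ z, F z ∂(μ.prod ν)) ^ 2 ∂(μ.prod ν) ≤ V₁ + V₂ := by
  have hint := h2.integrable (by norm_num)
  have hm := integral_prod F hint
  set m := ∫ z, F z ∂(μ.prod ν)
  rw [← hm] at h₂
  have hsq : Integrable (fun z => (F z - m) ^ 2) (μ.prod ν) := (h2.sub (memLp_const _)).integrable_sq
  have hg := h2.integral_snd hF
  have hg' : Integrable (fun x => (∫ y, F (x, y) ∂ν - m) ^ 2) μ :=
    (hg.sub (memLp_const _)).integrable_sq
  rw [integral_prod _ hsq]
  calc _ ≤ ∫ x, (V₁ + (∫ y, F (x, y) ∂ν - m) ^ 2) ∂μ := by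
        refine integral_mono_ae hsq.integral_prod_left
          ((integrable_const _).add hg') ?_
        filter_upwards [h₁, h2.integrable_sq.prod_right_ae, hint.prod_right_ae] with x h1 h3 h4
        have : MemLp (fun y => F (x, y)) 2 ν := by
          rw [memLp_two_iff_integrable_sq h4.aestronglyMeasurable]; exact h3
        rw [integral_sub_sq_eq this m]
        linarith
    _ ≤ V₁ + V₂ := by
        rw [integral_add (integrable_const _) hg']
        simp only [integral_const, probReal_univ, smul_eq_mul, one_mul]
        simpa using h₂

lemma ae_pi_mem {ι : Type*} [Fintype ι] {μ : Measure α} [IsProbabilityMeasure μ] {T : Set α}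
    (hT : ∀ᵐ x ∂μ, x ∈ T) : ∀ᵐ x ∂(Measure.pi fun _ : ι => μ), ∀ i, x i ∈ T := by
  rw [eventually_all]
  intro i
  exact (measurePreserving_eval (fun _ : ι => μ) i).quasiMeasurePreserving.ae hT

lemma memLp_of_abs_sub_le {μ : Measure α} [IsProbabilityMeasure μ] {T : Set α}
    (hT : ∀ᵐ x ∂μ, x ∈ T) {c : α → ℝ} (hc : MemLp c 2 μ) {g : α → ℝ} (hg : Measurable g)
    (h : ∀ x y, x ∈ T → y ∈ T → |g x - g y| ≤ c x + c y) :
    MemLp g 2 μ ∧ ∫ x, (g x - ∫ x, g x ∂μ) ^ 2 ∂μ ≤ 4 * ∫ x, c x ^ 2 ∂μ := by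
  obtain ⟨y₀, hy₀⟩ := hT.exists
  have hgp : MemLp g 2 μ := by
    have hb : MemLp (fun x => (|g y₀| + |c y₀|) + |c x|) 2 μ := by
      have h1 : MemLp (fun _ : α => |g y₀| + |c y₀|) 2 μ := memLp_const _
      have h2 : MemLp (fun x : α => |c x|) 2 μ := hc.abs
      exact h1.add h2
    refine hb.of_le hg.aestronglyMeasurable ?_
    filter_upwards [hT] with x hx
    have h1 := h x y₀ hx hy₀
    have h2 := abs_add_le (g x - g y₀) (g y₀)
    rw [sub_add_cancel] at h2
    have h0 : 0 ≤ |g y₀| + |c y₀| + |c x| := by positivity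
    rw [Real.norm_eq_abs, Real.norm_eq_abs, abs_of_nonneg h0]
    linarith [le_abs_self (c x), le_abs_self (c y₀)]
  refine ⟨hgp, ?_⟩
  have hgi := hgp.integrable (by norm_num)
  have hci := hc.integrable (by norm_num)
  set a := ∫ x, g x ∂μ with ha
  set b := ∫ x, c x ∂μ with hb
  have hcb : b ^ 2 ≤ ∫ x, c x ^ 2 ∂μ := by
    have := integral_sub_sq_eq hc 0
    simp only [sub_zero] at this
    rw [this]
    have : 0 ≤ ∫ y, (c y - ∫ (y : α), c y ∂μ) ^ 2 ∂μ := integral_nonneg fun _ => sq_nonneg _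
    linarith
  calc ∫ x, (g x - a) ^ 2 ∂μ ≤ ∫ x, (2 * c x ^ 2 + 2 * b ^ 2) ∂μ := by
        refine integral_mono_ae (hgp.sub (memLp_const _)).integrable_sq
          ((hc.integrable_sq.const_mul _).add (integrable_const _)) ?_
        filter_upwards [hT] with x hx
        have h1 : |g x - a| ≤ c x + b := by
          have e1 : g x - a = ∫ y, (g x - g y) ∂μ := by
            rw [integral_sub (integrable_const _) hgi]; simp [ha]
          have e2 : c x + b = ∫ y, (c x + c y) ∂μ := by
            rw [integral_add (integrable_const _) hci]; simp [hb]
          rw [e1, e2]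
          refine abs_integral_le_integral_abs.trans ?_
          refine integral_mono_ae ((integrable_const _).sub hgi).abs
            ((integrable_const _).add hci) ?_
          filter_upwards [hT] with y hy
          exact h x y hx hy
        have h3 : (g x - a) ^ 2 ≤ (c x + b) ^ 2 := by
          rw [← sq_abs (g x - a)]; exact pow_le_pow_left₀ (abs_nonneg _) h1 2
        nlinarith [sq_nonneg (c x - b)]
    _ ≤ _ := by
        rw [integral_add (hc.integrable_sq.const_mul _) (integrable_const _), integral_const_mul]
        simp only [integral_const, probReal_univ, smul_eq_mul, one_mul]
        linarith

lemma measurable_finCons {N : ℕ} :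
    Measurable (fun z : α × (Fin N → α) => (Fin.cons z.1 z.2 : Fin (N + 1) → α)) := by
  rw [measurable_pi_iff]
  intro i
  refine Fin.cases ?_ (fun j => ?_) i
  · simpa using measurable_fst
  · simp only [Fin.cons_succ]; exact (measurable_pi_apply j).comp measurable_snd

lemma measurePreserving_finCons {N : ℕ} (μ : Measure α) [IsProbabilityMeasure μ] :
    MeasurePreserving (fun z : α × (Fin N → α) => (Fin.cons z.1 z.2 : Fin (N + 1) → α))
      (μ.prod (Measure.pi fun _ => μ)) (Measure.pi fun _ => μ) := by
  have := (measurePreserving_piFinSuccAbove (fun _ : Fin (N + 1) => μ) 0).symm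
  convert! this using 1
  ext z j
  simp [MeasurableEquiv.piFinSuccAbove, Fin.insertNthEquiv]

/-- The Efron-Stein inequality, for a function that changes by at most `c (x i) + c y` when its
`i`-th argument `x i` is replaced by `y`. -/
theorem efronStein {μ : Measure α} [IsProbabilityMeasure μ] {T : Set α}
    (hT : ∀ᵐ x ∂μ, x ∈ T) {c : α → ℝ} (hc : MemLp c 2 μ) {N : ℕ} {f : (Fin N → α) → ℝ}
    (hf : Measurable f)
    (h : ∀ i x y, (∀ j, x j ∈ T) → y ∈ T → |f x - f (Function.update x i y)| ≤ c (x i) + c y) :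
    MemLp f 2 (Measure.pi fun _ => μ) ∧
      ∫ x, (f x - ∫ x, f x ∂(Measure.pi fun _ => μ)) ^ 2 ∂(Measure.pi fun _ => μ)
        ≤ 4 * N * ∫ x, c x ^ 2 ∂μ := by
  induction N with
  | zero =>
    have e : f = fun _ => f default := by ext x; rw [Subsingleton.elim x default]
    rw [e]
    exact ⟨memLp_const _, by simp⟩
  | succ N ih =>
    obtain ⟨y₀, hy₀⟩ := hT.exists
    set F : α × (Fin N → α) → ℝ := fun z => f (Fin.cons z.1 z.2) with hFdef
    have hF : Measurable F := hf.comp measurable_finCons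
    have hmem : ∀ (x : α) (x' : Fin N → α), x ∈ T → (∀ j, x' j ∈ T) →
        ∀ j, (Fin.cons x x' : Fin (N + 1) → α) j ∈ T := by
      intro x x' hx hx' j
      refine Fin.cases ?_ (fun j => ?_) j
      · simpa using hx
      · simpa using hx' j
    have h0 : ∀ x x' y, x ∈ T → (∀ j, x' j ∈ T) → y ∈ T → |F (x, x') - F (y, x')| ≤ c x + c y := by
      intro x x' y hx hx' hy
      have := h 0 (Fin.cons x x') y (hmem x x' hx hx') hy
      simpa [hFdef] using this
    have hs : ∀ x ∈ T, MemLp (fun x' => F (x, x')) 2 (Measure.pi fun _ => μ) ∧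
        ∫ x', (F (x, x') - ∫ x', F (x, x') ∂(Measure.pi fun _ => μ)) ^ 2 ∂(Measure.pi fun _ => μ)
        ≤ 4 * N * ∫ x, c x ^ 2 ∂μ := by
      intro x hx
      refine ih (hF.comp measurable_prodMk_left) ?_
      intro i x' y hx' hy
      have := h i.succ (Fin.cons x x') y (hmem x x' hx hx') hy
      simpa [hFdef, Fin.cons_update] using this
    have hTpi := ae_pi_mem (ι := Fin N) hT
    have hTprod : ∀ᵐ z ∂(μ.prod (Measure.pi fun _ : Fin N => μ)), z.1 ∈ T ∧ ∀ j, z.2 j ∈ T :=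
      (Measure.quasiMeasurePreserving_fst.ae hT).and (Measure.quasiMeasurePreserving_snd.ae hTpi)
    have hF2 : MemLp F 2 (μ.prod (Measure.pi fun _ : Fin N => μ)) := by
      have k1 : MemLp (fun z : α × (Fin N → α) => F (y₀, z.2)) 2
          (μ.prod (Measure.pi fun _ : Fin N => μ)) :=
        (hs y₀ hy₀).1.comp_measurePreserving measurePreserving_snd
      have k2 : MemLp (fun z : α × (Fin N → α) => c z.1) 2
          (μ.prod (Measure.pi fun _ : Fin N => μ)) :=
        hc.comp_measurePreserving measurePreserving_fst
      refine MemLp.of_le ((k1.abs.add k2.abs).add (memLp_const |c y₀|)) hF.aestronglyMeasurable ?_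
      filter_upwards [hTprod] with z hz
      have h1 := h0 z.1 z.2 y₀ hz.1 hz.2 hy₀
      have h2 := abs_add_le (F z - F (y₀, z.2)) (F (y₀, z.2))
      rw [sub_add_cancel] at h2
      have h3 : 0 ≤ |F (y₀, z.2)| + |c z.1| + |c y₀| := by positivity
      simp only [Pi.add_apply]
      change |F z| ≤ |(|F (y₀, z.2)| + |c z.1| + |c y₀|)|
      rw [abs_of_nonneg h3]
      have h4 : |F z - F (y₀, z.2)| ≤ c z.1 + c y₀ := h1
      linarith [le_abs_self (c z.1), le_abs_self (c y₀)]
    have hg : Measurable fun x => ∫ x', F (x, x') ∂(Measure.pi fun _ => μ) :=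
      (hF.stronglyMeasurable.integral_prod_right' (ν := Measure.pi fun _ : Fin N => μ)).measurable
    have hg2 := memLp_of_abs_sub_le hT hc hg (by
      intro x y hx hy
      rw [← integral_sub ((hs x hx).1.integrable (by norm_num)) ((hs y hy).1.integrable (by norm_num))]
      refine abs_integral_le_of_ae_abs_le ?_
      filter_upwards [hTpi] with x' hx'
      exact h0 x x' y hx hx' hy)
    have hv := variance_prod_le hF hF2 (hT.mono fun x hx => (hs x hx).2) hg2.2
    have hmp := measurePreserving_finCons (N := N) μ
    have hemb : MeasurableEmbedding
        (fun z : α × (Fin N → α) => (Fin.cons z.1 z.2 : Fin (N + 1) → α)) := by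
      have := (MeasurableEquiv.piFinSuccAbove (fun _ : Fin (N + 1) => α) 0).symm.measurableEmbedding
      convert! this using 1
      ext z j
      simp [MeasurableEquiv.piFinSuccAbove, Fin.insertNthEquiv]
    constructor
    · rw [← hmp.map_eq, hemb.memLp_map_measure_iff]
      exact hF2
    · rw [← hmp.map_eq, hemb.integral_map, hemb.integral_map]
      refine hv.trans (le_of_eq ?_)
      push_cast; ring

end Variance

section Resampling

variable {α : Type*} [MeasurableSpace α]

lemma measurePreserving_update {ι : Type*} [Fintype ι] [DecidableEq ι] (μ : ι → Measure α)
    [∀ i, IsProbabilityMeasure (μ i)] (i : ι) :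
    MeasurePreserving (fun z : (ι → α) × α => Function.update z.1 i z.2)
      ((Measure.pi μ).prod (μ i)) (Measure.pi μ) := by
  have hm : Measurable (fun z : (ι → α) × α => Function.update z.1 i z.2) := by
    rw [measurable_pi_iff]
    intro j
    by_cases hj : j = i
    · subst hj; simpa using measurable_snd
    · simp only [Function.update_of_ne hj]; exact (measurable_pi_apply j).comp measurable_fst
  refine ⟨hm, ?_⟩
  refine (Measure.pi_eq fun s hs => ?_).symm
  rw [Measure.map_apply hm (MeasurableSet.univ_pi hs)]
  have e : (fun z : (ι → α) × α => Function.update z.1 i z.2) ⁻¹' (Set.univ.pi s)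
      = (Set.univ.pi (Function.update s i Set.univ)) ×ˢ (s i) := by
    ext z
    simp only [mem_preimage, Set.mem_pi, mem_univ, forall_true_left, mem_prod]
    constructor
    · intro h
      refine ⟨fun j => ?_, by simpa using h i⟩
      by_cases hj : j = i
      · subst hj; simp
      · simpa [hj] using h j
    · rintro ⟨h1, h2⟩ j
      by_cases hj : j = i
      · subst hj; simpa using h2
      · simpa [hj] using h1 j
  rw [e, Measure.prod_prod, Measure.pi_pi, ← Finset.mul_prod_erase _ _ (Finset.mem_univ i),
    ← Finset.mul_prod_erase (a := i) Finset.univ (fun i => (μ i) (s i)) (Finset.mem_univ i)]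
  simp only [Function.update_self, measure_univ, one_mul]
  rw [mul_comm]
  congr 1
  refine Finset.prod_congr rfl fun j hj => ?_
  rw [Function.update_of_ne (Finset.ne_of_mem_erase hj)]

end Resampling

section Stein

lemma gaussian_stein {h h' : ℝ → ℝ} {c c' : ℝ} (hd : ∀ x, HasDerivAt h (h' x) x)
    (hm' : Measurable h') (hc : ∀ x, |h x| ≤ c) (hc' : ∀ x, |h' x| ≤ c') :
    ∫ x, x * h x ∂(gaussianReal 0 1) = ∫ x, h' x ∂(gaussianReal 0 1) := by
  have hm : Measurable h :=
    (continuous_iff_continuousAt.2 fun x => (hd x).continuousAt).measurable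
  rw [integral_gaussianReal_eq_integral_smul (by norm_num),
    integral_gaussianReal_eq_integral_smul (by norm_num)]
  have hpd : ∀ x, HasDerivAt (gaussianPDFReal 0 1) (-x * gaussianPDFReal 0 1 x) x := by
    intro x
    unfold gaussianPDFReal
    have h1 : HasDerivAt (fun x : ℝ => -(x - 0) ^ 2 / (2 * ((1 : NNReal) : ℝ)))
        (-x) x := by
      have := (((hasDerivAt_id x).sub_const 0).pow 2).neg.div_const (2 * ((1 : NNReal) : ℝ))
      convert! this using 1
      simp; ring
    convert! (h1.exp.const_mul _) using 1
    ring
  have hi0 : Integrable (gaussianPDFReal 0 1) := integrable_gaussianPDFReal 0 1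
  have hi1 : Integrable (fun x => x * gaussianPDFReal 0 1 x) := by
    have h1 : Integrable (fun x : ℝ => x) (gaussianReal 0 1) :=
      (IsGaussian.integrable_id (μ := gaussianReal 0 1))
    rw [gaussianReal_of_var_ne_zero _ (by norm_num), gaussianPDF_def] at h1
    rw [integrable_withDensity_iff_integrable_smul₀' (by fun_prop) (by simp)] at h1
    refine h1.congr (Eventually.of_forall fun x => ?_)
    simp [ENNReal.toReal_ofReal (gaussianPDFReal_nonneg 0 1 x), mul_comm]
  have key := integral_mul_deriv_eq_deriv_mul_of_integrable (u := h) (v := gaussianPDFReal 0 1)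
    (u' := h') (v' := fun x => -x * gaussianPDFReal 0 1 x) (fun x _ => hd x) (fun x _ => hpd x)
    ?_ ?_ ?_
  · simp only [smul_eq_mul]
    have e1 : ∫ x, gaussianPDFReal 0 1 x * (x * h x) = -∫ x, h x * (-x * gaussianPDFReal 0 1 x) := by
      rw [← integral_neg]; congr 1 with x; ring
    rw [e1, key, neg_neg]
    congr 1 with x; ring
  · have := (hi1.neg).bdd_mul (c := c) hm.aestronglyMeasurable (Eventually.of_forall hc)
    convert! this using 1
    ext x; simp
  · exact hi0.bdd_mul (c := c') hm'.aestronglyMeasurable (Eventually.of_forall hc')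
  · exact hi0.bdd_mul (c := c) hm.aestronglyMeasurable (Eventually.of_forall hc)

/-- Gaussian integration by parts in one coordinate. -/
lemma gaussian_pi_stein {n : ℕ} (i : Fin n) {Φ Φ' : (Fin n → ℝ) → ℝ} {c c' : ℝ}
    (hm : Measurable Φ) (hm' : Measurable Φ')
    (hd : ∀ z x, HasDerivAt (fun x => Φ (Function.update z i x)) (Φ' (Function.update z i x)) x)
    (hc : ∀ x, |Φ x| ≤ c) (hc' : ∀ x, |Φ' x| ≤ c') :
    ∫ z, z i * Φ z ∂(Measure.pi fun _ => gaussianReal 0 1)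
      = ∫ z, Φ' z ∂(Measure.pi fun _ => gaussianReal 0 1) := by
  have hmp := measurePreserving_update (fun _ : Fin n => gaussianReal 0 1) i
  have i1 : Integrable (fun z : Fin n → ℝ => z i * Φ z) (Measure.pi fun _ => gaussianReal 0 1) := by
    have : Integrable (fun z : Fin n → ℝ => z i) (Measure.pi fun _ => gaussianReal 0 1) :=
      (measurePreserving_eval (fun _ : Fin n => gaussianReal 0 1) i).integrable_comp_of_integrable
        (IsGaussian.integrable_id (μ := gaussianReal 0 1))
    exact this.mul_bdd (c := c) hm.aestronglyMeasurable (Eventually.of_forall hc)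
  have i2 : Integrable Φ' (Measure.pi fun _ : Fin n => gaussianReal 0 1) :=
    integrable_of_ae_abs_le hm' (Eventually.of_forall hc')
  rw [← hmp.map_eq] at i1 i2 ⊢
  have j1 := i1.comp_measurable hmp.measurable
  have j2 := i2.comp_measurable hmp.measurable
  rw [integral_map hmp.measurable.aemeasurable i1.aestronglyMeasurable,
    integral_map hmp.measurable.aemeasurable i2.aestronglyMeasurable]
  simp only [Function.comp_def] at j1 j2
  rw [integral_prod _ j1, integral_prod _ j2]
  congr 1 with z
  simp only [Function.update_self]
  exact gaussian_stein (hd z) (hm'.comp (measurable_update z)) (fun x => hc _) (fun x => hc' _)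

end Stein

end

noncomputable section

lemma integral_abs_le_sqrt {α : Type*} [MeasurableSpace α] {μ : Measure α}
    [IsProbabilityMeasure μ] {f : α → ℝ} (hf : MemLp f 2 μ) :
    ∫ x, |f x| ∂μ ≤ Real.sqrt (∫ x, f x ^ 2 ∂μ) := by
  refine Real.le_sqrt_of_sq_le ?_
  have h := integral_sub_sq_eq hf.abs 0
  simp only [sub_zero, Pi.abs_apply, sq_abs] at h
  rw [h]
  have : 0 ≤ ∫ y, (|f y| - ∫ y, |f y| ∂μ) ^ 2 ∂μ := integral_nonneg fun _ => sq_nonneg _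
  linarith

/-- A Bayesian inference problem with energy `H ω p`, observed in addition through `n` scalar
Gaussian channels, with signal `xs ω i` and estimated signal `x p i`. -/
structure SideChannel (Ω P : Type*) [MeasurableSpace Ω] [MeasurableSpace P] (n : ℕ) where
  law : Measure Ω
  prior : Measure P
  xs : Ω → Fin n → ℝ
  x : P → Fin n → ℝ
  H : Ω → P → ℝ
  M : ℝ
  prob_law : IsProbabilityMeasure law
  prob_prior : IsProbabilityMeasure prior
  measurable_xs : Measurable xs
  measurable_x : Measurable x
  measurable_H : Measurable (Function.uncurry H)
  M_nonneg : 0 ≤ M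
  abs_xs_le : ∀ᵐ ω ∂law, ∀ i, |xs ω i| ≤ M
  abs_x_le : ∀ᵐ p ∂prior, ∀ i, |x p i| ≤ M
  bdd_H : ∀ ω, ∃ c, ∀ᵐ p ∂prior, |H ω p| ≤ c

namespace SideChannel

variable {Ω P : Type*} [MeasurableSpace Ω] [MeasurableSpace P] {n : ℕ} (𝒮 : SideChannel Ω P n)

instance : IsProbabilityMeasure 𝒮.law := 𝒮.prob_law
instance : IsProbabilityMeasure 𝒮.prior := 𝒮.prob_prior

/-- The law of the channel noise. -/
abbrev noise (n : ℕ) : Measure (Fin n → ℝ) := Measure.pi fun _ => gaussianReal 0 1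

/-- The joint law of the disorder and of the channel noise. -/
abbrev joint : Measure (Ω × (Fin n → ℝ)) := 𝒮.law.prod (noise n)

def sig (ω : Ω) (p : P) : ℝ := ∑ i, (𝒮.x p i * 𝒮.xs ω i - 𝒮.x p i ^ 2 / 2)

def noi (z : Fin n → ℝ) (p : P) : ℝ := ∑ i, 𝒮.x p i * z i

/-- The energy at signal-to-noise ratio `l`. -/
def energy (l : ℝ) (ω : Ω × (Fin n → ℝ)) (p : P) : ℝ :=
  𝒮.H ω.1 p + l * 𝒮.sig ω.1 p + Real.sqrt l * 𝒮.noi ω.2 p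

/-- The Gibbs average at signal-to-noise ratio `l`. -/
def br (l : ℝ) (ω : Ω × (Fin n → ℝ)) (g : P → ℝ) : ℝ :=
  ∫ p, g p ∂(𝒮.prior.tilted (𝒮.energy l ω))

/-- The derivative of the energy in the signal-to-noise ratio. -/
def ell (l : ℝ) (ω : Ω × (Fin n → ℝ)) (p : P) : ℝ :=
  𝒮.sig ω.1 p + 𝒮.noi ω.2 p / (2 * Real.sqrt l)

/-- The scalar overlap. -/
def Q (ω : Ω) (p : P) : ℝ := (1 / n) * ∑ i, 𝒮.xs ω i * 𝒮.x p i

/-- The free entropy. -/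
def free (l : ℝ) (ω : Ω × (Fin n → ℝ)) : ℝ := logZ 𝒮.prior (𝒮.energy l ω)

/-- An upper bound on the noise part of the energy. -/
def amp (z : Fin n → ℝ) : ℝ := 𝒮.M * ∑ i, |z i|

lemma amp_nonneg (z : Fin n → ℝ) : 0 ≤ 𝒮.amp z :=
  mul_nonneg 𝒮.M_nonneg (Finset.sum_nonneg fun _ _ => abs_nonneg _)

section Measurability

lemma measurable_x_apply (i : Fin n) : Measurable fun p => 𝒮.x p i :=
  (measurable_pi_apply i).comp 𝒮.measurable_x

lemma measurable_xs_apply (i : Fin n) : Measurable fun ω => 𝒮.xs ω i :=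
  (measurable_pi_apply i).comp 𝒮.measurable_xs

lemma measurable_sig : Measurable (Function.uncurry 𝒮.sig) := by
  unfold Function.uncurry sig
  refine Finset.measurable_sum _ fun i _ => ?_
  have h1 : Measurable fun a : Ω × P => 𝒮.x a.2 i := (𝒮.measurable_x_apply i).comp measurable_snd
  have h2 : Measurable fun a : Ω × P => 𝒮.xs a.1 i := (𝒮.measurable_xs_apply i).comp measurable_fst
  exact (h1.mul h2).sub ((h1.pow_const 2).div_const 2)

lemma measurable_noi : Measurable (Function.uncurry 𝒮.noi) := by
  unfold Function.uncurry noi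
  refine Finset.measurable_sum _ fun i _ => ?_
  exact ((𝒮.measurable_x_apply i).comp measurable_snd).mul
    ((measurable_pi_apply i).comp measurable_fst)

lemma measurable_Q : Measurable (Function.uncurry 𝒮.Q) := by
  unfold Function.uncurry Q
  refine Measurable.const_mul (Finset.measurable_sum _ fun i _ => ?_) _
  exact ((𝒮.measurable_xs_apply i).comp measurable_fst).mul
    ((𝒮.measurable_x_apply i).comp measurable_snd)

lemma measurable_energy :
    Measurable fun a : (ℝ × (Ω × (Fin n → ℝ))) × P => 𝒮.energy a.1.1 a.1.2 a.2 := by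
  unfold energy
  have h1 := 𝒮.measurable_H.comp (g := Function.uncurry 𝒮.H)
    (f := fun a : (ℝ × (Ω × (Fin n → ℝ))) × P => (a.1.2.1, a.2)) (by fun_prop)
  have h2 := 𝒮.measurable_sig.comp (g := Function.uncurry 𝒮.sig)
    (f := fun a : (ℝ × (Ω × (Fin n → ℝ))) × P => (a.1.2.1, a.2)) (by fun_prop)
  have h3 := 𝒮.measurable_noi.comp (g := Function.uncurry 𝒮.noi)
    (f := fun a : (ℝ × (Ω × (Fin n → ℝ))) × P => (a.1.2.2, a.2)) (by fun_prop)
  have hl : Measurable fun a : (ℝ × (Ω × (Fin n → ℝ))) × P => a.1.1 := by fun_prop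
  exact (h1.add (hl.mul h2)).add (hl.sqrt.mul h3)

lemma measurable_energy_apply (l : ℝ) (ω : Ω × (Fin n → ℝ)) : Measurable (𝒮.energy l ω) :=
  𝒮.measurable_energy.comp (measurable_prodMk_left (x := (l, ω)))

lemma measurable_ell :
    Measurable fun a : (ℝ × (Ω × (Fin n → ℝ))) × P => 𝒮.ell a.1.1 a.1.2 a.2 := by
  unfold ell
  have h2 := 𝒮.measurable_sig.comp (g := Function.uncurry 𝒮.sig)
    (f := fun a : (ℝ × (Ω × (Fin n → ℝ))) × P => (a.1.2.1, a.2)) (by fun_prop)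
  have h3 := 𝒮.measurable_noi.comp (g := Function.uncurry 𝒮.noi)
    (f := fun a : (ℝ × (Ω × (Fin n → ℝ))) × P => (a.1.2.2, a.2)) (by fun_prop)
  have hl : Measurable fun a : (ℝ × (Ω × (Fin n → ℝ))) × P => a.1.1 := by fun_prop
  exact h2.add (h3.div (hl.sqrt.const_mul 2))

lemma measurable_ell_apply (l : ℝ) (ω : Ω × (Fin n → ℝ)) : Measurable (𝒮.ell l ω) :=
  𝒮.measurable_ell.comp (measurable_prodMk_left (x := (l, ω)))

lemma measurable_Q_apply (ω : Ω) : Measurable (𝒮.Q ω) :=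
  𝒮.measurable_Q.comp (measurable_prodMk_left (x := ω))

lemma measurable_br {g : ℝ × (Ω × (Fin n → ℝ)) → P → ℝ}
    (hg : Measurable (Function.uncurry g)) :
    Measurable fun a : ℝ × (Ω × (Fin n → ℝ)) => 𝒮.br a.1 a.2 (g a) := by
  unfold br
  simp only [integral_tilted_eq_div]
  have h1 : Measurable fun a : (ℝ × (Ω × (Fin n → ℝ))) × P =>
      g a.1 a.2 * Real.exp (𝒮.energy a.1.1 a.1.2 a.2) := hg.mul 𝒮.measurable_energy.exp
  have h2 : Measurable fun a : (ℝ × (Ω × (Fin n → ℝ))) × P =>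
      Real.exp (𝒮.energy a.1.1 a.1.2 a.2) := 𝒮.measurable_energy.exp
  exact (h1.stronglyMeasurable.integral_prod_right' (ν := 𝒮.prior)).measurable.div
    (h2.stronglyMeasurable.integral_prod_right' (ν := 𝒮.prior)).measurable

lemma measurable_br_apply (l : ℝ) {g : Ω × (Fin n → ℝ) → P → ℝ}
    (hg : Measurable (Function.uncurry g)) :
    Measurable fun ω : Ω × (Fin n → ℝ) => 𝒮.br l ω (g ω) := by
  unfold br
  simp only [integral_tilted_eq_div]
  have he : Measurable fun a : (Ω × (Fin n → ℝ)) × P => 𝒮.energy l a.1 a.2 := by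
    have h1 : Measurable fun a : (Ω × (Fin n → ℝ)) × P => ((l, a.1), a.2) := by fun_prop
    exact 𝒮.measurable_energy.comp h1
  have h1 : Measurable fun a : (Ω × (Fin n → ℝ)) × P =>
      g a.1 a.2 * Real.exp (𝒮.energy l a.1 a.2) := hg.mul he.exp
  exact (h1.stronglyMeasurable.integral_prod_right' (ν := 𝒮.prior)).measurable.div
    (he.exp.stronglyMeasurable.integral_prod_right' (ν := 𝒮.prior)).measurable

lemma measurable_br_const (l : ℝ) {g : P → ℝ} (hg : Measurable g) :
    Measurable fun ω : Ω × (Fin n → ℝ) => 𝒮.br l ω g :=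
  𝒮.measurable_br_apply l (g := fun _ => g) (hg.comp measurable_snd)

end Measurability

section Bounds

lemma abs_noi_le (z : Fin n → ℝ) : ∀ᵐ p ∂𝒮.prior, |𝒮.noi z p| ≤ 𝒮.amp z := by
  filter_upwards [𝒮.abs_x_le] with p hp
  unfold noi amp
  rw [Finset.mul_sum]
  refine (Finset.abs_sum_le_sum_abs _ _).trans (Finset.sum_le_sum fun i _ => ?_)
  rw [abs_mul]
  exact mul_le_mul_of_nonneg_right (hp i) (abs_nonneg _)

lemma abs_sig_le_of (ω : Ω) : ∀ᵐ p ∂𝒮.prior,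
    |𝒮.sig ω p| ≤ ∑ i, (𝒮.M * |𝒮.xs ω i| + 𝒮.M ^ 2 / 2) := by
  filter_upwards [𝒮.abs_x_le] with p hp
  unfold sig
  refine (Finset.abs_sum_le_sum_abs _ _).trans (Finset.sum_le_sum fun i _ => ?_)
  refine (abs_sub _ _).trans (add_le_add ?_ ?_)
  · rw [abs_mul]
    exact mul_le_mul_of_nonneg_right (hp i) (abs_nonneg _)
  · rw [abs_div, abs_pow, abs_two]
    have := pow_le_pow_left₀ (abs_nonneg _) (hp i) 2
    linarith

lemma abs_sig_le : ∀ᵐ ω ∂𝒮.law, ∀ᵐ p ∂𝒮.prior, |𝒮.sig ω p| ≤ n * (3 / 2 * 𝒮.M ^ 2) := by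
  filter_upwards [𝒮.abs_xs_le] with ω hω
  filter_upwards [𝒮.abs_sig_le_of ω] with p hp
  refine hp.trans ?_
  calc _ ≤ ∑ i : Fin n, (3 / 2 * 𝒮.M ^ 2) := by
        refine Finset.sum_le_sum fun i _ => ?_
        have := mul_le_mul_of_nonneg_left (hω i) 𝒮.M_nonneg
        nlinarith
    _ = _ := by simp

lemma bdd_energy (ω : Ω × (Fin n → ℝ)) (L : ℝ) :
    ∃ c, ∀ᵐ p ∂𝒮.prior, ∀ l, 0 ≤ l → l ≤ L → |𝒮.energy l ω p| ≤ c := by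
  obtain ⟨c, hc⟩ := 𝒮.bdd_H ω.1
  refine ⟨c + L * (∑ i, (𝒮.M * |𝒮.xs ω.1 i| + 𝒮.M ^ 2 / 2)) + Real.sqrt L * 𝒮.amp ω.2, ?_⟩
  filter_upwards [hc, 𝒮.abs_sig_le_of ω.1, 𝒮.abs_noi_le ω.2] with p h1 h2 h3 l hl hL
  unfold energy
  refine (abs_add_three _ _ _).trans (add_le_add (add_le_add h1 ?_) ?_)
  · rw [abs_mul, abs_of_nonneg hl]
    exact mul_le_mul hL h2 (abs_nonneg _) (hl.trans hL)
  · rw [abs_mul, abs_of_nonneg (Real.sqrt_nonneg _)]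
    exact mul_le_mul (Real.sqrt_le_sqrt hL) h3 (abs_nonneg _) (Real.sqrt_nonneg _)

lemma bdd_energy_apply {l : ℝ} (hl : 0 ≤ l) (ω : Ω × (Fin n → ℝ)) :
    ∃ c, ∀ᵐ p ∂𝒮.prior, |𝒮.energy l ω p| ≤ c := by
  obtain ⟨c, hc⟩ := 𝒮.bdd_energy ω l
  exact ⟨c, hc.mono fun p hp => hp l hl le_rfl⟩

lemma isProbabilityMeasure_gibbs {l : ℝ} (hl : 0 ≤ l) (ω : Ω × (Fin n → ℝ)) :
    IsProbabilityMeasure (𝒮.prior.tilted (𝒮.energy l ω)) := by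
  obtain ⟨c, hc⟩ := 𝒮.bdd_energy_apply hl ω
  exact isProbabilityMeasure_tilted_of_bdd (𝒮.measurable_energy_apply l ω) hc

lemma abs_br_le {l : ℝ} (hl : 0 ≤ l) (ω : Ω × (Fin n → ℝ)) {g : P → ℝ} {c : ℝ}
    (hg : ∀ᵐ p ∂𝒮.prior, |g p| ≤ c) : |𝒮.br l ω g| ≤ c := by
  have := 𝒮.isProbabilityMeasure_gibbs hl ω
  exact abs_integral_le_of_ae_abs_le (ae_tilted hg)

lemma integrable_gibbs {l : ℝ} (hl : 0 ≤ l) (ω : Ω × (Fin n → ℝ)) {g : P → ℝ} {c : ℝ}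
    (hgm : Measurable g) (hg : ∀ᵐ p ∂𝒮.prior, |g p| ≤ c) :
    Integrable g (𝒮.prior.tilted (𝒮.energy l ω)) := by
  have := 𝒮.isProbabilityMeasure_gibbs hl ω
  exact integrable_of_ae_abs_le hgm (ae_tilted hg)

lemma abs_Q_le (hn : 0 < n) : ∀ᵐ ω ∂𝒮.law, ∀ᵐ p ∂𝒮.prior, |𝒮.Q ω p| ≤ 𝒮.M ^ 2 := by
  filter_upwards [𝒮.abs_xs_le] with ω hω
  filter_upwards [𝒮.abs_x_le] with p hp
  have hn' : (0 : ℝ) < n := Nat.cast_pos.2 hn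
  unfold Q
  rw [abs_mul, abs_of_pos (by positivity)]
  have : |∑ i, 𝒮.xs ω i * 𝒮.x p i| ≤ n * 𝒮.M ^ 2 := by
    calc _ ≤ ∑ i : Fin n, 𝒮.M ^ 2 := by
          refine (Finset.abs_sum_le_sum_abs _ _).trans (Finset.sum_le_sum fun i _ => ?_)
          rw [abs_mul, sq]
          exact mul_le_mul (hω i) (hp i) (abs_nonneg _) 𝒮.M_nonneg
      _ = _ := by simp
  calc (1 / (n : ℝ)) * |∑ i, 𝒮.xs ω i * 𝒮.x p i| ≤ (1 / (n : ℝ)) * (n * 𝒮.M ^ 2) := by gcongr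
    _ = _ := by field_simp

lemma ae_joint {q : Ω → Prop} (h : ∀ᵐ ω ∂𝒮.law, q ω) : ∀ᵐ ω ∂𝒮.joint, q ω.1 :=
  Measure.quasiMeasurePreserving_fst.ae h

lemma memLp_abs_sum : MemLp (fun z : Fin n → ℝ => ∑ i, |z i|) 2 (noise n) ∧
    ∫ z, |∑ i, |z i| - ∫ z, ∑ i, |z i| ∂noise n| ∂(noise n) ≤ 2 * Real.sqrt n := by
  have hid : MemLp (fun x : ℝ => |x|) 2 (gaussianReal 0 1) :=
    (memLp_id_gaussianReal 2).abs
  have h := efronStein (μ := gaussianReal 0 1) (T := Set.univ) (by simp) hid (N := n)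
    (f := fun z => ∑ i, |z i|) (by fun_prop) (by
      intro i x y _ _
      rw [← Finset.sum_sub_distrib, Finset.sum_eq_single i]
      · simp only [Function.update_self]
        refine (abs_sub _ _).trans ?_
        simp
      · intro j _ hj; simp [hj]
      · simp)
  refine ⟨h.1, (integral_abs_le_sqrt (h.1.sub (memLp_const _))).trans ?_⟩
  have h2 : ∫ x, |x| ^ 2 ∂(gaussianReal 0 1) = 1 := by
    have := variance_id_gaussianReal (μ := 0) (v := 1)
    rw [variance_eq_integral (by fun_prop)] at this
    simpa using this
  rw [h2, mul_one] at h
  calc _ ≤ Real.sqrt (4 * n) := Real.sqrt_le_sqrt h.2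
    _ = 2 * Real.sqrt n := by
      rw [Real.sqrt_mul (by norm_num), show (4 : ℝ) = 2 ^ 2 by norm_num,
        Real.sqrt_sq (by norm_num)]

lemma integral_abs_gaussian_le : ∫ x, |x| ∂(gaussianReal 0 1) ≤ 1 := by
  refine (integral_abs_le_sqrt (memLp_id_gaussianReal 2)).trans ?_
  have := variance_id_gaussianReal (μ := 0) (v := 1)
  rw [variance_eq_integral (by fun_prop)] at this
  simp only [id, integral_id_gaussianReal, sub_zero, NNReal.coe_one] at this ⊢
  rw [this]; simp

lemma integral_amp_le : ∫ z, 𝒮.amp z ∂(noise n) ≤ 𝒮.M * n := by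
  unfold amp
  rw [integral_const_mul]
  refine mul_le_mul_of_nonneg_left ?_ 𝒮.M_nonneg
  have hi : ∀ i : Fin n, Integrable (fun z : Fin n → ℝ => |z i|) (noise n) := fun i =>
    (measurePreserving_eval (fun _ : Fin n => gaussianReal 0 1) i).integrable_comp_of_integrable
      (g := fun x => |x|) (memLp_id_gaussianReal 1 |>.integrable le_rfl).abs
  rw [integral_finsetSum _ fun i _ => hi i]
  calc _ ≤ ∑ i : Fin n, (1 : ℝ) := by
        refine Finset.sum_le_sum fun i _ => ?_
        have hmp := measurePreserving_eval (fun _ : Fin n => gaussianReal 0 1) i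
        have := integral_map (μ := noise n) (f := fun x : ℝ => |x|) hmp.measurable.aemeasurable
          (by fun_prop)
        rw [hmp.map_eq] at this
        change ∫ z : Fin n → ℝ, |Function.eval i z| ∂noise n ≤ 1
        rw [← this]
        exact integral_abs_gaussian_le
    _ = n := by simp

lemma integrable_amp : Integrable 𝒮.amp (noise n) := by
  have := memLp_abs_sum (n := n).1.integrable (by norm_num)
  exact this.const_mul _

lemma integrable_amp_snd : Integrable (fun ω : Ω × (Fin n → ℝ) => 𝒮.amp ω.2) 𝒮.joint :=
  measurePreserving_snd.integrable_comp_of_integrable 𝒮.integrable_amp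

end Bounds

end SideChannel

end

noncomputable section

namespace SideChannel

variable {Ω P : Type*} [MeasurableSpace Ω] [MeasurableSpace P] {n : ℕ} (𝒮 : SideChannel Ω P n)

lemma noi_update (z : Fin n → ℝ) (i : Fin n) (a : ℝ) (p : P) :
    𝒮.noi (Function.update z i a) p = 𝒮.noi (Function.update z i 0) p + a * 𝒮.x p i := by
  unfold noi
  rw [← Finset.add_sum_erase _ _ (Finset.mem_univ i),
    ← Finset.add_sum_erase (a := i) _ (fun j => 𝒮.x p j * Function.update z i 0 j)
      (Finset.mem_univ i)]
  have : ∀ b : ℝ, ∑ j ∈ Finset.univ.erase i, 𝒮.x p j * Function.update z i b j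
      = ∑ j ∈ Finset.univ.erase i, 𝒮.x p j * z j := fun b =>
    Finset.sum_congr rfl fun j hj => by rw [Function.update_of_ne (Finset.ne_of_mem_erase hj)]
  rw [this, this]
  simp only [Function.update_self]
  ring

lemma energy_update (l : ℝ) (ω : Ω) (z : Fin n → ℝ) (i : Fin n) (a : ℝ) (p : P) :
    𝒮.energy l (ω, Function.update z i a) p
      = 𝒮.energy l (ω, Function.update z i 0) p + a * (Real.sqrt l * 𝒮.x p i) := by
  unfold energy
  simp only
  rw [noi_update]
  ring

lemma abs_mul_x_le {g : P → ℝ} {c : ℝ} (hg : ∀ᵐ p ∂𝒮.prior, |g p| ≤ c) (i : Fin n) :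
    ∀ᵐ p ∂𝒮.prior, |g p * 𝒮.x p i| ≤ c * 𝒮.M := by
  filter_upwards [hg, 𝒮.abs_x_le] with p h1 h2
  rw [abs_mul]
  exact mul_le_mul h1 (h2 i) (abs_nonneg _) ((abs_nonneg _).trans h1)

lemma hasDerivAt_br_update {l : ℝ} (hl : 0 ≤ l) (ω : Ω) (z : Fin n → ℝ) (i : Fin n) (a : ℝ)
    {g : P → ℝ} {c : ℝ} (hgm : Measurable g) (hg : ∀ᵐ p ∂𝒮.prior, |g p| ≤ c) :
    HasDerivAt (fun a => 𝒮.br l (ω, Function.update z i a) g)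
      (Real.sqrt l * (𝒮.br l (ω, Function.update z i a) (fun p => g p * 𝒮.x p i)
        - 𝒮.br l (ω, Function.update z i a) g
          * 𝒮.br l (ω, Function.update z i a) (fun p => 𝒮.x p i))) a := by
  obtain ⟨c0, hc0⟩ := 𝒮.bdd_energy_apply hl (ω, Function.update z i 0)
  have hE := 𝒮.measurable_energy_apply l (ω, Function.update z i 0)
  have hx := (𝒮.measurable_x_apply i).const_mul (Real.sqrt l)
  have h := hasDerivAt_integral_tilted (π := 𝒮.prior)
    (θ := fun a p => 𝒮.energy l (ω, Function.update z i 0) p + a * (Real.sqrt l * 𝒮.x p i))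
    (θ' := fun _ p => Real.sqrt l * 𝒮.x p i) (s := Metric.ball a 1) (a := a)
    (Metric.ball_mem_nhds a one_pos) (fun a => hE.add (hx.const_mul a)) hx
    (c := c0 + (|a| + 1) * (Real.sqrt l * 𝒮.M)) (c' := Real.sqrt l * 𝒮.M) (M := c) ?_ ?_ ?_ hgm hg
  · have e : ∀ b, 𝒮.prior.tilted
        (fun p => 𝒮.energy l (ω, Function.update z i 0) p + b * (Real.sqrt l * 𝒮.x p i))
        = 𝒮.prior.tilted (𝒮.energy l (ω, Function.update z i b)) := by
      intro b; congr 1; ext p; rw [𝒮.energy_update l ω z i b p]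
    simp only [e] at h
    unfold br
    convert! h using 1
    have e2 : ∀ p, g p * (Real.sqrt l * 𝒮.x p i) = Real.sqrt l * (g p * 𝒮.x p i) := by
      intro p; ring
    simp only [e2]
    rw [integral_const_mul, integral_const_mul]
    ring
  · filter_upwards [hc0, 𝒮.abs_x_le] with p h1 h2 b hb
    refine (abs_add_le _ _).trans (add_le_add h1 ?_)
    rw [abs_mul, abs_mul, abs_of_nonneg (Real.sqrt_nonneg l)]
    have hb' : |b| ≤ |a| + 1 := by
      have h3 := abs_add_le (b - a) a
      rw [sub_add_cancel] at h3
      rw [Metric.mem_ball, Real.dist_eq] at hb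
      linarith
    exact mul_le_mul hb' (mul_le_mul_of_nonneg_left (h2 i) (Real.sqrt_nonneg _)) (by positivity)
      (by positivity)
  · filter_upwards [𝒮.abs_x_le] with p h2 b _
    rw [abs_mul, abs_of_nonneg (Real.sqrt_nonneg l)]
    exact mul_le_mul_of_nonneg_left (h2 i) (Real.sqrt_nonneg _)
  · intro p b _
    have := ((hasDerivAt_id b).mul_const (Real.sqrt l * 𝒮.x p i)).const_add
      (𝒮.energy l (ω, Function.update z i 0) p)
    simpa using this

lemma measurable_br_snd (l : ℝ) (ω : Ω) {g : P → ℝ} (hg : Measurable g) :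
    Measurable fun z : Fin n → ℝ => 𝒮.br l (ω, z) g := by
  have h := 𝒮.measurable_br_const l hg
  have h2 : Measurable fun z : Fin n → ℝ => (ω, z) := measurable_prodMk_left
  exact h.comp (f := fun z : Fin n → ℝ => (ω, z)) h2

lemma integrable_br_snd {l : ℝ} (hl : 0 ≤ l) (ω : Ω) {g : P → ℝ} {c : ℝ} (hgm : Measurable g)
    (hg : ∀ᵐ p ∂𝒮.prior, |g p| ≤ c) : Integrable (fun z => 𝒮.br l (ω, z) g) (noise n) :=
  integrable_of_ae_abs_le (𝒮.measurable_br_snd l ω hgm)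
    (Eventually.of_forall fun z => 𝒮.abs_br_le hl (ω, z) hg)

lemma integrable_eval (i : Fin n) : Integrable (fun z : Fin n → ℝ => z i) (noise n) :=
  (measurePreserving_eval (fun _ : Fin n => gaussianReal 0 1) i).integrable_comp_of_integrable
    (g := fun x => x) (memLp_id_gaussianReal 1 |>.integrable le_rfl)

lemma br_mul_noi {l : ℝ} (hl : 0 ≤ l) (ω : Ω) (z : Fin n → ℝ) {g : P → ℝ} {c : ℝ}
    (hgm : Measurable g) (hg : ∀ᵐ p ∂𝒮.prior, |g p| ≤ c) :
    𝒮.br l (ω, z) (fun p => g p * 𝒮.noi z p)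
      = ∑ i, z i * 𝒮.br l (ω, z) (fun p => g p * 𝒮.x p i) := by
  unfold br noi
  have e : ∀ p, g p * ∑ i, 𝒮.x p i * z i = ∑ i, z i * (g p * 𝒮.x p i) := by
    intro p; rw [Finset.mul_sum]; exact Finset.sum_congr rfl fun i _ => by ring
  simp only [e]
  rw [integral_finsetSum]
  · simp only [integral_const_mul]
  · intro i _
    exact (𝒮.integrable_gibbs hl (ω, z) (hgm.mul (𝒮.measurable_x_apply i))
      (𝒮.abs_mul_x_le hg i)).const_mul _

lemma integral_br_mul_noi {l : ℝ} (hl : 0 ≤ l) (ω : Ω) {g : P → ℝ} {c : ℝ}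
    (hgm : Measurable g) (hg : ∀ᵐ p ∂𝒮.prior, |g p| ≤ c) :
    ∫ z, 𝒮.br l (ω, z) (fun p => g p * 𝒮.noi z p) ∂(noise n)
      = ∑ i, ∫ z, Real.sqrt l * (𝒮.br l (ω, z) (fun p => g p * 𝒮.x p i * 𝒮.x p i)
          - 𝒮.br l (ω, z) (fun p => g p * 𝒮.x p i) * 𝒮.br l (ω, z) (fun p => 𝒮.x p i))
          ∂(noise n) := by
  simp only [fun z => 𝒮.br_mul_noi hl ω z hgm hg]
  have hgx : ∀ i, Measurable fun p => g p * 𝒮.x p i := fun i => hgm.mul (𝒮.measurable_x_apply i)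
  rw [integral_finsetSum]
  · refine Finset.sum_congr rfl fun i _ => ?_
    refine gaussian_pi_stein i (c := c * 𝒮.M)
      (c' := Real.sqrt l * (c * 𝒮.M * 𝒮.M + c * 𝒮.M * 𝒮.M)) (𝒮.measurable_br_snd l ω (hgx i)) ?_
      (fun z a => 𝒮.hasDerivAt_br_update hl ω z i a (hgx i) (𝒮.abs_mul_x_le hg i))
      (fun z => 𝒮.abs_br_le hl _ (𝒮.abs_mul_x_le hg i)) ?_
    · exact ((𝒮.measurable_br_snd l ω ((hgx i).mul (𝒮.measurable_x_apply i))).sub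
        ((𝒮.measurable_br_snd l ω (hgx i)).mul
          (𝒮.measurable_br_snd l ω (𝒮.measurable_x_apply i)))).const_mul _
    · intro z
      rw [abs_mul, abs_of_nonneg (Real.sqrt_nonneg l)]
      refine mul_le_mul_of_nonneg_left ((abs_sub _ _).trans (add_le_add ?_ ?_)) (Real.sqrt_nonneg _)
      · exact 𝒮.abs_br_le hl _ (𝒮.abs_mul_x_le (𝒮.abs_mul_x_le hg i) i)
      · rw [abs_mul]
        have h1 := 𝒮.abs_br_le hl (ω, z) (𝒮.abs_mul_x_le hg i)
        exact mul_le_mul h1 (𝒮.abs_br_le hl (ω, z) (𝒮.abs_x_le.mono fun p hp => hp i))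
          (abs_nonneg _) ((abs_nonneg _).trans h1)
  · intro i _
    exact (integrable_eval i).mul_bdd (c := c * 𝒮.M)
      (𝒮.measurable_br_snd l ω (hgx i)).aestronglyMeasurable
      (Eventually.of_forall fun z => 𝒮.abs_br_le hl _ (𝒮.abs_mul_x_le hg i))

/-- Gaussian integration by parts for the derivative of the energy. -/
lemma integral_br_mul_ell {l : ℝ} (hl : 0 < l) (ω : Ω) {g : P → ℝ} {c : ℝ}
    (hgm : Measurable g) (hg : ∀ᵐ p ∂𝒮.prior, |g p| ≤ c) :
    ∫ z, 𝒮.br l (ω, z) (fun p => g p * 𝒮.ell l (ω, z) p) ∂(noise n)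
      = ∫ z, ∑ i, (𝒮.xs ω i * 𝒮.br l (ω, z) (fun p => g p * 𝒮.x p i)
          - 1 / 2 * (𝒮.br l (ω, z) (fun p => g p * 𝒮.x p i)
            * 𝒮.br l (ω, z) (fun p => 𝒮.x p i))) ∂(noise n) := by
  have hgx : ∀ i, Measurable fun p => g p * 𝒮.x p i := fun i => hgm.mul (𝒮.measurable_x_apply i)
  have hgxx : ∀ i, Measurable fun p => g p * 𝒮.x p i * 𝒮.x p i :=
    fun i => (hgx i).mul (𝒮.measurable_x_apply i)
  have bx := fun i => 𝒮.abs_mul_x_le hg i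
  have bxx := fun i => 𝒮.abs_mul_x_le (𝒮.abs_mul_x_le hg i) i
  have hnm : ∀ z, Measurable fun p => g p * 𝒮.noi z p := fun z =>
    hgm.mul (𝒮.measurable_noi.comp (measurable_prodMk_left (x := z)))
  have hnb : ∀ z, ∀ᵐ p ∂𝒮.prior, |g p * 𝒮.noi z p| ≤ c * 𝒮.amp z := by
    intro z
    filter_upwards [hg, 𝒮.abs_noi_le z] with p h1 h2
    rw [abs_mul]
    exact mul_le_mul h1 h2 (abs_nonneg _) ((abs_nonneg _).trans h1)
  have ix := fun z i => 𝒮.integrable_gibbs hl.le (ω, z) (hgx i) (bx i)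
  have ixx := fun z i => 𝒮.integrable_gibbs hl.le (ω, z) (hgxx i) (bxx i)
  have hsl : 0 < Real.sqrt l := Real.sqrt_pos.2 hl
  have e1 : ∀ z, 𝒮.br l (ω, z) (fun p => g p * 𝒮.ell l (ω, z) p)
      = (∑ i, (𝒮.xs ω i * 𝒮.br l (ω, z) (fun p => g p * 𝒮.x p i)
          - 1 / 2 * 𝒮.br l (ω, z) (fun p => g p * 𝒮.x p i * 𝒮.x p i)))
        + 1 / (2 * Real.sqrt l) * 𝒮.br l (ω, z) (fun p => g p * 𝒮.noi z p) := by
    intro z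
    unfold br
    have e : ∀ p, g p * 𝒮.ell l (ω, z) p = (∑ i, (𝒮.xs ω i * (g p * 𝒮.x p i)
        - 1 / 2 * (g p * 𝒮.x p i * 𝒮.x p i))) + 1 / (2 * Real.sqrt l) * (g p * 𝒮.noi z p) := by
      intro p
      unfold ell sig
      rw [mul_add, Finset.mul_sum]
      congr 1
      · exact Finset.sum_congr rfl fun i _ => by ring
      · ring
    simp only [e]
    have hi : ∀ i, Integrable (fun p => 𝒮.xs ω i * (g p * 𝒮.x p i)
        - 1 / 2 * (g p * 𝒮.x p i * 𝒮.x p i)) (𝒮.prior.tilted (𝒮.energy l (ω, z))) :=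
      fun i => ((ix z i).const_mul _).sub ((ixx z i).const_mul _)
    rw [integral_add (integrable_finsetSum _ fun i _ => hi i)
      ((𝒮.integrable_gibbs hl.le (ω, z) (hnm z) (hnb z)).const_mul _),
      integral_finsetSum _ fun i _ => hi i, integral_const_mul]
    congr 1
    refine Finset.sum_congr rfl fun i _ => ?_
    rw [integral_sub ((ix z i).const_mul _) ((ixx z i).const_mul _), integral_const_mul,
      integral_const_mul]
  have jx := fun i => 𝒮.integrable_br_snd hl.le ω (hgx i) (bx i)
  have jxx := fun i => 𝒮.integrable_br_snd hl.le ω (hgxx i) (bxx i)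
  have jxm : ∀ i, Integrable (fun z => 𝒮.br l (ω, z) (fun p => g p * 𝒮.x p i)
      * 𝒮.br l (ω, z) (fun p => 𝒮.x p i)) (noise n) := fun i =>
    (jx i).mul_bdd (c := 𝒮.M) (𝒮.measurable_br_snd l ω (𝒮.measurable_x_apply i)).aestronglyMeasurable
      (Eventually.of_forall fun z => 𝒮.abs_br_le hl.le _ (𝒮.abs_x_le.mono fun p hp => hp i))
  have jn : Integrable (fun z => 𝒮.br l (ω, z) (fun p => g p * 𝒮.noi z p)) (noise n) := by
    simp only [fun z => 𝒮.br_mul_noi hl.le ω z hgm hg]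
    refine integrable_finsetSum _ fun i _ => ?_
    exact (integrable_eval i).mul_bdd (c := c * 𝒮.M)
      (𝒮.measurable_br_snd l ω (hgx i)).aestronglyMeasurable
      (Eventually.of_forall fun z => 𝒮.abs_br_le hl.le _ (bx i))
  have js : ∀ i, Integrable (fun z => 𝒮.xs ω i * 𝒮.br l (ω, z) (fun p => g p * 𝒮.x p i)
          - 1 / 2 * 𝒮.br l (ω, z) (fun p => g p * 𝒮.x p i * 𝒮.x p i)) (noise n) := fun i =>
    ((jx i).const_mul _).sub ((jxx i).const_mul _)
  have jm : ∀ i, Integrable (fun z => 𝒮.xs ω i * 𝒮.br l (ω, z) (fun p => g p * 𝒮.x p i)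
      - 1 / 2 * (𝒮.br l (ω, z) (fun p => g p * 𝒮.x p i)
            * 𝒮.br l (ω, z) (fun p => 𝒮.x p i))) (noise n) := fun i =>
    ((jx i).const_mul _).sub ((jxm i).const_mul _)
  simp only [e1]
  rw [integral_add (integrable_finsetSum _ fun i _ => js i) (jn.const_mul _),
    integral_finsetSum _ fun i _ => js i, integral_const_mul, 𝒮.integral_br_mul_noi hl.le ω hgm hg,
    integral_finsetSum _ fun i _ => jm i, Finset.mul_sum, ← Finset.sum_add_distrib]
  refine Finset.sum_congr rfl fun i _ => ?_
  rw [integral_sub ((jx i).const_mul _) ((jxx i).const_mul _),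
    integral_sub ((jx i).const_mul _) ((jxm i).const_mul _), integral_const_mul, integral_const_mul,
    integral_const_mul, integral_const_mul, integral_sub (jxx i) (jxm i)]
  field_simp
  ring

end SideChannel

end

noncomputable section

namespace SideChannel

variable {Ω P : Type*} [MeasurableSpace Ω] [MeasurableSpace P] {n : ℕ} (𝒮 : SideChannel Ω P n)

lemma abs_ell_le_forall : ∀ᵐ ω ∂𝒮.joint, ∀ l, ∀ᵐ p ∂𝒮.prior,
    |𝒮.ell l ω p| ≤ n * (3 / 2 * 𝒮.M ^ 2) + 𝒮.amp ω.2 / (2 * Real.sqrt l) := by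
  filter_upwards [𝒮.ae_joint 𝒮.abs_sig_le] with ω hω l
  filter_upwards [hω, 𝒮.abs_noi_le ω.2] with p h1 h2
  unfold ell
  refine (abs_add_le _ _).trans (add_le_add h1 ?_)
  rw [abs_div, abs_of_nonneg (a := 2 * Real.sqrt l) (by positivity)]
  gcongr

lemma abs_ell_le (l : ℝ) : ∀ᵐ ω ∂𝒮.joint, ∀ᵐ p ∂𝒮.prior,
    |𝒮.ell l ω p| ≤ n * (3 / 2 * 𝒮.M ^ 2) + 𝒮.amp ω.2 / (2 * Real.sqrt l) :=
  𝒮.abs_ell_le_forall.mono fun _ h => h l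

lemma integrable_ell_bound (l a : ℝ) : Integrable
    (fun ω : Ω × (Fin n → ℝ) => a * (n * (3 / 2 * 𝒮.M ^ 2) + 𝒮.amp ω.2 / (2 * Real.sqrt l)))
    𝒮.joint :=
  (((integrable_const (μ := 𝒮.joint) ((n : ℝ) * (3 / 2 * 𝒮.M ^ 2))).add
    (𝒮.integrable_amp_snd.div_const _))).const_mul _

lemma measurable_uncurry_of_fst {G : Ω → P → ℝ} (hG : Measurable (Function.uncurry G)) :
    Measurable (Function.uncurry fun (ω : Ω × (Fin n → ℝ)) p => G ω.1 p) := by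
  have h2 : Measurable fun a : (Ω × (Fin n → ℝ)) × P => (a.1.1, a.2) := by fun_prop
  exact hG.comp h2

lemma measurable_ell_uncurry (l : ℝ) :
    Measurable (Function.uncurry fun (ω : Ω × (Fin n → ℝ)) p => 𝒮.ell l ω p) := by
  have h1 : Measurable fun a : (Ω × (Fin n → ℝ)) × P => ((l, a.1), a.2) := by fun_prop
  exact 𝒮.measurable_ell.comp h1

lemma integrable_br_mul_ell {l : ℝ} (hl : 0 < l) {G : Ω → P → ℝ} {c : ℝ}
    (hG : Measurable (Function.uncurry G))
    (hc : ∀ᵐ ω ∂𝒮.law, ∀ᵐ p ∂𝒮.prior, |G ω p| ≤ c) :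
    Integrable (fun ω => 𝒮.br l ω (fun p => G ω.1 p * 𝒮.ell l ω p)) 𝒮.joint := by
  refine Integrable.mono' (𝒮.integrable_ell_bound l c) ?_ ?_
  · refine (𝒮.measurable_br_apply l ?_).aestronglyMeasurable
    exact (measurable_uncurry_of_fst hG).mul (𝒮.measurable_ell_uncurry l)
  · filter_upwards [𝒮.ae_joint hc, 𝒮.abs_ell_le l] with ω h1 h2
    refine 𝒮.abs_br_le hl.le ω ?_
    filter_upwards [h1, h2] with p h3 h4
    rw [abs_mul]
    exact mul_le_mul h3 h4 (abs_nonneg _) ((abs_nonneg _).trans h3)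

lemma integrable_br {l : ℝ} (hl : 0 ≤ l) {G : Ω → P → ℝ} {c : ℝ}
    (hG : Measurable (Function.uncurry G))
    (hc : ∀ᵐ ω ∂𝒮.law, ∀ᵐ p ∂𝒮.prior, |G ω p| ≤ c) :
    Integrable (fun ω => 𝒮.br l ω (fun p => G ω.1 p)) 𝒮.joint := by
  refine integrable_of_ae_abs_le (c := c) (𝒮.measurable_br_apply l (measurable_uncurry_of_fst hG)) ?_
  filter_upwards [𝒮.ae_joint hc] with ω h1
  exact 𝒮.abs_br_le hl ω h1

lemma measurable_mul_x {G : Ω → P → ℝ} (hG : Measurable (Function.uncurry G)) (i : Fin n) :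
    Measurable (Function.uncurry fun ω p => G ω p * 𝒮.x p i) := by
  have h : Measurable fun a : Ω × P => 𝒮.x a.2 i := (𝒮.measurable_x_apply i).comp measurable_snd
  exact hG.mul h

lemma integral_joint_br_mul_ell {l : ℝ} (hl : 0 < l) {G : Ω → P → ℝ} {c : ℝ}
    (hG : Measurable (Function.uncurry G))
    (hc : ∀ᵐ ω ∂𝒮.law, ∀ᵐ p ∂𝒮.prior, |G ω p| ≤ c) :
    ∫ ω, 𝒮.br l ω (fun p => G ω.1 p * 𝒮.ell l ω p) ∂𝒮.joint
      = ∫ ω, ∑ i, 𝒮.xs ω.1 i * 𝒮.br l ω (fun p => G ω.1 p * 𝒮.x p i) ∂𝒮.joint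
        - 1 / 2 * ∫ ω, ∑ i, 𝒮.br l ω (fun p => G ω.1 p * 𝒮.x p i)
            * 𝒮.br l ω (fun p => 𝒮.x p i) ∂𝒮.joint := by
  have hcx : ∀ i, ∀ᵐ ω ∂𝒮.law, ∀ᵐ p ∂𝒮.prior, |G ω p * 𝒮.x p i| ≤ c * 𝒮.M := fun i =>
    hc.mono fun ω h => 𝒮.abs_mul_x_le h i
  have i1 := fun i => 𝒮.integrable_br hl.le (𝒮.measurable_mul_x hG i) (hcx i)
  have mx : ∀ i, Measurable fun ω : Ω × (Fin n → ℝ) => 𝒮.br l ω (fun p => 𝒮.x p i) := fun i =>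
    𝒮.measurable_br_const l (𝒮.measurable_x_apply i)
  have i2 : ∀ i, Integrable (fun ω => 𝒮.xs ω.1 i * 𝒮.br l ω (fun p => G ω.1 p * 𝒮.x p i))
      𝒮.joint := fun i => by
    refine (i1 i).bdd_mul (c := 𝒮.M) ((𝒮.measurable_xs_apply i).comp
      measurable_fst).aestronglyMeasurable ?_
    exact (𝒮.ae_joint 𝒮.abs_xs_le).mono fun ω h => h i
  have i3 : ∀ i, Integrable (fun ω => 𝒮.br l ω (fun p => G ω.1 p * 𝒮.x p i)
            * 𝒮.br l ω (fun p => 𝒮.x p i)) 𝒮.joint := fun i => by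
    refine (i1 i).mul_bdd (c := 𝒮.M) (mx i).aestronglyMeasurable ?_
    exact Eventually.of_forall fun ω => 𝒮.abs_br_le hl.le ω (𝒮.abs_x_le.mono fun p hp => hp i)
  have i2' : Integrable (fun ω => ∑ i, 𝒮.xs ω.1 i * 𝒮.br l ω (fun p => G ω.1 p * 𝒮.x p i))
      𝒮.joint := integrable_finsetSum _ fun i _ => i2 i
  have i3' : Integrable (fun ω => ∑ i, 𝒮.br l ω (fun p => G ω.1 p * 𝒮.x p i)
            * 𝒮.br l ω (fun p => 𝒮.x p i)) 𝒮.joint := integrable_finsetSum _ fun i _ => i3 i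
  have i4 : Integrable (fun ω => ∑ i, (𝒮.xs ω.1 i * 𝒮.br l ω (fun p => G ω.1 p * 𝒮.x p i)
      - 1 / 2 * (𝒮.br l ω (fun p => G ω.1 p * 𝒮.x p i) * 𝒮.br l ω (fun p => 𝒮.x p i)))) 𝒮.joint :=
    integrable_finsetSum _ fun i _ => (i2 i).sub ((i3 i).const_mul _)
  rw [← integral_const_mul, ← integral_sub i2' (i3'.const_mul _)]
  have e : ∀ ω, ∑ i, 𝒮.xs ω.1 i * 𝒮.br l ω (fun p => G ω.1 p * 𝒮.x p i)
      - 1 / 2 * ∑ i, 𝒮.br l ω (fun p => G ω.1 p * 𝒮.x p i) * 𝒮.br l ω (fun p => 𝒮.x p i)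
      = ∑ i, (𝒮.xs ω.1 i * 𝒮.br l ω (fun p => G ω.1 p * 𝒮.x p i)
      - 1 / 2 * (𝒮.br l ω (fun p => G ω.1 p * 𝒮.x p i) * 𝒮.br l ω (fun p => 𝒮.x p i))) := by
    intro ω; rw [Finset.mul_sum, ← Finset.sum_sub_distrib]
  simp only [e]
  rw [integral_prod _ (𝒮.integrable_br_mul_ell hl hG hc), integral_prod _ i4]
  refine integral_congr_ae ?_
  filter_upwards [hc] with ω h
  exact 𝒮.integral_br_mul_ell hl ω (hG.comp (measurable_prodMk_left (x := ω))) h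

/-- The mean overlap. -/
def mean (l : ℝ) : ℝ := ∫ ω, 𝒮.br l ω (𝒮.Q ω.1) ∂𝒮.joint

/-- The overlap fluctuation. -/
def fluct (l : ℝ) : ℝ := ∫ ω, 𝒮.br l ω (fun p => (𝒮.Q ω.1 p - 𝒮.mean l) ^ 2) ∂𝒮.joint

/-- The Gibbs covariance of the overlap and the derivative of the energy. -/
def cov (l : ℝ) (ω : Ω × (Fin n → ℝ)) : ℝ :=
  𝒮.br l ω (fun p => 𝒮.Q ω.1 p * 𝒮.ell l ω p) - 𝒮.br l ω (𝒮.Q ω.1) * 𝒮.br l ω (𝒮.ell l ω)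

/-- The two instances of the Nishimori identity used below. -/
structure Nishimori (l : ℝ) : Prop where
  first : ∫ ω, ∑ i, 𝒮.xs ω.1 i * 𝒮.br l ω (fun p => 𝒮.x p i) ∂𝒮.joint
    = ∫ ω, ∑ i, 𝒮.br l ω (fun p => 𝒮.x p i) * 𝒮.br l ω (fun p => 𝒮.x p i) ∂𝒮.joint
  second : ∫ ω, ∑ i, 𝒮.br l ω (fun p => 𝒮.Q ω.1 p * 𝒮.x p i) * 𝒮.br l ω (fun p => 𝒮.x p i) ∂𝒮.joint
    = n * ∫ ω, 𝒮.br l ω (𝒮.Q ω.1) ^ 2 ∂𝒮.joint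

lemma measurable_brQ (l : ℝ) : Measurable fun ω => 𝒮.br l ω (𝒮.Q ω.1) :=
  𝒮.measurable_br_apply l (g := fun ω => 𝒮.Q ω.1) (measurable_uncurry_of_fst 𝒮.measurable_Q)

lemma measurable_bell (l : ℝ) : Measurable fun ω => 𝒮.br l ω (𝒮.ell l ω) :=
  𝒮.measurable_br_apply l (g := fun ω => 𝒮.ell l ω) (𝒮.measurable_ell_uncurry l)

lemma integrable_bell {l : ℝ} (hl : 0 < l) : Integrable (fun ω => 𝒮.br l ω (𝒮.ell l ω)) 𝒮.joint := by
  have := 𝒮.integrable_br_mul_ell hl (G := fun _ _ => 1) (c := 1) measurable_const (by simp)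
  simpa using this

lemma abs_brQ_le (hn : 0 < n) {l : ℝ} (hl : 0 ≤ l) :
    ∀ᵐ ω ∂𝒮.joint, |𝒮.br l ω (𝒮.Q ω.1)| ≤ 𝒮.M ^ 2 := by
  filter_upwards [𝒮.ae_joint (𝒮.abs_Q_le hn)] with ω h
  exact 𝒮.abs_br_le hl ω h

lemma abs_cov_le_forall (hn : 0 < n) : ∀ᵐ ω ∂𝒮.joint, ∀ l, 0 < l →
    |𝒮.cov l ω| ≤ 2 * 𝒮.M ^ 2 * (n * (3 / 2 * 𝒮.M ^ 2) + 𝒮.amp ω.2 / (2 * Real.sqrt l)) := by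
  filter_upwards [𝒮.ae_joint (𝒮.abs_Q_le hn), 𝒮.abs_ell_le_forall] with ω h1 h2' l hl
  have h2 := h2' l
  unfold cov
  have a1 := 𝒮.abs_br_le hl.le ω h1
  have a2 := 𝒮.abs_br_le hl.le ω h2
  have a3 : |𝒮.br l ω (fun p => 𝒮.Q ω.1 p * 𝒮.ell l ω p)| ≤ 𝒮.M ^ 2 *
      (n * (3 / 2 * 𝒮.M ^ 2) + 𝒮.amp ω.2 / (2 * Real.sqrt l)) := by
    refine 𝒮.abs_br_le hl.le ω ?_
    filter_upwards [h1, h2] with p h3 h4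
    rw [abs_mul]
    exact mul_le_mul h3 h4 (abs_nonneg _) ((abs_nonneg _).trans h3)
  refine (abs_sub _ _).trans ?_
  rw [abs_mul]
  have := mul_le_mul a1 a2 (abs_nonneg _) ((abs_nonneg _).trans a1)
  linarith

lemma measurable_cov_joint : Measurable fun a : ℝ × (Ω × (Fin n → ℝ)) => 𝒮.cov a.1 a.2 := by
  have hQ : Measurable fun a : (ℝ × (Ω × (Fin n → ℝ))) × P => 𝒮.Q a.1.2.1 a.2 := by
    have h : Measurable fun a : (ℝ × (Ω × (Fin n → ℝ))) × P => (a.1.2.1, a.2) := by fun_prop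
    exact 𝒮.measurable_Q.comp h
  unfold cov
  exact (𝒮.measurable_br (g := fun a p => 𝒮.Q a.2.1 p * 𝒮.ell a.1 a.2 p)
    (hQ.mul 𝒮.measurable_ell)).sub ((𝒮.measurable_br (g := fun a p => 𝒮.Q a.2.1 p) hQ).mul
    (𝒮.measurable_br (g := fun a p => 𝒮.ell a.1 a.2 p) 𝒮.measurable_ell))

lemma measurable_cov (l : ℝ) : Measurable (𝒮.cov l) := by
  have h1 : Measurable fun ω => 𝒮.br l ω (fun p => 𝒮.Q ω.1 p * 𝒮.ell l ω p) :=
    𝒮.measurable_br_apply l (g := fun ω p => 𝒮.Q ω.1 p * 𝒮.ell l ω p)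
      ((measurable_uncurry_of_fst 𝒮.measurable_Q).mul (𝒮.measurable_ell_uncurry l))
  exact h1.sub ((𝒮.measurable_brQ l).mul (𝒮.measurable_bell l))

lemma integrable_cov (hn : 0 < n) {l : ℝ} (hl : 0 < l) : Integrable (𝒮.cov l) 𝒮.joint :=
  Integrable.mono' (𝒮.integrable_ell_bound l _) (𝒮.measurable_cov l).aestronglyMeasurable
    ((𝒮.abs_cov_le_forall hn).mono fun _ h => h l hl)

lemma integrable_brQ (hn : 0 < n) {l : ℝ} (hl : 0 ≤ l) :
    Integrable (fun ω => 𝒮.br l ω (𝒮.Q ω.1)) 𝒮.joint :=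
  𝒮.integrable_br hl 𝒮.measurable_Q (𝒮.abs_Q_le hn)

lemma abs_Q_sq_le (hn : 0 < n) :
    ∀ᵐ ω ∂𝒮.law, ∀ᵐ p ∂𝒮.prior, |𝒮.Q ω p ^ 2| ≤ (𝒮.M ^ 2) ^ 2 := by
  filter_upwards [𝒮.abs_Q_le hn] with ω h
  filter_upwards [h] with p hp
  rw [abs_pow]; exact pow_le_pow_left₀ (abs_nonneg _) hp 2

lemma integrable_brQ_sq (hn : 0 < n) {l : ℝ} (hl : 0 ≤ l) :
    Integrable (fun ω => 𝒮.br l ω (fun p => 𝒮.Q ω.1 p ^ 2)) 𝒮.joint :=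
  𝒮.integrable_br hl (G := fun ω p => 𝒮.Q ω p ^ 2) (𝒮.measurable_Q.pow_const 2) (𝒮.abs_Q_sq_le hn)

lemma fluct_eq (hn : 0 < n) {l : ℝ} (hl : 0 ≤ l) :
    𝒮.fluct l = ∫ ω, 𝒮.br l ω (fun p => 𝒮.Q ω.1 p ^ 2) ∂𝒮.joint - 𝒮.mean l ^ 2 := by
  have i1 := 𝒮.integrable_brQ hn hl
  have i2 := 𝒮.integrable_brQ_sq hn hl
  have e : ∀ᵐ ω ∂𝒮.joint, 𝒮.br l ω (fun p => (𝒮.Q ω.1 p - 𝒮.mean l) ^ 2)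
      = 𝒮.br l ω (fun p => 𝒮.Q ω.1 p ^ 2) - 2 * 𝒮.mean l * 𝒮.br l ω (𝒮.Q ω.1) + 𝒮.mean l ^ 2 := by
    filter_upwards [𝒮.ae_joint (𝒮.abs_Q_le hn), 𝒮.ae_joint (𝒮.abs_Q_sq_le hn)] with ω h1 h2
    have := 𝒮.isProbabilityMeasure_gibbs hl ω
    have j1 := 𝒮.integrable_gibbs hl ω (𝒮.measurable_Q_apply ω.1) h1
    have j2 := 𝒮.integrable_gibbs hl ω ((𝒮.measurable_Q_apply ω.1).pow_const 2) h2
    unfold br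
    have e : ∀ p, (𝒮.Q ω.1 p - 𝒮.mean l) ^ 2
        = 𝒮.Q ω.1 p ^ 2 - 2 * 𝒮.mean l * 𝒮.Q ω.1 p + 𝒮.mean l ^ 2 := by intro p; ring
    have j3 : Integrable (fun p => 𝒮.Q ω.1 p ^ 2 - 2 * 𝒮.mean l * 𝒮.Q ω.1 p)
      (𝒮.prior.tilted (𝒮.energy l ω)) := j2.sub (j1.const_mul _)
    simp only [e]
    rw [integral_add j3 (integrable_const _), integral_sub j2 (j1.const_mul _), integral_const_mul]
    simp
  unfold fluct
  rw [integral_congr_ae e]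
  have i3 : Integrable (fun ω => 𝒮.br l ω (fun p => 𝒮.Q ω.1 p ^ 2)
      - 2 * 𝒮.mean l * 𝒮.br l ω (𝒮.Q ω.1)) 𝒮.joint := i2.sub (i1.const_mul _)
  rw [integral_add i3 (integrable_const _), integral_sub i2 (i1.const_mul _), integral_const_mul]
  simp only [integral_const, probReal_univ, smul_eq_mul, one_mul]
  unfold mean
  ring

/-- The overlap fluctuation is controlled by a Gibbs covariance, which is a total derivative, and
by the fluctuation of the derivative of the free entropy. -/
lemma fluct_le (hn : 0 < n) {l : ℝ} (hl : 0 < l) (hN : 𝒮.Nishimori l) :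
    n * 𝒮.fluct l ≤ 2 * ∫ ω, 𝒮.cov l ω ∂𝒮.joint
      + 2 * 𝒮.M ^ 2 * ∫ ω, |𝒮.br l ω (𝒮.ell l ω) - ∫ ω, 𝒮.br l ω (𝒮.ell l ω) ∂𝒮.joint| ∂𝒮.joint := by
  have hn' : (0 : ℝ) < n := Nat.cast_pos.2 hn
  have i1 := 𝒮.integrable_brQ hn hl.le
  have i2 := 𝒮.integrable_brQ_sq hn hl.le
  have i3 := 𝒮.integrable_bell hl
  have i4 := 𝒮.integrable_cov hn hl
  have hb := 𝒮.abs_brQ_le hn hl.le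
  have i5 : Integrable (fun ω => 𝒮.br l ω (𝒮.Q ω.1) ^ 2) 𝒮.joint := by
    refine integrable_of_ae_abs_le (c := (𝒮.M ^ 2) ^ 2) ((𝒮.measurable_brQ l).pow_const 2) ?_
    filter_upwards [hb] with ω h
    rw [abs_pow]; exact pow_le_pow_left₀ (abs_nonneg _) h 2
  set w2 := ∫ ω, 𝒮.br l ω (fun p => 𝒮.Q ω.1 p ^ 2) ∂𝒮.joint with hw2
  set b2 := ∫ ω, 𝒮.br l ω (𝒮.Q ω.1) ^ 2 ∂𝒮.joint with hb2
  set e0 := ∫ ω, 𝒮.br l ω (𝒮.ell l ω) ∂𝒮.joint with he0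
  have hjen : b2 ≤ w2 := by
    refine integral_mono_ae i5 i2 ?_
    filter_upwards [𝒮.ae_joint (𝒮.abs_Q_le hn)] with ω h1
    have := 𝒮.isProbabilityMeasure_gibbs hl.le ω
    have hm : MemLp (𝒮.Q ω.1) 2 (𝒮.prior.tilted (𝒮.energy l ω)) :=
      MemLp.of_bound (𝒮.measurable_Q_apply ω.1).aestronglyMeasurable (𝒮.M ^ 2) (ae_tilted h1)
    have := integral_sub_sq_eq hm 0
    simp only [sub_zero] at this
    unfold br
    rw [this]
    have : 0 ≤ ∫ y, (𝒮.Q ω.1 y - ∫ y, 𝒮.Q ω.1 y ∂(𝒮.prior.tilted (𝒮.energy l ω))) ^ 2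
      ∂(𝒮.prior.tilted (𝒮.energy l ω)) := integral_nonneg fun _ => sq_nonneg _
    linarith
  have hsum : ∀ (G : P → ℝ) (c : ℝ), Measurable G → (∀ᵐ p ∂𝒮.prior, |G p| ≤ c) → ∀ ω,
      ∑ i, 𝒮.xs ω.1 i * 𝒮.br l ω (fun p => G p * 𝒮.x p i)
      = n * 𝒮.br l ω (fun p => G p * 𝒮.Q ω.1 p) := by
    intro G c hG hc ω
    unfold br Q
    have e : ∀ p, G p * (1 / (n : ℝ) * ∑ i, 𝒮.xs ω.1 i * 𝒮.x p i)
        = ∑ i, (1 / (n : ℝ)) * (𝒮.xs ω.1 i * (G p * 𝒮.x p i)) := by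
      intro p
      rw [Finset.mul_sum, Finset.mul_sum]
      exact Finset.sum_congr rfl fun i _ => by ring
    have hGx : ∀ i, Integrable (fun p => G p * 𝒮.x p i) (𝒮.prior.tilted (𝒮.energy l ω)) :=
      fun i => 𝒮.integrable_gibbs hl.le ω (hG.mul (𝒮.measurable_x_apply i)) (𝒮.abs_mul_x_le hc i)
    simp only [e]
    rw [integral_finsetSum _ fun i _ => ((hGx i).const_mul _).const_mul _, Finset.mul_sum]
    refine Finset.sum_congr rfl fun i _ => ?_
    rw [integral_const_mul, integral_const_mul]
    field_simp
  have hQell : ∫ ω, 𝒮.br l ω (fun p => 𝒮.Q ω.1 p * 𝒮.ell l ω p) ∂𝒮.joint = n * w2 - 1 / 2 * (n * b2) := by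
    rw [𝒮.integral_joint_br_mul_ell hl 𝒮.measurable_Q (𝒮.abs_Q_le hn), hN.second, hw2]
    congr 1
    rw [← integral_const_mul]
    refine integral_congr_ae ?_
    filter_upwards [𝒮.ae_joint (𝒮.abs_Q_le hn)] with ω h1
    rw [hsum _ _ (𝒮.measurable_Q_apply ω.1) h1]
    simp only [sq]
  have hell : e0 = 1 / 2 * (n * 𝒮.mean l) := by
    have h := 𝒮.integral_joint_br_mul_ell hl (G := fun _ _ => 1) (c := 1) measurable_const (by simp)
    simp only [one_mul] at h
    rw [← hN.first] at h
    have h2 : ∫ ω, ∑ i, 𝒮.xs ω.1 i * 𝒮.br l ω (fun p => 𝒮.x p i) ∂𝒮.joint = n * 𝒮.mean l := by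
      unfold mean
      rw [← integral_const_mul]
      congr 1 with ω
      have := hsum (fun _ => 1) 1 measurable_const (by simp) ω
      simpa only [one_mul] using this
    rw [h2] at h
    rw [he0]
    have h3 : ∀ ω, 𝒮.br l ω (fun p => 𝒮.ell l ω p) = 𝒮.br l ω (𝒮.ell l ω) := fun ω => rfl
    simp only [h3] at h
    rw [h]; ring
  have i6 : Integrable (fun ω => 𝒮.br l ω (𝒮.Q ω.1) * (𝒮.br l ω (𝒮.ell l ω) - e0)) 𝒮.joint :=
    (i3.sub (integrable_const _)).bdd_mul (c := 𝒮.M ^ 2) (𝒮.measurable_brQ l).aestronglyMeasurable hb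
  have hsplit : ∫ ω, 𝒮.br l ω (fun p => 𝒮.Q ω.1 p * 𝒮.ell l ω p) ∂𝒮.joint
      = ∫ ω, 𝒮.cov l ω ∂𝒮.joint
        + (∫ ω, 𝒮.br l ω (𝒮.Q ω.1) * (𝒮.br l ω (𝒮.ell l ω) - e0) ∂𝒮.joint + e0 * 𝒮.mean l) := by
    unfold mean
    have i7 : Integrable (fun ω => 𝒮.br l ω (𝒮.Q ω.1) * (𝒮.br l ω (𝒮.ell l ω) - e0)
        + e0 * 𝒮.br l ω (𝒮.Q ω.1)) 𝒮.joint := i6.add (i1.const_mul _)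
    rw [← integral_const_mul, ← integral_add i6 (i1.const_mul _), ← integral_add i4 i7]
    congr 1 with ω
    unfold cov
    ring
  have hle : ∫ ω, 𝒮.br l ω (𝒮.Q ω.1) * (𝒮.br l ω (𝒮.ell l ω) - e0) ∂𝒮.joint
      ≤ 𝒮.M ^ 2 * ∫ ω, |𝒮.br l ω (𝒮.ell l ω) - e0| ∂𝒮.joint := by
    rw [← integral_const_mul]
    refine integral_mono_ae i6 ((i3.sub (integrable_const _)).abs.const_mul _) ?_
    filter_upwards [hb] with ω h
    refine (le_abs_self _).trans ?_
    rw [abs_mul]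
    exact mul_le_mul_of_nonneg_right h (abs_nonneg _)
  rw [𝒮.fluct_eq hn hl.le, ← hw2]
  rw [hQell, hell] at hsplit
  rw [hell] at hle ⊢
  nlinarith

end SideChannel

end

noncomputable section

/-- The integral of the second difference of a Lipschitz function. -/
lemma integral_second_diff_le {F : ℝ → ℝ} {a b h L : ℝ} (hh : 0 ≤ h) (hab : a ≤ b)
    (hF : ∀ u ∈ Icc (a - h) (b + h), ∀ u' ∈ Icc (a - h) (b + h), |F u - F u'| ≤ L * |u - u'|) :
    IntervalIntegrable (fun l => F (l + h) + F (l - h) - 2 * F l) volume a b ∧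
    ∫ l in a..b, (F (l + h) + F (l - h) - 2 * F l) ≤ 2 * h ^ 2 * L := by
  have hc : ContinuousOn F (Icc (a - h) (b + h)) := by
    have : LipschitzOnWith (Real.toNNReal L) F (Icc (a - h) (b + h)) := by
      refine LipschitzOnWith.of_dist_le_mul fun x hx y hy => ?_
      rw [Real.dist_eq, Real.dist_eq]
      refine (hF x hx y hy).trans ?_
      exact mul_le_mul_of_nonneg_right (Real.le_coe_toNNReal L) (abs_nonneg _)
    exact this.continuousOn
  set G : ℝ → ℝ := fun l => F l - F (l - h) with hG
  have hGc : ContinuousOn G (Icc a (b + h)) := by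
    refine (hc.mono (Icc_subset_Icc (by linarith) le_rfl)).sub
      (hc.comp (by fun_prop) fun x hx => ⟨?_, ?_⟩)
    · linarith [hx.1]
    · linarith [hx.2]
  have hGb : ∀ l ∈ Icc a (b + h), |G l| ≤ L * h := by
    intro l hl
    have := hF l ⟨by linarith [hl.1], hl.2⟩ (l - h) ⟨by linarith [hl.1], by linarith [hl.2]⟩
    rwa [sub_sub_cancel, abs_of_nonneg hh] at this
  have hGi : ∀ x ∈ Icc a (b + h), ∀ y ∈ Icc a (b + h), IntervalIntegrable G volume x y := by
    intro x hx y hy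
    refine (hGc.mono ?_).intervalIntegrable
    exact Set.uIcc_subset_Icc hx hy
  have e : ∀ l, F (l + h) + F (l - h) - 2 * F l = G (l + h) - G l := by
    intro l; simp only [hG, add_sub_cancel_right]; ring
  have ha : a ∈ Icc a (b + h) := ⟨le_rfl, by linarith⟩
  have hb : b ∈ Icc a (b + h) := ⟨hab, by linarith⟩
  have hah : a + h ∈ Icc a (b + h) := ⟨by linarith, by linarith⟩
  have hbh : b + h ∈ Icc a (b + h) := ⟨by linarith, le_rfl⟩
  simp only [e]
  have hi : IntervalIntegrable (fun l => G (l + h)) volume a b := by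
    have hcs : ContinuousOn (fun l => G (l + h)) (uIcc a b) := by
      rw [uIcc_of_le hab]
      exact hGc.comp (by fun_prop) fun x hx => ⟨by linarith [hx.1], by linarith [hx.2]⟩
    exact hcs.intervalIntegrable
  refine ⟨hi.sub (hGi a ha b hb), ?_⟩
  rw [intervalIntegral.integral_sub hi (hGi a ha b hb), intervalIntegral.integral_comp_add_right]
  have e1 := intervalIntegral.integral_add_adjacent_intervals (hGi a ha (a + h) hah)
    (hGi (a + h) hah (b + h) hbh)
  have e2 := intervalIntegral.integral_add_adjacent_intervals (hGi a ha b hb)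
    (hGi b hb (b + h) hbh)
  have b1 := intervalIntegral.norm_integral_le_of_norm_le_const (a := a) (b := a + h) (f := G)
    (C := L * h) (by
      intro x hx
      rw [uIoc_of_le (by linarith)] at hx
      exact hGb x ⟨hx.1.le, by linarith [hx.2]⟩)
  have b2 := intervalIntegral.norm_integral_le_of_norm_le_const (a := b) (b := b + h) (f := G)
    (C := L * h) (by
      intro x hx
      rw [uIoc_of_le (by linarith)] at hx
      exact hGb x ⟨by linarith [hx.1], hx.2⟩)
  rw [add_sub_cancel_left, abs_of_nonneg hh, Real.norm_eq_abs] at b1 b2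
  have c1 := (abs_le.1 b1).1
  have c2 := (abs_le.1 b2).2
  nlinarith

namespace SideChannel

variable {Ω P : Type*} [MeasurableSpace Ω] [MeasurableSpace P] {n : ℕ} (𝒮 : SideChannel Ω P n)

lemma hasDerivAt_energy {l : ℝ} (hl : 0 < l) (ω : Ω × (Fin n → ℝ)) (p : P) :
    HasDerivAt (fun l => 𝒮.energy l ω p) (𝒮.ell l ω p) l := by
  unfold energy ell
  have h1 := ((hasDerivAt_id l).mul_const (𝒮.sig ω.1 p)).const_add (𝒮.H ω.1 p)
  have h2 := (Real.hasDerivAt_sqrt hl.ne').mul_const (𝒮.noi ω.2 p)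
  convert! h1.add h2 using 1
  ring

lemma hasDerivAt_brQ (hn : 0 < n) : ∀ᵐ ω ∂𝒮.joint, ∀ l, 0 < l →
    HasDerivAt (fun l => 𝒮.br l ω (𝒮.Q ω.1)) (𝒮.cov l ω) l := by
  filter_upwards [𝒮.ae_joint (𝒮.abs_Q_le hn), 𝒮.ae_joint 𝒮.abs_sig_le] with ω h1 h2 l hl
  obtain ⟨c, hc⟩ := 𝒮.bdd_energy ω (2 * l)
  refine hasDerivAt_integral_tilted (π := 𝒮.prior) (θ := fun l => 𝒮.energy l ω)
    (θ' := fun l => 𝒮.ell l ω) (s := Ioo (l / 2) (2 * l)) (c := c)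
    (c' := n * (3 / 2 * 𝒮.M ^ 2) + 𝒮.amp ω.2 / (2 * Real.sqrt (l / 2)))
    (Ioo_mem_nhds (by linarith) (by linarith)) (fun l => 𝒮.measurable_energy_apply l ω)
    (𝒮.measurable_ell_apply l ω) ?_ ?_ ?_ (𝒮.measurable_Q_apply ω.1) h1
  · filter_upwards [hc] with p hp x hx
    exact hp x (by linarith [hx.1]) hx.2.le
  · filter_upwards [h2, 𝒮.abs_noi_le ω.2] with p h3 h4 x hx
    unfold ell
    refine (abs_add_le _ _).trans (add_le_add h3 ?_)
    have h5 : 0 < Real.sqrt (l / 2) := Real.sqrt_pos.2 (by linarith)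
    rw [abs_div, abs_of_nonneg (a := 2 * Real.sqrt x) (by positivity)]
    have := Real.sqrt_le_sqrt hx.1.le
    gcongr
    exact 𝒮.amp_nonneg _
  · intro p x hx
    exact 𝒮.hasDerivAt_energy (by linarith [hx.1]) ω p

lemma integral_cov_eq (hn : 0 < n) {d : ℝ} (hd : 0 < d) :
    IntervalIntegrable (fun l => ∫ ω, 𝒮.cov l ω ∂𝒮.joint) volume d (2 * d) ∧
    ∫ l in d..(2 * d), ∫ ω, 𝒮.cov l ω ∂𝒮.joint ≤ 2 * 𝒮.M ^ 2 := by
  have hd2 : d ≤ 2 * d := by linarith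
  have hbd : ∀ᵐ ω ∂𝒮.joint, ∀ l, d ≤ l →
      |𝒮.cov l ω| ≤ 2 * 𝒮.M ^ 2 * (n * (3 / 2 * 𝒮.M ^ 2) + 𝒮.amp ω.2 / (2 * Real.sqrt d)) := by
    filter_upwards [𝒮.abs_cov_le_forall hn] with ω h l hl
    refine (h l (hd.trans_le hl)).trans ?_
    have h5 : 0 < Real.sqrt d := Real.sqrt_pos.2 hd
    have := Real.sqrt_le_sqrt hl
    gcongr
    exact 𝒮.amp_nonneg _
  have hint : Integrable (fun a : ℝ × (Ω × (Fin n → ℝ)) => 𝒮.cov a.1 a.2)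
      ((volume.restrict (Ioc d (2 * d))).prod 𝒮.joint) := by
    refine Integrable.mono' ((𝒮.integrable_ell_bound d (2 * 𝒮.M ^ 2)).comp_snd
      (volume.restrict (Ioc d (2 * d)))) 𝒮.measurable_cov_joint.aestronglyMeasurable ?_
    have h1 : ∀ᵐ a ∂((volume.restrict (Ioc d (2 * d))).prod 𝒮.joint), a.1 ∈ Ioc d (2 * d) :=
      Measure.quasiMeasurePreserving_fst.ae (ae_restrict_mem measurableSet_Ioc)
    have h2 := Measure.quasiMeasurePreserving_snd (μ := volume.restrict (Ioc d (2 * d)))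
      (ν := 𝒮.joint) |>.ae hbd
    filter_upwards [h1, h2] with a h3 h4
    exact h4 a.1 h3.1.le
  constructor
  · rw [intervalIntegrable_iff_integrableOn_Ioc_of_le hd2]
    exact hint.integral_prod_left
  · rw [intervalIntegral.integral_of_le hd2, integral_integral_swap hint]
    have h1 : ∀ᵐ ω ∂𝒮.joint, |∫ l in Ioc d (2 * d), 𝒮.cov l ω| ≤ 2 * 𝒮.M ^ 2 := by
      filter_upwards [𝒮.hasDerivAt_brQ hn, 𝒮.ae_joint (𝒮.abs_Q_le hn), hbd] with ω h1 h2 h3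
      have hm : Measurable fun l => 𝒮.cov l ω := by
        have h4 : Measurable fun l : ℝ => (l, ω) := by fun_prop
        have h5 := 𝒮.measurable_cov_joint.comp h4
        simpa only [Function.comp_def] using h5
      have hii : IntervalIntegrable (fun l => 𝒮.cov l ω) volume d (2 * d) := by
        rw [intervalIntegrable_iff_integrableOn_Ioc_of_le hd2]
        refine integrable_of_ae_abs_le
          (c := 2 * 𝒮.M ^ 2 * (n * (3 / 2 * 𝒮.M ^ 2) + 𝒮.amp ω.2 / (2 * Real.sqrt d))) hm ?_
        filter_upwards [ae_restrict_mem measurableSet_Ioc] with l hl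
        exact h3 l hl.1.le
      rw [← intervalIntegral.integral_of_le hd2,
        intervalIntegral.integral_eq_sub_of_hasDerivAt (f := fun l => 𝒮.br l ω (𝒮.Q ω.1)) ?_ hii]
      · refine (abs_sub _ _).trans ?_
        have a1 := 𝒮.abs_br_le (l := d) hd.le ω h2
        have a2 := 𝒮.abs_br_le (l := 2 * d) (by linarith) ω h2
        linarith
      · intro x hx
        rw [uIcc_of_le hd2] at hx
        exact h1 x (by linarith [hx.1])
    exact (le_abs_self _).trans (abs_integral_le_of_ae_abs_le h1)

/-- The free entropy, corrected to be convex in the signal-to-noise ratio. -/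
def convFree (l : ℝ) (ω : Ω × (Fin n → ℝ)) : ℝ := 𝒮.free l ω - Real.sqrt l * 𝒮.amp ω.2

/-- The derivative of the corrected free entropy. -/
def convFreeDeriv (l : ℝ) (ω : Ω × (Fin n → ℝ)) : ℝ :=
  𝒮.br l ω (𝒮.ell l ω) - 𝒮.amp ω.2 / (2 * Real.sqrt l)

lemma convFree_le {l l' : ℝ} (hl : 0 < l) (hl' : 0 < l') (ω : Ω × (Fin n → ℝ)) :
    (l' - l) * 𝒮.convFreeDeriv l ω ≤ 𝒮.convFree l' ω - 𝒮.convFree l ω := by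
  obtain ⟨c, hc⟩ := 𝒮.bdd_energy_apply hl.le ω
  obtain ⟨c', hc'⟩ := 𝒮.bdd_energy_apply hl'.le ω
  have hj := integral_sub_le_logZ_sub (𝒮.measurable_energy_apply l ω) hc
    (𝒮.measurable_energy_apply l' ω) hc'
  have hsl : 0 < Real.sqrt l := Real.sqrt_pos.2 hl
  have q1 := Real.sq_sqrt hl.le
  have q2 := Real.sq_sqrt hl'.le
  set a := Real.sqrt l with ha
  set b := Real.sqrt l' with hb
  have hk : b - a - (l' - l) / (2 * a) ≤ 0 := by
    rw [sub_nonpos, le_div_iff₀ (by positivity), ← q1, ← q2]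
    nlinarith [sq_nonneg (b - a)]
  set k := b - a - (l' - l) / (2 * a) with hkd
  have := 𝒮.isProbabilityMeasure_gibbs hl.le ω
  have hnb := 𝒮.abs_noi_le ω.2
  have hnm : Measurable (𝒮.noi ω.2) := 𝒮.measurable_noi.comp (measurable_prodMk_left (x := ω.2))
  have inoi := 𝒮.integrable_gibbs hl.le ω hnm hnb
  have hsm : Measurable (𝒮.sig ω.1) := 𝒮.measurable_sig.comp (measurable_prodMk_left (x := ω.1))
  have isig := 𝒮.integrable_gibbs hl.le ω hsm (𝒮.abs_sig_le_of ω.1)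
  have iell : Integrable (𝒮.ell l ω) (𝒮.prior.tilted (𝒮.energy l ω)) := isig.add (inoi.div_const _)
  have e : ∀ p, 𝒮.energy l' ω p - 𝒮.energy l ω p = (l' - l) * 𝒮.ell l ω p + k * 𝒮.noi ω.2 p := by
    intro p
    unfold energy ell
    rw [hkd, ← ha, ← hb]
    field_simp
    ring
  simp only [e] at hj
  rw [integral_add (iell.const_mul _) (inoi.const_mul _), integral_const_mul, integral_const_mul] at hj
  have h1 : |∫ p, 𝒮.noi ω.2 p ∂(𝒮.prior.tilted (𝒮.energy l ω))| ≤ 𝒮.amp ω.2 :=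
    𝒮.abs_br_le hl.le ω hnb
  have h2 := mul_le_mul_of_nonpos_left (abs_le.1 h1).2 hk
  unfold convFree convFreeDeriv free br
  rw [← ha, ← hb]
  have h3 : (l' - l) * (∫ p, 𝒮.ell l ω p ∂(𝒮.prior.tilted (𝒮.energy l ω)) - 𝒮.amp ω.2 / (2 * a))
      = (l' - l) * ∫ p, 𝒮.ell l ω p ∂(𝒮.prior.tilted (𝒮.energy l ω)) + k * 𝒮.amp ω.2
        - (b - a) * 𝒮.amp ω.2 := by
    rw [hkd]; ring
  rw [h3]
  linarith

lemma abs_convFree_sub_le {d : ℝ} (hd : 0 < d) : ∀ᵐ ω ∂𝒮.joint, ∀ l ∈ Ici d, ∀ l' ∈ Ici d,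
    |𝒮.convFree l ω - 𝒮.convFree l' ω|
      ≤ (n * (3 / 2 * 𝒮.M ^ 2) + 𝒮.amp ω.2 / Real.sqrt d) * |l - l'| := by
  filter_upwards [𝒮.ae_joint 𝒮.abs_sig_le] with ω h1 l hl l' hl'
  have hl0 : 0 < l := hd.trans_le hl
  have hl0' : 0 < l' := hd.trans_le hl'
  obtain ⟨c, hc⟩ := 𝒮.bdd_energy_apply hl0'.le ω
  have hsd : 0 < Real.sqrt d := Real.sqrt_pos.2 hd
  have hs : |Real.sqrt l - Real.sqrt l'| ≤ |l - l'| / (2 * Real.sqrt d) := by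
    have q1 := Real.sq_sqrt hl0.le
    have q2 := Real.sq_sqrt hl0'.le
    have e : l - l' = (Real.sqrt l - Real.sqrt l') * (Real.sqrt l + Real.sqrt l') := by
      linear_combination q2 - q1
    rw [le_div_iff₀ (by positivity), e, abs_mul]
    refine mul_le_mul_of_nonneg_left ?_ (abs_nonneg _)
    rw [abs_of_nonneg (by positivity)]
    have := Real.sqrt_le_sqrt (mem_Ici.1 hl)
    have := Real.sqrt_le_sqrt (mem_Ici.1 hl')
    linarith
  have hamp := 𝒮.amp_nonneg ω.2
  have h2 : |𝒮.free l ω - 𝒮.free l' ω| ≤ |l - l'| * (n * (3 / 2 * 𝒮.M ^ 2))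
      + |l - l'| / (2 * Real.sqrt d) * 𝒮.amp ω.2 := by
    refine abs_logZ_sub_le (𝒮.measurable_energy_apply l' ω) hc (𝒮.measurable_energy_apply l ω) ?_
    filter_upwards [h1, 𝒮.abs_noi_le ω.2] with p h3 h4
    have e : 𝒮.energy l ω p - 𝒮.energy l' ω p = (l - l') * 𝒮.sig ω.1 p
        + (Real.sqrt l - Real.sqrt l') * 𝒮.noi ω.2 p := by unfold energy; ring
    rw [e]
    refine (abs_add_le _ _).trans (add_le_add ?_ ?_)
    · rw [abs_mul]; exact mul_le_mul_of_nonneg_left h3 (abs_nonneg _)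
    · rw [abs_mul]; exact mul_le_mul hs h4 (abs_nonneg _) (by positivity)
  have h3 : |(Real.sqrt l - Real.sqrt l') * 𝒮.amp ω.2| ≤ |l - l'| / (2 * Real.sqrt d) * 𝒮.amp ω.2 := by
    rw [abs_mul, abs_of_nonneg hamp]
    exact mul_le_mul_of_nonneg_right hs hamp
  have e : 𝒮.convFree l ω - 𝒮.convFree l' ω = (𝒮.free l ω - 𝒮.free l' ω)
      - (Real.sqrt l - Real.sqrt l') * 𝒮.amp ω.2 := by unfold convFree; ring
  rw [e]
  refine (abs_sub _ _).trans ((add_le_add h2 h3).trans (le_of_eq ?_))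
  field_simp
  ring

lemma integral_abs_amp_sub_le :
    ∫ ω : Ω × (Fin n → ℝ), |𝒮.amp ω.2 - ∫ ω : Ω × (Fin n → ℝ), 𝒮.amp ω.2 ∂𝒮.joint| ∂𝒮.joint
      ≤ 2 * 𝒮.M * Real.sqrt n := by
  rw [integral_fun_snd (μ := 𝒮.law) (ν := noise n) (fun z => 𝒮.amp z)]
  rw [integral_fun_snd (μ := 𝒮.law) (ν := noise n)
    (fun z => |𝒮.amp z - (𝒮.law.real univ) • ∫ z, 𝒮.amp z ∂(noise n)|)]
  simp only [probReal_univ, one_smul]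
  unfold amp
  rw [integral_const_mul]
  simp only [← mul_sub, abs_mul, abs_of_nonneg 𝒮.M_nonneg]
  rw [integral_const_mul]
  have := mul_le_mul_of_nonneg_left (memLp_abs_sum (n := n)).2 𝒮.M_nonneg
  linarith

end SideChannel

end

noncomputable section

namespace SideChannel

variable {Ω P : Type*} [MeasurableSpace Ω] [MeasurableSpace P] {n : ℕ} (𝒮 : SideChannel Ω P n)

/-- The mean of the corrected free entropy. -/
def meanConvFree (l : ℝ) : ℝ := ∫ ω, 𝒮.convFree l ω ∂𝒮.joint

lemma integrable_convFree {l : ℝ} (h : Integrable (𝒮.free l) 𝒮.joint) :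
    Integrable (𝒮.convFree l) 𝒮.joint := h.sub (𝒮.integrable_amp_snd.const_mul _)

lemma integral_abs_convFree_sub_le {l L v : ℝ} (hL : l ≤ L)
    (hi : Integrable (𝒮.free l) 𝒮.joint)
    (hv : ∫ ω, |𝒮.free l ω - ∫ ω, 𝒮.free l ω ∂𝒮.joint| ∂𝒮.joint ≤ v) :
    ∫ ω, |𝒮.convFree l ω - 𝒮.meanConvFree l| ∂𝒮.joint
      ≤ v + Real.sqrt L * (2 * 𝒮.M * Real.sqrt n) := by
  have ia := 𝒮.integrable_amp_snd
  set A := ∫ ω : Ω × (Fin n → ℝ), 𝒮.amp ω.2 ∂𝒮.joint with hA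
  have e : 𝒮.meanConvFree l = ∫ ω, 𝒮.free l ω ∂𝒮.joint - Real.sqrt l * A := by
    unfold meanConvFree convFree
    rw [integral_sub hi (ia.const_mul _), integral_const_mul]
  have i1 : Integrable (fun ω => |𝒮.free l ω - ∫ ω, 𝒮.free l ω ∂𝒮.joint|) 𝒮.joint :=
    (hi.sub (integrable_const _)).abs
  have i2 : Integrable (fun ω : Ω × (Fin n → ℝ) => |𝒮.amp ω.2 - A|) 𝒮.joint :=
    (ia.sub (integrable_const _)).abs
  have i3 := i2.const_mul (Real.sqrt l)
  calc _ ≤ ∫ ω, (|𝒮.free l ω - ∫ ω, 𝒮.free l ω ∂𝒮.joint|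
        + Real.sqrt l * |𝒮.amp ω.2 - A|) ∂𝒮.joint := by
        refine integral_mono ((𝒮.integrable_convFree hi).sub (integrable_const _)).abs
          (i1.add i3) fun ω => ?_
        dsimp only
        have e2 : 𝒮.convFree l ω - 𝒮.meanConvFree l = (𝒮.free l ω - ∫ ω, 𝒮.free l ω ∂𝒮.joint)
            - Real.sqrt l * (𝒮.amp ω.2 - A) := by rw [e]; unfold convFree; ring
        rw [e2]
        refine (abs_sub _ _).trans (add_le_add le_rfl ?_)
        rw [abs_mul, abs_of_nonneg (Real.sqrt_nonneg _)]
    _ ≤ v + Real.sqrt L * (2 * 𝒮.M * Real.sqrt n) := by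
        rw [integral_add i1 i3, integral_const_mul]
        refine add_le_add hv (mul_le_mul (Real.sqrt_le_sqrt hL) 𝒮.integral_abs_amp_sub_le
          (integral_nonneg fun _ => abs_nonneg _) (Real.sqrt_nonneg _))

/-- The fluctuation of the derivative of the free entropy, by convexity. -/
lemma integral_abs_bell_sub_le {l h L v : ℝ} (hh : 0 < h) (hhl : h < l) (hL : l + h ≤ L)
    (hi : ∀ u ∈ Icc (l - h) (l + h), Integrable (𝒮.free u) 𝒮.joint)
    (hv : ∀ u ∈ Icc (l - h) (l + h),
      ∫ ω, |𝒮.free u ω - ∫ ω, 𝒮.free u ω ∂𝒮.joint| ∂𝒮.joint ≤ v) :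
    ∫ ω, |𝒮.br l ω (𝒮.ell l ω) - ∫ ω, 𝒮.br l ω (𝒮.ell l ω) ∂𝒮.joint| ∂𝒮.joint
      ≤ (3 * (v + Real.sqrt L * (2 * 𝒮.M * Real.sqrt n))
        + (𝒮.meanConvFree (l + h) + 𝒮.meanConvFree (l - h) - 2 * 𝒮.meanConvFree l)) / h
        + 𝒮.M * Real.sqrt n / Real.sqrt l := by
  have hl : 0 < l := hh.trans hhl
  have m0 : l ∈ Icc (l - h) (l + h) := ⟨by linarith, by linarith⟩
  have m1 : l + h ∈ Icc (l - h) (l + h) := ⟨by linarith, by linarith⟩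
  have m2 : l - h ∈ Icc (l - h) (l + h) := ⟨by linarith, by linarith⟩
  have f0 := 𝒮.integrable_convFree (hi _ m0)
  have f1 := 𝒮.integrable_convFree (hi _ m1)
  have f2 := 𝒮.integrable_convFree (hi _ m2)
  have ia := 𝒮.integrable_amp_snd
  have ib := 𝒮.integrable_bell hl
  have iD : Integrable (𝒮.convFreeDeriv l) 𝒮.joint := ib.sub (ia.div_const _)
  set w := v + Real.sqrt L * (2 * 𝒮.M * Real.sqrt n) with hw
  have w0 := 𝒮.integral_abs_convFree_sub_le (L := L) (by linarith) (hi _ m0) (hv _ m0)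
  have w1 := 𝒮.integral_abs_convFree_sub_le (L := L) (by linarith) (hi _ m1) (hv _ m1)
  have w2 := 𝒮.integral_abs_convFree_sub_le (L := L) (by linarith) (hi _ m2) (hv _ m2)
  set D0 := ∫ ω, 𝒮.convFreeDeriv l ω ∂𝒮.joint with hD0
  have up : ∀ ω, h * 𝒮.convFreeDeriv l ω ≤ 𝒮.convFree (l + h) ω - 𝒮.convFree l ω := by
    intro ω
    have := 𝒮.convFree_le hl (l' := l + h) (by linarith) ω
    rwa [add_sub_cancel_left] at this
  have dn : ∀ ω, 𝒮.convFree l ω - 𝒮.convFree (l - h) ω ≤ h * 𝒮.convFreeDeriv l ω := by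
    intro ω
    have := 𝒮.convFree_le hl (l' := l - h) (by linarith) ω
    rw [sub_sub_cancel_left] at this
    linarith
  have Up : h * D0 ≤ 𝒮.meanConvFree (l + h) - 𝒮.meanConvFree l := by
    have := integral_mono (iD.const_mul h) (f1.sub f0) up
    rw [integral_const_mul] at this
    simp only [Pi.sub_apply] at this
    rwa [integral_sub f1 f0] at this
  have Dn : 𝒮.meanConvFree l - 𝒮.meanConvFree (l - h) ≤ h * D0 := by
    have := integral_mono (f0.sub f2) (iD.const_mul h) dn
    rw [integral_const_mul] at this
    simp only [Pi.sub_apply] at this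
    rwa [integral_sub f0 f2] at this
  set Δ2 := 𝒮.meanConvFree (l + h) + 𝒮.meanConvFree (l - h) - 2 * 𝒮.meanConvFree l with hΔ
  have j0 : Integrable (fun ω => |𝒮.convFree l ω - 𝒮.meanConvFree l|) 𝒮.joint :=
    (f0.sub (integrable_const _)).abs
  have j1 : Integrable (fun ω => |𝒮.convFree (l + h) ω - 𝒮.meanConvFree (l + h)|) 𝒮.joint :=
    (f1.sub (integrable_const _)).abs
  have j2 : Integrable (fun ω => |𝒮.convFree (l - h) ω - 𝒮.meanConvFree (l - h)|) 𝒮.joint :=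
    (f2.sub (integrable_const _)).abs
  have hdev : ∫ ω, |𝒮.convFreeDeriv l ω - D0| ∂𝒮.joint ≤ (3 * w + Δ2) / h := by
    rw [le_div_iff₀ hh, ← integral_mul_const]
    have j3 : Integrable (fun ω => |𝒮.convFree l ω - 𝒮.meanConvFree l|
        + |𝒮.convFree (l + h) ω - 𝒮.meanConvFree (l + h)|) 𝒮.joint := j0.add j1
    have j4 : Integrable (fun ω => |𝒮.convFree l ω - 𝒮.meanConvFree l|
        + |𝒮.convFree (l + h) ω - 𝒮.meanConvFree (l + h)|
        + |𝒮.convFree (l - h) ω - 𝒮.meanConvFree (l - h)|) 𝒮.joint := j3.add j2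
    calc _ ≤ ∫ ω, (|𝒮.convFree l ω - 𝒮.meanConvFree l|
        + |𝒮.convFree (l + h) ω - 𝒮.meanConvFree (l + h)|
        + |𝒮.convFree (l - h) ω - 𝒮.meanConvFree (l - h)| + Δ2) ∂𝒮.joint := by
          refine integral_mono ((iD.sub (integrable_const _)).abs.mul_const _)
            (j4.add (integrable_const _)) fun ω => ?_
          dsimp only
          rw [← abs_of_pos hh, ← abs_mul, abs_of_pos hh]
          have a0 := abs_le.1 (le_refl |𝒮.convFree l ω - 𝒮.meanConvFree l|)
          have a1 := abs_le.1 (le_refl |𝒮.convFree (l + h) ω - 𝒮.meanConvFree (l + h)|)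
          have a2 := abs_le.1 (le_refl |𝒮.convFree (l - h) ω - 𝒮.meanConvFree (l - h)|)
          have u := up ω
          have d := dn ω
          have p1 := abs_nonneg (𝒮.convFree (l + h) ω - 𝒮.meanConvFree (l + h))
          have p2 := abs_nonneg (𝒮.convFree (l - h) ω - 𝒮.meanConvFree (l - h))
          rw [abs_le]
          constructor <;> nlinarith [a0.1, a0.2, a1.1, a1.2, a2.1, a2.2]
      _ ≤ _ := by
          rw [integral_add j4 (integrable_const _), integral_add j3 j2, integral_add j0 j1]
          simp only [integral_const, probReal_univ, smul_eq_mul, one_mul]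
          linarith
  have hsl : 0 < Real.sqrt l := Real.sqrt_pos.2 hl
  set A := ∫ ω : Ω × (Fin n → ℝ), 𝒮.amp ω.2 ∂𝒮.joint with hA
  have eD : D0 = ∫ ω, 𝒮.br l ω (𝒮.ell l ω) ∂𝒮.joint - A / (2 * Real.sqrt l) := by
    rw [hD0, hA]
    unfold convFreeDeriv
    rw [integral_sub ib (ia.div_const _), integral_div]
  have i2 : Integrable (fun ω : Ω × (Fin n → ℝ) => |𝒮.amp ω.2 - A|) 𝒮.joint :=
    (ia.sub (integrable_const _)).abs
  have i1 : Integrable (fun ω => |𝒮.convFreeDeriv l ω - D0|) 𝒮.joint :=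
    (iD.sub (integrable_const _)).abs
  calc _ ≤ ∫ ω, (|𝒮.convFreeDeriv l ω - D0| + 1 / (2 * Real.sqrt l) * |𝒮.amp ω.2 - A|) ∂𝒮.joint := by
        refine integral_mono (ib.sub (integrable_const _)).abs (i1.add (i2.const_mul _)) fun ω => ?_
        dsimp only
        have e2 : 𝒮.br l ω (𝒮.ell l ω) - ∫ ω, 𝒮.br l ω (𝒮.ell l ω) ∂𝒮.joint
            = (𝒮.convFreeDeriv l ω - D0) + 1 / (2 * Real.sqrt l) * (𝒮.amp ω.2 - A) := by
          rw [eD]; unfold convFreeDeriv; ring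
        rw [e2]
        refine (abs_add_le _ _).trans (add_le_add le_rfl ?_)
        rw [abs_mul, abs_of_nonneg (a := 1 / (2 * Real.sqrt l)) (by positivity)]
    _ ≤ (3 * w + Δ2) / h + 1 / (2 * Real.sqrt l) * (2 * 𝒮.M * Real.sqrt n) := by
        rw [integral_add i1 (i2.const_mul _), integral_const_mul]
        exact add_le_add hdev (mul_le_mul_of_nonneg_left 𝒮.integral_abs_amp_sub_le (by positivity))
    _ = _ := by field_simp

lemma measurable_Q_joint :
    Measurable fun a : (ℝ × (Ω × (Fin n → ℝ))) × P => 𝒮.Q a.1.2.1 a.2 := by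
  have h : Measurable fun a : (ℝ × (Ω × (Fin n → ℝ))) × P => (a.1.2.1, a.2) := by fun_prop
  exact 𝒮.measurable_Q.comp h

lemma measurable_mean : Measurable 𝒮.mean := by
  have h := 𝒮.measurable_br (g := fun a p => 𝒮.Q a.2.1 p) 𝒮.measurable_Q_joint
  exact (h.stronglyMeasurable.integral_prod_right' (ν := 𝒮.joint)).measurable

lemma measurable_fluct : Measurable 𝒮.fluct := by
  have hm : Measurable fun a : (ℝ × (Ω × (Fin n → ℝ))) × P => 𝒮.mean a.1.1 := by
    have h : Measurable fun a : (ℝ × (Ω × (Fin n → ℝ))) × P => a.1.1 := by fun_prop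
    exact 𝒮.measurable_mean.comp h
  have h := 𝒮.measurable_br (g := fun a p => (𝒮.Q a.2.1 p - 𝒮.mean a.1) ^ 2)
    ((𝒮.measurable_Q_joint.sub hm).pow_const 2)
  exact (h.stronglyMeasurable.integral_prod_right' (ν := 𝒮.joint)).measurable

lemma fluct_nonneg (l : ℝ) : 0 ≤ 𝒮.fluct l :=
  integral_nonneg fun _ => integral_nonneg fun _ => sq_nonneg _

lemma fluct_le_of_bdd (hn : 0 < n) {l : ℝ} (hl : 0 ≤ l) : 𝒮.fluct l ≤ (𝒮.M ^ 2) ^ 2 := by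
  rw [𝒮.fluct_eq hn hl]
  have h : |∫ ω, 𝒮.br l ω (fun p => 𝒮.Q ω.1 p ^ 2) ∂𝒮.joint| ≤ (𝒮.M ^ 2) ^ 2 := by
    refine abs_integral_le_of_ae_abs_le ?_
    filter_upwards [𝒮.ae_joint (𝒮.abs_Q_sq_le hn)] with ω h
    exact 𝒮.abs_br_le hl ω h
  nlinarith [(abs_le.1 h).2, sq_nonneg (𝒮.mean l)]

/-- Concentration of the scalar overlap, on average over the signal-to-noise ratio. -/
theorem integral_fluct_le (hn : 0 < n) {d h v : ℝ} (hd : 0 < d) (hh : 0 < h) (hhd : h ≤ d / 2)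
    (hN : ∀ l ∈ Icc d (2 * d), 𝒮.Nishimori l)
    (hi : ∀ l ∈ Icc (d / 2) (3 * d), Integrable (𝒮.free l) 𝒮.joint)
    (hv : ∀ l ∈ Icc (d / 2) (3 * d),
      ∫ ω, |𝒮.free l ω - ∫ ω, 𝒮.free l ω ∂𝒮.joint| ∂𝒮.joint ≤ v) :
    IntervalIntegrable 𝒮.fluct volume d (2 * d) ∧
    n * ∫ l in d..(2 * d), 𝒮.fluct l ≤ 4 * 𝒮.M ^ 2 + 2 * 𝒮.M ^ 2 *
      (d * (3 * (v + Real.sqrt (3 * d) * (2 * 𝒮.M * Real.sqrt n)) / h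
        + 𝒮.M * Real.sqrt n / Real.sqrt d)
      + 2 * h * (n * (3 / 2 * 𝒮.M ^ 2) + 𝒮.M * n / Real.sqrt (d / 2))) := by
  have hd2 : d ≤ 2 * d := by linarith
  have hfi : IntervalIntegrable 𝒮.fluct volume d (2 * d) := by
    rw [intervalIntegrable_iff_integrableOn_Ioc_of_le hd2]
    refine integrable_of_ae_abs_le (c := (𝒮.M ^ 2) ^ 2) 𝒮.measurable_fluct ?_
    filter_upwards [ae_restrict_mem measurableSet_Ioc] with l hl
    rw [abs_of_nonneg (𝒮.fluct_nonneg l)]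
    exact 𝒮.fluct_le_of_bdd hn (hd.trans hl.1).le
  refine ⟨hfi, ?_⟩
  have hsd : 0 < Real.sqrt d := Real.sqrt_pos.2 hd
  have hsd2 : 0 < Real.sqrt (d / 2) := Real.sqrt_pos.2 (by linarith)
  set w := v + Real.sqrt (3 * d) * (2 * 𝒮.M * Real.sqrt n) with hw
  obtain ⟨hci, hcov⟩ := 𝒮.integral_cov_eq hn hd
  set L := n * (3 / 2 * 𝒮.M ^ 2) + 𝒮.M * n / Real.sqrt (d / 2) with hL
  have hLip : ∀ u ∈ Icc (d - h) (2 * d + h), ∀ u' ∈ Icc (d - h) (2 * d + h),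
      |𝒮.meanConvFree u - 𝒮.meanConvFree u'| ≤ L * |u - u'| := by
    intro u hu u' hu'
    have iu := 𝒮.integrable_convFree (hi u ⟨by linarith [hu.1], by linarith [hu.2]⟩)
    have iu' := 𝒮.integrable_convFree (hi u' ⟨by linarith [hu'.1], by linarith [hu'.2]⟩)
    unfold meanConvFree
    rw [← integral_sub iu iu']
    refine abs_integral_le_integral_abs.trans ?_
    have hae := 𝒮.abs_convFree_sub_le (d := d / 2) (by linarith)
    have ib : Integrable (fun ω : Ω × (Fin n → ℝ) =>
        (n * (3 / 2 * 𝒮.M ^ 2) + 𝒮.amp ω.2 / Real.sqrt (d / 2))) 𝒮.joint :=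
      (integrable_const _).add (𝒮.integrable_amp_snd.div_const _)
    refine (integral_mono_ae (iu.sub iu').abs (ib.mul_const |u - u'|) ?_).trans ?_
    · filter_upwards [hae] with ω hω
      exact hω u (mem_Ici.2 (by linarith [hu.1])) u' (mem_Ici.2 (by linarith [hu'.1]))
    · rw [integral_mul_const]
      refine mul_le_mul_of_nonneg_right ?_ (abs_nonneg _)
      rw [integral_add (integrable_const _) (𝒮.integrable_amp_snd.div_const _), integral_div,
        integral_fun_snd (μ := 𝒮.law) (ν := noise n) (fun z => 𝒮.amp z)]
      simp only [integral_const, probReal_univ, smul_eq_mul, one_mul]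
      rw [hL]
      have := 𝒮.integral_amp_le
      gcongr
  obtain ⟨hsi, hsecond⟩ := integral_second_diff_le hh.le hd2 hLip
  set Δ2 : ℝ → ℝ := fun l =>
    𝒮.meanConvFree (l + h) + 𝒮.meanConvFree (l - h) - 2 * 𝒮.meanConvFree l with hΔ
  have hpt : ∀ l ∈ Icc d (2 * d), n * 𝒮.fluct l ≤ 2 * ∫ ω, 𝒮.cov l ω ∂𝒮.joint
      + (2 * 𝒮.M ^ 2 * (1 / h) * Δ2 l
        + 2 * 𝒮.M ^ 2 * (3 * w / h + 𝒮.M * Real.sqrt n / Real.sqrt d)) := by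
    intro l hl
    have h1 := 𝒮.fluct_le hn (hd.trans_le hl.1) (hN l hl)
    have h2 := 𝒮.integral_abs_bell_sub_le (l := l) (h := h) (L := 3 * d) (v := v) hh
      (by linarith [hl.1]) (by linarith [hl.2])
      (fun u hu => hi u ⟨by linarith [hu.1, hl.1], by linarith [hu.2, hl.2]⟩)
      (fun u hu => hv u ⟨by linarith [hu.1, hl.1], by linarith [hu.2, hl.2]⟩)
    have h3 : 𝒮.M * Real.sqrt n / Real.sqrt l ≤ 𝒮.M * Real.sqrt n / Real.sqrt d :=
      div_le_div_of_nonneg_left (mul_nonneg 𝒮.M_nonneg (Real.sqrt_nonneg _)) hsd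
        (Real.sqrt_le_sqrt hl.1)
    have h4 : (3 * w + Δ2 l) / h = 3 * w / h + 1 / h * Δ2 l := by ring
    have h5 := mul_le_mul_of_nonneg_left (h2.trans (add_le_add (le_of_eq h4) h3))
      (show 0 ≤ 2 * 𝒮.M ^ 2 by positivity)
    linarith
  have hint := intervalIntegral.integral_mono_on hd2 (hfi.const_mul (n : ℝ))
    ((hci.const_mul 2).add ((hsi.const_mul (2 * 𝒮.M ^ 2 * (1 / h))).add
      (intervalIntegrable_const (c := 2 * 𝒮.M ^ 2 * (3 * w / h + 𝒮.M * Real.sqrt n / Real.sqrt d)))))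
    hpt
  rw [intervalIntegral.integral_const_mul] at hint
  refine hint.trans ?_
  rw [intervalIntegral.integral_add (hci.const_mul 2) ((hsi.const_mul _).add
      intervalIntegrable_const), intervalIntegral.integral_add (hsi.const_mul _)
      intervalIntegrable_const, intervalIntegral.integral_const_mul,
      intervalIntegral.integral_const_mul, intervalIntegral.integral_const]
  have e : 2 * d - d = d := by ring
  rw [e, smul_eq_mul]
  have h6 : 2 * 𝒮.M ^ 2 * (1 / h) * ∫ l in d..(2 * d), Δ2 l
      ≤ 2 * 𝒮.M ^ 2 * (1 / h) * (2 * h ^ 2 * L) :=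
    mul_le_mul_of_nonneg_left hsecond (by positivity)
  have h7 : 2 * 𝒮.M ^ 2 * (1 / h) * (2 * h ^ 2 * L) = 2 * 𝒮.M ^ 2 * (2 * h * L) := by
    field_simp
  nlinarith

end SideChannel

end

noncomputable section

/-- A Bayes-optimal inference problem: the posterior of the hidden `truth` given the observed
`data` has energy `W data` with respect to the prior. -/
structure BayesModel (Ω D P : Type*) [MeasurableSpace Ω] [MeasurableSpace D]
    [MeasurableSpace P] where
  law : Measure Ω
  prior : Measure P
  W : D → P → ℝ
  data : Ω → D
  truth : Ω → P
  prob_law : IsProbabilityMeasure law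
  prob_prior : IsProbabilityMeasure prior
  measurable_W : Measurable (Function.uncurry W)
  bdd_W : ∀ d, ∃ c, ∀ᵐ p ∂prior, |W d p| ≤ c
  measurable_data : Measurable data
  measurePreserving_truth : MeasurePreserving truth law prior
  nishimori : ∀ (f : D → P → ℝ) (c : ℝ), Measurable (Function.uncurry f) →
    (∀ d, ∀ᵐ p ∂prior, |f d p| ≤ c) →
    ∫ ω, f (data ω) (truth ω) ∂law
      = ∫ ω, (∫ p, f (data ω) p ∂(prior.tilted (W (data ω)))) ∂law

namespace BayesModel

variable {Ω D P : Type*} [MeasurableSpace Ω] [MeasurableSpace D] [MeasurableSpace P]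
  (ℬ : BayesModel Ω D P)

instance : IsProbabilityMeasure ℬ.law := ℬ.prob_law
instance : IsProbabilityMeasure ℬ.prior := ℬ.prob_prior

/-- The posterior average of a function of the sample, given the data. -/
def post (d : D) (g : P → ℝ) : ℝ := ∫ p, g p ∂(ℬ.prior.tilted (ℬ.W d))

/-- The energy. -/
def H (ω : Ω) (p : P) : ℝ := ℬ.W (ℬ.data ω) p

/-- The Gibbs average. -/
def br (ω : Ω) (g : P → ℝ) : ℝ := ∫ p, g p ∂(ℬ.prior.tilted (ℬ.H ω))

lemma br_eq (ω : Ω) (g : P → ℝ) : ℬ.br ω g = ℬ.post (ℬ.data ω) g := rfl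

lemma measurable_H : Measurable (Function.uncurry ℬ.H) :=
  ℬ.measurable_W.comp ((ℬ.measurable_data.comp measurable_fst).prodMk measurable_snd)

lemma bdd_H (ω : Ω) : ∃ c, ∀ᵐ p ∂ℬ.prior, |ℬ.H ω p| ≤ c := ℬ.bdd_W _

/-- The mean of a function of the disorder and of a posterior sample. -/
def mean (f : Ω → P → ℝ) : ℝ := ∫ ω, ℬ.br ω (f ω) ∂ℬ.law

/-- The variance of a function of the disorder and of a posterior sample. -/
def var (f : Ω → P → ℝ) : ℝ := ℬ.mean fun ω p => (f ω p - ℬ.mean f) ^ 2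

/-- The joint law of the disorder and of a posterior sample. -/
def joint : Measure (Ω × P) :=
  (ℬ.law.prod ℬ.prior).withDensity fun z =>
    ENNReal.ofReal (Real.exp (ℬ.H z.1 z.2) / ∫ p, Real.exp (ℬ.H z.1 p) ∂ℬ.prior)

lemma measurable_H_apply (ω : Ω) : Measurable (ℬ.H ω) :=
  ℬ.measurable_H.comp (measurable_prodMk_left (x := ω))

lemma isProbabilityMeasure_gibbs (ω : Ω) :
    IsProbabilityMeasure (ℬ.prior.tilted (ℬ.H ω)) := by
  obtain ⟨c, hc⟩ := ℬ.bdd_H ω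
  exact isProbabilityMeasure_tilted_of_bdd (ℬ.measurable_H_apply ω) hc

lemma isProbabilityMeasure_post (d : D) :
    IsProbabilityMeasure (ℬ.prior.tilted (ℬ.W d)) := by
  obtain ⟨c, hc⟩ := ℬ.bdd_W d
  exact isProbabilityMeasure_tilted_of_bdd (ℬ.measurable_W.comp (measurable_prodMk_left (x := d))) hc

lemma abs_post_le (d : D) {g : P → ℝ} {c : ℝ} (hg : ∀ᵐ p ∂ℬ.prior, |g p| ≤ c) :
    |ℬ.post d g| ≤ c := by
  have := ℬ.isProbabilityMeasure_post d
  exact abs_integral_le_of_ae_abs_le (ae_tilted hg)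

lemma measurable_post {g : P → ℝ} (hg : Measurable g) : Measurable fun d => ℬ.post d g := by
  have h1 : Measurable fun z : D × P => Real.exp (ℬ.W z.1 z.2) := ℬ.measurable_W.exp
  have h3 : Measurable fun z : D × P => g z.2 * Real.exp (ℬ.W z.1 z.2) :=
    (hg.comp measurable_snd).mul h1
  have h2 : Measurable fun d => ∫ p, Real.exp (ℬ.W d p) ∂ℬ.prior :=
    (h1.stronglyMeasurable.integral_prod_right' (ν := ℬ.prior)).measurable
  have h4 : Measurable fun d => ∫ p, g p * Real.exp (ℬ.W d p) ∂ℬ.prior :=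
    (h3.stronglyMeasurable.integral_prod_right' (ν := ℬ.prior)).measurable
  unfold post
  simp only [integral_tilted_eq_div]
  exact h4.div h2

lemma abs_br_le (ω : Ω) {g : P → ℝ} {c : ℝ} (hg : ∀ᵐ p ∂ℬ.prior, |g p| ≤ c) : |ℬ.br ω g| ≤ c := by
  have := ℬ.isProbabilityMeasure_gibbs ω
  exact abs_integral_le_of_ae_abs_le (ae_tilted hg)

lemma integrable_gibbs (ω : Ω) {g : P → ℝ} {c : ℝ} (hgm : Measurable g)
    (hg : ∀ᵐ p ∂ℬ.prior, |g p| ≤ c) : Integrable g (ℬ.prior.tilted (ℬ.H ω)) := by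
  have := ℬ.isProbabilityMeasure_gibbs ω
  exact integrable_of_ae_abs_le hgm (ae_tilted hg)

lemma measurable_dens : Measurable fun z : Ω × P =>
    Real.exp (ℬ.H z.1 z.2) / ∫ p, Real.exp (ℬ.H z.1 p) ∂ℬ.prior := by
  have h1 : Measurable fun z : Ω × P => Real.exp (ℬ.H z.1 z.2) := ℬ.measurable_H.exp
  have h2 : Measurable fun ω => ∫ p, Real.exp (ℬ.H ω p) ∂ℬ.prior :=
    (h1.stronglyMeasurable.integral_prod_right' (ν := ℬ.prior)).measurable
  have h3 : Measurable fun z : Ω × P => ∫ p, Real.exp (ℬ.H z.1 p) ∂ℬ.prior := h2.comp measurable_fst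
  exact h1.div h3

lemma ae_joint {q : Ω × P → Prop} (h : ∀ᵐ z ∂(ℬ.law.prod ℬ.prior), q z) : ∀ᵐ z ∂ℬ.joint, q z :=
  (withDensity_absolutelyContinuous _ _).ae_le h

lemma lintegral_dens (ω : Ω) : ∫⁻ p, ENNReal.ofReal
    (Real.exp (ℬ.H ω p) / ∫ p, Real.exp (ℬ.H ω p) ∂ℬ.prior) ∂ℬ.prior = 1 := by
  have := (ℬ.isProbabilityMeasure_gibbs ω).measure_univ
  rw [Measure.tilted, withDensity_apply _ MeasurableSet.univ, setLIntegral_univ] at this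
  exact this

instance : IsProbabilityMeasure ℬ.joint := by
  refine ⟨?_⟩
  unfold joint
  rw [withDensity_apply _ MeasurableSet.univ, setLIntegral_univ,
    lintegral_prod _ ℬ.measurable_dens.ennreal_ofReal.aemeasurable]
  simp only [lintegral_dens]
  simp

/-- Almost sure boundedness with respect to the disorder and the prior. -/
def Bdd (f : Ω → P → ℝ) (c : ℝ) : Prop :=
  Measurable (Function.uncurry f) ∧ ∀ᵐ z ∂(ℬ.law.prod ℬ.prior), |f z.1 z.2| ≤ c

variable {ℬ} in
lemma Bdd.integrable {f : Ω → P → ℝ} {c : ℝ} (hf : ℬ.Bdd f c) :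
    Integrable (Function.uncurry f) ℬ.joint :=
  integrable_of_ae_abs_le hf.1 (ℬ.ae_joint hf.2)

variable {ℬ} in
lemma Bdd.memLp {f : Ω → P → ℝ} {c : ℝ} (hf : ℬ.Bdd f c) :
    MemLp (Function.uncurry f) 2 ℬ.joint :=
  MemLp.of_bound hf.1.aestronglyMeasurable c (ℬ.ae_joint hf.2)

variable {ℬ} in
lemma Bdd.mean_eq {f : Ω → P → ℝ} {c : ℝ} (hf : ℬ.Bdd f c) :
    ℬ.mean f = ∫ z, f z.1 z.2 ∂ℬ.joint := by
  have hi := hf.integrable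
  have hd := ℬ.measurable_dens
  have hnn : ∀ z : Ω × P, 0 ≤ Real.exp (ℬ.H z.1 z.2) / ∫ p, Real.exp (ℬ.H z.1 p) ∂ℬ.prior :=
    fun z => div_nonneg (Real.exp_pos _).le (integral_nonneg fun p => (Real.exp_pos _).le)
  unfold joint at hi ⊢
  rw [integrable_withDensity_iff_integrable_smul₀' hd.ennreal_ofReal.aemeasurable (by simp)] at hi
  rw [integral_withDensity_eq_integral_toReal_smul hd.ennreal_ofReal (by simp)]
  simp only [ENNReal.toReal_ofReal (hnn _), smul_eq_mul] at hi ⊢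
  have hi' : Integrable (fun z : Ω × P => Real.exp (ℬ.H z.1 z.2) /
      (∫ p, Real.exp (ℬ.H z.1 p) ∂ℬ.prior) * f z.1 z.2) (ℬ.law.prod ℬ.prior) := hi
  rw [integral_prod _ hi']
  unfold mean br
  congr 1 with ω
  rw [integral_tilted]
  simp only [smul_eq_mul]

variable {ℬ} in
lemma Bdd.ae_ae {f : Ω → P → ℝ} {c : ℝ} (hf : ℬ.Bdd f c) :
    ∀ᵐ ω ∂ℬ.law, ∀ᵐ p ∂ℬ.prior, |f ω p| ≤ c := Measure.ae_ae_of_ae_prod hf.2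

variable {ℬ} in
lemma Bdd.mul {f g : Ω → P → ℝ} {c c' : ℝ} (hf : ℬ.Bdd f c) (hg : ℬ.Bdd g c') :
    ℬ.Bdd (fun ω p => f ω p * g ω p) (c * c') := by
  refine ⟨hf.1.mul hg.1, ?_⟩
  filter_upwards [hf.2, hg.2] with z h1 h2
  rw [abs_mul]
  exact mul_le_mul h1 h2 (abs_nonneg _) ((abs_nonneg _).trans h1)

variable {ℬ} in
lemma Bdd.sub {f g : Ω → P → ℝ} {c c' : ℝ} (hf : ℬ.Bdd f c) (hg : ℬ.Bdd g c') :
    ℬ.Bdd (fun ω p => f ω p - g ω p) (c + c') := by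
  refine ⟨hf.1.sub hg.1, ?_⟩
  filter_upwards [hf.2, hg.2] with z h1 h2
  exact (abs_sub _ _).trans (add_le_add h1 h2)

variable {ℬ} in
lemma Bdd.sum {n : ℕ} {f : Fin n → Ω → P → ℝ} {c : Fin n → ℝ} (hf : ∀ i, ℬ.Bdd (f i) (c i)) :
    ℬ.Bdd (fun ω p => ∑ i, f i ω p) (∑ i, c i) := by
  refine ⟨Finset.measurable_sum _ fun i _ => (hf i).1, ?_⟩
  have : ∀ᵐ z ∂(ℬ.law.prod ℬ.prior), ∀ i, |f i z.1 z.2| ≤ c i := by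
    rw [eventually_all]; exact fun i => (hf i).2
  filter_upwards [this] with z h
  exact (Finset.abs_sum_le_sum_abs _ _).trans (Finset.sum_le_sum fun i _ => h i)

lemma bdd_const (a : ℝ) : ℬ.Bdd (fun _ _ => a) |a| :=
  ⟨measurable_const, Eventually.of_forall fun _ => le_rfl⟩

lemma bdd_fst {f : Ω → ℝ} {c : ℝ} (hf : Measurable f) (hc : ∀ᵐ ω ∂ℬ.law, |f ω| ≤ c) :
    ℬ.Bdd (fun ω _ => f ω) c :=
  ⟨hf.comp measurable_fst, Measure.quasiMeasurePreserving_fst.ae hc⟩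

variable {ℬ} in
lemma Bdd.measurable_br {f : Ω → P → ℝ} {c : ℝ} (hf : ℬ.Bdd f c) :
    Measurable fun ω => ℬ.br ω (f ω) := by
  have h1 : Measurable fun z : Ω × P => Real.exp (ℬ.H z.1 z.2) := ℬ.measurable_H.exp
  have h3 : Measurable fun z : Ω × P => f z.1 z.2 * Real.exp (ℬ.H z.1 z.2) := hf.1.mul h1
  have h2 : Measurable fun ω => ∫ p, Real.exp (ℬ.H ω p) ∂ℬ.prior :=
    (h1.stronglyMeasurable.integral_prod_right' (ν := ℬ.prior)).measurable
  have h4 : Measurable fun ω => ∫ p, f ω p * Real.exp (ℬ.H ω p) ∂ℬ.prior :=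
    (h3.stronglyMeasurable.integral_prod_right' (ν := ℬ.prior)).measurable
  unfold br
  simp only [integral_tilted_eq_div]
  exact h4.div h2

variable {ℬ} in
lemma Bdd.integrable_br {f : Ω → P → ℝ} {c : ℝ} (hf : ℬ.Bdd f c) :
    Integrable (fun ω => ℬ.br ω (f ω)) ℬ.law :=
  integrable_of_ae_abs_le (c := c) hf.measurable_br (hf.ae_ae.mono fun ω h => ℬ.abs_br_le ω h)

lemma mean_fst (f : Ω → ℝ) : ℬ.mean (fun ω _ => f ω) = ∫ ω, f ω ∂ℬ.law := by
  unfold mean br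
  congr 1 with ω
  have := ℬ.isProbabilityMeasure_gibbs ω
  simp

variable {ℬ} in
lemma Bdd.var_eq {f : Ω → P → ℝ} {c : ℝ} (hf : ℬ.Bdd f c) :
    ℬ.var f = ∫ z, (f z.1 z.2 - ∫ z, f z.1 z.2 ∂ℬ.joint) ^ 2 ∂ℬ.joint := by
  have h1 := hf.sub (ℬ.bdd_const (ℬ.mean f))
  have h2 := h1.mul h1
  have h3 := h2.mean_eq
  unfold var
  simp only [← sq] at h3
  rw [h3, hf.mean_eq]

lemma var_nonneg (f : Ω → P → ℝ) : 0 ≤ ℬ.var f :=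
  integral_nonneg fun _ => integral_nonneg fun _ => sq_nonneg _

variable {ℬ} in
lemma Bdd.mean_sq_sub {f : Ω → P → ℝ} {c : ℝ} (hf : ℬ.Bdd f c) (a : ℝ) :
    ∫ z, (f z.1 z.2 - a) ^ 2 ∂ℬ.joint = ℬ.var f + (∫ z, f z.1 z.2 ∂ℬ.joint - a) ^ 2 := by
  rw [hf.var_eq]
  exact integral_sub_sq_eq hf.memLp a

variable {ℬ} in
lemma Bdd.var_le_mean_sq {f : Ω → P → ℝ} {c : ℝ} (hf : ℬ.Bdd f c) :
    ℬ.var f ≤ ∫ z, f z.1 z.2 ^ 2 ∂ℬ.joint := by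
  have := hf.mean_sq_sub 0
  simp only [sub_zero] at this
  rw [this]
  nlinarith [sq_nonneg (∫ z, f z.1 z.2 ∂ℬ.joint)]

section Overlap

variable {n : ℕ} (a b : P → Fin n → ℝ)

/-- The overlap of the true `a` with the estimated `b`. -/
def ovl (ω : Ω) (p : P) : ℝ := (1 / n) * ∑ i, a (ℬ.truth ω) i * b p i

/-- The posterior covariance of `a`. -/
def cov (d : D) (i j : Fin n) : ℝ :=
  ℬ.post d (fun p => a p i * a p j) - ℬ.post d (fun p => a p i) * ℬ.post d (fun p => a p j)

/-- The posterior fluctuation of a linear combination of `a`. -/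
def therm (k : Fin n → ℝ) (d : D) (p : P) : ℝ :=
  (1 / n) * ∑ i, k i * (a p i - ℬ.post d (fun p => a p i))

/-- The normalized squared Hilbert-Schmidt norm of the posterior covariance. -/
def covSq : ℝ := ∫ ω, (1 / n) ^ 2 * ∑ i, ∑ j, ℬ.cov a (ℬ.data ω) i j ^ 2 ∂ℬ.law

lemma abs_avg_le (hn : 0 < n) {x : Fin n → ℝ} {c : ℝ} (h : ∀ i, |x i| ≤ c) :
    |(1 / (n : ℝ)) * ∑ i, x i| ≤ c := by
  have hn' : (0 : ℝ) < n := Nat.cast_pos.2 hn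
  rw [abs_mul, abs_of_pos (by positivity), one_div, inv_mul_le_iff₀ hn']
  refine (Finset.abs_sum_le_sum_abs _ _).trans ((Finset.sum_le_sum fun i _ => h i).trans ?_)
  simp

lemma abs_avg_sq_le (hn : 0 < n) {x : Fin n → Fin n → ℝ} {c : ℝ} (h : ∀ i j, |x i j| ≤ c) :
    |(1 / (n : ℝ)) ^ 2 * ∑ i, ∑ j, x i j| ≤ c := by
  have e : (1 / (n : ℝ)) ^ 2 * ∑ i, ∑ j, x i j
      = 1 / (n : ℝ) * ∑ i, (1 / (n : ℝ) * ∑ j, x i j) := by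
    rw [← Finset.mul_sum]; ring
  rw [e]
  exact abs_avg_le hn fun i => abs_avg_le hn (h i)

variable {a b} {M : ℝ} (ha : Measurable a) (hM : 0 ≤ M) (haM : ∀ᵐ p ∂ℬ.prior, ∀ i, |a p i| ≤ M)

include ha in
lemma measurable_cov (i j : Fin n) : Measurable fun d => ℬ.cov a d i j := by
  have hai : ∀ i, Measurable fun p => a p i := fun i => (measurable_pi_apply i).comp ha
  exact (ℬ.measurable_post ((hai i).mul (hai j))).sub
    ((ℬ.measurable_post (hai i)).mul (ℬ.measurable_post (hai j)))

include ha in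
lemma measurable_therm {k : D × P → Fin n → ℝ} (hk : Measurable k) :
    Measurable fun z : D × P => ℬ.therm a (k z) z.1 z.2 := by
  have hai : ∀ i, Measurable fun p => a p i := fun i => (measurable_pi_apply i).comp ha
  unfold therm
  refine measurable_const.mul (Finset.measurable_sum _ fun i _ => ?_)
  exact ((measurable_pi_apply i).comp hk).mul (((hai i).comp measurable_snd).sub
    ((ℬ.measurable_post (hai i)).comp measurable_fst))

include hM haM in
lemma abs_mul_le (i j : Fin n) : ∀ᵐ p ∂ℬ.prior, |a p i * a p j| ≤ M * M := by
  filter_upwards [haM] with p h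
  rw [abs_mul]
  exact mul_le_mul (h i) (h j) (abs_nonneg _) hM

include hM haM in
lemma abs_cov_le (d : D) (i j : Fin n) : |ℬ.cov a d i j| ≤ M * M + M * M := by
  have hb := fun i => ℬ.abs_post_le d (g := fun p => a p i) (haM.mono fun p h => h i)
  refine (abs_sub _ _).trans (add_le_add (ℬ.abs_post_le d (ℬ.abs_mul_le hM haM i j)) ?_)
  rw [abs_mul]
  exact mul_le_mul (hb i) (hb j) (abs_nonneg _) hM

include hM haM in
lemma abs_therm_le (hn : 0 < n) {k : Fin n → ℝ} (hk : ∀ i, |k i| ≤ M) (d : D) :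
    ∀ᵐ p ∂ℬ.prior, |ℬ.therm a k d p| ≤ M * (M + M) := by
  have hb := fun i => ℬ.abs_post_le d (g := fun p => a p i) (haM.mono fun p h => h i)
  filter_upwards [haM] with p h
  refine abs_avg_le hn fun i => ?_
  rw [abs_mul]
  exact mul_le_mul (hk i) ((abs_sub _ _).trans (add_le_add (h i) (hb i))) (abs_nonneg _) hM

include ha hM haM

lemma post_mul_sub (d : D) (i j : Fin n) :
    ℬ.post d (fun p => (a p i - ℬ.post d (fun p => a p i)) * (a p j - ℬ.post d (fun p => a p j)))
      = ℬ.cov a d i j := by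
  have hai : ∀ i, Measurable fun p => a p i := fun i => (measurable_pi_apply i).comp ha
  have := ℬ.isProbabilityMeasure_post d
  have ii : ∀ i, Integrable (fun p => a p i) (ℬ.prior.tilted (ℬ.W d)) :=
    fun i => integrable_of_ae_abs_le (hai i) (ae_tilted (haM.mono fun p h => h i))
  have iij : Integrable (fun p => a p i * a p j) (ℬ.prior.tilted (ℬ.W d)) :=
    integrable_of_ae_abs_le ((hai i).mul (hai j)) (ae_tilted (ℬ.abs_mul_le hM haM i j))
  set mi := ℬ.post d (fun p => a p i) with hmi
  set mj := ℬ.post d (fun p => a p j) with hmj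
  have e : ∀ p, (a p i - mi) * (a p j - mj) = a p i * a p j - mi * a p j - mj * a p i + mi * mj := by
    intro p; ring
  unfold cov
  rw [← hmi, ← hmj]
  simp only [e]
  have i1 : Integrable (fun p => a p i * a p j - mi * a p j) (ℬ.prior.tilted (ℬ.W d)) :=
    iij.sub ((ii j).const_mul _)
  have i2 : Integrable (fun p => a p i * a p j - mi * a p j - mj * a p i)
      (ℬ.prior.tilted (ℬ.W d)) := i1.sub ((ii i).const_mul _)
  unfold post at hmi hmj ⊢
  rw [integral_add i2 (integrable_const _), integral_sub i1 ((ii i).const_mul _),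
    integral_sub iij ((ii j).const_mul _), integral_const_mul, integral_const_mul, ← hmi, ← hmj]
  simp
  ring

lemma post_therm_sq (k : Fin n → ℝ) (d : D) :
    ℬ.post d (fun p => ℬ.therm a k d p ^ 2)
      = (1 / n) ^ 2 * ∑ i, ∑ j, k i * k j * ℬ.cov a d i j := by
  have hai : ∀ i, Measurable fun p => a p i := fun i => (measurable_pi_apply i).comp ha
  have := ℬ.isProbabilityMeasure_post d
  have hbd : ∀ i j, Integrable (fun p => (a p i - ℬ.post d (fun p => a p i))
      * (a p j - ℬ.post d (fun p => a p j))) (ℬ.prior.tilted (ℬ.W d)) := by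
    intro i j
    refine integrable_of_ae_abs_le (c := (M + M) * (M + M)) (((hai i).sub_const _).mul
      ((hai j).sub_const _)) (ae_tilted ?_)
    filter_upwards [haM] with p h
    have hb := fun i => ℬ.abs_post_le d (g := fun p => a p i) (haM.mono fun p h => h i)
    rw [abs_mul]
    exact mul_le_mul ((abs_sub _ _).trans (add_le_add (h i) (hb i)))
      ((abs_sub _ _).trans (add_le_add (h j) (hb j))) (abs_nonneg _) (by positivity)
  have e : ∀ p, ℬ.therm a k d p ^ 2 = ∑ i, ∑ j, (1 / (n : ℝ)) ^ 2 * (k i * k j) *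
      ((a p i - ℬ.post d (fun p => a p i)) * (a p j - ℬ.post d (fun p => a p j))) := by
    intro p
    unfold therm
    rw [mul_pow, sq (∑ i, _), Finset.sum_mul_sum, Finset.mul_sum]
    refine Finset.sum_congr rfl fun i _ => ?_
    rw [Finset.mul_sum]
    exact Finset.sum_congr rfl fun j _ => by ring
  simp only [e]
  have hb2 := fun i j => ℬ.post_mul_sub ha hM haM d i j
  unfold post at hb2 hbd ⊢
  rw [integral_finsetSum _ fun i _ => integrable_finsetSum _ fun j _ => (hbd i j).const_mul _,
    Finset.mul_sum]
  refine Finset.sum_congr rfl fun i _ => ?_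
  rw [integral_finsetSum _ fun j _ => (hbd i j).const_mul _, Finset.mul_sum]
  refine Finset.sum_congr rfl fun j _ => ?_
  rw [integral_const_mul, hb2]
  ring

lemma covSq_le_var (hn : 0 < n) : ℬ.covSq a ≤ ℬ.var (ℬ.ovl a a) := by
  have hai : ∀ i, Measurable fun p => a p i := fun i => (measurable_pi_apply i).comp ha
  have hMM : 0 ≤ M * M := mul_nonneg hM hM
  have htr : ∀ᵐ ω ∂ℬ.law, ∀ i, |a (ℬ.truth ω) i| ≤ M :=
    ℬ.measurePreserving_truth.quasiMeasurePreserving.ae haM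
  have hfm : Measurable fun z : D × P =>
      (1 / (n : ℝ)) ^ 2 * ∑ i, ∑ j, a z.2 i * a z.2 j * ℬ.cov a z.1 i j :=
    measurable_const.mul (Finset.measurable_sum _ fun i _ => Finset.measurable_sum _ fun j _ =>
      (((hai i).comp measurable_snd).mul ((hai j).comp measurable_snd)).mul
        ((ℬ.measurable_cov ha i j).comp measurable_fst))
  have hN := ℬ.nishimori
    (fun d p => (1 / n) ^ 2 * ∑ i, ∑ j, a p i * a p j * ℬ.cov a d i j)
    (M * M * (M * M + M * M)) hfm
    (fun d => by
      filter_upwards [haM] with p h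
      refine abs_avg_sq_le hn fun i j => ?_
      rw [abs_mul, abs_mul]
      exact mul_le_mul (mul_le_mul (h i) (h j) (abs_nonneg _) hM) (ℬ.abs_cov_le hM haM d i j)
        (abs_nonneg _) hMM)
  have hpost : ∀ d, ∫ p, (1 / (n : ℝ)) ^ 2 * ∑ i, ∑ j, a p i * a p j * ℬ.cov a d i j
      ∂(ℬ.prior.tilted (ℬ.W d))
      = (1 / (n : ℝ)) ^ 2 * ∑ i, ∑ j, ℬ.cov a d i j ^ 2
        + ℬ.post d (fun p => ℬ.therm a (fun i => ℬ.post d (fun p => a p i)) d p ^ 2) := by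
    intro d
    have := ℬ.isProbabilityMeasure_post d
    have iij : ∀ i j, Integrable (fun p => a p i * a p j * ℬ.cov a d i j)
        (ℬ.prior.tilted (ℬ.W d)) := fun i j =>
      (integrable_of_ae_abs_le ((hai i).mul (hai j)) (ae_tilted (ℬ.abs_mul_le hM haM i j))).mul_const _
    rw [ℬ.post_therm_sq ha hM haM, integral_const_mul, integral_finsetSum _ fun i _ =>
      integrable_finsetSum _ fun j _ => iij i j, ← mul_add, ← Finset.sum_add_distrib]
    congr 1
    refine Finset.sum_congr rfl fun i _ => ?_
    rw [integral_finsetSum _ fun j _ => iij i j, ← Finset.sum_add_distrib]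
    refine Finset.sum_congr rfl fun j _ => ?_
    rw [integral_mul_const]
    have : ∫ p, a p i * a p j ∂(ℬ.prior.tilted (ℬ.W d)) = ℬ.cov a d i j +
        ℬ.post d (fun p => a p i) * ℬ.post d (fun p => a p j) := by
      unfold cov; unfold post; ring
    rw [this]; ring
  have hb := fun d i => ℬ.abs_post_le d (g := fun p => a p i) (haM.mono fun p h => h i)
  have hint1 : Integrable (fun ω => (1 / (n : ℝ)) ^ 2 * ∑ i, ∑ j, ℬ.cov a (ℬ.data ω) i j ^ 2)
      ℬ.law := by
    refine integrable_of_ae_abs_le (c := (M * M + M * M) ^ 2) (measurable_const.mul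
      (Finset.measurable_sum _ fun i _ => Finset.measurable_sum _ fun j _ =>
      ((ℬ.measurable_cov ha i j).comp ℬ.measurable_data).pow_const 2))
      (Eventually.of_forall fun ω => abs_avg_sq_le hn fun i j => ?_)
    rw [abs_pow]
    exact pow_le_pow_left₀ (abs_nonneg _) (ℬ.abs_cov_le hM haM _ i j) 2
  have hle1 : ℬ.covSq a ≤ ∫ ω, (∫ p, (1 / (n : ℝ)) ^ 2 * ∑ i, ∑ j,
      a p i * a p j * ℬ.cov a (ℬ.data ω) i j ∂(ℬ.prior.tilted (ℬ.W (ℬ.data ω)))) ∂ℬ.law := by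
    simp only [hpost]
    refine integral_mono hint1 (hint1.add ?_) fun ω => ?_
    · simp only [ℬ.post_therm_sq ha hM haM]
      refine integrable_of_ae_abs_le (c := M * M * (M * M + M * M)) (measurable_const.mul
        (Finset.measurable_sum _ fun i _ => Finset.measurable_sum _ fun j _ =>
        (((ℬ.measurable_post (hai i)).comp ℬ.measurable_data).mul
          ((ℬ.measurable_post (hai j)).comp ℬ.measurable_data)).mul
          ((ℬ.measurable_cov ha i j).comp ℬ.measurable_data)))
        (Eventually.of_forall fun ω => abs_avg_sq_le hn fun i j => ?_)
      rw [abs_mul, abs_mul]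
      exact mul_le_mul (mul_le_mul (hb _ i) (hb _ j) (abs_nonneg _) hM) (ℬ.abs_cov_le hM haM _ i j)
        (abs_nonneg _) hMM
    · exact le_add_of_nonneg_right (integral_nonneg fun _ => sq_nonneg _)
  refine hle1.trans ?_
  rw [← hN]
  -- the thermal fluctuations of the overlap
  have hbo : ℬ.Bdd (ℬ.ovl a a) (M * M) := by
    refine ⟨?_, ?_⟩
    · exact measurable_const.mul (Finset.measurable_sum _ fun i _ =>
        ((hai i).comp (ℬ.measurePreserving_truth.measurable.comp measurable_fst)).mul
          ((hai i).comp measurable_snd))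
    · filter_upwards [Measure.quasiMeasurePreserving_fst.ae htr,
        Measure.quasiMeasurePreserving_snd.ae haM] with z h1 h2
      refine abs_avg_le hn fun i => ?_
      rw [abs_mul]
      exact mul_le_mul (h1 i) (h2 i) (abs_nonneg _) hM
  have hms := (hbo.sub (ℬ.bdd_const (ℬ.mean (ℬ.ovl a a))))
  have hms2 := hms.mul hms
  refine integral_mono_ae (integrable_of_ae_abs_le (c := M * M * (M * M + M * M))
    (measurable_const.mul (Finset.measurable_sum _ fun i _ => Finset.measurable_sum _ fun j _ =>
      (((hai i).comp ℬ.measurePreserving_truth.measurable).mul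
        ((hai j).comp ℬ.measurePreserving_truth.measurable)).mul
        ((ℬ.measurable_cov ha i j).comp ℬ.measurable_data))) ?_) ?_ ?_
  · filter_upwards [htr] with ω h
    refine abs_avg_sq_le hn fun i j => ?_
    rw [abs_mul, abs_mul]
    exact mul_le_mul (mul_le_mul (h i) (h j) (abs_nonneg _) hM) (ℬ.abs_cov_le hM haM _ i j)
      (abs_nonneg _) hMM
  · simp only [sq]
    exact hms2.integrable_br
  · filter_upwards [htr, hbo.ae_ae] with ω h hω
    have := ℬ.isProbabilityMeasure_gibbs ω
    have h1 := ℬ.post_therm_sq ha hM haM (fun i => a (ℬ.truth ω) i) (ℬ.data ω)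
    rw [← h1, ← br_eq]
    have io : Integrable (ℬ.ovl a a ω) (ℬ.prior.tilted (ℬ.H ω)) :=
      ℬ.integrable_gibbs ω (hbo.1.comp measurable_prodMk_left) hω
    have e1 : ∀ p, ℬ.therm a (fun i => a (ℬ.truth ω) i) (ℬ.data ω) p
        = ℬ.ovl a a ω p - ℬ.br ω (ℬ.ovl a a ω) := by
      intro p
      unfold therm ovl
      unfold br
      rw [integral_const_mul, integral_finsetSum _ fun i _ => (ℬ.integrable_gibbs ω (hai i)
        (haM.mono fun p h => h i)).const_mul _, ← mul_sub, ← Finset.sum_sub_distrib]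
      congr 1
      refine Finset.sum_congr rfl fun i _ => ?_
      rw [integral_const_mul, mul_sub]
      rfl
    simp only [e1]
    have hmem : MemLp (ℬ.ovl a a ω) 2 (ℬ.prior.tilted (ℬ.H ω)) :=
      MemLp.of_bound (hbo.1.comp measurable_prodMk_left).aestronglyMeasurable _ (ae_tilted hω)
    have h3 := integral_sub_sq_eq hmem (ℬ.mean (ℬ.ovl a a))
    have h4 := sq_nonneg ((∫ p, ℬ.ovl a a ω p ∂(ℬ.prior.tilted (ℬ.H ω))) - ℬ.mean (ℬ.ovl a a))
    unfold br at h3 h4 ⊢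
    linarith

lemma mean_therm_sq_le (hn : 0 < n) {k : Ω → Fin n → ℝ} (hk : Measurable k)
    (hkM : ∀ᵐ ω ∂ℬ.law, ∀ i, |k ω i| ≤ M) :
    ℬ.mean (fun ω p => ℬ.therm a (k ω) (ℬ.data ω) p ^ 2) ≤ M ^ 2 * √(ℬ.covSq a) := by
  have hai : ∀ i, Measurable fun p => a p i := fun i => (measurable_pi_apply i).comp ha
  have hMM : 0 ≤ M * M := mul_nonneg hM hM
  have hn' : (0 : ℝ) < n := Nat.cast_pos.2 hn
  unfold mean
  simp only [br_eq, ℬ.post_therm_sq ha hM haM]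
  set A : Ω → ℝ := fun ω => (1 / (n : ℝ)) ^ 2 * ∑ i, ∑ j, |ℬ.cov a (ℬ.data ω) i j| with hA
  have hki : ∀ i, Measurable fun ω => k ω i := fun i => (measurable_pi_apply i).comp hk
  have hcm : ∀ i j, Measurable fun ω => ℬ.cov a (ℬ.data ω) i j :=
    fun i j => (ℬ.measurable_cov ha i j).comp ℬ.measurable_data
  have hAb : ∀ ω, |A ω| ≤ M * M + M * M := fun ω => abs_avg_sq_le hn fun i j => by
    rw [abs_abs]; exact ℬ.abs_cov_le hM haM _ i j
  have hAm : Measurable A := measurable_const.mul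
    (Finset.measurable_sum _ fun i _ => Finset.measurable_sum _ fun j _ => (hcm i j).abs)
  have hAi : Integrable A ℬ.law := integrable_of_ae_abs_le hAm (Eventually.of_forall hAb)
  have h1 : ∫ ω, (1 / (n : ℝ)) ^ 2 * ∑ i, ∑ j, k ω i * k ω j * ℬ.cov a (ℬ.data ω) i j ∂ℬ.law
      ≤ ∫ ω, M ^ 2 * A ω ∂ℬ.law := by
    refine integral_mono_ae (integrable_of_ae_abs_le (c := M * M * (M * M + M * M))
      (measurable_const.mul (Finset.measurable_sum _ fun i _ => Finset.measurable_sum _ fun j _ =>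
      ((hki i).mul (hki j)).mul (hcm i j))) ?_) (hAi.const_mul _) ?_
    · filter_upwards [hkM] with ω h
      refine abs_avg_sq_le hn fun i j => ?_
      rw [abs_mul, abs_mul]
      exact mul_le_mul (mul_le_mul (h i) (h j) (abs_nonneg _) hM) (ℬ.abs_cov_le hM haM _ i j)
        (abs_nonneg _) hMM
    · filter_upwards [hkM] with ω h
      have : M ^ 2 * A ω = (1 / (n : ℝ)) ^ 2 * ∑ i, ∑ j, M ^ 2 * |ℬ.cov a (ℬ.data ω) i j| := by
        simp only [hA, ← Finset.mul_sum]; ring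
      rw [this]
      refine mul_le_mul_of_nonneg_left (Finset.sum_le_sum fun i _ => Finset.sum_le_sum fun j _ => ?_)
        (by positivity)
      refine (le_abs_self _).trans ?_
      rw [abs_mul, abs_mul, sq]
      exact mul_le_mul_of_nonneg_right (mul_le_mul (h i) (h j) (abs_nonneg _) hM) (abs_nonneg _)
  refine h1.trans ?_
  rw [integral_const_mul]
  refine mul_le_mul_of_nonneg_left ?_ (sq_nonneg M)
  have h2 : ∫ ω, A ω ∂ℬ.law ≤ √(∫ ω, A ω ^ 2 ∂ℬ.law) := by
    refine (integral_mono hAi hAi.abs fun ω => le_abs_self _).trans ?_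
    exact integral_abs_le_sqrt (MemLp.of_bound hAm.aestronglyMeasurable _
      (Eventually.of_forall hAb))
  refine h2.trans (Real.sqrt_le_sqrt ?_)
  refine integral_mono (integrable_of_ae_abs_le (c := (M * M + M * M) ^ 2) (hAm.pow_const 2)
    (Eventually.of_forall fun ω => ?_)) (integrable_of_ae_abs_le (c := (M * M + M * M) ^ 2)
    (measurable_const.mul (Finset.measurable_sum _ fun i _ => Finset.measurable_sum _ fun j _ =>
      (hcm i j).pow_const 2)) (Eventually.of_forall fun ω => abs_avg_sq_le hn fun i j => ?_))
    fun ω => ?_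
  · rw [abs_pow]
    exact pow_le_pow_left₀ (abs_nonneg _) (hAb ω) 2
  · rw [abs_pow]
    exact pow_le_pow_left₀ (abs_nonneg _) (ℬ.abs_cov_le hM haM _ i j) 2
  · simp only [hA]
    rw [← Finset.sum_product', ← Finset.sum_product', mul_pow]
    have := sq_sum_le_card_mul_sum_sq (s := (Finset.univ : Finset (Fin n)) ×ˢ Finset.univ)
      (f := fun x => |ℬ.cov a (ℬ.data ω) x.1 x.2|)
    simp only [sq_abs, Finset.card_product, Finset.card_univ, Fintype.card_fin, Nat.cast_mul] at this
    calc _ ≤ ((1 / (n : ℝ)) ^ 2) ^ 2 * (n * n * _) := mul_le_mul_of_nonneg_left this (by positivity)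
      _ = _ := by field_simp

lemma bdd_ovl (hn : 0 < n) (hb : Measurable b) (hbM : ∀ᵐ p ∂ℬ.prior, ∀ i, |b p i| ≤ M) :
    ℬ.Bdd (ℬ.ovl a b) (M * M) := by
  have hai : ∀ i, Measurable fun p => a p i := fun i => (measurable_pi_apply i).comp ha
  have hbi : ∀ i, Measurable fun p => b p i := fun i => (measurable_pi_apply i).comp hb
  refine ⟨measurable_const.mul (Finset.measurable_sum _ fun i _ =>
      ((hai i).comp (ℬ.measurePreserving_truth.measurable.comp measurable_fst)).mul
        ((hbi i).comp measurable_snd)), ?_⟩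
  filter_upwards [Measure.quasiMeasurePreserving_fst.ae
    (ℬ.measurePreserving_truth.quasiMeasurePreserving.ae haM),
    Measure.quasiMeasurePreserving_snd.ae hbM] with z h1 h2
  refine abs_avg_le hn fun i => ?_
  rw [abs_mul]
  exact mul_le_mul (h1 i) (h2 i) (abs_nonneg _) hM

/-- The overlap is close to the overlap of the posterior means. -/
lemma integral_ovl_sub_sq_le (hn : 0 < n) (hb : Measurable b)
    (hbM : ∀ᵐ p ∂ℬ.prior, ∀ i, |b p i| ≤ M) :
    ∫ z, (ℬ.ovl a b z.1 z.2 - (1 / n) * ∑ i, ℬ.post (ℬ.data z.1) (fun p => a p i)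
        * ℬ.post (ℬ.data z.1) (fun p => b p i)) ^ 2 ∂ℬ.joint
      ≤ 2 * M ^ 2 * (√(ℬ.covSq a) + √(ℬ.covSq b)) := by
  have hai : ∀ i, Measurable fun p => a p i := fun i => (measurable_pi_apply i).comp ha
  have hbi : ∀ i, Measurable fun p => b p i := fun i => (measurable_pi_apply i).comp hb
  have htm := ℬ.measurePreserving_truth.measurable
  have htr : ∀ᵐ ω ∂ℬ.law, ∀ i, |a (ℬ.truth ω) i| ≤ M :=
    ℬ.measurePreserving_truth.quasiMeasurePreserving.ae haM
  have hpb := fun d i => ℬ.abs_post_le d (g := fun p => b p i) (hbM.mono fun p h => h i)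
  set kb : D → Fin n → ℝ := fun d i => ℬ.post d (fun p => b p i) with hkb
  have hkbm : Measurable kb := measurable_pi_lambda _ fun i => ℬ.measurable_post (hbi i)
  -- the two parts of the difference
  have hBa : ℬ.Bdd (fun ω p => ℬ.therm b (a (ℬ.truth ω)) (ℬ.data ω) p) (M * (M + M)) := by
    have h1 : Measurable fun z : Ω × P => ℬ.therm b (a (ℬ.truth z.1)) (ℬ.data z.1) z.2 := by
      unfold therm
      refine measurable_const.mul (Finset.measurable_sum _ fun i _ => ?_)
      exact ((hai i).comp (htm.comp measurable_fst)).mul (((hbi i).comp measurable_snd).sub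
        ((ℬ.measurable_post (hbi i)).comp (ℬ.measurable_data.comp measurable_fst)))
    refine ⟨h1, ?_⟩
    filter_upwards [Measure.quasiMeasurePreserving_fst.ae htr,
      Measure.quasiMeasurePreserving_snd.ae hbM] with z h1 h2
    refine abs_avg_le hn fun i => ?_
    rw [abs_mul]
    exact mul_le_mul (h1 i) ((abs_sub _ _).trans (add_le_add (h2 i) (hpb _ i))) (abs_nonneg _) hM
  have hBb : ℬ.Bdd (fun ω _ => ℬ.therm a (kb (ℬ.data ω)) (ℬ.data ω) (ℬ.truth ω))
      (M * (M + M)) := by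
    have h1 := ℬ.measurable_therm ha (k := fun z => kb z.1) (hkbm.comp measurable_fst)
    have h2 := h1.comp (ℬ.measurable_data.prodMk htm)
    simp only [Function.comp_def] at h2
    refine ℬ.bdd_fst h2 ?_
    filter_upwards [htr] with ω h1
    refine abs_avg_le hn fun i => ?_
    rw [abs_mul]
    exact mul_le_mul (hpb _ i) ((abs_sub _ _).trans (add_le_add (h1 i)
      (ℬ.abs_post_le _ (haM.mono fun p h => h i)))) (abs_nonneg _) hM
  have hN := ℬ.nishimori (fun d p => ℬ.therm a (kb d) d p ^ 2) ((M * (M + M)) ^ 2)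
    ((ℬ.measurable_therm ha (k := fun z => kb z.1) (hkbm.comp measurable_fst)).pow_const 2)
    (fun d => by
      filter_upwards [ℬ.abs_therm_le hM haM hn (hpb d) d] with p hp
      rw [abs_pow]
      exact pow_le_pow_left₀ (abs_nonneg _) hp 2)
  have e1 := ℬ.mean_therm_sq_le hb hM hbM hn (ha.comp htm) htr
  have e2 := ℬ.mean_therm_sq_le ha hM haM hn (hkbm.comp ℬ.measurable_data)
    (Eventually.of_forall fun ω => hpb (ℬ.data ω))
  have hBa2 := hBa.mul hBa
  have hBb2 := hBb.mul hBb
  have ha2 := hBa2.mean_eq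
  have hb2 := hBb2.mean_eq
  rw [mean_fst] at hb2
  simp only [← sq] at ha2 hb2
  simp only [Function.comp_def] at e1 e2
  rw [ha2] at e1
  have e2' : ∫ ω, ℬ.therm a (kb (ℬ.data ω)) (ℬ.data ω) (ℬ.truth ω) ^ 2 ∂ℬ.law
      ≤ M ^ 2 * √(ℬ.covSq a) := hN.trans_le e2
  rw [hb2] at e2'
  have i1 : Integrable (fun z : Ω × P => ℬ.therm b (a (ℬ.truth z.1)) (ℬ.data z.1) z.2 ^ 2)
      ℬ.joint := by simp only [sq]; exact hBa2.integrable
  have i2 : Integrable (fun z : Ω × P =>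
      ℬ.therm a (kb (ℬ.data z.1)) (ℬ.data z.1) (ℬ.truth z.1) ^ 2) ℬ.joint := by
    simp only [sq]; exact hBb2.integrable
  have hle : ∫ z, (ℬ.ovl a b z.1 z.2 - (1 / n) * ∑ i, ℬ.post (ℬ.data z.1) (fun p => a p i)
        * ℬ.post (ℬ.data z.1) (fun p => b p i)) ^ 2 ∂ℬ.joint
      ≤ ∫ z, (2 * ℬ.therm b (a (ℬ.truth z.1)) (ℬ.data z.1) z.2 ^ 2 +
        2 * ℬ.therm a (kb (ℬ.data z.1)) (ℬ.data z.1) (ℬ.truth z.1) ^ 2) ∂ℬ.joint := by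
    refine integral_mono_of_nonneg (Eventually.of_forall fun z => sq_nonneg _)
      ((i1.const_mul 2).add (i2.const_mul 2)) (Eventually.of_forall fun z => ?_)
    have : ℬ.ovl a b z.1 z.2 - (1 / n) * ∑ i, ℬ.post (ℬ.data z.1) (fun p => a p i)
        * ℬ.post (ℬ.data z.1) (fun p => b p i) = ℬ.therm b (a (ℬ.truth z.1)) (ℬ.data z.1) z.2
          + ℬ.therm a (kb (ℬ.data z.1)) (ℬ.data z.1) (ℬ.truth z.1) := by
      unfold ovl therm
      rw [← mul_sub, ← Finset.sum_sub_distrib, ← mul_add, ← Finset.sum_add_distrib]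
      congr 1
      refine Finset.sum_congr rfl fun i _ => ?_
      simp only [hkb]; ring
    dsimp only
    rw [this]
    nlinarith [sq_nonneg (ℬ.therm b (a (ℬ.truth z.1)) (ℬ.data z.1) z.2
          - ℬ.therm a (kb (ℬ.data z.1)) (ℬ.data z.1) (ℬ.truth z.1))]
  rw [integral_add (i1.const_mul 2) (i2.const_mul 2), integral_const_mul, integral_const_mul] at hle
  linarith

/-- The fluctuations of an overlap of two quantities are controlled by those of the
self-overlaps. -/
lemma var_ovl_le (hn : 0 < n) (hb : Measurable b) (hbM : ∀ᵐ p ∂ℬ.prior, ∀ i, |b p i| ≤ M) :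
    ℬ.var (ℬ.ovl a b) ≤ ℬ.var (ℬ.ovl (a + b) (a + b)) + ℬ.var (ℬ.ovl a a) + ℬ.var (ℬ.ovl b b)
      + 8 * M ^ 2 * (√(ℬ.var (ℬ.ovl a a)) + √(ℬ.var (ℬ.ovl b b))) := by
  have h1 := ℬ.integral_ovl_sub_sq_le ha hM haM hn hb hbM
  have h2 := ℬ.integral_ovl_sub_sq_le hb hM hbM hn ha haM
  have sa := Real.sqrt_le_sqrt (ℬ.covSq_le_var ha hM haM hn)
  have sb := Real.sqrt_le_sqrt (ℬ.covSq_le_var hb hM hbM hn)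
  have hM2 := sq_nonneg M
  have habM : ∀ᵐ p ∂ℬ.prior, ∀ i, |(a + b) p i| ≤ M + M := by
    filter_upwards [haM, hbM] with p h1 h2 i
    exact (abs_add_le _ _).trans (add_le_add (h1 i) (h2 i))
  have Baa := ℬ.bdd_ovl ha hM haM hn ha haM
  have Bab := ℬ.bdd_ovl ha hM haM hn hb hbM
  have Bba := ℬ.bdd_ovl hb hM hbM hn ha haM
  have Bbb := ℬ.bdd_ovl hb hM hbM hn hb hbM
  have Bss := ℬ.bdd_ovl (ha.add hb) (add_nonneg hM hM) habM hn (ha.add hb) habM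
  have iv : ∀ {f : Ω → P → ℝ} {c : ℝ}, ℬ.Bdd f c → ∀ m : ℝ,
      Integrable (fun z : Ω × P => (f z.1 z.2 - m) ^ 2) ℬ.joint := by
    intro f c hf m
    have := hf.sub (ℬ.bdd_const m)
    simp only [sq]
    exact (this.mul this).integrable
  set q : Ω → ℝ := fun ω => (1 / n) * ∑ i, ℬ.post (ℬ.data ω) (fun p => a p i)
        * ℬ.post (ℬ.data ω) (fun p => b p i) with hq
  have hqb : ℬ.Bdd (fun ω _ => q ω) (M * M) := by
    have hai : ∀ i, Measurable fun p => a p i := fun i => (measurable_pi_apply i).comp ha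
    have hbi : ∀ i, Measurable fun p => b p i := fun i => (measurable_pi_apply i).comp hb
    refine ℬ.bdd_fst (measurable_const.mul (Finset.measurable_sum _ fun i _ =>
      ((ℬ.measurable_post (hai i)).comp ℬ.measurable_data).mul
      ((ℬ.measurable_post (hbi i)).comp ℬ.measurable_data)))
      (Eventually.of_forall fun ω => abs_avg_le hn fun i => ?_)
    rw [abs_mul]
    exact mul_le_mul (ℬ.abs_post_le _ (haM.mono fun p h => h i))
      (ℬ.abs_post_le _ (hbM.mono fun p h => h i)) (abs_nonneg _) hM
  have h2' : ∫ z, (ℬ.ovl b a z.1 z.2 - q z.1) ^ 2 ∂ℬ.joint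
      ≤ 2 * M ^ 2 * (√(ℬ.covSq b) + √(ℬ.covSq a)) := by
    refine le_of_eq_of_le ?_ h2
    simp only [hq, mul_comm (ℬ.post _ fun p => a p _)]
  have iab : Integrable (fun z : Ω × P => (ℬ.ovl a b z.1 z.2 - q z.1) ^ 2) ℬ.joint := by
    have := Bab.sub hqb
    simp only [sq]; exact (this.mul this).integrable
  have iba : Integrable (fun z : Ω × P => (ℬ.ovl b a z.1 z.2 - q z.1) ^ 2) ℬ.joint := by
    have := Bba.sub hqb
    simp only [sq]; exact (this.mul this).integrable
  set ms := ∫ z, ℬ.ovl (a + b) (a + b) z.1 z.2 ∂ℬ.joint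
  set ma := ∫ z, ℬ.ovl a a z.1 z.2 ∂ℬ.joint
  set mb := ∫ z, ℬ.ovl b b z.1 z.2 ∂ℬ.joint
  have hvar := Bab.mean_sq_sub ((ms - ma - mb) / 2)
  have key : ∫ z, (ℬ.ovl a b z.1 z.2 - (ms - ma - mb) / 2) ^ 2 ∂ℬ.joint
      ≤ ∫ z, ((ℬ.ovl (a + b) (a + b) z.1 z.2 - ms) ^ 2 + ((ℬ.ovl a a z.1 z.2 - ma) ^ 2
        + ((ℬ.ovl b b z.1 z.2 - mb) ^ 2 + (2 * (ℬ.ovl a b z.1 z.2 - q z.1) ^ 2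
        + 2 * (ℬ.ovl b a z.1 z.2 - q z.1) ^ 2)))) ∂ℬ.joint := by
    refine integral_mono (iv Bab _) ((iv Bss _).add ((iv Baa _).add ((iv Bbb _).add
      ((iab.const_mul 2).add (iba.const_mul 2))))) fun z => ?_
    have e : ℬ.ovl (a + b) (a + b) z.1 z.2 = ℬ.ovl a a z.1 z.2 + ℬ.ovl a b z.1 z.2
        + ℬ.ovl b a z.1 z.2 + ℬ.ovl b b z.1 z.2 := by
      unfold ovl
      simp only [← mul_add, ← Finset.sum_add_distrib]
      congr 1
      refine Finset.sum_congr rfl fun i _ => ?_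
      simp only [Pi.add_apply]; ring
    have e' : ℬ.ovl b a z.1 z.2 = ℬ.ovl (a + b) (a + b) z.1 z.2 - ℬ.ovl a a z.1 z.2
        - ℬ.ovl b b z.1 z.2 - ℬ.ovl a b z.1 z.2 := by rw [e]; ring
    dsimp only
    rw [e']
    generalize ℬ.ovl (a + b) (a + b) z.1 z.2 = s
    generalize ℬ.ovl a a z.1 z.2 = x
    generalize ℬ.ovl b b z.1 z.2 = y
    generalize ℬ.ovl a b z.1 z.2 = u
    generalize q z.1 = w
    have e4 : u - (ms - ma - mb) / 2 = ((s - ms) + -(x - ma) + -(y - mb)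
      + ((u - w) - (s - x - y - u - w))) / 2 := by ring
    rw [e4]
    generalize s - ms = s'
    generalize x - ma = x'
    generalize y - mb = y'
    generalize s - x - y - u - w = v'
    generalize u - w = u'
    nlinarith [sq_nonneg (s' + x'), sq_nonneg (s' + y'), sq_nonneg (x' - y'),
      sq_nonneg (s' - (u' - v')), sq_nonneg (x' + (u' - v')), sq_nonneg (y' + (u' - v')),
      sq_nonneg (u' + v')]
  have i5 : Integrable (fun z : Ω × P => 2 * (ℬ.ovl a b z.1 z.2 - q z.1) ^ 2
        + 2 * (ℬ.ovl b a z.1 z.2 - q z.1) ^ 2) ℬ.joint := (iab.const_mul 2).add (iba.const_mul 2)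
  have i4 : Integrable (fun z : Ω × P => (ℬ.ovl b b z.1 z.2 - mb) ^ 2
      + (2 * (ℬ.ovl a b z.1 z.2 - q z.1) ^ 2
        + 2 * (ℬ.ovl b a z.1 z.2 - q z.1) ^ 2)) ℬ.joint := (iv Bbb mb).add i5
  have i3 : Integrable (fun z : Ω × P => (ℬ.ovl a a z.1 z.2 - ma) ^ 2 +
      ((ℬ.ovl b b z.1 z.2 - mb) ^ 2 + (2 * (ℬ.ovl a b z.1 z.2 - q z.1) ^ 2
        + 2 * (ℬ.ovl b a z.1 z.2 - q z.1) ^ 2))) ℬ.joint := (iv Baa ma).add i4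
  rw [integral_add (iv Bss ms) i3, integral_add (iv Baa ma) i4, integral_add (iv Bbb mb) i5,
    integral_add (iab.const_mul 2) (iba.const_mul 2), integral_const_mul, integral_const_mul,
    ← Bss.var_eq, ← Baa.var_eq, ← Bbb.var_eq] at key
  have hsq := sq_nonneg (∫ z, ℬ.ovl a b z.1 z.2 ∂ℬ.joint - (ms - ma - mb) / 2)
  have f1 : M ^ 2 * √(ℬ.covSq a) ≤ M ^ 2 * √(ℬ.var (ℬ.ovl a a)) :=
    mul_le_mul_of_nonneg_left sa hM2
  have f2 : M ^ 2 * √(ℬ.covSq b) ≤ M ^ 2 * √(ℬ.var (ℬ.ovl b b)) :=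
    mul_le_mul_of_nonneg_left sb hM2
  linarith

end Overlap

end BayesModel

end

noncomputable section

section Coupling

variable {Ω Ω' D P : Type*} [MeasurableSpace Ω] [MeasurableSpace Ω'] [MeasurableSpace D]
  [MeasurableSpace P] {n : ℕ}

/-- The side channel model `𝒮` at signal-to-noise ratio `l` is realized by the inference problem
`ℬ` through the map `T`. -/
structure Realizes (𝒮 : SideChannel Ω' P n) (l : ℝ) (ℬ : BayesModel Ω D P)
    (T : Ω' × (Fin n → ℝ) → Ω) : Prop where
  measurePreserving : MeasurePreserving T 𝒮.joint ℬ.law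
  energy_eq : ∀ ω p, 𝒮.energy l ω p = ℬ.H (T ω) p
  prior_eq : 𝒮.prior = ℬ.prior
  xs_eq : ∀ ω, 𝒮.xs ω.1 = 𝒮.x (ℬ.truth (T ω))

namespace Realizes

variable {𝒮 : SideChannel Ω' P n} {l : ℝ} {ℬ : BayesModel Ω D P} {T : Ω' × (Fin n → ℝ) → Ω}

include T in
lemma abs_x_le (h : Realizes 𝒮 l ℬ T) : ∀ᵐ p ∂ℬ.prior, ∀ i, |𝒮.x p i| ≤ 𝒮.M := by
  rw [← h.prior_eq]; exact 𝒮.abs_x_le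

lemma br_eq (h : Realizes 𝒮 l ℬ T) (ω : Ω' × (Fin n → ℝ)) (g : P → ℝ) :
    𝒮.br l ω g = ℬ.br (T ω) g := by
  have : 𝒮.energy l ω = ℬ.H (T ω) := funext fun p => h.energy_eq ω p
  unfold SideChannel.br BayesModel.br
  rw [this, h.prior_eq]

lemma free_eq (h : Realizes 𝒮 l ℬ T) (ω : Ω' × (Fin n → ℝ)) :
    𝒮.free l ω = logZ ℬ.prior (ℬ.H (T ω)) := by
  have : 𝒮.energy l ω = ℬ.H (T ω) := funext fun p => h.energy_eq ω p
  unfold SideChannel.free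
  rw [this, h.prior_eq]

lemma Q_eq (h : Realizes 𝒮 l ℬ T) (ω : Ω' × (Fin n → ℝ)) :
    𝒮.Q ω.1 = ℬ.ovl 𝒮.x 𝒮.x (T ω) := by
  funext p
  unfold SideChannel.Q BayesModel.ovl
  rw [h.xs_eq ω]

lemma integral_eq (h : Realizes 𝒮 l ℬ T) {f : Ω → ℝ} (hf : Measurable f) :
    ∫ ω, f (T ω) ∂𝒮.joint = ∫ ω, f ω ∂ℬ.law := by
  rw [← h.measurePreserving.map_eq, integral_map h.measurePreserving.measurable.aemeasurable
    hf.aestronglyMeasurable]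

include T in
lemma bdd_ovl (h : Realizes 𝒮 l ℬ T) (hn : 0 < n) :
    ℬ.Bdd (ℬ.ovl 𝒮.x 𝒮.x) (𝒮.M * 𝒮.M) :=
  ℬ.bdd_ovl 𝒮.measurable_x 𝒮.M_nonneg h.abs_x_le hn 𝒮.measurable_x h.abs_x_le

lemma fluct_eq (h : Realizes 𝒮 l ℬ T) (hn : 0 < n) :
    𝒮.fluct l = ℬ.var (ℬ.ovl 𝒮.x 𝒮.x) := by
  have hb := h.bdd_ovl hn
  have e : 𝒮.mean l = ℬ.mean (ℬ.ovl 𝒮.x 𝒮.x) := by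
    unfold SideChannel.mean BayesModel.mean
    simp only [h.br_eq, h.Q_eq]
    exact h.integral_eq hb.measurable_br
  have hs := hb.sub (ℬ.bdd_const (ℬ.mean (ℬ.ovl 𝒮.x 𝒮.x)))
  have hs2 := (hs.mul hs).measurable_br
  simp only [← sq] at hs2
  unfold SideChannel.fluct BayesModel.var BayesModel.mean
  rw [e]
  have e2 : ∀ ω : Ω' × (Fin n → ℝ), ∀ p, 𝒮.Q ω.1 p = ℬ.ovl 𝒮.x 𝒮.x (T ω) p :=
    fun ω p => by rw [h.Q_eq]
  simp only [h.br_eq, e2]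
  exact h.integral_eq hs2

lemma br_Q_mul (h : Realizes 𝒮 l ℬ T) (ω : Ω' × (Fin n → ℝ)) {g : P → ℝ} {c : ℝ}
    (hg : Measurable g) (hc : ∀ᵐ p ∂ℬ.prior, |g p| ≤ c) :
    𝒮.br l ω (fun p => 𝒮.Q ω.1 p * g p)
      = 1 / n * ∑ j, 𝒮.x (ℬ.truth (T ω)) j * ℬ.post (ℬ.data (T ω)) (fun p => 𝒮.x p j * g p) := by
  rw [h.br_eq, h.Q_eq]
  have := ℬ.isProbabilityMeasure_gibbs (T ω)
  have e : ∀ p, ℬ.ovl 𝒮.x 𝒮.x (T ω) p * g p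
      = 1 / n * ∑ j, 𝒮.x (ℬ.truth (T ω)) j * (𝒮.x p j * g p) := by
    intro p
    unfold BayesModel.ovl
    rw [mul_assoc, Finset.sum_mul]
    simp only [mul_assoc]
  have hi : ∀ j, Integrable (fun p => 𝒮.x p j * g p) (ℬ.prior.tilted (ℬ.H (T ω))) := fun j => by
    refine ℬ.integrable_gibbs (c := 𝒮.M * c) _ ((𝒮.measurable_x_apply j).mul hg) ?_
    filter_upwards [hc, h.abs_x_le] with p h1 h2
    rw [abs_mul]
    exact mul_le_mul (h2 j) h1 (abs_nonneg _) 𝒮.M_nonneg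
  simp only [e, BayesModel.br]
  rw [integral_const_mul, integral_finsetSum _ fun j _ => (hi j).const_mul _]
  simp only [integral_const_mul]
  rfl

lemma nishimori (h : Realizes 𝒮 l ℬ T) (hn : 0 < n) : 𝒮.Nishimori l := by
  have hn' : (0 : ℝ) < n := Nat.cast_pos.2 hn
  have hx := 𝒮.measurable_x_apply
  have hM := 𝒮.M_nonneg
  have hMM : 0 ≤ 𝒮.M * 𝒮.M := mul_nonneg hM hM
  have hxM := h.abs_x_le
  have hpm : ∀ i, Measurable fun d => ℬ.post d (fun p => 𝒮.x p i) :=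
    fun i => ℬ.measurable_post (hx i)
  have hp2m : ∀ i j, Measurable fun d => ℬ.post d (fun p => 𝒮.x p i * 𝒮.x p j) :=
    fun i j => ℬ.measurable_post ((hx i).mul (hx j))
  have hpb : ∀ d i, |ℬ.post d (fun p => 𝒮.x p i)| ≤ 𝒮.M :=
    fun d i => ℬ.abs_post_le d (hxM.mono fun p h => h i)
  have hp2b : ∀ d i j, |ℬ.post d (fun p => 𝒮.x p i * 𝒮.x p j)| ≤ 𝒮.M * 𝒮.M :=
    fun d i j => ℬ.abs_post_le d (ℬ.abs_mul_le hM hxM i j)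
  have htm := ℬ.measurePreserving_truth.measurable
  have hxi : ∀ d i, Integrable (fun p => 𝒮.x p i) (ℬ.prior.tilted (ℬ.W d)) := fun d i => by
    have := ℬ.isProbabilityMeasure_post d
    exact integrable_of_ae_abs_le (hx i) (ae_tilted (hxM.mono fun p h => h i))
  have hxxi : ∀ d i j, Integrable (fun p => 𝒮.x p i * 𝒮.x p j) (ℬ.prior.tilted (ℬ.W d)) :=
    fun d i j => by
      have := ℬ.isProbabilityMeasure_post d
      exact integrable_of_ae_abs_le ((hx i).mul (hx j)) (ae_tilted (ℬ.abs_mul_le hM hxM i j))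
  constructor
  · simp only [h.br_eq, h.xs_eq]
    have m1 : Measurable fun ω => ∑ i, 𝒮.x (ℬ.truth ω) i * ℬ.br ω (fun p => 𝒮.x p i) :=
      Finset.measurable_sum _ fun i _ => ((hx i).comp htm).mul ((hpm i).comp ℬ.measurable_data)
    have m2 : Measurable fun ω => ∑ i, ℬ.br ω (fun p => 𝒮.x p i) * ℬ.br ω (fun p => 𝒮.x p i) :=
      Finset.measurable_sum _ fun i _ =>
        ((hpm i).comp ℬ.measurable_data).mul ((hpm i).comp ℬ.measurable_data)
    rw [h.integral_eq m1, h.integral_eq m2]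
    have hfm : Measurable fun z : D × P => ∑ i, 𝒮.x z.2 i * ℬ.post z.1 (fun p => 𝒮.x p i) :=
      Finset.measurable_sum _ fun i _ => ((hx i).comp measurable_snd).mul
        ((hpm i).comp measurable_fst)
    have := ℬ.nishimori (fun d p => ∑ i, 𝒮.x p i * ℬ.post d (fun p => 𝒮.x p i))
      (∑ _i : Fin n, 𝒮.M * 𝒮.M) hfm (fun d => by
        filter_upwards [hxM] with p hp
        refine (Finset.abs_sum_le_sum_abs _ _).trans (Finset.sum_le_sum fun i _ => ?_)
        rw [abs_mul]
        exact mul_le_mul (hp i) (hpb d i) (abs_nonneg _) hM)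
    simp only [BayesModel.br_eq]
    rw [this]
    congr 1 with ω
    rw [integral_finsetSum _ fun i _ => (hxi _ i).mul_const _]
    simp only [integral_mul_const]
    rfl
  · have hL : ∀ ω : Ω' × (Fin n → ℝ),
        ∑ i, 𝒮.br l ω (fun p => 𝒮.Q ω.1 p * 𝒮.x p i) * 𝒮.br l ω (fun p => 𝒮.x p i)
        = 1 / n * ∑ i, ∑ j, 𝒮.x (ℬ.truth (T ω)) j *
          (ℬ.post (ℬ.data (T ω)) (fun p => 𝒮.x p j * 𝒮.x p i)
            * ℬ.post (ℬ.data (T ω)) (fun p => 𝒮.x p i)) := by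
      intro ω
      rw [Finset.mul_sum]
      refine Finset.sum_congr rfl fun i _ => ?_
      rw [h.br_Q_mul ω (hx i) (hxM.mono fun p h => h i), h.br_eq, BayesModel.br_eq, mul_assoc,
        Finset.sum_mul]
      simp only [mul_assoc]
    have hR : ∀ ω : Ω' × (Fin n → ℝ), 𝒮.br l ω (𝒮.Q ω.1) ^ 2
        = (1 / n) ^ 2 * ∑ i, ∑ j, 𝒮.x (ℬ.truth (T ω)) j * 𝒮.x (ℬ.truth (T ω)) i *
          (ℬ.post (ℬ.data (T ω)) (fun p => 𝒮.x p j)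
            * ℬ.post (ℬ.data (T ω)) (fun p => 𝒮.x p i)) := by
      intro ω
      have := h.br_Q_mul ω (g := fun _ => 1) (c := 1) measurable_const (by simp)
      simp only [mul_one] at this
      have e : 𝒮.br l ω (𝒮.Q ω.1) = 𝒮.br l ω (fun p => 𝒮.Q ω.1 p) := rfl
      rw [e, this, mul_pow, sq (∑ j, _), Finset.sum_mul_sum, Finset.sum_comm]
      congr 1
      refine Finset.sum_congr rfl fun i _ => Finset.sum_congr rfl fun j _ => ?_
      ring
    simp only [hL, hR]
    have f1m : Measurable fun z : D × P => 1 / (n : ℝ) * ∑ i, ∑ j, 𝒮.x z.2 j *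
        (ℬ.post z.1 (fun p => 𝒮.x p j * 𝒮.x p i) * ℬ.post z.1 (fun p => 𝒮.x p i)) :=
      measurable_const.mul (Finset.measurable_sum _ fun i _ => Finset.measurable_sum _ fun j _ =>
        ((hx j).comp measurable_snd).mul (((hp2m j i).comp measurable_fst).mul
          ((hpm i).comp measurable_fst)))
    have f2m : Measurable fun z : D × P => (1 / (n : ℝ)) ^ 2 * ∑ i, ∑ j, 𝒮.x z.2 j * 𝒮.x z.2 i *
        (ℬ.post z.1 (fun p => 𝒮.x p j) * ℬ.post z.1 (fun p => 𝒮.x p i)) :=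
      measurable_const.mul (Finset.measurable_sum _ fun i _ => Finset.measurable_sum _ fun j _ =>
        (((hx j).comp measurable_snd).mul ((hx i).comp measurable_snd)).mul
          (((hpm j).comp measurable_fst).mul ((hpm i).comp measurable_fst)))
    have hdt := ℬ.measurable_data.prodMk htm
    have m1 := f1m.comp hdt
    have m2 := f2m.comp hdt
    simp only [Function.comp_def] at m1 m2
    have n1 := ℬ.nishimori (fun d p => 1 / (n : ℝ) * ∑ i, ∑ j, 𝒮.x p j *
        (ℬ.post d (fun p => 𝒮.x p j * 𝒮.x p i) * ℬ.post d (fun p => 𝒮.x p i)))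
      (1 / (n : ℝ) * ∑ _i : Fin n, ∑ _j : Fin n, 𝒮.M * (𝒮.M * 𝒮.M * 𝒮.M)) f1m (fun d => by
        filter_upwards [hxM] with p hp
        rw [abs_mul, abs_of_pos (by positivity : (0 : ℝ) < 1 / n)]
        refine mul_le_mul_of_nonneg_left ?_ (by positivity)
        refine (Finset.abs_sum_le_sum_abs _ _).trans (Finset.sum_le_sum fun i _ =>
          (Finset.abs_sum_le_sum_abs _ _).trans (Finset.sum_le_sum fun j _ => ?_))
        rw [abs_mul, abs_mul]
        exact mul_le_mul (hp j) (mul_le_mul (hp2b d j i) (hpb d i) (abs_nonneg _) hMM)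
          (by positivity) hM)
    have n2 := ℬ.nishimori (fun d p => (1 / (n : ℝ)) ^ 2 * ∑ i, ∑ j, 𝒮.x p j * 𝒮.x p i *
        (ℬ.post d (fun p => 𝒮.x p j) * ℬ.post d (fun p => 𝒮.x p i)))
      (𝒮.M * 𝒮.M * (𝒮.M * 𝒮.M)) f2m (fun d => by
        filter_upwards [hxM] with p hp
        refine BayesModel.abs_avg_sq_le hn fun i j => ?_
        rw [abs_mul, abs_mul, abs_mul]
        exact mul_le_mul (mul_le_mul (hp j) (hp i) (abs_nonneg _) hM)
          (mul_le_mul (hpb d j) (hpb d i) (abs_nonneg _) hM) (by positivity) hMM)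
    have I1 := h.integral_eq m1
    have I2 := h.integral_eq m2
    rw [I1, I2, n1, n2, ← integral_const_mul]
    congr 1 with ω
    rw [integral_const_mul, integral_const_mul,
      integral_finsetSum _ fun i _ => integrable_finsetSum _ fun j _ => (hxi _ j).mul_const _,
      integral_finsetSum _ fun i _ => integrable_finsetSum _ fun j _ => (hxxi _ j i).mul_const _]
    have : ∀ x y : ℝ, x = y → 1 / (n : ℝ) * x = n * ((1 / (n : ℝ)) ^ 2 * y) := by
      rintro x y rfl; field_simp
    refine this _ _ (Finset.sum_congr rfl fun i _ => ?_)
    rw [integral_finsetSum _ fun j _ => (hxi _ j).mul_const _,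
      integral_finsetSum _ fun j _ => (hxxi _ j i).mul_const _]
    refine Finset.sum_congr rfl fun j _ => ?_
    rw [integral_mul_const, integral_mul_const]
    unfold BayesModel.post
    ring

end Realizes

end Coupling

section Density

variable {Ω D P : Type*} [MeasurableSpace Ω] [MeasurableSpace D] [MeasurableSpace P]

/-- If the law of `(data, truth)` has density `exp W` with respect to a product `ν ⊗ prior`, then
the Gibbs measure of energy `W` is the posterior of the truth given the data. -/
lemma nishimori_of_map_eq {law : Measure Ω} [IsProbabilityMeasure law] {prior : Measure P}
    [IsProbabilityMeasure prior] {W : D → P → ℝ} (hW : Measurable (Function.uncurry W))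
    (hWb : ∀ d, ∃ c, ∀ᵐ p ∂prior, |W d p| ≤ c) {data : Ω → D} (hd : Measurable data)
    {truth : Ω → P} (ht : Measurable truth) {ν : Measure D} [SFinite ν]
    (hmap : law.map (fun ω => (data ω, truth ω))
      = (ν.prod prior).withDensity fun z => ENNReal.ofReal (Real.exp (W z.1 z.2)))
    (f : D → P → ℝ) (c : ℝ) (hf : Measurable (Function.uncurry f))
    (hfc : ∀ d, ∀ᵐ p ∂prior, |f d p| ≤ c) :
    ∫ ω, f (data ω) (truth ω) ∂law
      = ∫ ω, (∫ p, f (data ω) p ∂(prior.tilted (W (data ω)))) ∂law := by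
  set ρ₁ := (ν.prod prior).withDensity fun z => ENNReal.ofReal (Real.exp (W z.1 z.2)) with hρ₁
  have hE : Measurable fun z : D × P => Real.exp (W z.1 z.2) := hW.exp
  have hfE : Measurable fun z : D × P => f z.1 z.2 * Real.exp (W z.1 z.2) := Measurable.mul hf hE
  set F : D → ℝ := fun d => ∫ p, f d p ∂(prior.tilted (W d)) with hF
  have hprob : ∀ d, IsProbabilityMeasure (prior.tilted (W d)) := fun d => by
    obtain ⟨c, hc⟩ := hWb d
    exact isProbabilityMeasure_tilted_of_bdd (hW.comp (measurable_prodMk_left (x := d))) hc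
  have hFm : Measurable F := by
    have h2 : Measurable fun d => ∫ p, Real.exp (W d p) ∂prior :=
      (hE.stronglyMeasurable.integral_prod_right' (ν := prior)).measurable
    have h4 : Measurable fun d => ∫ p, f d p * Real.exp (W d p) ∂prior :=
      (hfE.stronglyMeasurable.integral_prod_right' (ν := prior)).measurable
    simp only [hF, integral_tilted_eq_div]
    exact h4.div h2
  have hFc : ∀ d, |F d| ≤ c := fun d => by
    have := hprob d
    exact abs_integral_le_of_ae_abs_le (ae_tilted (hfc d))
  have hp : IsProbabilityMeasure ρ₁ := by
    rw [← hmap]; exact Measure.isProbabilityMeasure_map (hd.prodMk ht).aemeasurable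
  have key : ∀ g : D × P → ℝ, Measurable g → ∫ ω, g (data ω, truth ω) ∂law = ∫ z, g z ∂ρ₁ := by
    intro g hg
    rw [← hmap, integral_map (hd.prodMk ht).aemeasurable hg.aestronglyMeasurable]
  have k1 := key (fun z => f z.1 z.2) hf
  have k2 := key (fun z => F z.1) (hFm.comp measurable_fst)
  dsimp only at k1 k2
  rw [k1, k2]
  have conv : ∀ g : D × P → ℝ, Measurable g → (∀ᵐ z ∂(ν.prod prior), |g z| ≤ c) →
      ∫ z, g z ∂ρ₁ = ∫ d, ∫ p, g (d, p) * Real.exp (W d p) ∂prior ∂ν := by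
    intro g hg hgc
    have hi : Integrable g ρ₁ :=
      integrable_of_ae_abs_le hg ((withDensity_absolutelyContinuous _ _).ae_le hgc)
    rw [hρ₁, integrable_withDensity_iff_integrable_smul₀' hE.ennreal_ofReal.aemeasurable
      (by simp)] at hi
    rw [hρ₁, integral_withDensity_eq_integral_toReal_smul hE.ennreal_ofReal (by simp)]
    simp only [ENNReal.toReal_ofReal (Real.exp_pos _).le, smul_eq_mul] at hi ⊢
    have hi' : Integrable (fun z : D × P => Real.exp (W z.1 z.2) * g z) (ν.prod prior) := hi
    rw [integral_prod _ hi']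
    simp only [mul_comm]
  have hae : ∀ᵐ z ∂(ν.prod prior), |f z.1 z.2| ≤ c := by
    have hms : MeasurableSet {z : D × P | |f z.1 z.2| ≤ c} :=
      measurableSet_le (Measurable.abs hf) measurable_const
    exact (Measure.ae_prod_iff_ae_ae hms).2 (Eventually.of_forall hfc)
  rw [conv (fun z => f z.1 z.2) hf hae, conv (fun z => F z.1) (hFm.comp measurable_fst) (Eventually.of_forall fun z => hFc z.1)]
  congr 1 with d
  dsimp only
  rw [integral_const_mul]
  simp only [hF, integral_tilted_eq_div]
  have hne : ∫ p, Real.exp (W d p) ∂prior ≠ 0 := by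
    obtain ⟨c, hc⟩ := hWb d
    exact (integral_exp_pos (integrable_exp_of_ae_abs_le
      (hW.comp (measurable_prodMk_left (x := d))) hc)).ne'
  field_simp

end Density

end

noncomputable section

section Pi

variable {α β : Type*} [MeasurableSpace α] [MeasurableSpace β]

lemma lintegral_pi_prod (μ : Measure α) [SigmaFinite μ] : ∀ {N : ℕ} {f : Fin N → α → ENNReal},
    (∀ i, Measurable (f i)) →
    ∫⁻ x, ∏ i, f i (x i) ∂(Measure.pi fun _ => μ) = ∏ i, ∫⁻ a, f i a ∂μ
  | 0, f, _ => by simp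
  | N + 1, f, hf => by
    have hmp := (measurePreserving_piFinSuccAbove (fun _ : Fin (N + 1) => μ) 0).symm
    rw [← hmp.lintegral_comp_emb (MeasurableEquiv.measurableEmbedding _)]
    have e : ∀ z : α × (Fin N → α),
        ∏ i, f i ((MeasurableEquiv.piFinSuccAbove (fun _ : Fin (N + 1) => α) 0).symm z i)
          = f 0 z.1 * ∏ i : Fin N, f i.succ (z.2 i) := by
      intro z
      rw [Fin.prod_univ_succ]
      simp [MeasurableEquiv.piFinSuccAbove, Fin.insertNthEquiv]
    simp only [e]
    rw [lintegral_prod_mul (f := f 0) (g := fun y : Fin N → α => ∏ i : Fin N, f i.succ (y i))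
      (hf 0).aemeasurable
      (Finset.measurable_prod _ fun i _ => (hf _).comp (measurable_pi_apply i)).aemeasurable,
      lintegral_pi_prod μ fun i => hf i.succ, Fin.prod_univ_succ]

lemma pi_withDensity (μ : Measure α) [SigmaFinite μ] {N : ℕ} {f : Fin N → α → ENNReal}
    (hf : ∀ i, Measurable (f i)) [∀ i, SigmaFinite (μ.withDensity (f i))] :
    Measure.pi (fun i => μ.withDensity (f i))
      = (Measure.pi fun _ : Fin N => μ).withDensity fun x => ∏ i, f i (x i) := by
  refine Measure.pi_eq fun s hs => ?_
  have hsm := MeasurableSet.univ_pi hs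
  rw [withDensity_apply _ hsm, ← lintegral_indicator hsm]
  have e : ∀ i, μ.withDensity (f i) (s i) = ∫⁻ a, (s i).indicator (f i) a ∂μ := fun i => by
    rw [withDensity_apply _ (hs i), lintegral_indicator (hs i)]
  simp only [e]
  rw [← lintegral_pi_prod μ fun i => (hf i).indicator (hs i)]
  congr 1 with x
  by_cases hx : x ∈ univ.pi s
  · rw [indicator_of_mem hx]
    exact Finset.prod_congr rfl fun i _ => (indicator_of_mem (hx i (mem_univ i)) _).symm
  · rw [indicator_of_notMem hx]
    simp only [mem_univ_pi, not_forall] at hx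
    obtain ⟨i, hi⟩ := hx
    exact (Finset.prod_eq_zero (Finset.mem_univ i) (indicator_of_notMem hi _)).symm

/-- Independent changes of variables with densities. -/
lemma map_pi_eq_withDensity (ν : Measure β) [IsProbabilityMeasure ν] (μ : Measure α)
    [SigmaFinite μ] {N : ℕ} {f : Fin N → α → ENNReal} (hf : ∀ i, Measurable (f i))
    {T : Fin N → β → α} (hT : ∀ i, Measurable (T i))
    (h : ∀ i, ν.map (T i) = μ.withDensity (f i)) :
    (Measure.pi fun _ => ν).map (fun x i => T i (x i))
      = (Measure.pi fun _ : Fin N => μ).withDensity fun x => ∏ i, f i (x i) := by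
  have hp : ∀ i, IsProbabilityMeasure (ν.map (T i)) :=
    fun i => Measure.isProbabilityMeasure_map (hT i).aemeasurable
  rw [Measure.pi_map_pi fun i => (hT i).aemeasurable]
  have : ∀ i, SigmaFinite (μ.withDensity (f i)) := fun i => by rw [← h i]; infer_instance
  simp only [h]
  exact pi_withDensity μ hf

end Pi

section Gauss

/-- The standard Gaussian measure on `Fin k → ℝ`. -/
abbrev gauss (k : ℕ) : Measure (Fin k → ℝ) := Measure.pi fun _ => gaussianReal 0 1

lemma gaussianReal_map_add_eq_withDensity (h : ℝ) :
    (gaussianReal 0 1).map (fun x => h + x)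
      = (gaussianReal 0 1).withDensity fun x => ENNReal.ofReal (Real.exp (h * x - h ^ 2 / 2)) := by
  have e := gaussianReal_map_const_add (μ := 0) (v := 1) h
  rw [show (fun x => h + x) = (h + ·) from rfl, e, gaussianReal_of_var_ne_zero _ one_ne_zero,
    gaussianReal_of_var_ne_zero _ one_ne_zero, ← withDensity_mul _ (measurable_gaussianPDF _ _)
    (by fun_prop)]
  congr 1 with x
  simp only [Pi.mul_apply, gaussianPDF]
  rw [← ENNReal.ofReal_mul (gaussianPDFReal_nonneg _ _ _)]
  congr 1
  simp only [gaussianPDFReal]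
  rw [mul_assoc _ (Real.exp _) (Real.exp _), ← Real.exp_add]
  congr 2
  simp
  ring

/-- The Cameron-Martin formula in finite dimension. -/
lemma gauss_map_add_eq_withDensity {k : ℕ} (h : Fin k → ℝ) :
    (gauss k).map (fun x => h + x)
      = (gauss k).withDensity fun x =>
        ENNReal.ofReal (Real.exp (∑ i, (h i * x i - h i ^ 2 / 2))) := by
  have := map_pi_eq_withDensity (gaussianReal 0 1) (gaussianReal 0 1) (N := k)
    (f := fun i x => ENNReal.ofReal (Real.exp (h i * x - h i ^ 2 / 2))) (fun i => by fun_prop)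
    (T := fun i x => h i + x) (fun i => by fun_prop)
    (fun i => gaussianReal_map_add_eq_withDensity (h i))
  refine this.trans ?_
  congr 1 with x
  rw [Real.exp_sum, ENNReal.ofReal_prod_of_nonneg fun i _ => (Real.exp_pos _).le]

/-- The law of `A g` for a standard Gaussian vector `g`. -/
def colored {k : ℕ} (A : Matrix (Fin k) (Fin k) ℝ) : Measure (Fin k → ℝ) :=
  (gauss k).map fun g => A *ᵥ g

lemma measurable_mulVec {k : ℕ} (A : Matrix (Fin k) (Fin k) ℝ) :
    Measurable fun g : Fin k → ℝ => A *ᵥ g := by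
  unfold Matrix.mulVec dotProduct
  exact measurable_pi_lambda _ fun i => Finset.measurable_sum _ fun j _ =>
    measurable_const.mul (measurable_pi_apply j)

instance {k : ℕ} (A : Matrix (Fin k) (Fin k) ℝ) : IsProbabilityMeasure (colored A) :=
  Measure.isProbabilityMeasure_map (measurable_mulVec A).aemeasurable

lemma colored_map_add_eq_withDensity {k : ℕ} (A : Matrix (Fin k) (Fin k) ℝ) (w : Fin k → ℝ) :
    (colored A).map (fun g => (A * Aᵀ) *ᵥ w + g)
      = (colored A).withDensity fun y =>
        ENNReal.ofReal (Real.exp (w ⬝ᵥ y - w ⬝ᵥ ((A * Aᵀ) *ᵥ w) / 2)) := by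
  have hA := measurable_mulVec A
  have hdot : Measurable fun y : Fin k → ℝ => w ⬝ᵥ y := by
    unfold dotProduct
    exact Finset.measurable_sum _ fun j _ => measurable_const.mul (measurable_pi_apply j)
  have hadd : Measurable fun g : Fin k → ℝ => (A * Aᵀ) *ᵥ w + g := measurable_const.add measurable_id
  have hadd' : Measurable fun g : Fin k → ℝ => Aᵀ *ᵥ w + g := measurable_const.add measurable_id
  ext s hs
  have h1 := gauss_map_add_eq_withDensity (Aᵀ *ᵥ w)
  have e1 : (colored A).map (fun g => (A * Aᵀ) *ᵥ w + g)
      = ((gauss k).map (fun x => Aᵀ *ᵥ w + x)).map (fun g => A *ᵥ g) := by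
    unfold colored
    rw [Measure.map_map hadd hA, Measure.map_map hA hadd']
    congr 1 with g : 1
    simp [Matrix.mulVec_add, Matrix.mulVec_mulVec]
  have hd : Measurable fun y : Fin k → ℝ =>
      ENNReal.ofReal (Real.exp (w ⬝ᵥ y - w ⬝ᵥ ((A * Aᵀ) *ᵥ w) / 2)) := by fun_prop
  rw [e1, h1, Measure.map_apply hA hs, withDensity_apply _ (hA hs), withDensity_apply _ hs]
  unfold colored
  rw [setLIntegral_map hs hd hA]
  refine lintegral_congr fun x => ?_
  congr 2
  have e2 : w ⬝ᵥ (A *ᵥ x) = ∑ i, (Aᵀ *ᵥ w) i * x i := by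
    rw [Matrix.dotProduct_mulVec, ← Matrix.mulVec_transpose]; rfl
  have e3 : w ⬝ᵥ ((A * Aᵀ) *ᵥ w) = ∑ i, (Aᵀ *ᵥ w) i ^ 2 := by
    rw [← Matrix.mulVec_mulVec, Matrix.dotProduct_mulVec, ← Matrix.mulVec_transpose]
    simp [dotProduct, sq]
  rw [e2, e3, Finset.sum_sub_distrib, Finset.sum_div]

lemma integral_cexp_gauss {k : ℕ} (d : Fin k → ℝ) :
    ∫ g, Complex.exp (((∑ j, d j * g j : ℝ) : ℂ) * Complex.I) ∂(gauss k)
      = Complex.exp (-((∑ j, d j ^ 2 : ℝ) : ℂ) / 2) := by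
  have e : ∀ g : Fin k → ℝ, Complex.exp (((∑ j, d j * g j : ℝ) : ℂ) * Complex.I)
      = ∏ j, Complex.exp ((d j : ℂ) * (g j : ℂ) * Complex.I) := by
    intro g
    rw [← Complex.exp_sum]
    push_cast
    rw [Finset.sum_mul]
  simp only [e]
  rw [integral_fintype_prod_eq_prod (f := fun j (x : ℝ) => Complex.exp ((d j : ℂ) * x * Complex.I))]
  simp only [← charFun_apply_real, charFun_gaussianReal]
  rw [← Complex.exp_sum]
  congr 1
  push_cast
  simp [neg_div, Finset.sum_div]

lemma integral_cexp_colored {k : ℕ} (A : Matrix (Fin k) (Fin k) ℝ) (c : Fin k → ℝ) :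
    ∫ x, Complex.exp (((c ⬝ᵥ x : ℝ) : ℂ) * Complex.I) ∂(colored A)
      = Complex.exp (-((c ⬝ᵥ ((A * Aᵀ) *ᵥ c) : ℝ) : ℂ) / 2) := by
  have hdot : Measurable fun y : Fin k → ℝ => c ⬝ᵥ y := by
    unfold dotProduct
    exact Finset.measurable_sum _ fun j _ => measurable_const.mul (measurable_pi_apply j)
  unfold colored
  rw [integral_map (measurable_mulVec A).aemeasurable
    (by fun_prop : Measurable fun x => Complex.exp (((c ⬝ᵥ x : ℝ) : ℂ) * Complex.I)).aestronglyMeasurable]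
  have e2 : ∀ x, c ⬝ᵥ (A *ᵥ x) = ∑ i, (Aᵀ *ᵥ c) i * x i := fun x => by
    rw [Matrix.dotProduct_mulVec, ← Matrix.mulVec_transpose]; rfl
  have e3 : c ⬝ᵥ ((A * Aᵀ) *ᵥ c) = ∑ i, (Aᵀ *ᵥ c) i ^ 2 := by
    rw [← Matrix.mulVec_mulVec, Matrix.dotProduct_mulVec, ← Matrix.mulVec_transpose]
    simp [dotProduct, sq]
  simp only [e2, e3]
  exact integral_cexp_gauss _

/-- The sum of independent Gaussian vectors of covariances `A Aᵀ` and `l v vᵀ`. -/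
lemma measurePreserving_colored_add {k : ℕ} {A A' : Matrix (Fin k) (Fin k) ℝ} {v : Fin k → ℝ}
    {l : ℝ} (hl : 0 ≤ l) (h : A' * A'ᵀ = A * Aᵀ + l • Matrix.vecMulVec v v) :
    MeasurePreserving (fun x : (Fin k → ℝ) × ℝ => x.1 + (√l * x.2) • v)
      ((colored A).prod (gaussianReal 0 1)) (colored A') := by
  have hm : Measurable (fun x : (Fin k → ℝ) × ℝ => x.1 + (√l * x.2) • v) :=
    measurable_fst.add ((measurable_snd.const_mul _).smul_const v)
  have := Measure.isProbabilityMeasure_map (μ := (colored A).prod (gaussianReal 0 1)) hm.aemeasurable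
  refine ⟨hm, Measure.ext_of_charFunDual ?_⟩
  ext Λ
  set c : Fin k → ℝ := fun i => Λ (Pi.single i 1) with hc
  have hΛ : ∀ x, Λ x = c ⬝ᵥ x := by
    intro x
    conv_lhs => rw [← Finset.univ_sum_single x]
    rw [map_sum]
    unfold dotProduct
    refine Finset.sum_congr rfl fun i _ => ?_
    have : Pi.single i (x i) = x i • (Pi.single i 1 : Fin k → ℝ) := by
      rw [← Pi.single_smul']; simp
    rw [this, map_smul, smul_eq_mul, mul_comm]
  have hdot : Measurable fun y : Fin k → ℝ => c ⬝ᵥ y := by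
    unfold dotProduct
    exact Finset.measurable_sum _ fun j _ => measurable_const.mul (measurable_pi_apply j)
  rw [charFunDual_apply, charFunDual_apply]
  simp only [hΛ]
  rw [integral_cexp_colored, integral_map hm.aemeasurable
    (by fun_prop : Measurable fun x => Complex.exp (((c ⬝ᵥ x : ℝ) : ℂ) * Complex.I)).aestronglyMeasurable]
  have e1 : ∀ x : (Fin k → ℝ) × ℝ, Complex.exp (((c ⬝ᵥ (x.1 + (√l * x.2) • v) : ℝ) : ℂ) * Complex.I)
      = Complex.exp (((c ⬝ᵥ x.1 : ℝ) : ℂ) * Complex.I)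
        * Complex.exp (((√l * (c ⬝ᵥ v) : ℝ) : ℂ) * x.2 * Complex.I) := by
    intro x
    rw [← Complex.exp_add]
    congr 1
    rw [dotProduct_add, dotProduct_smul, smul_eq_mul]
    push_cast
    ring
  simp only [e1]
  rw [integral_prod_mul (f := fun x : Fin k → ℝ => Complex.exp (((c ⬝ᵥ x : ℝ) : ℂ) * Complex.I))
    (g := fun z : ℝ => Complex.exp (((√l * (c ⬝ᵥ v) : ℝ) : ℂ) * z * Complex.I)),
    integral_cexp_colored, ← charFun_apply_real, charFun_gaussianReal, ← Complex.exp_add]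
  congr 1
  have e3 : c ⬝ᵥ ((A' * A'ᵀ) *ᵥ c) = c ⬝ᵥ ((A * Aᵀ) *ᵥ c) + l * (c ⬝ᵥ v) ^ 2 := by
    rw [h, Matrix.add_mulVec, dotProduct_add, Matrix.smul_mulVec, dotProduct_smul,
      Matrix.vecMulVec_mulVec]
    simp [dotProduct_comm v c, sq]
  rw [e3]
  have e4 : (((√l * (c ⬝ᵥ v) : ℝ) : ℂ)) ^ 2 = ((l * (c ⬝ᵥ v) ^ 2 : ℝ) : ℂ) := by
    rw [← Complex.ofReal_pow, mul_pow, Real.sq_sqrt hl]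
  rw [e4]
  push_cast
  simp
  ring

end Gauss

end

noncomputable section

/-- The hidden vector and the disorder `(u, x, v, a, z)` of one observation. -/
abbrev RowNoise (n K : ℕ) : Type := (Fin K → ℝ) × (Fin n → ℝ) × (Fin K → ℝ) × ℝ × ℝ

/-- What is observed, `(x, v, y)`, in one observation. -/
abbrev RowObs (n K : ℕ) : Type := (Fin n → ℝ) × (Fin K → ℝ) × ℝ

/-- A generalized linear model with `K` hidden units, with arbitrary mixing matrices. -/
structure GLM (n K : ℕ) where
  φ : (Fin K → ℝ) → ℝ → ℝ
  Δ : ℝ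
  PA : Measure ℝ
  P0 : Measure (Fin K → ℝ)
  κ : ℝ
  M₂ : Matrix (Fin K) (Fin K) ℝ
  M₃ : Matrix (Fin K) (Fin K) ℝ
  L : ℝ
  M : ℝ
  prob_PA : IsProbabilityMeasure PA
  prob_P0 : IsProbabilityMeasure P0
  measurable_φ : Measurable (Function.uncurry φ)
  abs_φ_le : ∀ x a, |φ x a| ≤ L
  lipschitz_φ : ∀ x h a, |φ (x + h) a - φ x a| ≤ L * ‖h‖
  second_φ : ∀ x h a, |φ (x + h) a + φ (x - h) a - 2 * φ x a| ≤ L * ‖h‖ ^ 2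
  Δ_pos : 0 < Δ
  M_nonneg : 0 ≤ M
  ae_abs_le : ∀ᵐ w ∂P0, ∀ l, |w l| ≤ M
  κ_sq : κ ^ 2 * n ≤ 1

namespace GLM

variable {n K : ℕ} (𝒢 : GLM n K)

instance : IsProbabilityMeasure 𝒢.PA := 𝒢.prob_PA
instance : IsProbabilityMeasure 𝒢.P0 := 𝒢.prob_P0

lemma L_nonneg : 0 ≤ 𝒢.L := (abs_nonneg _).trans (𝒢.abs_φ_le 0 0)

/-- The argument of the activation function. -/
def pre (w : Rows n K) (u : Fin K → ℝ) (x : Fin n → ℝ) (v : Fin K → ℝ) : Fin K → ℝ :=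
  𝒢.κ • (∑ i, x i • w i) + 𝒢.M₂ *ᵥ v + 𝒢.M₃ *ᵥ u

/-- The law of the disorder of one observation. -/
abbrev rowLaw : Measure (RowNoise n K) :=
  (gauss K).prod ((gauss n).prod ((gauss K).prod (𝒢.PA.prod (gaussianReal 0 1))))

/-- A reference measure for one observation. -/
abbrev rowRef (n K : ℕ) : Measure (RowObs n K) := (gauss n).prod ((gauss K).prod volume)

/-- The observed output. -/
def out (w : Rows n K) (ξ : RowNoise n K) : ℝ :=
  𝒢.φ (𝒢.pre w ξ.1 ξ.2.1 ξ.2.2.1) ξ.2.2.2.1 + √𝒢.Δ * ξ.2.2.2.2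

def rowObs (w : Rows n K) (ξ : RowNoise n K) : RowObs n K := (ξ.2.1, ξ.2.2.1, 𝒢.out w ξ)

/-- The likelihood of one observation. -/
def like (w : Rows n K) (u : Fin K → ℝ) (o : RowObs n K) : ℝ :=
  outputKernel 𝒢.φ 𝒢.Δ 𝒢.PA o.2.2 (𝒢.pre w u o.1 o.2.1)

/-- The log-likelihood, up to a function of the data, of the Gaussian observation `y = R w + g`. -/
def side (R : Matrix (Fin K) (Fin K) ℝ) (w y : Fin K → ℝ) : ℝ := w ⬝ᵥ y - w ⬝ᵥ (R *ᵥ w) / 2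

section Measurability

lemma measurable_pre : Measurable fun q : Rows n K × (Fin K → ℝ) × (Fin n → ℝ) × (Fin K → ℝ) =>
    𝒢.pre q.1 q.2.1 q.2.2.1 q.2.2.2 := by
  have h1 : Measurable fun q : Rows n K × (Fin K → ℝ) × (Fin n → ℝ) × (Fin K → ℝ) =>
      𝒢.κ • ∑ i, q.2.2.1 i • q.1 i := by fun_prop
  have h2 : Measurable fun q : Rows n K × (Fin K → ℝ) × (Fin n → ℝ) × (Fin K → ℝ) =>
      𝒢.M₂ *ᵥ q.2.2.2 := (measurable_mulVec _).comp (by fun_prop)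
  have h3 : Measurable fun q : Rows n K × (Fin K → ℝ) × (Fin n → ℝ) × (Fin K → ℝ) =>
      𝒢.M₃ *ᵥ q.2.1 := (measurable_mulVec _).comp (by fun_prop)
  exact (h1.add h2).add h3

lemma measurable_out : Measurable fun q : Rows n K × RowNoise n K => 𝒢.out q.1 q.2 := by
  unfold out
  have h := 𝒢.measurable_pre.comp (f := fun q : Rows n K × RowNoise n K =>
    (q.1, q.2.1, q.2.2.1, q.2.2.2.1)) (by fun_prop)
  simp only [Function.comp_def] at h
  exact (𝒢.measurable_φ.comp (h.prodMk (by fun_prop : Measurable fun q : Rows n K × RowNoise n K =>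
    q.2.2.2.2.1))).add (measurable_const.mul (by fun_prop))

lemma measurable_outputKernel :
    Measurable fun q : ℝ × (Fin K → ℝ) => outputKernel 𝒢.φ 𝒢.Δ 𝒢.PA q.1 q.2 := by
  unfold outputKernel
  have h1 : Measurable fun q : (ℝ × (Fin K → ℝ)) × ℝ =>
      Real.exp (-(q.1.1 - 𝒢.φ q.1.2 q.2) ^ 2 / (2 * 𝒢.Δ)) := by
    have h2 : Measurable fun q : (ℝ × (Fin K → ℝ)) × ℝ => 𝒢.φ q.1.2 q.2 :=
      𝒢.measurable_φ.comp (f := fun q : (ℝ × (Fin K → ℝ)) × ℝ => (q.1.2, q.2)) (by fun_prop)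
    fun_prop
  exact measurable_const.mul (h1.stronglyMeasurable.integral_prod_right' (ν := 𝒢.PA)).measurable

lemma measurable_like : Measurable fun q : Rows n K × (Fin K → ℝ) × RowObs n K =>
    𝒢.like q.1 q.2.1 q.2.2 := by
  unfold like
  have h := 𝒢.measurable_pre.comp (f := fun q : Rows n K × (Fin K → ℝ) × RowObs n K =>
    (q.1, q.2.1, q.2.2.1, q.2.2.2.1)) (by fun_prop)
  simp only [Function.comp_def] at h
  have h2 := 𝒢.measurable_outputKernel.comp ((by fun_prop : Measurable
    fun q : Rows n K × (Fin K → ℝ) × RowObs n K => q.2.2.2.2).prodMk h)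
  simpa only [Function.comp_def] using h2

lemma measurable_side (R : Matrix (Fin K) (Fin K) ℝ) :
    Measurable fun q : (Fin K → ℝ) × (Fin K → ℝ) => side R q.1 q.2 := by
  unfold side dotProduct
  refine (Finset.measurable_sum _ fun j _ => by fun_prop).sub
    ((Finset.measurable_sum _ fun j _ => ?_).div_const _)
  exact ((measurable_pi_apply j).comp measurable_fst).mul
    ((measurable_pi_apply j).comp ((measurable_mulVec R).comp measurable_fst))

end Measurability

section OutputKernel

lemma exp_integrable (y : ℝ) (x : Fin K → ℝ) :
    Integrable (fun a => Real.exp (-(y - 𝒢.φ x a) ^ 2 / (2 * 𝒢.Δ))) 𝒢.PA := by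
  have := 𝒢.Δ_pos
  have h2 : Measurable fun a => 𝒢.φ x a := 𝒢.measurable_φ.comp measurable_prodMk_left
  refine integrable_of_ae_abs_le (c := 1) (by fun_prop) (Eventually.of_forall fun a => ?_)
  rw [abs_of_pos (Real.exp_pos _), Real.exp_le_one_iff]
  exact div_nonpos_of_nonpos_of_nonneg (neg_nonpos.2 (sq_nonneg _)) (by positivity)

lemma outputKernel_pos (y : ℝ) (x : Fin K → ℝ) : 0 < outputKernel 𝒢.φ 𝒢.Δ 𝒢.PA y x := by
  have := 𝒢.Δ_pos
  have := Real.pi_pos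
  exact mul_pos (inv_pos.2 (Real.sqrt_pos.2 (by positivity))) (integral_exp_pos (𝒢.exp_integrable y x))

/-- The output kernel is the density of the observed output. -/
lemma lintegral_out (s : Fin K → ℝ) {F : ℝ → ENNReal} (hF : Measurable F) :
    ∫⁻ a, ∫⁻ z, F (𝒢.φ s a + √𝒢.Δ * z) ∂(gaussianReal 0 1) ∂𝒢.PA
      = ∫⁻ y, ENNReal.ofReal (outputKernel 𝒢.φ 𝒢.Δ 𝒢.PA y s) * F y := by
  have hΔ := 𝒢.Δ_pos
  have hφ : Measurable fun a => 𝒢.φ s a := 𝒢.measurable_φ.comp measurable_prodMk_left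
  have h1 : ∀ c : ℝ, ∫⁻ z, F (c + √𝒢.Δ * z) ∂(gaussianReal 0 1)
      = ∫⁻ y, ENNReal.ofReal ((√(2 * Real.pi * 𝒢.Δ))⁻¹ *
        Real.exp (-(y - c) ^ 2 / (2 * 𝒢.Δ))) * F y := by
    intro c
    have e1 := gaussianReal_map_const_mul (μ := 0) (v := 1) (√𝒢.Δ)
    have e2 := gaussianReal_map_const_add (μ := √𝒢.Δ * 0)
      (v := .mk (√𝒢.Δ ^ 2) (sq_nonneg _) * 1) c
    rw [← e1, Measure.map_map (by fun_prop) (by fun_prop)] at e2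
    have hv : (.mk (√𝒢.Δ ^ 2) (sq_nonneg _) * 1 : NNReal) ≠ 0 := by
      rw [mul_one, ne_eq, ← NNReal.coe_eq_zero]
      simp [Real.sq_sqrt hΔ.le, hΔ.ne']
    have : ∫⁻ z, F (c + √𝒢.Δ * z) ∂(gaussianReal 0 1)
        = ∫⁻ y, F y ∂((gaussianReal 0 1).map ((c + ·) ∘ (√𝒢.Δ * ·))) := by
      rw [lintegral_map hF (by fun_prop)]; rfl
    rw [this, e2, gaussianReal_of_var_ne_zero _ hv, lintegral_withDensity_eq_lintegral_mul _
      (measurable_gaussianPDF _ _) hF]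
    refine lintegral_congr fun y => ?_
    simp only [Pi.mul_apply, gaussianPDF, gaussianPDFReal]
    congr 2
    simp [Real.sq_sqrt hΔ.le]
  simp only [h1]
  have hm : Measurable fun q : ℝ × ℝ => ENNReal.ofReal ((√(2 * Real.pi * 𝒢.Δ))⁻¹ *
        Real.exp (-(q.2 - 𝒢.φ s q.1) ^ 2 / (2 * 𝒢.Δ))) * F q.2 := by
    have : Measurable fun q : ℝ × ℝ => 𝒢.φ s q.1 := hφ.comp measurable_fst
    fun_prop
  rw [lintegral_lintegral_swap hm.aemeasurable]
  refine lintegral_congr fun y => ?_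
  rw [lintegral_mul_const _ (by fun_prop)]
  congr 1
  unfold outputKernel
  rw [← integral_const_mul, ofReal_integral_eq_lintegral_ofReal ((𝒢.exp_integrable y s).const_mul _)
    (Eventually.of_forall fun a => by positivity)]

end OutputKernel

/-- The joint law of the hidden vector and of the observation. -/
lemma map_rowObs (w : Rows n K) :
    𝒢.rowLaw.map (fun ξ => (ξ.1, 𝒢.rowObs w ξ))
      = ((gauss K).prod (rowRef n K)).withDensity
        fun q => ENNReal.ofReal (𝒢.like w q.1 q.2) := by
  have hobs : Measurable fun ξ : RowNoise n K => (ξ.1, 𝒢.rowObs w ξ) := by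
    have := 𝒢.measurable_out.comp (measurable_prodMk_left (x := w))
    simp only [Function.comp_def] at this
    unfold rowObs
    fun_prop
  have hlike : Measurable fun q : (Fin K → ℝ) × RowObs n K => 𝒢.like w q.1 q.2 := by
    have := 𝒢.measurable_like.comp (measurable_prodMk_left (x := w))
    simpa only [Function.comp_def] using this
  refine Measure.ext_of_lintegral _ fun F hF => ?_
  rw [lintegral_map hF hobs, lintegral_withDensity_eq_lintegral_mul _ hlike.ennreal_ofReal hF]
  simp only [Pi.mul_apply]
  have hF' : Measurable fun ξ : RowNoise n K => F (ξ.1, 𝒢.rowObs w ξ) := hF.comp hobs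
  have hG : Measurable fun q : (Fin K → ℝ) × RowObs n K =>
      ENNReal.ofReal (𝒢.like w q.1 q.2) * F q := hlike.ennreal_ofReal.mul hF
  generalize hlw : 𝒢.like w = lw at hG ⊢
  rw [lintegral_prod _ hF'.aemeasurable, lintegral_prod _ hG.aemeasurable]
  refine lintegral_congr fun u => ?_
  have m1 := hF'.comp (measurable_prodMk_left (x := u))
  have m1' := hG.comp (measurable_prodMk_left (x := u))
  simp only [Function.comp_def] at m1 m1'
  rw [lintegral_prod _ m1.aemeasurable, lintegral_prod _ m1'.aemeasurable]
  refine lintegral_congr fun x => ?_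
  have m2 := m1.comp (measurable_prodMk_left (x := x))
  have m2' := m1'.comp (measurable_prodMk_left (x := x))
  simp only [Function.comp_def] at m2 m2'
  rw [lintegral_prod _ m2.aemeasurable, lintegral_prod _ m2'.aemeasurable]
  refine lintegral_congr fun v => ?_
  have m3 := m2.comp (measurable_prodMk_left (x := v))
  simp only [Function.comp_def] at m3
  rw [lintegral_prod _ m3.aemeasurable, ← hlw]
  have m4 : Measurable fun y : ℝ => F (u, x, v, y) := hF.comp (by fun_prop)
  have := 𝒢.lintegral_out (𝒢.pre w u x v) m4
  simp only [rowObs, out, like]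
  exact this

end GLM

end

noncomputable section

namespace GLM

variable {n K : ℕ} (𝒢 : GLM n K) (m : ℕ) (A : Matrix (Fin K) (Fin K) ℝ)

/-- The hidden rows, the disorder of the observations, and the noise of the side channel. -/
abbrev Omega (n m K : ℕ) : Type := Rows n K × (Fin m → RowNoise n K) × Rows n K

/-- The observed data. -/
abbrev Data (n m K : ℕ) : Type := (Fin m → RowObs n K) × Rows n K

/-- The law of the disorder. -/
abbrev law : Measure (Omega n m K) :=
  (Measure.pi fun _ => 𝒢.P0).prod <| (Measure.pi fun _ => 𝒢.rowLaw).prod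
    (Measure.pi fun _ => colored A)

/-- The prior. -/
abbrev prior : Measure (Rows n K × Rows m K) :=
  (Measure.pi fun _ => 𝒢.P0).prod (Measure.pi fun _ => gauss K)

variable {m} in
/-- The energy of the posterior. -/
def energy (R : Matrix (Fin K) (Fin K) ℝ) (d : Data n m K) (p : Rows n K × Rows m K) : ℝ :=
  ∑ μ, Real.log (𝒢.like p.1 (p.2 μ) (d.1 μ)) + ∑ i, side R (p.1 i) (d.2 i)

variable {m} in
def data (R : Matrix (Fin K) (Fin K) ℝ) (ω : Omega n m K) : Data n m K :=
  (fun μ => 𝒢.rowObs ω.1 (ω.2.1 μ), fun i => R *ᵥ ω.1 i + ω.2.2 i)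

def truth (n m K : ℕ) (ω : Omega n m K) : Rows n K × Rows m K := (ω.1, fun μ => (ω.2.1 μ).1)

lemma measurable_energy (R : Matrix (Fin K) (Fin K) ℝ) :
    Measurable (Function.uncurry (𝒢.energy (m := m) R)) := by
  unfold Function.uncurry energy
  refine (Finset.measurable_sum _ fun μ _ => ?_).add (Finset.measurable_sum _ fun i _ => ?_)
  · have h : Measurable fun a : Data n m K × (Rows n K × Rows m K) =>
        (a.2.1, a.2.2 μ, a.1.1 μ) := by fun_prop
    have h2 := 𝒢.measurable_like.comp h
    simp only [Function.comp_def] at h2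
    exact h2.log
  · have h : Measurable fun a : Data n m K × (Rows n K × Rows m K) => (a.2.1 i, a.1.2 i) := by
      fun_prop
    have h2 := (measurable_side R).comp h
    simpa only [Function.comp_def] using h2

lemma measurable_rowObs : Measurable fun q : Rows n K × RowNoise n K => 𝒢.rowObs q.1 q.2 := by
  have := 𝒢.measurable_out
  unfold rowObs
  fun_prop

lemma measurable_data (R : Matrix (Fin K) (Fin K) ℝ) : Measurable (𝒢.data (m := m) R) := by
  refine (measurable_pi_lambda _ fun μ => ?_).prodMk (measurable_pi_lambda _ fun i => ?_)
  · have h : Measurable fun a : Omega n m K => (a.1, a.2.1 μ) := by fun_prop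
    have h2 := 𝒢.measurable_rowObs.comp h
    simpa only [Function.comp_def] using h2
  · have h : Measurable fun a : Omega n m K => a.1 i := by fun_prop
    have h2 := (measurable_mulVec R).comp h
    simp only [Function.comp_def] at h2
    have h3 : Measurable fun a : Omega n m K => a.2.2 i := by fun_prop
    exact h2.add h3

lemma measurable_truth : Measurable (truth n m K) := by unfold truth; fun_prop

lemma ae_abs_le_rows : ∀ᵐ w ∂(Measure.pi fun _ : Fin n => 𝒢.P0), ∀ i l, |w i l| ≤ 𝒢.M := by
  rw [eventually_all]
  intro i
  exact (measurePreserving_eval (fun _ : Fin n => 𝒢.P0) i).quasiMeasurePreserving.ae 𝒢.ae_abs_le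

lemma ae_abs_le_prior : ∀ᵐ p ∂(𝒢.prior m), ∀ i l, |p.1 i l| ≤ 𝒢.M :=
  Measure.quasiMeasurePreserving_fst.ae 𝒢.ae_abs_le_rows

/-- A bound on the logarithm of the output kernel. -/
lemma abs_log_outputKernel_le (y : ℝ) (x : Fin K → ℝ) :
    |Real.log (outputKernel 𝒢.φ 𝒢.Δ 𝒢.PA y x)|
      ≤ |Real.log (√(2 * Real.pi * 𝒢.Δ))⁻¹| + (|y| + 𝒢.L) ^ 2 / (2 * 𝒢.Δ) := by
  have hΔ := 𝒢.Δ_pos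
  have hpos : 0 < (√(2 * Real.pi * 𝒢.Δ))⁻¹ := by
    have := Real.pi_pos
    exact inv_pos.2 (Real.sqrt_pos.2 (by positivity))
  have hi := 𝒢.exp_integrable y x
  have hip := integral_exp_pos hi
  have h2 : Measurable fun a => 𝒢.φ x a := 𝒢.measurable_φ.comp measurable_prodMk_left
  unfold outputKernel
  rw [Real.log_mul hpos.ne' hip.ne']
  refine (abs_add_le _ _).trans (add_le_add le_rfl ?_)
  have h3 := abs_logZ_sub_le (π := 𝒢.PA) (H := fun _ => 0) (c := 0)
    (H' := fun a => -(y - 𝒢.φ x a) ^ 2 / (2 * 𝒢.Δ)) (D := (|y| + 𝒢.L) ^ 2 / (2 * 𝒢.Δ))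
    measurable_const (by simp) (by fun_prop) (Eventually.of_forall fun a => by
      rw [sub_zero, neg_div, abs_neg, abs_div, abs_of_pos (by positivity : 0 < 2 * 𝒢.Δ), abs_pow]
      have := abs_sub y (𝒢.φ x a)
      have h4 := 𝒢.abs_φ_le x a
      gcongr
      linarith)
  simpa [logZ] using h3

lemma energy_bdd (R : Matrix (Fin K) (Fin K) ℝ) (d : Data n m K) :
    ∃ c, ∀ᵐ p ∂(𝒢.prior m), |𝒢.energy R d p| ≤ c := by
  have hM := 𝒢.M_nonneg
  refine ⟨∑ μ, (|Real.log (√(2 * Real.pi * 𝒢.Δ))⁻¹| + (|(d.1 μ).2.2| + 𝒢.L) ^ 2 / (2 * 𝒢.Δ))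
    + ∑ i, (∑ l, 𝒢.M * |d.2 i l| + (∑ l, 𝒢.M * ∑ k, |R l k| * 𝒢.M) / 2), ?_⟩
  filter_upwards [𝒢.ae_abs_le_prior m] with p hp
  refine (abs_add_le _ _).trans (add_le_add ?_ ?_)
  · exact (Finset.abs_sum_le_sum_abs _ _).trans (Finset.sum_le_sum fun μ _ =>
      𝒢.abs_log_outputKernel_le _ _)
  · refine (Finset.abs_sum_le_sum_abs _ _).trans (Finset.sum_le_sum fun i _ => ?_)
    unfold side dotProduct Matrix.mulVec dotProduct
    refine (abs_sub _ _).trans (add_le_add ?_ ?_)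
    · refine (Finset.abs_sum_le_sum_abs _ _).trans (Finset.sum_le_sum fun l _ => ?_)
      rw [abs_mul]
      exact mul_le_mul_of_nonneg_right (hp i l) (abs_nonneg _)
    · rw [abs_div, abs_two]
      refine div_le_div_of_nonneg_right ?_ zero_le_two
      refine (Finset.abs_sum_le_sum_abs _ _).trans (Finset.sum_le_sum fun l _ => ?_)
      rw [abs_mul]
      refine mul_le_mul (hp i l) ?_ (abs_nonneg _) hM
      refine (Finset.abs_sum_le_sum_abs _ _).trans (Finset.sum_le_sum fun k _ => ?_)
      rw [abs_mul]
      exact mul_le_mul_of_nonneg_left (hp i k) (abs_nonneg _)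

lemma measurePreserving_truth : MeasurePreserving (truth n m K) (𝒢.law m A) (𝒢.prior m) := by
  have h1 : MeasurePreserving (fun ξ : Fin m → RowNoise n K => fun μ => (ξ μ).1)
      (Measure.pi fun _ => 𝒢.rowLaw) (Measure.pi fun _ => gauss K) :=
    measurePreserving_pi _ _ fun _ => measurePreserving_fst
  exact (MeasurePreserving.id _).prod (h1.comp measurePreserving_fst)

instance : SigmaFinite (rowRef n K) := by unfold rowRef; infer_instance

instance : SigmaFinite ((gauss K).prod (rowRef n K)) := by unfold rowRef; infer_instance

instance : SFinite ((Measure.pi fun _ : Fin m => rowRef n K).prod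
    (Measure.pi fun _ : Fin n => colored A)) := by
  have h2 : SigmaFinite (Measure.pi fun _ : Fin m => rowRef n K) := inferInstance
  infer_instance

/-- The joint law of the data and of the hidden variables. -/
lemma map_data_truth : (𝒢.law m A).map (fun ω => (𝒢.data (A * Aᵀ) ω, truth n m K ω))
    = (((Measure.pi fun _ => rowRef n K).prod (Measure.pi fun _ => colored A)).prod
      (𝒢.prior m)).withDensity fun z => ENNReal.ofReal (Real.exp (𝒢.energy (A * Aᵀ) z.1 z.2)) := by
  have hdt := (𝒢.measurable_data (m := m) (A * Aᵀ)).prodMk (measurable_truth (n := n) m (K := K))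
  have hE := (𝒢.measurable_energy m (A * Aᵀ)).exp.ennreal_ofReal
  simp only [Function.uncurry] at hE
  refine Measure.ext_of_lintegral _ fun F hF => ?_
  rw [lintegral_map hF hdt, lintegral_withDensity_eq_lintegral_mul _ hE hF]
  have hl : ∀ w : Rows n K, ∀ i, Measurable fun y : Fin K → ℝ =>
      ENNReal.ofReal (Real.exp (side (A * Aᵀ) (w i) y)) := fun w i => by
    have := (measurable_side (A * Aᵀ)).comp (measurable_prodMk_left (x := w i))
    simp only [Function.comp_def] at this
    exact this.exp.ennreal_ofReal
  have hlike : ∀ w : Rows n K, Measurable fun q : (Fin K → ℝ) × RowObs n K =>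
      ENNReal.ofReal (𝒢.like w q.1 q.2) := fun w => by
    have := 𝒢.measurable_like.comp (measurable_prodMk_left (x := w))
    simp only [Function.comp_def] at this
    exact this.ennreal_ofReal
  have hexp : ∀ z : Data n m K × (Rows n K × Rows m K),
      ENNReal.ofReal (Real.exp (𝒢.energy (A * Aᵀ) z.1 z.2))
      = (∏ μ, ENNReal.ofReal (𝒢.like z.2.1 (z.2.2 μ) (z.1.1 μ)))
        * ∏ i, ENNReal.ofReal (Real.exp (side (A * Aᵀ) (z.2.1 i) (z.1.2 i))) := by
    intro z
    unfold energy
    rw [Real.exp_add, ENNReal.ofReal_mul (Real.exp_pos _).le, Real.exp_sum, Real.exp_sum,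
      ENNReal.ofReal_prod_of_nonneg fun i _ => (Real.exp_pos _).le,
      ENNReal.ofReal_prod_of_nonneg fun i _ => (Real.exp_pos _).le]
    congr 1
    refine Finset.prod_congr rfl fun μ _ => ?_
    have : 0 < 𝒢.like z.2.1 (z.2.2 μ) (z.1.1 μ) := 𝒢.outputKernel_pos _ _
    rw [Real.exp_log this]
  have hFE : Measurable fun z : Data n m K × (Rows n K × Rows m K) =>
      ENNReal.ofReal (Real.exp (𝒢.energy (A * Aᵀ) z.1 z.2)) * F z := hE.mul hF
  simp only [Pi.mul_apply]
  rw [lintegral_prod_symm _ hFE.aemeasurable]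
  have hFd : Measurable fun ω => F (𝒢.data (A * Aᵀ) ω, truth n m K ω) := hF.comp hdt
  have hFdE : Measurable fun q : (Rows n K × Rows m K) × Data n m K =>
      ENNReal.ofReal (Real.exp (𝒢.energy (A * Aᵀ) q.2 q.1)) * F (q.2, q.1) := by
    have := hFE.comp measurable_swap
    simpa only [Function.comp_def, Prod.fst_swap, Prod.snd_swap, Prod.swap] using this
  rw [lintegral_prod _ hFd.aemeasurable, lintegral_prod _ hFdE.lintegral_prod_right'.aemeasurable]
  refine lintegral_congr fun w => ?_
  -- the noise of the side channel
  have hFs : ∀ (ξ : Fin m → RowNoise n K),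
      ∫⁻ G, F (𝒢.data (A * Aᵀ) (w, ξ, G), truth n m K (w, ξ, G)) ∂(Measure.pi fun _ => colored A)
      = ∫⁻ y, (∏ i, ENNReal.ofReal (Real.exp (side (A * Aᵀ) (w i) (y i)))) *
        F ((fun μ => 𝒢.rowObs w (ξ μ), y), (w, fun μ => (ξ μ).1))
          ∂(Measure.pi fun _ => colored A) := by
    intro ξ
    have hmap := map_pi_eq_withDensity (colored A) (colored A) (N := n) (hl w)
      (T := fun i g => (A * Aᵀ) *ᵥ w i + g) (fun i => measurable_const.add measurable_id)
      (fun i => colored_map_add_eq_withDensity A (w i))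
    have hFy : Measurable fun y : Rows n K =>
        F ((fun μ => 𝒢.rowObs w (ξ μ), y), (w, fun μ => (ξ μ).1)) := hF.comp (by fun_prop)
    have hd : Measurable fun y : Rows n K =>
        ∏ i, ENNReal.ofReal (Real.exp (side (A * Aᵀ) (w i) (y i))) :=
      Finset.measurable_prod _ fun i _ => (hl w i).comp (measurable_pi_apply i)
    have h2 := lintegral_withDensity_eq_lintegral_mul (Measure.pi fun _ => colored A) hd hFy
    simp only [Pi.mul_apply] at h2
    have hadd : Measurable fun (x : Rows n K) i => (A * Aᵀ) *ᵥ w i + x i :=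
      measurable_pi_lambda _ fun i => measurable_const.add (measurable_pi_apply i)
    rw [← h2, ← hmap, lintegral_map hFy hadd]
    rfl
  have hF1 := hFd.comp (measurable_prodMk_left (x := w))
  simp only [Function.comp_def] at hF1
  rw [lintegral_prod _ hF1.aemeasurable]
  simp only [hFs]
  -- the observations
  set Φ : (Fin m → (Fin K → ℝ) × RowObs n K) → ENNReal := fun ζ =>
    ∫⁻ y, (∏ i, ENNReal.ofReal (Real.exp (side (A * Aᵀ) (w i) (y i)))) *
        F ((fun μ => (ζ μ).2, y), (w, fun μ => (ζ μ).1)) ∂(Measure.pi fun _ => colored A) with hΦ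
  have hΦm : Measurable Φ := by
    have h1 : Measurable fun q : (Fin m → (Fin K → ℝ) × RowObs n K) × Rows n K =>
        (∏ i, ENNReal.ofReal (Real.exp (side (A * Aᵀ) (w i) (q.2 i)))) *
        F ((fun μ => (q.1 μ).2, q.2), (w, fun μ => (q.1 μ).1)) := by
      refine Measurable.mul (Finset.measurable_prod _ fun i _ =>
        (hl w i).comp ((measurable_pi_apply i).comp measurable_snd)) (hF.comp (by fun_prop))
    exact h1.lintegral_prod_right'
  have hobs : Measurable fun ξ : RowNoise n K => (ξ.1, 𝒢.rowObs w ξ) := by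
    have := 𝒢.measurable_rowObs.comp (measurable_prodMk_left (x := w))
    simp only [Function.comp_def] at this
    exact measurable_fst.prodMk this
  have hmap := map_pi_eq_withDensity 𝒢.rowLaw ((gauss K).prod (rowRef n K)) (N := m)
    (fun _ => hlike w) (fun _ => hobs) (fun _ => 𝒢.map_rowObs w)
  have hobs' : Measurable fun ξ : Fin m → RowNoise n K => fun μ => ((ξ μ).1, 𝒢.rowObs w (ξ μ)) :=
    measurable_pi_lambda _ fun μ => hobs.comp (measurable_pi_apply μ)
  have hd : Measurable fun ζ : Fin m → (Fin K → ℝ) × RowObs n K =>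
      ∏ μ, ENNReal.ofReal (𝒢.like w (ζ μ).1 (ζ μ).2) :=
    Finset.measurable_prod _ fun μ _ => (hlike w).comp (measurable_pi_apply μ)
  have e1 : ∫⁻ ξ, Φ (fun μ => ((ξ μ).1, 𝒢.rowObs w (ξ μ))) ∂(Measure.pi fun _ => 𝒢.rowLaw)
      = ∫⁻ ζ, (∏ μ, ENNReal.ofReal (𝒢.like w (ζ μ).1 (ζ μ).2)) * Φ ζ
        ∂(Measure.pi fun _ => (gauss K).prod (rowRef n K)) := by
    have h2 := lintegral_withDensity_eq_lintegral_mul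
      (Measure.pi fun _ => (gauss K).prod (rowRef n K)) hd hΦm
    simp only [Pi.mul_apply] at h2
    rw [← h2, ← hmap, lintegral_map hΦm hobs']
  refine e1.trans ?_
  have hzip := (measurePreserving_arrowProdEquivProdArrow (Fin K → ℝ) (RowObs n K) (Fin m)
    (fun _ => gauss K) (fun _ => rowRef n K)).symm
  rw [← hzip.lintegral_comp_emb (MeasurableEquiv.measurableEmbedding _)]
  have e2 : ∀ q : (Fin m → Fin K → ℝ) × (Fin m → RowObs n K),
      (MeasurableEquiv.arrowProdEquivProdArrow (Fin K → ℝ) (RowObs n K) (Fin m)).symm q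
        = fun μ => (q.1 μ, q.2 μ) := fun q => rfl
  simp only [e2]
  have hm2 : Measurable fun q : (Fin m → Fin K → ℝ) × (Fin m → RowObs n K) =>
      (∏ μ, ENNReal.ofReal (𝒢.like w (q.1 μ) (q.2 μ))) * Φ fun μ => (q.1 μ, q.2 μ) := by
    have hz : Measurable fun (q : (Fin m → Fin K → ℝ) × (Fin m → RowObs n K)) μ =>
        (q.1 μ, q.2 μ) := measurable_pi_lambda _ fun μ => by fun_prop
    have h1 := hd.comp hz
    have h2 := hΦm.comp hz
    simp only [Function.comp_def] at h1 h2
    exact h1.mul h2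
  rw [lintegral_prod _ hm2.aemeasurable]
  refine lintegral_congr fun U => ?_
  have hm3 := hFdE.comp (measurable_prodMk_left (x := (w, U)))
  simp only [Function.comp_def] at hm3
  rw [lintegral_prod _ hm3.aemeasurable]
  refine lintegral_congr fun O => ?_
  have hm4 : Measurable fun y : Rows n K =>
      (∏ i, ENNReal.ofReal (Real.exp (side (A * Aᵀ) (w i) (y i)))) * F ((O, y), (w, U)) :=
    (Finset.measurable_prod _ fun i _ => (hl w i).comp (measurable_pi_apply i)).mul
      (hF.comp (by fun_prop))
  simp only [hΦ]
  rw [← lintegral_const_mul _ hm4]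
  refine lintegral_congr fun y => ?_
  rw [hexp ((O, y), (w, U)), mul_assoc]

/-- The posterior of the model. -/
def bayes : BayesModel (Omega n m K) (Data n m K) (Rows n K × Rows m K) where
  law := 𝒢.law m A
  prior := 𝒢.prior m
  W := 𝒢.energy (A * Aᵀ)
  data := 𝒢.data (A * Aᵀ)
  truth := truth n m K
  prob_law := inferInstance
  prob_prior := inferInstance
  measurable_W := 𝒢.measurable_energy m _
  bdd_W := 𝒢.energy_bdd m _
  measurable_data := 𝒢.measurable_data m _
  measurePreserving_truth := 𝒢.measurePreserving_truth m A
  nishimori := nishimori_of_map_eq (𝒢.measurable_energy m _) (𝒢.energy_bdd m _)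
    (𝒢.measurable_data m _) (measurable_truth m) (𝒢.map_data_truth m A)

end GLM

end

noncomputable section

lemma sum_update_sub {ι α : Type*} [Fintype ι] [DecidableEq ι] (f : ι → α → ℝ) (ξ : ι → α) (k : ι)
    (a : α) : ∑ μ, f μ (Function.update ξ k a μ) - ∑ μ, f μ (ξ μ) = f k a - f k (ξ k) := by
  rw [← Finset.sum_sub_distrib, Finset.sum_eq_single k]
  · simp
  · intro j _ hj; simp [Function.update_of_ne hj]
  · simp

namespace GLM

variable {n K : ℕ} (𝒢 : GLM n K) {m : ℕ}

/-- The exponent in the output kernel. -/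
def expo (y : ℝ) (s : Fin K → ℝ) (a : ℝ) : ℝ := -(y - 𝒢.φ s a) ^ 2 / (2 * 𝒢.Δ)

lemma measurable_expo (y : ℝ) (s : Fin K → ℝ) : Measurable (𝒢.expo y s) := by
  have h2 : Measurable fun a => 𝒢.φ s a := 𝒢.measurable_φ.comp measurable_prodMk_left
  unfold expo
  fun_prop

/-- The logarithm of the prefactor of the output kernel. -/
def logConst : ℝ := Real.log (√(2 * Real.pi * 𝒢.Δ))⁻¹

lemma log_outputKernel (y : ℝ) (s : Fin K → ℝ) :
    Real.log (outputKernel 𝒢.φ 𝒢.Δ 𝒢.PA y s) = 𝒢.logConst + logZ 𝒢.PA (𝒢.expo y s) := by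
  have hΔ := 𝒢.Δ_pos
  have hpos : 0 < (√(2 * Real.pi * 𝒢.Δ))⁻¹ := by
    have := Real.pi_pos
    exact inv_pos.2 (Real.sqrt_pos.2 (by positivity))
  exact Real.log_mul hpos.ne' (integral_exp_pos (𝒢.exp_integrable y s)).ne'

/-- The log-likelihood of the observation with disorder `ξ`, when the hidden weights are `W`. -/
def logLike (W w : Rows n K) (u : Fin K → ℝ) (ξ : RowNoise n K) : ℝ :=
  Real.log (𝒢.like w u (𝒢.rowObs W ξ))

/-- A bound on the residuals, in terms of the noise. -/
def resid (z : ℝ) : ℝ := 2 * 𝒢.L + √𝒢.Δ * |z|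

lemma resid_nonneg (z : ℝ) : 0 ≤ 𝒢.resid z := by
  have := 𝒢.L_nonneg
  unfold resid; positivity

lemma abs_residual_le (S s : Fin K → ℝ) (a' a z : ℝ) :
    |𝒢.φ S a' + √𝒢.Δ * z - 𝒢.φ s a| ≤ 𝒢.resid z := by
  have h1 := abs_le.1 (𝒢.abs_φ_le S a')
  have h2 := abs_le.1 (𝒢.abs_φ_le s a)
  have h3 : |√𝒢.Δ * z| = √𝒢.Δ * |z| := by rw [abs_mul, abs_of_nonneg (Real.sqrt_nonneg _)]
  have h4 := abs_le.1 h3.le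
  unfold resid
  rw [abs_le]
  constructor <;> linarith

lemma abs_expo_le (S s : Fin K → ℝ) (a' a z : ℝ) :
    |𝒢.expo (𝒢.φ S a' + √𝒢.Δ * z) s a| ≤ 𝒢.resid z ^ 2 / (2 * 𝒢.Δ) := by
  have hΔ := 𝒢.Δ_pos
  unfold expo
  rw [neg_div, abs_neg, abs_div, abs_of_pos (by positivity : 0 < 2 * 𝒢.Δ), abs_pow]
  exact div_le_div_of_nonneg_right (pow_le_pow_left₀ (abs_nonneg _)
    (𝒢.abs_residual_le S s a' a z) 2) (by positivity)

lemma abs_logLike_sub_le (W w : Rows n K) (u : Fin K → ℝ) (ξ : RowNoise n K) :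
    |𝒢.logLike W w u ξ - 𝒢.logConst| ≤ 𝒢.resid ξ.2.2.2.2 ^ 2 / (2 * 𝒢.Δ) := by
  unfold logLike like
  rw [log_outputKernel, add_sub_cancel_left]
  have h3 := abs_logZ_sub_le (π := 𝒢.PA) (H := fun _ => 0) (c := 0)
    (H' := 𝒢.expo (𝒢.out W ξ) (𝒢.pre w u ξ.2.1 ξ.2.2.1))
    (D := 𝒢.resid ξ.2.2.2.2 ^ 2 / (2 * 𝒢.Δ)) measurable_const (by simp) (𝒢.measurable_expo _ _)
    (Eventually.of_forall fun a => by
      rw [sub_zero]; exact 𝒢.abs_expo_le _ _ _ _ _)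
  simp only [logZ, sub_zero, Real.exp_zero, integral_const, probReal_univ, smul_eq_mul, mul_one,
    Real.log_one] at h3
  exact h3

/-- The disorder with the entry `x i` replaced by `c`. -/
def setX (i : Fin n) (c : ℝ) (ξ : RowNoise n K) : RowNoise n K :=
  (ξ.1, Function.update ξ.2.1 i c, ξ.2.2)

lemma pre_update (w : Rows n K) (u : Fin K → ℝ) (x : Fin n → ℝ) (v : Fin K → ℝ) (i : Fin n)
    (c : ℝ) : 𝒢.pre w u (Function.update x i c) v
      = 𝒢.pre w u (Function.update x i 0) v + (𝒢.κ * c) • w i := by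
  have e : ∀ c : ℝ, ∑ j, Function.update x i c j • w j
      = c • w i + ∑ j ∈ Finset.univ.erase i, x j • w j := by
    intro c
    rw [← Finset.add_sum_erase _ _ (Finset.mem_univ i)]
    congr 1
    · simp
    · refine Finset.sum_congr rfl fun j hj => ?_
      rw [Function.update_of_ne (Finset.ne_of_mem_erase hj)]
  unfold pre
  rw [e c, e 0, mul_smul, zero_smul, zero_add, smul_add]
  abel

/-- First and second differences of the exponent. -/
lemma expo_diff_le (S s H h : Fin K → ℝ) (a' a z : ℝ) {η : ℝ} (hH : ‖H‖ ≤ η) (hh : ‖h‖ ≤ η) :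
    |𝒢.expo (𝒢.φ (S + H) a' + √𝒢.Δ * z) (s + h) a - 𝒢.expo (𝒢.φ S a' + √𝒢.Δ * z) s a|
      ≤ 2 * 𝒢.L * 𝒢.resid z / 𝒢.Δ * η ∧
    |𝒢.expo (𝒢.φ (S + H) a' + √𝒢.Δ * z) (s + h) a + 𝒢.expo (𝒢.φ (S - H) a' + √𝒢.Δ * z) (s - h) a
      - 2 * 𝒢.expo (𝒢.φ S a' + √𝒢.Δ * z) s a|
      ≤ (4 * 𝒢.L ^ 2 + 2 * 𝒢.L * 𝒢.resid z) / 𝒢.Δ * η ^ 2 := by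
  have hΔ := 𝒢.Δ_pos
  have hL := 𝒢.L_nonneg
  have hη : 0 ≤ η := (norm_nonneg _).trans hH
  have b0 := 𝒢.abs_residual_le S s a' a z
  have b1 := 𝒢.abs_residual_le (S + H) (s + h) a' a z
  have l1 := (𝒢.lipschitz_φ S H a').trans (mul_le_mul_of_nonneg_left hH hL)
  have l2 := (𝒢.lipschitz_φ s h a).trans (mul_le_mul_of_nonneg_left hh hL)
  have l3 := (𝒢.lipschitz_φ S (-H) a').trans
    (mul_le_mul_of_nonneg_left (show ‖-H‖ ≤ η by rwa [norm_neg]) hL)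
  have l4 := (𝒢.lipschitz_φ s (-h) a).trans
    (mul_le_mul_of_nonneg_left (show ‖-h‖ ≤ η by rwa [norm_neg]) hL)
  rw [← sub_eq_add_neg] at l3 l4
  have s1 := (𝒢.second_φ S H a').trans
    (mul_le_mul_of_nonneg_left (pow_le_pow_left₀ (norm_nonneg _) hH 2) hL)
  have s2 := (𝒢.second_φ s h a).trans
    (mul_le_mul_of_nonneg_left (pow_le_pow_left₀ (norm_nonneg _) hh 2) hL)
  have hB := 𝒢.resid_nonneg z
  unfold expo
  generalize 𝒢.resid z = B at *
  generalize 𝒢.φ (S + H) a' = A₁ at *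
  generalize 𝒢.φ (S - H) a' = A₂ at *
  generalize 𝒢.φ S a' = A₀ at *
  generalize 𝒢.φ (s + h) a = f₁ at *
  generalize 𝒢.φ (s - h) a = f₂ at *
  generalize 𝒢.φ s a = f₀ at *
  generalize √𝒢.Δ * z = ζ at *
  have d1 : |(A₁ + ζ - f₁) - (A₀ + ζ - f₀)| ≤ 2 * 𝒢.L * η := by
    rw [abs_le] at *; constructor <;> linarith
  have d2 : |(A₂ + ζ - f₂) - (A₀ + ζ - f₀)| ≤ 2 * 𝒢.L * η := by
    rw [abs_le] at *; constructor <;> linarith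
  have d3 : |(A₁ + ζ - f₁) + (A₂ + ζ - f₂) - 2 * (A₀ + ζ - f₀)| ≤ 2 * 𝒢.L * η ^ 2 := by
    rw [abs_le] at *; constructor <;> linarith
  generalize A₁ + ζ - f₁ = q₁ at *
  generalize A₂ + ζ - f₂ = q₂ at *
  generalize A₀ + ζ - f₀ = q₀ at *
  constructor
  · have e : -q₁ ^ 2 / (2 * 𝒢.Δ) - -q₀ ^ 2 / (2 * 𝒢.Δ) = -((q₁ - q₀) * (q₁ + q₀)) / (2 * 𝒢.Δ) := by
      ring
    have e2 : 2 * 𝒢.L * B / 𝒢.Δ * η = (2 * 𝒢.L * η) * (B + B) / (2 * 𝒢.Δ) := by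
      field_simp; ring
    rw [e, e2, neg_div, abs_neg, abs_div, abs_of_pos (by positivity : 0 < 2 * 𝒢.Δ), abs_mul]
    refine div_le_div_of_nonneg_right ?_ (by positivity)
    exact mul_le_mul d1 ((abs_add_le _ _).trans (add_le_add b1 b0)) (abs_nonneg _) (by positivity)
  · have e : -q₁ ^ 2 / (2 * 𝒢.Δ) + -q₂ ^ 2 / (2 * 𝒢.Δ) - 2 * (-q₀ ^ 2 / (2 * 𝒢.Δ))
        = -((q₁ - q₀) ^ 2 + (q₂ - q₀) ^ 2 + 2 * q₀ * (q₁ + q₂ - 2 * q₀)) / (2 * 𝒢.Δ) := by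
      ring
    have e2 : (4 * 𝒢.L ^ 2 + 2 * 𝒢.L * B) / 𝒢.Δ * η ^ 2
        = ((2 * 𝒢.L * η) ^ 2 + (2 * 𝒢.L * η) ^ 2 + 2 * B * (2 * 𝒢.L * η ^ 2)) / (2 * 𝒢.Δ) := by
      field_simp; ring
    rw [e, e2, neg_div, abs_neg, abs_div, abs_of_pos (by positivity : 0 < 2 * 𝒢.Δ)]
    refine div_le_div_of_nonneg_right ?_ (by positivity)
    refine (abs_add_le _ _).trans (add_le_add ((abs_add_le _ _).trans (add_le_add ?_ ?_)) ?_)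
    · rw [abs_pow]; exact pow_le_pow_left₀ (abs_nonneg _) d1 2
    · rw [abs_pow]; exact pow_le_pow_left₀ (abs_nonneg _) d2 2
    · rw [abs_mul, abs_mul, abs_two]
      exact mul_le_mul (mul_le_mul_of_nonneg_left b0 zero_le_two) d3 (abs_nonneg _) (by positivity)

/-- First and second differences of the log-likelihood in an entry of the design matrix. -/
lemma logLike_diff_le {W w : Rows n K} (u : Fin K → ℝ) (ξ : RowNoise n K) (i : Fin n) (c : ℝ)
    (hW : ‖W i‖ ≤ 𝒢.M) (hw : ‖w i‖ ≤ 𝒢.M) :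
    |𝒢.logLike W w u (setX i c ξ) - 𝒢.logLike W w u (setX i 0 ξ)|
      ≤ 2 * 𝒢.L * 𝒢.resid ξ.2.2.2.2 / 𝒢.Δ * (|𝒢.κ * c| * 𝒢.M) ∧
    |𝒢.logLike W w u (setX i c ξ) + 𝒢.logLike W w u (setX i (-c) ξ)
      - 2 * 𝒢.logLike W w u (setX i 0 ξ)|
      ≤ (4 * 𝒢.L ^ 2 + 2 * 𝒢.L * 𝒢.resid ξ.2.2.2.2) / 𝒢.Δ * (|𝒢.κ * c| * 𝒢.M) ^ 2
        + 4 * (2 * 𝒢.L * 𝒢.resid ξ.2.2.2.2 / 𝒢.Δ * (|𝒢.κ * c| * 𝒢.M)) ^ 2 := by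
  obtain ⟨u', x, v, a', z⟩ := ξ
  set s := 𝒢.pre w u (Function.update x i 0) v with hs
  set S := 𝒢.pre W u' (Function.update x i 0) v with hS
  set η := |𝒢.κ * c| * 𝒢.M with hη
  have key : ∀ c' : ℝ, 𝒢.logLike W w u (setX i c' (u', x, v, a', z)) = 𝒢.logConst
      + logZ 𝒢.PA (𝒢.expo (𝒢.φ (S + (𝒢.κ * c') • W i) a' + √𝒢.Δ * z) (s + (𝒢.κ * c') • w i)) := by
    intro c'
    unfold logLike like
    rw [log_outputKernel]
    simp only [setX, rowObs, out, hs, hS, ← pre_update]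
  have key0 : 𝒢.logLike W w u (setX i 0 (u', x, v, a', z)) = 𝒢.logConst
      + logZ 𝒢.PA (𝒢.expo (𝒢.φ S a' + √𝒢.Δ * z) s) := by
    rw [key 0]; simp
  have hH : ‖(𝒢.κ * c) • W i‖ ≤ η := by
    rw [norm_smul, Real.norm_eq_abs]; exact mul_le_mul_of_nonneg_left hW (abs_nonneg _)
  have hh : ‖(𝒢.κ * c) • w i‖ ≤ η := by
    rw [norm_smul, Real.norm_eq_abs]; exact mul_le_mul_of_nonneg_left hw (abs_nonneg _)
  have kneg : 𝒢.logLike W w u (setX i (-c) (u', x, v, a', z)) = 𝒢.logConst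
      + logZ 𝒢.PA (𝒢.expo (𝒢.φ (S - (𝒢.κ * c) • W i) a' + √𝒢.Δ * z) (s - (𝒢.κ * c) • w i)) := by
    rw [key (-c), mul_neg, neg_smul, neg_smul, ← sub_eq_add_neg, ← sub_eq_add_neg]
  rw [key c, kneg, key0]
  have hc : ∀ᵐ a ∂𝒢.PA, |𝒢.expo (𝒢.φ S a' + √𝒢.Δ * z) s a| ≤ 𝒢.resid z ^ 2 / (2 * 𝒢.Δ) :=
    Eventually.of_forall fun a => 𝒢.abs_expo_le _ _ _ _ _
  have hd := fun a => 𝒢.expo_diff_le S s _ _ a' a z hH hh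
  have hd' := fun a => (𝒢.expo_diff_le S s (-((𝒢.κ * c) • W i)) (-((𝒢.κ * c) • w i)) a' a z (η := η)
    (by rwa [norm_neg]) (by rwa [norm_neg])).1
  simp only [← sub_eq_add_neg] at hd'
  constructor
  · have := abs_logZ_sub_le (𝒢.measurable_expo (𝒢.φ S a' + √𝒢.Δ * z) s) hc
      (𝒢.measurable_expo (𝒢.φ (S + (𝒢.κ * c) • W i) a' + √𝒢.Δ * z) (s + (𝒢.κ * c) • w i))
      (Eventually.of_forall fun a => (hd a).1)
    rwa [add_sub_add_left_eq_sub]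
  · have := abs_logZ_second_diff_le (𝒢.measurable_expo (𝒢.φ S a' + √𝒢.Δ * z) s) hc
      (𝒢.measurable_expo (𝒢.φ (S + (𝒢.κ * c) • W i) a' + √𝒢.Δ * z) (s + (𝒢.κ * c) • w i))
      (𝒢.measurable_expo (𝒢.φ (S - (𝒢.κ * c) • W i) a' + √𝒢.Δ * z) (s - (𝒢.κ * c) • w i))
      (Eventually.of_forall fun a => (hd a).1) (Eventually.of_forall fun a => hd' a)
      (Eventually.of_forall fun a => (hd a).2)
    refine le_trans (le_of_eq ?_) this
    congr 1
    ring

end GLM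

end

noncomputable section

lemma logZ_const_zero {P : Type*} [MeasurableSpace P] (π : Measure P) [IsProbabilityMeasure π] :
    logZ π (fun _ => 0) = 0 := by simp [logZ]

lemma measurable_logZ {Ω P : Type*} [MeasurableSpace Ω] [MeasurableSpace P] {π : Measure P}
    [IsProbabilityMeasure π] {H : Ω → P → ℝ} (hH : Measurable (Function.uncurry H)) :
    Measurable fun ω => logZ π (H ω) := by
  have h1 : Measurable fun z : Ω × P => Real.exp (H z.1 z.2) := hH.exp
  exact (h1.stronglyMeasurable.integral_prod_right' (ν := π)).measurable.log

lemma abs_dotProduct_le {K : ℕ} {w y : Fin K → ℝ} {M : ℝ} (hw : ∀ l, |w l| ≤ M) :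
    |w ⬝ᵥ y| ≤ M * ∑ l, |y l| := by
  unfold dotProduct
  rw [Finset.mul_sum]
  refine (Finset.abs_sum_le_sum_abs _ _).trans (Finset.sum_le_sum fun l _ => ?_)
  rw [abs_mul]
  exact mul_le_mul_of_nonneg_right (hw l) (abs_nonneg _)

lemma sum_abs_mulVec_le {K : ℕ} {R : Matrix (Fin K) (Fin K) ℝ} {b : ℝ} (hR : ∀ l k, |R l k| ≤ b)
    {w : Fin K → ℝ} {M : ℝ} (hb : 0 ≤ b) (hw : ∀ l, |w l| ≤ M) :
    ∑ l, |(R *ᵥ w) l| ≤ K ^ 2 * b * M := by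
  have : ∀ l, |(R *ᵥ w) l| ≤ K * (b * M) := by
    intro l
    unfold Matrix.mulVec dotProduct
    refine (Finset.abs_sum_le_sum_abs _ _).trans ((Finset.sum_le_sum fun k _ => ?_).trans_eq
      (by simp : ∑ _k : Fin K, b * M = K * (b * M)))
    rw [abs_mul]
    exact mul_le_mul (hR l k) (hw k) (abs_nonneg _) hb
  refine (Finset.sum_le_sum fun l _ => this l).trans (le_of_eq ?_)
  simp; ring

namespace GLM

variable {n K : ℕ} (𝒢 : GLM n K) {m : ℕ} (R : Matrix (Fin K) (Fin K) ℝ)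

/-- The free entropy. -/
def fe (ω : Omega n m K) : ℝ := logZ (𝒢.prior m) (𝒢.energy R (𝒢.data R ω))

lemma energy_data (ω : Omega n m K) (p : Rows n K × Rows m K) :
    𝒢.energy R (𝒢.data R ω) p = ∑ μ, 𝒢.logLike ω.1 p.1 (p.2 μ) (ω.2.1 μ)
      + ∑ i, side R (p.1 i) (R *ᵥ ω.1 i + ω.2.2 i) := rfl

lemma measurable_energy_data : Measurable fun q : Omega n m K × (Rows n K × Rows m K) =>
    𝒢.energy R (𝒢.data R q.1) q.2 := by
  have h := (𝒢.measurable_energy m R).comp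
    (((𝒢.measurable_data m R).comp measurable_fst).prodMk (measurable_snd (α := Omega n m K)))
  simpa only [Function.comp_def, Function.uncurry] using h

lemma measurable_fe : Measurable (𝒢.fe (m := m) R) :=
  measurable_logZ (H := fun ω => 𝒢.energy R (𝒢.data R ω)) (𝒢.measurable_energy_data R)

lemma measurable_energy_apply (d : Data n m K) : Measurable (𝒢.energy R d) := by
  have h := (𝒢.measurable_energy m R).comp (measurable_prodMk_left (x := d))
  simpa only [Function.comp_def, Function.uncurry] using h

lemma abs_fe_sub_le {ω ω' : Omega n m K} {D : ℝ}
    (h : ∀ᵐ p ∂(𝒢.prior m), |𝒢.energy R (𝒢.data R ω') p - 𝒢.energy R (𝒢.data R ω) p| ≤ D) :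
    |𝒢.fe R ω' - 𝒢.fe R ω| ≤ D := by
  obtain ⟨c, hc⟩ := 𝒢.energy_bdd m R (𝒢.data R ω)
  exact abs_logZ_sub_le (𝒢.measurable_energy_apply R _) hc (𝒢.measurable_energy_apply R _) h

/-- A bound on the log-likelihood of an observation, up to a constant. -/
def rowBound (ξ : RowNoise n K) : ℝ := 𝒢.resid ξ.2.2.2.2 ^ 2 / (2 * 𝒢.Δ)

/-- A bound on the effect of the noise of the side channel. -/
def sideBound (g : Fin K → ℝ) : ℝ := 𝒢.M * ∑ l, |g l|

lemma fe_update_row (W : Rows n K) (ξ : Fin m → RowNoise n K) (G : Rows n K) (k : Fin m)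
    (ξ' : RowNoise n K) :
    |𝒢.fe R (W, ξ, G) - 𝒢.fe R (W, Function.update ξ k ξ', G)|
      ≤ 𝒢.rowBound (ξ k) + 𝒢.rowBound ξ' := by
  rw [abs_sub_comm]
  refine 𝒢.abs_fe_sub_le R (Eventually.of_forall fun p => ?_)
  rw [energy_data, energy_data, add_sub_add_right_eq_sub]
  dsimp only
  rw [sum_update_sub (fun μ a => 𝒢.logLike W p.1 (p.2 μ) a)]
  have h1 := abs_le.1 (𝒢.abs_logLike_sub_le W p.1 (p.2 k) (ξ k))
  have h2 := abs_le.1 (𝒢.abs_logLike_sub_le W p.1 (p.2 k) ξ')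
  unfold rowBound
  rw [abs_le]
  constructor <;> linarith [h1.1, h1.2, h2.1, h2.2]

lemma fe_update_side (W : Rows n K) (ξ : Fin m → RowNoise n K) (G : Rows n K) (i : Fin n)
    (g : Fin K → ℝ) :
    |𝒢.fe R (W, ξ, G) - 𝒢.fe R (W, ξ, Function.update G i g)|
      ≤ 𝒢.sideBound (G i) + 𝒢.sideBound g := by
  rw [abs_sub_comm]
  refine 𝒢.abs_fe_sub_le R ?_
  filter_upwards [𝒢.ae_abs_le_prior m] with p hp
  rw [energy_data, energy_data, add_sub_add_left_eq_sub]
  dsimp only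
  rw [sum_update_sub (fun j a => side R (p.1 j) (R *ᵥ W j + a))]
  have h1 := abs_le.1 (abs_dotProduct_le (y := G i) (hp i))
  have h2 := abs_le.1 (abs_dotProduct_le (y := g) (hp i))
  unfold sideBound side
  rw [dotProduct_add, dotProduct_add, abs_le]
  constructor <;> linarith [h1.1, h1.2, h2.1, h2.2]

variable {R} {b : ℝ} (hb : 0 ≤ b) (hR : ∀ l k, |R l k| ≤ b)

include hb hR in
lemma fe_update_weight {W : Rows n K} {ξ : Fin m → RowNoise n K} (G : Rows n K) (i : Fin n)
    {w : Fin K → ℝ} (hW : ∀ l, |W i l| ≤ 𝒢.M) (hw : ∀ l, |w l| ≤ 𝒢.M)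
    (hξ : ∀ μ, (ξ μ).2.1 i = 0) :
    |𝒢.fe R (W, ξ, G) - 𝒢.fe R (Function.update W i w, ξ, G)| ≤ 2 * K ^ 2 * b * 𝒢.M ^ 2 := by
  rw [abs_sub_comm]
  refine 𝒢.abs_fe_sub_le R ?_
  filter_upwards [𝒢.ae_abs_le_prior m] with p hp
  rw [energy_data, energy_data]
  dsimp only
  have hout : ∀ μ, 𝒢.logLike (Function.update W i w) p.1 (p.2 μ) (ξ μ)
      = 𝒢.logLike W p.1 (p.2 μ) (ξ μ) := by
    intro μ
    have e : 𝒢.pre (Function.update W i w) (ξ μ).1 (ξ μ).2.1 (ξ μ).2.2.1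
        = 𝒢.pre W (ξ μ).1 (ξ μ).2.1 (ξ μ).2.2.1 := by
      unfold pre
      congr 3
      refine Finset.sum_congr rfl fun j _ => ?_
      by_cases hj : j = i
      · subst hj; rw [hξ μ, zero_smul, zero_smul]
      · rw [Function.update_of_ne hj]
    unfold logLike rowObs out
    rw [e]
  simp only [hout]
  rw [add_sub_add_left_eq_sub, sum_update_sub (fun j a => side R (p.1 j) (R *ᵥ a + G j))]
  have hM := 𝒢.M_nonneg
  have h1 := abs_le.1 ((abs_dotProduct_le (y := R *ᵥ W i) (hp i)).trans
    (mul_le_mul_of_nonneg_left (sum_abs_mulVec_le hR hb hW) hM))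
  have h2 := abs_le.1 ((abs_dotProduct_le (y := R *ᵥ w) (hp i)).trans
    (mul_le_mul_of_nonneg_left (sum_abs_mulVec_le hR hb hw) hM))
  unfold side
  rw [dotProduct_add, dotProduct_add, abs_le]
  constructor <;> nlinarith [h1.1, h1.2, h2.1, h2.2]

include hb hR in
lemma abs_fe_le {W : Rows n K} (ξ : Fin m → RowNoise n K) (G : Rows n K)
    (hW : ∀ i l, |W i l| ≤ 𝒢.M) :
    |𝒢.fe R (W, ξ, G)| ≤ ∑ μ, (|𝒢.logConst| + 𝒢.rowBound (ξ μ))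
      + ∑ i, (3 / 2 * K ^ 2 * b * 𝒢.M ^ 2 + 𝒢.sideBound (G i)) := by
  have hM := 𝒢.M_nonneg
  have h := abs_logZ_sub_le (π := 𝒢.prior m) (H := fun _ => 0) (c := 0)
    (H' := 𝒢.energy R (𝒢.data R (W, ξ, G)))
    (D := ∑ μ, (|𝒢.logConst| + 𝒢.rowBound (ξ μ))
      + ∑ i, (3 / 2 * K ^ 2 * b * 𝒢.M ^ 2 + 𝒢.sideBound (G i)))
    measurable_const (by simp) (𝒢.measurable_energy_apply R _) (by
      filter_upwards [𝒢.ae_abs_le_prior m] with p hp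
      rw [sub_zero, energy_data]
      refine (abs_add_le _ _).trans (add_le_add
        ((Finset.abs_sum_le_sum_abs _ _).trans (Finset.sum_le_sum fun μ _ => ?_))
        ((Finset.abs_sum_le_sum_abs _ _).trans (Finset.sum_le_sum fun i _ => ?_)))
      · have h1 := 𝒢.abs_logLike_sub_le W p.1 (p.2 μ) (ξ μ)
        have h2 := abs_add_le (𝒢.logLike W p.1 (p.2 μ) (ξ μ) - 𝒢.logConst) 𝒢.logConst
        rw [sub_add_cancel] at h2
        unfold rowBound
        dsimp only
        linarith
      · have h1 := abs_le.1 ((abs_dotProduct_le (y := R *ᵥ W i) (hp i)).trans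
          (mul_le_mul_of_nonneg_left (sum_abs_mulVec_le hR hb (hW i)) hM))
        have h2 := abs_le.1 ((abs_dotProduct_le (y := R *ᵥ p.1 i) (hp i)).trans
          (mul_le_mul_of_nonneg_left (sum_abs_mulVec_le hR hb (hp i)) hM))
        have h3 := abs_le.1 (abs_dotProduct_le (y := G i) (hp i))
        unfold side sideBound
        dsimp only
        rw [dotProduct_add, abs_le]
        constructor <;> nlinarith [h1.1, h1.2, h2.1, h2.2, h3.1, h3.2])
  rwa [logZ_const_zero, sub_zero] at h

/-- The second difference bound. -/
def curvBound (z : ℝ) : ℝ :=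
  (4 * 𝒢.L ^ 2 + 2 * 𝒢.L * 𝒢.resid z) / 𝒢.Δ + 8 * (2 * 𝒢.L * 𝒢.resid z / 𝒢.Δ) ^ 2

/-- The second difference of the free entropy in an entry of the design matrix. -/
lemma fe_second_diff {W : Rows n K} (ξ : Fin m → RowNoise n K) (G : Rows n K) (k : Fin m)
    (i : Fin n) (c : ℝ) (hW : ∀ l, |W i l| ≤ 𝒢.M) :
    |𝒢.fe R (W, Function.update ξ k (setX i c (ξ k)), G)
      + 𝒢.fe R (W, Function.update ξ k (setX i (-c) (ξ k)), G)
      - 2 * 𝒢.fe R (W, Function.update ξ k (setX i 0 (ξ k)), G)|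
      ≤ (|𝒢.κ * c| * 𝒢.M) ^ 2 * 𝒢.curvBound (ξ k).2.2.2.2 := by
  have hM := 𝒢.M_nonneg
  set B := 2 * 𝒢.L * 𝒢.resid (ξ k).2.2.2.2 / 𝒢.Δ with hB
  set η := |𝒢.κ * c| * 𝒢.M with hη
  have hWn : ‖W i‖ ≤ 𝒢.M := (pi_norm_le_iff_of_nonneg hM).2 hW
  have hdiff : ∀ c c' : ℝ, ∀ p : Rows n K × Rows m K,
      𝒢.energy R (𝒢.data R (W, Function.update ξ k (setX i c (ξ k)), G)) p
        - 𝒢.energy R (𝒢.data R (W, Function.update ξ k (setX i c' (ξ k)), G)) p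
      = 𝒢.logLike W p.1 (p.2 k) (setX i c (ξ k)) - 𝒢.logLike W p.1 (p.2 k) (setX i c' (ξ k)) := by
    intro c c' p
    rw [energy_data, energy_data, add_sub_add_right_eq_sub]
    dsimp only
    have h1 := sum_update_sub (fun μ a => 𝒢.logLike W p.1 (p.2 μ) a) ξ k (setX i c (ξ k))
    have h2 := sum_update_sub (fun μ a => 𝒢.logLike W p.1 (p.2 μ) a) ξ k (setX i c' (ξ k))
    linarith
  have hcneg : |𝒢.κ * -c| * 𝒢.M = η := by rw [mul_neg, abs_neg]
  obtain ⟨c₀, hc₀⟩ := 𝒢.energy_bdd m R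
    (𝒢.data R (W, Function.update ξ k (setX i 0 (ξ k)), G))
  have hpn : ∀ᵐ p ∂(𝒢.prior m), ‖p.1 i‖ ≤ 𝒢.M := by
    filter_upwards [𝒢.ae_abs_le_prior m] with p hp
    exact (pi_norm_le_iff_of_nonneg hM).2 (hp i)
  have key := abs_logZ_second_diff_le (π := 𝒢.prior m) (D := B * η)
    (E := (4 * 𝒢.L ^ 2 + 2 * 𝒢.L * 𝒢.resid (ξ k).2.2.2.2) / 𝒢.Δ * η ^ 2 + 4 * (B * η) ^ 2)
    (H := 𝒢.energy R (𝒢.data R (W, Function.update ξ k (setX i 0 (ξ k)), G)))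
    (H₁ := 𝒢.energy R (𝒢.data R (W, Function.update ξ k (setX i c (ξ k)), G)))
    (H₂ := 𝒢.energy R (𝒢.data R (W, Function.update ξ k (setX i (-c) (ξ k)), G)))
    (𝒢.measurable_energy_apply R _) hc₀ (𝒢.measurable_energy_apply R _)
    (𝒢.measurable_energy_apply R _)
    (by
      filter_upwards [hpn] with p hp
      rw [hdiff]
      exact (𝒢.logLike_diff_le (p.2 k) (ξ k) i c hWn hp).1)
    (by
      filter_upwards [hpn] with p hp
      rw [hdiff, ← hcneg]
      exact (𝒢.logLike_diff_le (p.2 k) (ξ k) i (-c) hWn hp).1)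
    (by
      filter_upwards [hpn] with p hp
      have h1 := hdiff c 0 p
      have h2 := hdiff (-c) 0 p
      have h3 := (𝒢.logLike_diff_le (p.2 k) (ξ k) i c hWn hp).2
      refine le_trans (le_of_eq ?_) h3
      congr 1
      linarith)
  refine key.trans (le_of_eq ?_)
  unfold curvBound
  ring

end GLM

end

noncomputable section

lemma MeasureTheory.MeasurePreserving.integral_comp_of_measurable {α β : Type*} [MeasurableSpace α]
    [MeasurableSpace β] {μ : Measure α} {ν : Measure β} {T : α → β} (h : MeasurePreserving T μ ν)
    {f : β → ℝ} (hf : Measurable f) : ∫ x, f (T x) ∂μ = ∫ y, f y ∂ν := by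
  rw [← h.map_eq, integral_map h.measurable.aemeasurable hf.aestronglyMeasurable]

lemma integral_sq_gaussianReal : ∫ x, x ^ 2 ∂(gaussianReal 0 1) = 1 := by
  have := variance_id_gaussianReal (μ := 0) (v := 1)
  rw [variance_eq_integral (by fun_prop)] at this
  simpa using this

lemma integrable_abs_pow_gaussianReal (k : ℕ) :
    Integrable (fun x => |x| ^ k) (gaussianReal 0 1) := by
  have := (memLp_id_gaussianReal (μ := 0) (v := 1) k).integrable_norm_pow'
  simpa using this

namespace GLM

variable {n K : ℕ} (𝒢 : GLM n K) {m : ℕ}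

lemma resid_measurable : Measurable 𝒢.resid := by unfold resid; fun_prop

lemma integrable_resid_pow (k : ℕ) : Integrable (fun z => 𝒢.resid z ^ k) (gaussianReal 0 1) := by
  unfold resid
  simp only [add_pow, mul_pow]
  refine integrable_finsetSum _ fun j _ => ?_
  have := (integrable_abs_pow_gaussianReal (k - j)).const_mul
    (2 ^ j * 𝒢.L ^ j * √𝒢.Δ ^ (k - j) * (k.choose j))
  refine this.congr (Eventually.of_forall fun x => ?_)
  simp only; ring

/-- The second moment of the bound on the log-likelihood of one observation. -/
def rowConst : ℝ := ∫ z, (𝒢.resid z ^ 2 / (2 * 𝒢.Δ)) ^ 2 ∂(gaussianReal 0 1)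

/-- The mean of the second difference bound. -/
def curvConst : ℝ := ∫ z, 𝒢.curvBound z ∂(gaussianReal 0 1)

lemma curvBound_measurable : Measurable 𝒢.curvBound := by
  have := 𝒢.resid_measurable
  unfold curvBound; fun_prop

lemma integrable_curvBound : Integrable 𝒢.curvBound (gaussianReal 0 1) := by
  have h1 := 𝒢.integrable_resid_pow 1
  have h2 := 𝒢.integrable_resid_pow 2
  have e : 𝒢.curvBound = fun z => 4 * 𝒢.L ^ 2 / 𝒢.Δ + 2 * 𝒢.L / 𝒢.Δ * 𝒢.resid z ^ 1
      + 32 * 𝒢.L ^ 2 / 𝒢.Δ ^ 2 * 𝒢.resid z ^ 2 := by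
    funext z; unfold curvBound; ring
  rw [e]
  exact ((integrable_const _).add (h1.const_mul _)).add (h2.const_mul _)

lemma curvBound_nonneg (z : ℝ) : 0 ≤ 𝒢.curvBound z := by
  have := 𝒢.L_nonneg
  have := 𝒢.Δ_pos
  have := 𝒢.resid_nonneg z
  unfold curvBound; positivity

lemma curvConst_nonneg : 0 ≤ 𝒢.curvConst := integral_nonneg 𝒢.curvBound_nonneg

lemma measurePreserving_z :
    MeasurePreserving (fun ξ : RowNoise n K => ξ.2.2.2.2) 𝒢.rowLaw (gaussianReal 0 1) :=
  measurePreserving_snd.comp (measurePreserving_snd.comp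
    (measurePreserving_snd.comp measurePreserving_snd))

lemma measurePreserving_xz (i : Fin n) :
    MeasurePreserving (fun ξ : RowNoise n K => (ξ.2.1 i, ξ.2.2.2.2)) 𝒢.rowLaw
      ((gaussianReal 0 1).prod (gaussianReal 0 1)) :=
  ((measurePreserving_eval (fun _ : Fin n => gaussianReal 0 1) i).prod
    (measurePreserving_snd.comp measurePreserving_snd)).comp measurePreserving_snd

lemma memLp_rowBound : MemLp 𝒢.rowBound 2 𝒢.rowLaw := by
  have h : MemLp (fun z => 𝒢.resid z ^ 2 / (2 * 𝒢.Δ)) 2 (gaussianReal 0 1) := by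
    have hm := 𝒢.resid_measurable
    rw [memLp_two_iff_integrable_sq (by fun_prop)]
    refine ((𝒢.integrable_resid_pow 4).const_mul (1 / (2 * 𝒢.Δ) ^ 2)).congr
      (Eventually.of_forall fun z => ?_)
    simp only; ring
  exact h.comp_measurePreserving 𝒢.measurePreserving_z

lemma integral_rowBound_sq : ∫ ξ, 𝒢.rowBound ξ ^ 2 ∂𝒢.rowLaw = 𝒢.rowConst := by
  have hm := 𝒢.resid_measurable
  exact 𝒢.measurePreserving_z.integral_comp_of_measurable
    (f := fun z => (𝒢.resid z ^ 2 / (2 * 𝒢.Δ)) ^ 2) (by fun_prop)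

lemma sideBound_measurable : Measurable 𝒢.sideBound := by unfold sideBound; fun_prop

lemma integral_sum_sq_gauss (k : ℕ) : Integrable (fun g : Fin k → ℝ => ∑ j, g j ^ 2) (gauss k) ∧
    ∫ g, ∑ j, g j ^ 2 ∂(gauss k) = k := by
  have h : Integrable (fun x : ℝ => x ^ 2) (gaussianReal 0 1) := by
    simpa using integrable_abs_pow_gaussianReal 2
  have hi : ∀ j : Fin k, Integrable (fun g : Fin k → ℝ => g j ^ 2) (gauss k) := fun j =>
    (measurePreserving_eval (fun _ : Fin k => gaussianReal 0 1) j).integrable_comp_of_integrable h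
  refine ⟨integrable_finsetSum _ fun j _ => hi j, ?_⟩
  rw [integral_finsetSum _ fun j _ => hi j]
  have : ∀ j : Fin k, ∫ g, g j ^ 2 ∂(gauss k) = 1 := fun j =>
    ((measurePreserving_eval (fun _ : Fin k => gaussianReal 0 1) j).integral_comp_of_measurable
      (f := fun x => x ^ 2) (by fun_prop)).trans integral_sq_gaussianReal
  simp [this]

variable {A : Matrix (Fin K) (Fin K) ℝ} {b : ℝ} (hR : ∀ l k, |(A * Aᵀ) l k| ≤ b)

include hR in
lemma sideBound_sq_le (g : Fin K → ℝ) :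
    𝒢.sideBound (A *ᵥ g) ^ 2 ≤ 𝒢.M ^ 2 * K ^ 2 * b * ∑ j, g j ^ 2 := by
  unfold sideBound
  have h1 := sq_sum_le_card_mul_sum_sq (s := (Finset.univ : Finset (Fin K)))
    (f := fun l => |(A *ᵥ g) l|)
  simp only [sq_abs, Finset.card_univ, Fintype.card_fin] at h1
  have h2 : ∀ l, (A *ᵥ g) l ^ 2 ≤ b * ∑ j, g j ^ 2 := by
    intro l
    have h3 := Finset.sum_mul_sq_le_sq_mul_sq Finset.univ (fun j => A l j) g
    have h4 : ∑ j, A l j ^ 2 = (A * Aᵀ) l l := by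
      simp [Matrix.mul_apply, sq]
    rw [h4] at h3
    exact h3.trans (mul_le_mul_of_nonneg_right ((le_abs_self _).trans (hR l l))
      (Finset.sum_nonneg fun j _ => sq_nonneg _))
  have h3 : ∑ l, (A *ᵥ g) l ^ 2 ≤ K * (b * ∑ j, g j ^ 2) :=
    (Finset.sum_le_sum fun l _ => h2 l).trans_eq (by simp)
  rw [mul_pow]
  calc _ ≤ 𝒢.M ^ 2 * (K * (K * (b * ∑ j, g j ^ 2))) :=
        mul_le_mul_of_nonneg_left (h1.trans (mul_le_mul_of_nonneg_left h3 (Nat.cast_nonneg _)))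
          (sq_nonneg _)
    _ = _ := by ring

include hR in
lemma memLp_sideBound : MemLp 𝒢.sideBound 2 (colored A) ∧
    ∫ g, 𝒢.sideBound g ^ 2 ∂(colored A) ≤ 𝒢.M ^ 2 * K ^ 3 * b := by
  have hs := 𝒢.sideBound_measurable
  have hA := measurable_mulVec A
  obtain ⟨h1, h2⟩ := integral_sum_sq_gauss K
  have hle := 𝒢.sideBound_sq_le hR
  have hi : Integrable (fun g => 𝒢.sideBound (A *ᵥ g) ^ 2) (gauss K) := by
    refine (h1.const_mul (𝒢.M ^ 2 * K ^ 2 * b)).mono'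
      ((hs.comp hA).pow_const 2).aestronglyMeasurable (Eventually.of_forall fun g => ?_)
    rw [Real.norm_eq_abs, abs_of_nonneg (sq_nonneg _)]
    exact hle g
  constructor
  · rw [memLp_two_iff_integrable_sq hs.aestronglyMeasurable, colored,
      integrable_map_measure (hs.pow_const 2).aestronglyMeasurable hA.aemeasurable]
    exact hi
  · unfold colored
    rw [integral_map hA.aemeasurable (hs.pow_const 2).aestronglyMeasurable]
    refine (integral_mono hi (h1.const_mul _) hle).trans (le_of_eq ?_)
    rw [integral_const_mul, h2]; ring

/-- Change the sign of one entry of the design matrix. -/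
lemma measurePreserving_flip (i : Fin n) (k : Fin m) :
    MeasurePreserving (fun ξ : Fin m → RowNoise n K =>
      Function.update ξ k (setX i (-(ξ k).2.1 i) (ξ k)))
      (Measure.pi fun _ => 𝒢.rowLaw) (Measure.pi fun _ => 𝒢.rowLaw) := by
  have h0 : MeasurePreserving (fun x : ℝ => -x) (gaussianReal 0 1) (gaussianReal 0 1) :=
    ⟨measurable_neg, by rw [gaussianReal_map_neg, neg_zero]⟩
  have h1 : MeasurePreserving (fun x : Fin n → ℝ => Function.update x i (-x i))
      (gauss n) (gauss n) := by
    have h := measurePreserving_pi (fun _ : Fin n => gaussianReal 0 1) (fun _ => gaussianReal 0 1)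
      (f := fun j => if j = i then (fun x : ℝ => -x) else id) (fun j => by
        split_ifs
        · exact h0
        · exact MeasurePreserving.id _)
    convert! h using 1
    funext x j
    by_cases hj : j = i
    · subst hj; simp
    · simp [hj]
  have h2 : MeasurePreserving (fun ξ : RowNoise n K => setX i (-ξ.2.1 i) ξ) 𝒢.rowLaw 𝒢.rowLaw :=
    (MeasurePreserving.id _).prod (h1.prod (MeasurePreserving.id _))
  have h := measurePreserving_pi (fun _ : Fin m => 𝒢.rowLaw) (fun _ => 𝒢.rowLaw)
    (f := fun μ => if μ = k then (fun ξ : RowNoise n K => setX i (-ξ.2.1 i) ξ) else id) (fun j => by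
      split_ifs
      · exact h2
      · exact MeasurePreserving.id _)
  convert! h using 1
  funext ξ j
  by_cases hj : j = k
  · subst hj; simp
  · simp [hj]

lemma measurable_setX (i : Fin n) (c : ℝ) : Measurable (setX (K := K) i c) := by
  unfold setX
  have : Measurable fun ξ : RowNoise n K => Function.update ξ.2.1 i c := by
    refine measurable_pi_lambda _ fun j => ?_
    by_cases hj : j = i
    · subst hj; simp
    · simp only [Function.update_of_ne hj]; fun_prop
  fun_prop

lemma integrable_sum_rowBound (c : ℝ) :
    Integrable (fun ξ : Fin m → RowNoise n K => c + ∑ μ, 𝒢.rowBound (ξ μ))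
      (Measure.pi fun _ => 𝒢.rowLaw) := by
  refine (integrable_const _).add (integrable_finsetSum _ fun μ _ => ?_)
  exact (measurePreserving_eval (fun _ : Fin m => 𝒢.rowLaw) μ).integrable_comp_of_integrable
    (𝒢.memLp_rowBound.integrable (by norm_num))

/-- The effect on the mean of a function of setting a column of the design matrix to zero, when
the second differences in the entries of the column are small. -/
lemma abs_integral_setX_sub_le {J : (Fin m → RowNoise n K) → ℝ} (hJm : Measurable J) {c₀ : ℝ}
    (hJb : ∀ ξ, |J ξ| ≤ c₀ + ∑ μ, 𝒢.rowBound (ξ μ)) (i : Fin n)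
    (hJ : ∀ ξ k c, |J (Function.update ξ k (setX i c (ξ k)))
      + J (Function.update ξ k (setX i (-c) (ξ k))) - 2 * J (Function.update ξ k (setX i 0 (ξ k)))|
      ≤ (|𝒢.κ * c| * 𝒢.M) ^ 2 * 𝒢.curvBound (ξ k).2.2.2.2) :
    |∫ ξ, J (fun μ => setX i 0 (ξ μ)) ∂(Measure.pi fun _ => 𝒢.rowLaw)
      - ∫ ξ, J ξ ∂(Measure.pi fun _ => 𝒢.rowLaw)| ≤ m * (𝒢.κ ^ 2 * 𝒢.M ^ 2 * 𝒢.curvConst / 2) := by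
  set P : Measure (Fin m → RowNoise n K) := Measure.pi fun _ => 𝒢.rowLaw with hP
  set hyb : Finset (Fin m) → (Fin m → RowNoise n K) → (Fin m → RowNoise n K) :=
    fun S ξ μ => if μ ∈ S then setX i 0 (ξ μ) else ξ μ with hhyb
  have hybm : ∀ S, Measurable (hyb S) := fun S => measurable_pi_lambda _ fun μ => by
    simp only [hhyb]
    split_ifs
    · exact (measurable_setX i 0).comp (measurable_pi_apply μ)
    · exact measurable_pi_apply μ
  have hrow : ∀ S ξ μ, 𝒢.rowBound (hyb S ξ μ) = 𝒢.rowBound (ξ μ) := by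
    intro S ξ μ
    simp only [hhyb]
    split_ifs <;> rfl
  have hint : ∀ S, Integrable (fun ξ => J (hyb S ξ)) P := fun S => by
    refine (𝒢.integrable_sum_rowBound c₀).mono' (hJm.comp (hybm S)).aestronglyMeasurable
      (Eventually.of_forall fun ξ => ?_)
    have := hJb (hyb S ξ)
    simpa only [hrow, Real.norm_eq_abs] using this
  have main : ∀ S : Finset (Fin m), |∫ ξ, J (hyb S ξ) ∂P - ∫ ξ, J ξ ∂P|
      ≤ S.card * (𝒢.κ ^ 2 * 𝒢.M ^ 2 * 𝒢.curvConst / 2) := by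
    intro S
    induction S using Finset.induction_on with
    | empty =>
      have : hyb ∅ = id := by funext ξ μ; simp [hhyb]
      simp [this]
    | insert k S hk ih =>
      have hfl := 𝒢.measurePreserving_flip (m := m) i k
      rw [← hP] at hfl
      have e1 : ∀ ξ, hyb S ξ = Function.update (hyb S ξ) k (setX i ((ξ k).2.1 i) (hyb S ξ k)) := by
        intro ξ
        have : setX i ((ξ k).2.1 i) (hyb S ξ k) = hyb S ξ k := by
          simp only [hhyb, if_neg hk, setX, Function.update_eq_self]
        rw [this, Function.update_eq_self]
      have e2 : ∀ ξ, hyb S (Function.update ξ k (setX i (-(ξ k).2.1 i) (ξ k)))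
          = Function.update (hyb S ξ) k (setX i (-(ξ k).2.1 i) (hyb S ξ k)) := by
        intro ξ; funext μ
        by_cases hμ : μ = k
        · subst hμ; simp [hhyb, hk]
        · simp [hhyb, hμ]
      have e3 : ∀ ξ, hyb (insert k S) ξ = Function.update (hyb S ξ) k (setX i 0 (hyb S ξ k)) := by
        intro ξ; funext μ
        by_cases hμ : μ = k
        · subst hμ; simp [hhyb, hk]
        · simp [hhyb, hμ]
      have hflip : ∫ ξ, J (Function.update (hyb S ξ) k (setX i (-(ξ k).2.1 i) (hyb S ξ k))) ∂P
          = ∫ ξ, J (hyb S ξ) ∂P := by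
        simp only [← e2]
        exact hfl.integral_comp_of_measurable (hJm.comp (hybm S))
      have hfi : Integrable (fun ξ => J (Function.update (hyb S ξ) k
          (setX i (-(ξ k).2.1 i) (hyb S ξ k)))) P := by
        simp only [← e2]
        exact hfl.integrable_comp_of_integrable (hint S)
      have hsum : Integrable (fun ξ => J (hyb S ξ) + J (Function.update (hyb S ξ) k
          (setX i (-(ξ k).2.1 i) (hyb S ξ k)))) P := (hint S).add hfi
      have hq := 𝒢.measurePreserving_xz i
      have hcm := 𝒢.curvBound_measurable
      have hpe := measurePreserving_eval (fun _ : Fin m => 𝒢.rowLaw) k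
      rw [← hP] at hpe
      have hqk := hq.comp hpe
      have ix2 : Integrable (fun x : ℝ => x ^ 2) (gaussianReal 0 1) := by
        simpa using integrable_abs_pow_gaussianReal 2
      have ixz : Integrable (fun q : ℝ × ℝ => q.1 ^ 2 * 𝒢.curvBound q.2)
          ((gaussianReal 0 1).prod (gaussianReal 0 1)) := ix2.mul_prod 𝒢.integrable_curvBound
      have hb2 : ∫ ξ : Fin m → RowNoise n K, (ξ k).2.1 i ^ 2 * 𝒢.curvBound (ξ k).2.2.2.2 ∂P
          = 𝒢.curvConst := by
        have h1 := hqk.integral_comp_of_measurable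
          (f := fun q => q.1 ^ 2 * 𝒢.curvBound q.2) (by fun_prop)
        simp only [Function.comp_def, Function.eval] at h1
        rw [h1, integral_prod_mul (f := fun x : ℝ => x ^ 2), integral_sq_gaussianReal, one_mul]
        rfl
      have hbi : Integrable (fun ξ : Fin m → RowNoise n K =>
          𝒢.κ ^ 2 * 𝒢.M ^ 2 * ((ξ k).2.1 i ^ 2 * 𝒢.curvBound (ξ k).2.2.2.2)) P :=
        (hqk.integrable_comp_of_integrable ixz).const_mul _
      have hstep : |2 * (∫ ξ, J (hyb S ξ) ∂P - ∫ ξ, J (hyb (insert k S) ξ) ∂P)|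
          ≤ 𝒢.κ ^ 2 * 𝒢.M ^ 2 * 𝒢.curvConst := by
        have e4 : 2 * (∫ ξ, J (hyb S ξ) ∂P - ∫ ξ, J (hyb (insert k S) ξ) ∂P)
            = ∫ ξ, (J (hyb S ξ) + J (Function.update (hyb S ξ) k
              (setX i (-(ξ k).2.1 i) (hyb S ξ k))) - 2 * J (hyb (insert k S) ξ)) ∂P := by
          rw [integral_sub hsum ((hint _).const_mul 2), integral_add (hint S) hfi, hflip,
            integral_const_mul]
          ring
        rw [e4]
        refine abs_integral_le_integral_abs.trans ?_
        rw [← hb2, ← integral_const_mul]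
        refine integral_mono (hsum.sub ((hint _).const_mul 2)).abs hbi fun ξ => ?_
        have h1 := hJ (hyb S ξ) k ((ξ k).2.1 i)
        rw [← e1, ← e3] at h1
        refine h1.trans (le_of_eq ?_)
        have h2 : (hyb S ξ k).2.2.2.2 = (ξ k).2.2.2.2 := by simp [hhyb, hk]
        rw [h2, mul_pow, sq_abs]
        ring
      rw [abs_mul, abs_two, abs_sub_comm] at hstep
      rw [Finset.card_insert_of_notMem hk]
      push_cast
      have h5 := abs_sub_le (∫ ξ, J (hyb (insert k S) ξ) ∂P) (∫ ξ, J (hyb S ξ) ∂P) (∫ ξ, J ξ ∂P)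
      linarith
  have := main Finset.univ
  simpa [hhyb] using this

end GLM

end

noncomputable section

namespace GLM

variable {n K : ℕ} (𝒢 : GLM n K) {m : ℕ} {A : Matrix (Fin K) (Fin K) ℝ} {b : ℝ}

lemma memLp_sum_eval {α : Type*} [MeasurableSpace α] {μ : Measure α} [IsProbabilityMeasure μ]
    {N : ℕ} {f : α → ℝ} (hf : MemLp f 2 μ) (c : ℝ) :
    MemLp (fun x : Fin N → α => ∑ i, (c + f (x i))) 2 (Measure.pi fun _ => μ) :=
  memLp_finsetSum _ fun i _ => (memLp_const c).add
    (hf.comp_measurePreserving (measurePreserving_eval (fun _ : Fin N => μ) i))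

lemma memLp_rows_side (hR : ∀ l k, |(A * Aᵀ) l k| ≤ b) (c c' : ℝ) :
    MemLp (fun q : (Fin m → RowNoise n K) × Rows n K => ∑ μ, (c + 𝒢.rowBound (q.1 μ))
      + ∑ i, (c' + 𝒢.sideBound (q.2 i))) 2
      ((Measure.pi fun _ => 𝒢.rowLaw).prod (Measure.pi fun _ => colored A)) :=
  ((memLp_sum_eval 𝒢.memLp_rowBound c).comp_measurePreserving measurePreserving_fst).add
    ((memLp_sum_eval (𝒢.memLp_sideBound hR).1 c').comp_measurePreserving measurePreserving_snd)

lemma memLp_fe_apply (hb : 0 ≤ b) (hR : ∀ l k, |(A * Aᵀ) l k| ≤ b) {W : Rows n K}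
    (hW : ∀ i l, |W i l| ≤ 𝒢.M) :
    MemLp (fun q : (Fin m → RowNoise n K) × Rows n K => 𝒢.fe (A * Aᵀ) (W, q)) 2
      ((Measure.pi fun _ => 𝒢.rowLaw).prod (Measure.pi fun _ => colored A)) := by
  have hm := (𝒢.measurable_fe (m := m) (A * Aᵀ)).comp (measurable_prodMk_left (x := W))
  simp only [Function.comp_def] at hm
  refine (𝒢.memLp_rows_side hR (|𝒢.logConst|) (3 / 2 * K ^ 2 * b * 𝒢.M ^ 2)).of_le
    hm.aestronglyMeasurable (Eventually.of_forall fun q => ?_)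
  rw [Real.norm_eq_abs, Real.norm_eq_abs]
  exact (𝒢.abs_fe_le hb hR q.1 q.2 hW).trans (le_abs_self _)

lemma memLp_fe (hb : 0 ≤ b) (hR : ∀ l k, |(A * Aᵀ) l k| ≤ b) :
    MemLp (𝒢.fe (m := m) (A * Aᵀ)) 2 (𝒢.law m A) := by
  refine ((𝒢.memLp_rows_side (m := m) hR (|𝒢.logConst|)
    (3 / 2 * K ^ 2 * b * 𝒢.M ^ 2)).comp_measurePreserving
    (measurePreserving_snd (μ := Measure.pi fun _ : Fin n => 𝒢.P0))).of_le
    (𝒢.measurable_fe _).aestronglyMeasurable ?_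
  filter_upwards [Measure.quasiMeasurePreserving_fst.ae 𝒢.ae_abs_le_rows] with ω hω
  rw [Real.norm_eq_abs, Real.norm_eq_abs]
  exact (𝒢.abs_fe_le hb hR ω.2.1 ω.2.2 hω).trans (le_abs_self _)

/-- The free entropy averaged over the noise of the side channel. -/
def feSide (A : Matrix (Fin K) (Fin K) ℝ) (W : Rows n K) (ξ : Fin m → RowNoise n K) : ℝ :=
  ∫ G, 𝒢.fe (A * Aᵀ) (W, ξ, G) ∂(Measure.pi fun _ => colored A)

/-- The free entropy averaged over everything but the hidden weights. -/
def feMean (m : ℕ) (A : Matrix (Fin K) (Fin K) ℝ) (W : Rows n K) : ℝ :=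
  ∫ q, 𝒢.fe (m := m) (A * Aᵀ) (W, q)
    ∂((Measure.pi fun _ => 𝒢.rowLaw).prod (Measure.pi fun _ => colored A))

lemma efronStein_side (hR : ∀ l k, |(A * Aᵀ) l k| ≤ b) (W : Rows n K)
    (ξ : Fin m → RowNoise n K) :
    MemLp (fun G => 𝒢.fe (A * Aᵀ) (W, ξ, G)) 2 (Measure.pi fun _ => colored A) ∧
    ∫ G, (𝒢.fe (A * Aᵀ) (W, ξ, G) - 𝒢.feSide A W ξ) ^ 2 ∂(Measure.pi fun _ => colored A)
      ≤ 4 * n * (𝒢.M ^ 2 * K ^ 3 * b) := by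
  have hm : Measurable fun G : Rows n K => 𝒢.fe (A * Aᵀ) (W, ξ, G) := by
    have h := (𝒢.measurable_fe (m := m) (A * Aᵀ)).comp
      (measurable_prodMk_left.comp (measurable_prodMk_left (x := ξ)) :
        Measurable fun G : Rows n K => (W, ξ, G))
    simpa only [Function.comp_def] using h
  have h := efronStein (μ := colored A) (T := univ) (Eventually.of_forall fun _ => mem_univ _)
    (𝒢.memLp_sideBound hR).1 hm fun i x y _ _ => 𝒢.fe_update_side (A * Aᵀ) W ξ x i y
  exact ⟨h.1, h.2.trans (mul_le_mul_of_nonneg_left (𝒢.memLp_sideBound hR).2 (by positivity))⟩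

lemma integrable_fe_side (hR : ∀ l k, |(A * Aᵀ) l k| ≤ b) (W : Rows n K)
    (ξ : Fin m → RowNoise n K) :
    Integrable (fun G => 𝒢.fe (A * Aᵀ) (W, ξ, G)) (Measure.pi fun _ => colored A) :=
  (𝒢.efronStein_side hR W ξ).1.integrable (by norm_num)

lemma measurable_feSide (W : Rows n K) : Measurable (𝒢.feSide (m := m) A W) := by
  have h := (𝒢.measurable_fe (m := m) (A * Aᵀ)).comp (measurable_prodMk_left (x := W))
  simp only [Function.comp_def] at h
  exact (h.stronglyMeasurable.integral_prod_right' (ν := Measure.pi fun _ => colored A)).measurable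

lemma efronStein_row (hR : ∀ l k, |(A * Aᵀ) l k| ≤ b) (W : Rows n K) :
    ∫ ξ, (𝒢.feSide A W ξ - ∫ ξ, 𝒢.feSide A W ξ ∂(Measure.pi fun _ : Fin m => 𝒢.rowLaw)) ^ 2
      ∂(Measure.pi fun _ : Fin m => 𝒢.rowLaw) ≤ 4 * m * 𝒢.rowConst := by
  have h := efronStein (μ := 𝒢.rowLaw) (T := univ) (Eventually.of_forall fun _ => mem_univ _)
    𝒢.memLp_rowBound (𝒢.measurable_feSide (m := m) (A := A) W) fun k ξ ξ' _ _ => by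
      unfold feSide
      rw [← integral_sub (𝒢.integrable_fe_side hR W _) (𝒢.integrable_fe_side hR W _)]
      exact abs_integral_le_of_ae_abs_le
        (Eventually.of_forall fun G => 𝒢.fe_update_row (A * Aᵀ) W ξ G k ξ')
  rw [𝒢.integral_rowBound_sq] at h
  exact h.2

/-- The conditional variance given the hidden weights. -/
lemma condVar_le (hb : 0 ≤ b) (hR : ∀ l k, |(A * Aᵀ) l k| ≤ b) {W : Rows n K}
    (hW : ∀ i l, |W i l| ≤ 𝒢.M) :
    ∫ q, (𝒢.fe (m := m) (A * Aᵀ) (W, q) - 𝒢.feMean m A W) ^ 2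
      ∂((Measure.pi fun _ => 𝒢.rowLaw).prod (Measure.pi fun _ => colored A))
      ≤ 4 * n * (𝒢.M ^ 2 * K ^ 3 * b) + 4 * m * 𝒢.rowConst := by
  have hm := (𝒢.measurable_fe (m := m) (A * Aᵀ)).comp (measurable_prodMk_left (x := W))
  simp only [Function.comp_def] at hm
  exact variance_prod_le hm (𝒢.memLp_fe_apply hb hR hW)
    (Eventually.of_forall fun ξ => (𝒢.efronStein_side hR W ξ).2) (𝒢.efronStein_row hR W)

lemma abs_feSide_le (hb : 0 ≤ b) (hR : ∀ l k, |(A * Aᵀ) l k| ≤ b) {W : Rows n K}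
    (hW : ∀ i l, |W i l| ≤ 𝒢.M) : ∃ c, ∀ ξ : Fin m → RowNoise n K,
    |𝒢.feSide A W ξ| ≤ c + ∑ μ, 𝒢.rowBound (ξ μ) := by
  set S : Rows n K → ℝ := fun G => ∑ i, (3 / 2 * K ^ 2 * b * 𝒢.M ^ 2 + 𝒢.sideBound (G i)) with hS
  have hSi : Integrable S (Measure.pi fun _ => colored A) :=
    (memLp_sum_eval (𝒢.memLp_sideBound hR).1 _).integrable (by norm_num)
  refine ⟨m * |𝒢.logConst| + ∫ G, S G ∂(Measure.pi fun _ => colored A), fun ξ => ?_⟩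
  have h1 : |𝒢.feSide A W ξ| ≤ ∫ G, (∑ μ, (|𝒢.logConst| + 𝒢.rowBound (ξ μ)) + S G)
      ∂(Measure.pi fun _ => colored A) := by
    refine abs_integral_le_integral_abs.trans (integral_mono (𝒢.integrable_fe_side hR W ξ).abs
      ((integrable_const _).add hSi) fun G => 𝒢.abs_fe_le hb hR ξ G hW)
  refine h1.trans (le_of_eq ?_)
  rw [integral_add (integrable_const _) hSi, integral_const, Finset.sum_add_distrib]
  simp
  ring

lemma feMean_eq (hb : 0 ≤ b) (hR : ∀ l k, |(A * Aᵀ) l k| ≤ b) {W : Rows n K}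
    (hW : ∀ i l, |W i l| ≤ 𝒢.M) :
    𝒢.feMean m A W = ∫ ξ, 𝒢.feSide A W ξ ∂(Measure.pi fun _ : Fin m => 𝒢.rowLaw) :=
  integral_prod _ ((𝒢.memLp_fe_apply hb hR hW).integrable (by norm_num))

lemma abs_feSide_setX_sub_le (hb : 0 ≤ b) (hR : ∀ l k, |(A * Aᵀ) l k| ≤ b) {W : Rows n K}
    (hW : ∀ i l, |W i l| ≤ 𝒢.M) (i : Fin n) :
    |∫ ξ, 𝒢.feSide A W (fun μ => setX i 0 (ξ μ)) ∂(Measure.pi fun _ : Fin m => 𝒢.rowLaw)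
      - 𝒢.feMean m A W| ≤ m * (𝒢.κ ^ 2 * 𝒢.M ^ 2 * 𝒢.curvConst / 2) := by
  obtain ⟨c, hc⟩ := 𝒢.abs_feSide_le (m := m) hb hR hW
  rw [𝒢.feMean_eq hb hR hW]
  refine 𝒢.abs_integral_setX_sub_le (𝒢.measurable_feSide W) hc i fun ξ k x => ?_
  have hi := fun ξ : Fin m → RowNoise n K => 𝒢.integrable_fe_side hR W ξ
  have hs : Integrable (fun G => 𝒢.fe (A * Aᵀ) (W, Function.update ξ k (setX i x (ξ k)), G)
      + 𝒢.fe (A * Aᵀ) (W, Function.update ξ k (setX i (-x) (ξ k)), G))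
      (Measure.pi fun _ => colored A) := (hi _).add (hi _)
  unfold feSide
  rw [← integral_add (hi _) (hi _), ← integral_const_mul, ← integral_sub hs ((hi _).const_mul 2)]
  exact abs_integral_le_of_ae_abs_le
    (Eventually.of_forall fun G => 𝒢.fe_second_diff ξ G k i x (hW i))

lemma abs_feMean_update_le (hb : 0 ≤ b) (hR : ∀ l k, |(A * Aᵀ) l k| ≤ b) {W : Rows n K}
    (hW : ∀ i l, |W i l| ≤ 𝒢.M) (i : Fin n) {w : Fin K → ℝ} (hw : ∀ l, |w l| ≤ 𝒢.M) :
    |𝒢.feMean m A W - 𝒢.feMean m A (Function.update W i w)|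
      ≤ m * (𝒢.κ ^ 2 * 𝒢.M ^ 2 * 𝒢.curvConst) + 2 * K ^ 2 * b * 𝒢.M ^ 2 := by
  have hW' : ∀ j l, |Function.update W i w j l| ≤ 𝒢.M := by
    intro j l
    by_cases hj : j = i
    · subst hj; simpa using hw l
    · rw [Function.update_of_ne hj]; exact hW j l
  have h1 := 𝒢.abs_feSide_setX_sub_le (m := m) hb hR hW i
  have h2 := 𝒢.abs_feSide_setX_sub_le (m := m) hb hR hW' i
  have hint : ∀ {W : Rows n K}, (∀ i l, |W i l| ≤ 𝒢.M) →
      Integrable (fun ξ : Fin m → RowNoise n K => 𝒢.feSide A W (fun μ => setX i 0 (ξ μ)))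
      (Measure.pi fun _ => 𝒢.rowLaw) := by
    intro W hW
    obtain ⟨c, hc⟩ := 𝒢.abs_feSide_le (m := m) hb hR hW
    refine (𝒢.integrable_sum_rowBound c).mono' ((𝒢.measurable_feSide W).comp
      (measurable_pi_lambda _ fun μ => (measurable_setX i 0).comp
        (measurable_pi_apply μ))).aestronglyMeasurable (Eventually.of_forall fun ξ => ?_)
    exact hc fun μ => setX i 0 (ξ μ)
  have h3 : |∫ ξ, 𝒢.feSide A W (fun μ => setX i 0 (ξ μ)) ∂(Measure.pi fun _ : Fin m => 𝒢.rowLaw)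
      - ∫ ξ, 𝒢.feSide A (Function.update W i w) (fun μ => setX i 0 (ξ μ))
        ∂(Measure.pi fun _ : Fin m => 𝒢.rowLaw)| ≤ 2 * K ^ 2 * b * 𝒢.M ^ 2 := by
    rw [← integral_sub (hint hW) (hint hW')]
    refine abs_integral_le_of_ae_abs_le (Eventually.of_forall fun ξ => ?_)
    unfold feSide
    rw [← integral_sub (𝒢.integrable_fe_side hR W _) (𝒢.integrable_fe_side hR _ _)]
    exact abs_integral_le_of_ae_abs_le (Eventually.of_forall fun G =>
      𝒢.fe_update_weight hb hR G i (hW i) hw fun μ => by simp [setX])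
  rw [abs_le] at *
  constructor <;> linarith [h1.1, h1.2, h2.1, h2.2, h3.1, h3.2]

/-- The free entropy concentrates. -/
theorem variance_fe_le (hb : 0 ≤ b) (hR : ∀ l k, |(A * Aᵀ) l k| ≤ b) :
    ∫ ω, (𝒢.fe (A * Aᵀ) ω - ∫ ω, 𝒢.fe (A * Aᵀ) ω ∂(𝒢.law m A)) ^ 2 ∂(𝒢.law m A)
      ≤ 4 * n * (𝒢.M ^ 2 * K ^ 3 * b) + 4 * m * 𝒢.rowConst
        + n * (m * (𝒢.κ ^ 2 * 𝒢.M ^ 2 * 𝒢.curvConst) + 2 * K ^ 2 * b * 𝒢.M ^ 2) ^ 2 := by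
  refine variance_prod_le (𝒢.measurable_fe _) (𝒢.memLp_fe hb hR) ?_ ?_
  · filter_upwards [𝒢.ae_abs_le_rows] with W hW
    exact 𝒢.condVar_le hb hR hW
  · set c := m * (𝒢.κ ^ 2 * 𝒢.M ^ 2 * 𝒢.curvConst) + 2 * K ^ 2 * b * 𝒢.M ^ 2 with hc
    have hm : Measurable (𝒢.feMean m A) :=
      ((𝒢.measurable_fe (m := m) (A * Aᵀ)).stronglyMeasurable.integral_prod_right'
        (ν := (Measure.pi fun _ => 𝒢.rowLaw).prod (Measure.pi fun _ => colored A))).measurable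
    have h := efronStein (μ := 𝒢.P0) (T := {w | ∀ l, |w l| ≤ 𝒢.M}) 𝒢.ae_abs_le
      (c := fun _ => c / 2) (memLp_const _) hm fun i W w hW hw => by
        have := 𝒢.abs_feMean_update_le (m := m) hb hR hW i hw
        linarith
    refine h.2.trans (le_of_eq ?_)
    simp
    ring

end GLM

end

noncomputable section

lemma abs_dotProduct_le_mul {K : ℕ} {v w : Fin K → ℝ} {c M : ℝ} (hM : 0 ≤ M) (hv : ∑ l, |v l| ≤ c)
    (hw : ∀ l, |w l| ≤ M) : |v ⬝ᵥ w| ≤ c * M := by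
  refine (Finset.abs_sum_le_sum_abs _ _).trans ?_
  refine le_trans ?_ (mul_le_mul_of_nonneg_right hv hM)
  rw [Finset.sum_mul]
  refine Finset.sum_le_sum fun l _ => ?_
  rw [abs_mul]
  exact mul_le_mul_of_nonneg_left (hw l) (abs_nonneg _)

lemma side_add_vecMulVec {K : ℕ} (R : Matrix (Fin K) (Fin K) ℝ) (v w W G : Fin K → ℝ) {l : ℝ}
    (z : ℝ) :
    GLM.side (R + l • Matrix.vecMulVec v v) w ((R + l • Matrix.vecMulVec v v) *ᵥ W
        + (G + (√l * z) • v))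
      = GLM.side R w (R *ᵥ W + G) + l * ((v ⬝ᵥ w) * (v ⬝ᵥ W) - (v ⬝ᵥ w) ^ 2 / 2)
        + √l * ((v ⬝ᵥ w) * z) := by
  unfold GLM.side
  simp only [Matrix.add_mulVec, Matrix.smul_mulVec, Matrix.vecMulVec_mulVec, dotProduct_add,
    dotProduct_smul, smul_eq_mul, dotProduct_comm w v, op_smul_eq_smul]
  ring

namespace GLM

variable {n K : ℕ} (𝒢 : GLM n K) (m : ℕ)

/-- The component of the hidden weights along `v`. -/
def comp (v : Fin K → ℝ) (p : Rows n K × Rows m K) (i : Fin n) : ℝ := v ⬝ᵥ p.1 i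

lemma measurable_comp (v : Fin K → ℝ) : Measurable (comp (n := n) m v) := by
  unfold comp dotProduct; fun_prop

lemma abs_comp_le {v : Fin K → ℝ} (hv : ∑ l, |v l| ≤ 2) :
    ∀ᵐ p ∂(𝒢.prior m), ∀ i, |comp m v p i| ≤ 2 * 𝒢.M := by
  filter_upwards [𝒢.ae_abs_le_prior m] with p hp i
  exact abs_dotProduct_le_mul 𝒢.M_nonneg hv (hp i)

/-- The model with an additional scalar side channel on the component along `v`. -/
def channel (A : Matrix (Fin K) (Fin K) ℝ) (v : Fin K → ℝ) (hv : ∑ l, |v l| ≤ 2) :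
    SideChannel (Omega n m K) (Rows n K × Rows m K) n where
  law := 𝒢.law m A
  prior := 𝒢.prior m
  xs ω := comp m v (truth n m K ω)
  x := comp m v
  H ω p := 𝒢.energy (A * Aᵀ) (𝒢.data (A * Aᵀ) ω) p
  M := 2 * 𝒢.M
  prob_law := inferInstance
  prob_prior := inferInstance
  measurable_xs := (measurable_comp m v).comp (measurable_truth m)
  measurable_x := measurable_comp m v
  measurable_H := 𝒢.measurable_energy_data _
  M_nonneg := mul_nonneg zero_le_two 𝒢.M_nonneg
  abs_xs_le := (𝒢.measurePreserving_truth m A).quasiMeasurePreserving.ae (𝒢.abs_comp_le m hv)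
  abs_x_le := 𝒢.abs_comp_le m hv
  bdd_H _ := 𝒢.energy_bdd m _ _

/-- The two Gaussian side channels merged into one. -/
def merge (v : Fin K → ℝ) (l : ℝ) (q : Omega n m K × (Fin n → ℝ)) : Omega n m K :=
  (q.1.1, q.1.2.1, fun i => q.1.2.2 i + (√l * q.2 i) • v)

variable {A A' : Matrix (Fin K) (Fin K) ℝ} {v : Fin K → ℝ} {l : ℝ}

lemma measurePreserving_merge (hl : 0 ≤ l)
    (h : A' * A'ᵀ = A * Aᵀ + l • Matrix.vecMulVec v v) :
    MeasurePreserving (merge m v l) ((𝒢.law m A).prod (Measure.pi fun _ => gaussianReal 0 1))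
      (𝒢.law m A') := by
  have h1 : MeasurePreserving (fun (q : Rows n K × (Fin n → ℝ)) i => q.1 i + (√l * q.2 i) • v)
      ((Measure.pi fun _ => colored A).prod (Measure.pi fun _ => gaussianReal 0 1))
      (Measure.pi fun _ => colored A') :=
    (measurePreserving_pi (fun _ : Fin n => (colored A).prod (gaussianReal 0 1))
      (fun _ => colored A') fun _ => measurePreserving_colored_add hl h).comp
      (measurePreserving_arrowProdEquivProdArrow (Fin K → ℝ) ℝ (Fin n)
        (fun _ => colored A) (fun _ => gaussianReal 0 1)).symm
  have h2 := (MeasurePreserving.id (Measure.pi fun _ : Fin m => 𝒢.rowLaw)).prod h1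
  have h3 := h2.comp (measurePreserving_prodAssoc (Measure.pi fun _ : Fin m => 𝒢.rowLaw)
    (Measure.pi fun _ : Fin n => colored A) (Measure.pi fun _ : Fin n => gaussianReal 0 1))
  have h4 := (MeasurePreserving.id (Measure.pi fun _ : Fin n => 𝒢.P0)).prod h3
  exact h4.comp (measurePreserving_prodAssoc (Measure.pi fun _ : Fin n => 𝒢.P0)
    ((Measure.pi fun _ : Fin m => 𝒢.rowLaw).prod (Measure.pi fun _ : Fin n => colored A))
    (Measure.pi fun _ : Fin n => gaussianReal 0 1))

lemma realizes (hv : ∑ l, |v l| ≤ 2) (hl : 0 ≤ l)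
    (h : A' * A'ᵀ = A * Aᵀ + l • Matrix.vecMulVec v v) :
    Realizes (𝒢.channel m A v hv) l (𝒢.bayes m A') (merge m v l) where
  measurePreserving := 𝒢.measurePreserving_merge m hl h
  prior_eq := rfl
  xs_eq _ := rfl
  energy_eq q p := by
    have e1 : (𝒢.bayes m A').H (merge m v l q) p
        = ∑ μ, Real.log (𝒢.like p.1 (p.2 μ) (𝒢.rowObs q.1.1 (q.1.2.1 μ)))
          + ∑ i, side (A' * A'ᵀ) (p.1 i)
            ((A' * A'ᵀ) *ᵥ q.1.1 i + (q.1.2.2 i + (√l * q.2 i) • v)) := rfl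
    have e2 : (𝒢.channel m A v hv).energy l q p
        = (∑ μ, Real.log (𝒢.like p.1 (p.2 μ) (𝒢.rowObs q.1.1 (q.1.2.1 μ)))
          + ∑ i, side (A * Aᵀ) (p.1 i) ((A * Aᵀ) *ᵥ q.1.1 i + q.1.2.2 i))
          + l * ∑ i, ((v ⬝ᵥ p.1 i) * (v ⬝ᵥ q.1.1 i) - (v ⬝ᵥ p.1 i) ^ 2 / 2)
          + √l * ∑ i, (v ⬝ᵥ p.1 i) * q.2 i := rfl
    rw [e1, e2, h]
    simp only [side_add_vecMulVec, Finset.sum_add_distrib, Finset.mul_sum]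
    ring

/-- The fluctuation of the overlap of the components along `v`. -/
def varComp (A : Matrix (Fin K) (Fin K) ℝ) (v : Fin K → ℝ) : ℝ :=
  (𝒢.bayes m A).var ((𝒢.bayes m A).ovl (comp m v) (comp m v))

lemma integral_abs_fe_sub_le {b V : ℝ} (hb : 0 ≤ b) (hR : ∀ l k, |(A * Aᵀ) l k| ≤ b)
    (hV : 4 * n * (𝒢.M ^ 2 * K ^ 3 * b) + 4 * m * 𝒢.rowConst
        + n * (m * (𝒢.κ ^ 2 * 𝒢.M ^ 2 * 𝒢.curvConst) + 2 * K ^ 2 * b * 𝒢.M ^ 2) ^ 2 ≤ V) :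
    ∫ ω, |𝒢.fe (A * Aᵀ) ω - ∫ ω, 𝒢.fe (A * Aᵀ) ω ∂(𝒢.law m A)| ∂(𝒢.law m A) ≤ √V := by
  have h1 := 𝒢.memLp_fe (m := m) hb hR
  refine (integral_abs_le_sqrt (h1.sub (memLp_const _))).trans (Real.sqrt_le_sqrt ?_)
  exact (𝒢.variance_fe_le hb hR).trans hV

/-- The overlap fluctuation averaged over the strength of a rank one perturbation. -/
theorem integral_varComp_le (hn : 0 < n) (hv : ∑ l, |v l| ≤ 2) {d h V b : ℝ} (hd : 0 < d)
    (hh : 0 < h) (hhd : h ≤ d / 2) (hb : 0 ≤ b) (F : ℝ → Matrix (Fin K) (Fin K) ℝ)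
    (hF : ∀ l ∈ Icc (d / 2) (3 * d), F l * (F l)ᵀ = A * Aᵀ + l • Matrix.vecMulVec v v)
    (hR : ∀ l ∈ Icc (d / 2) (3 * d), ∀ i j, |(F l * (F l)ᵀ) i j| ≤ b)
    (hV : 4 * n * (𝒢.M ^ 2 * K ^ 3 * b) + 4 * m * 𝒢.rowConst
        + n * (m * (𝒢.κ ^ 2 * 𝒢.M ^ 2 * 𝒢.curvConst) + 2 * K ^ 2 * b * 𝒢.M ^ 2) ^ 2 ≤ V) :
    IntervalIntegrable (fun l => 𝒢.varComp m (F l) v) volume d (2 * d) ∧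
    n * ∫ l in d..(2 * d), 𝒢.varComp m (F l) v ≤ 4 * (2 * 𝒢.M) ^ 2 + 2 * (2 * 𝒢.M) ^ 2 *
      (d * (3 * (√V + √(3 * d) * (2 * (2 * 𝒢.M) * √n)) / h + 2 * 𝒢.M * √n / √d)
      + 2 * h * (n * (3 / 2 * (2 * 𝒢.M) ^ 2) + 2 * 𝒢.M * n / √(d / 2))) := by
  set 𝒮 := 𝒢.channel m A v hv with h𝒮
  have hreal : ∀ l ∈ Icc (d / 2) (3 * d), Realizes 𝒮 l (𝒢.bayes m (F l)) (merge m v l) :=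
    fun l hl => 𝒢.realizes m hv (by linarith [hl.1]) (hF l hl)
  have hsub : ∀ l ∈ Icc d (2 * d), l ∈ Icc (d / 2) (3 * d) := fun l hl =>
    ⟨by linarith [hl.1], by linarith [hl.2]⟩
  have hfree : ∀ l ∈ Icc (d / 2) (3 * d),
      𝒮.free l = fun ω => 𝒢.fe (F l * (F l)ᵀ) (merge m v l ω) := fun l hl =>
    funext fun ω => (hreal l hl).free_eq ω
  have hmp : ∀ l ∈ Icc (d / 2) (3 * d), MeasurePreserving (merge m v l) 𝒮.joint
      (𝒢.law m (F l)) := fun l hl => (hreal l hl).measurePreserving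
  have key := 𝒮.integral_fluct_le hn (d := d) (h := h) (v := √V) hd hh hhd
    (fun l hl => (hreal l (hsub l hl)).nishimori hn)
    (fun l hl => by
      rw [hfree l hl]
      exact (hmp l hl).integrable_comp_of_integrable
        ((𝒢.memLp_fe hb (hR l hl)).integrable one_le_two))
    (fun l hl => by
      have hm := 𝒢.measurable_fe (m := m) (F l * (F l)ᵀ)
      have e1 : ∫ ω, 𝒮.free l ω ∂𝒮.joint = ∫ ω, 𝒢.fe (F l * (F l)ᵀ) ω ∂(𝒢.law m (F l)) := by
        rw [hfree l hl]
        exact (hmp l hl).integral_comp_of_measurable hm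
      rw [e1, hfree l hl]
      refine le_of_eq_of_le ?_ (𝒢.integral_abs_fe_sub_le m hb (hR l hl) hV)
      exact (hmp l hl).integral_comp_of_measurable (hm.sub_const _).norm)
  have hfl : ∀ l ∈ Icc d (2 * d), 𝒮.fluct l = 𝒢.varComp m (F l) v := fun l hl =>
    (hreal l (hsub l hl)).fluct_eq hn
  have hd2 : d ≤ 2 * d := by linarith
  refine ⟨key.1.congr ?_, ?_⟩
  · intro l hl
    rw [uIoc_of_le hd2] at hl
    exact hfl l ⟨hl.1.le, hl.2⟩
  · refine le_of_eq_of_le ?_ key.2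
    congr 1
    refine intervalIntegral.integral_congr fun l hl => ?_
    rw [uIcc_of_le hd2] at hl
    exact (hfl l hl).symm

end GLM

end

noncomputable section

section Activation

variable {E : Type*} [NormedAddCommGroup E] [NormedSpace ℝ E] {f : E → ℝ} {L : ℝ}

lemma abs_add_sub_le_of_norm_fderiv_le (hf : ContDiff ℝ 2 f) (h1 : ∀ x, ‖fderiv ℝ f x‖ ≤ L)
    (x h : E) : |f (x + h) - f x| ≤ L * ‖h‖ := by
  have := convex_univ.norm_image_sub_le_of_norm_fderiv_le (𝕜 := ℝ) (f := f) (C := L)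
    (fun y _ => (hf.differentiable two_ne_zero) y) (fun y _ => h1 y) (mem_univ x) (mem_univ (x + h))
  simpa using this

lemma second_difference_le (hf : ContDiff ℝ 2 f) (h2 : ∀ x, ‖iteratedFDeriv ℝ 2 f x‖ ≤ L)
    (x h : E) : |f (x + h) + f (x - h) - 2 * f x| ≤ 2 * L * ‖h‖ ^ 2 := by
  have hL : 0 ≤ L := (norm_nonneg _).trans (h2 x)
  have hd : Differentiable ℝ (fderiv ℝ f) :=
    (hf.fderiv_right (m := 1) (by norm_num)).differentiable one_ne_zero
  have h3 : ∀ y, ‖fderiv ℝ (fderiv ℝ f) y‖ ≤ L := fun y => by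
    rw [← norm_iteratedFDeriv_one, norm_iteratedFDeriv_fderiv]
    exact h2 y
  have h4 : ∀ y, ‖fderiv ℝ f y - fderiv ℝ f x‖ ≤ L * ‖y - x‖ := fun y =>
    convex_univ.norm_image_sub_le_of_norm_fderiv_le (𝕜 := ℝ) (fun z _ => hd z)
      (fun z _ => h3 z) (mem_univ x) (mem_univ y)
  have h5 : ∀ g : E, ‖g‖ = ‖h‖ → |f (x + g) - f x - fderiv ℝ f x g| ≤ L * ‖h‖ * ‖h‖ := fun g hg => by
    have := (convex_closedBall x ‖h‖).norm_image_sub_le_of_norm_fderiv_le' (𝕜 := ℝ) (f := f)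
      (C := L * ‖h‖) (φ := fderiv ℝ f x) (x := x) (y := x + g)
      (fun y _ => (hf.differentiable two_ne_zero) y)
      (fun y hy => (h4 y).trans (mul_le_mul_of_nonneg_left (mem_closedBall_iff_norm.1 hy) hL))
      (Metric.mem_closedBall_self (norm_nonneg _)) (by simp [hg])
    simpa [hg] using this
  have h6 := abs_le.1 (h5 h rfl)
  have h7 := abs_le.1 (h5 (-h) (norm_neg h))
  rw [← sub_eq_add_neg, map_neg] at h7
  rw [abs_le]
  constructor <;> nlinarith [h6.1, h6.2, h7.1, h7.2]

lemma RegularActivation.exists_bound {K : ℕ} {φ : (Fin K → ℝ) → ℝ → ℝ} (hφ : RegularActivation φ) :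
    ∃ L : ℝ, (∀ x a, |φ x a| ≤ L) ∧ (∀ x h a, |φ (x + h) a - φ x a| ≤ L * ‖h‖) ∧
      ∀ x h a, |φ (x + h) a + φ (x - h) a - 2 * φ x a| ≤ L * ‖h‖ ^ 2 := by
  obtain ⟨_, hd, L, hL⟩ := hφ
  have hL0 : 0 ≤ L := (abs_nonneg _).trans (hL 0 0).1
  refine ⟨2 * L, fun x a => ((hL x a).1).trans (by linarith), fun x h a => ?_, fun x h a =>
    second_difference_le (hd a) (fun y => (hL y a).2.2) x h⟩
  refine (abs_add_sub_le_of_norm_fderiv_le (hd a) (fun y => (hL y a).2.1) x h).trans ?_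
  nlinarith [norm_nonneg h]

end Activation

section PsdSqrt

variable {K : ℕ}

lemma SymMat.isHermitian (v : SymMat K) : v.toMatrix.IsHermitian := by
  ext i j
  rw [Matrix.conjTranspose_apply, star_trivial]
  unfold SymMat.toMatrix
  simp only [Matrix.of_apply]
  rcases lt_trichotomy i j with h | h | h
  · rw [dif_neg (not_le.2 h), dif_pos h.le]
  · subst h; rfl
  · rw [dif_pos h.le, dif_neg (not_le.2 h)]

lemma psdSqrt_transpose (A : Matrix (Fin K) (Fin K) ℝ) : (psdSqrt A)ᵀ = psdSqrt A := by
  have h : IsSelfAdjoint (psdSqrt A) := cfc_predicate Real.sqrt A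
  have h2 : (psdSqrt A)ᴴ = psdSqrt A := h
  rwa [Matrix.conjTranspose_eq_transpose_of_trivial] at h2

lemma psdSqrt_mul_transpose {A : Matrix (Fin K) (Fin K) ℝ} (hA : A.PosSemidef) :
    psdSqrt A * (psdSqrt A)ᵀ = A := by
  rw [psdSqrt_transpose]
  have ha : IsSelfAdjoint A := hA.1
  unfold psdSqrt
  rw [← cfc_mul Real.sqrt Real.sqrt A]
  conv_rhs => rw [← cfc_id ℝ A]
  refine cfc_congr fun x hx => ?_
  rw [hA.1.spectrum_real_eq_range_eigenvalues] at hx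
  obtain ⟨i, rfl⟩ := hx
  exact Real.mul_self_sqrt (hA.eigenvalues_nonneg i)

lemma continuous_psdSqrt : Continuous fun A : {A : Matrix (Fin K) (Fin K) ℝ // A.IsHermitian} =>
    psdSqrt A.1 := by
  open scoped Matrix.Norms.L2Operator in
  rw [continuous_iff_continuousAt]
  intro A₀
  have hs : ∀ᶠ A : {A : Matrix (Fin K) (Fin K) ℝ // A.IsHermitian} in 𝓝 A₀,
      spectrum ℝ A.1 ⊆ Metric.closedBall 0
        ((‖A₀.1‖ + 1) * ‖(1 : Matrix (Fin K) (Fin K) ℝ)‖) := by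
    have : ∀ᶠ A : {A : Matrix (Fin K) (Fin K) ℝ // A.IsHermitian} in 𝓝 A₀,
        ‖A.1‖ < ‖A₀.1‖ + 1 := (continuous_subtype_val.norm.tendsto A₀).eventually_lt_const (by simp)
    filter_upwards [this] with A hA x hx
    rw [mem_closedBall_zero_iff]
    exact (spectrum.norm_le_norm_mul_of_mem hx).trans
      (mul_le_mul_of_nonneg_right hA.le (norm_nonneg _))
  exact ContinuousAt.cfc (isCompact_closedBall _ _) Real.sqrt continuous_subtype_val.continuousAt hs
    (Eventually.of_forall fun A => A.2) (by fun_prop)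

lemma SymMat.continuous_toMatrix : Continuous (SymMat.toMatrix (K := K)) := by
  refine continuous_matrix fun i j => ?_
  unfold SymMat.toMatrix
  simp only [Matrix.of_apply]
  split_ifs <;> fun_prop

end PsdSqrt

end

noncomputable section

namespace BayesModel

variable {Ω D P : Type*} [MeasurableSpace Ω] [MeasurableSpace D] [MeasurableSpace P]
  {ℬ : BayesModel Ω D P}

lemma Bdd.mean_sum {k : ℕ} {f : Fin k → Ω → P → ℝ} {c : Fin k → ℝ} (hf : ∀ i, ℬ.Bdd (f i) (c i)) :
    ℬ.mean (fun ω p => ∑ i, f i ω p) = ∑ i, ℬ.mean (f i) := by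
  have h : ∀ i, Integrable (fun z : Ω × P => f i z.1 z.2) ℬ.joint := fun i => (hf i).integrable
  rw [(Bdd.sum hf).mean_eq, integral_finsetSum _ fun i _ => h i]
  exact Finset.sum_congr rfl fun i _ => (hf i).mean_eq.symm

lemma Bdd.var_le_sq {f : Ω → P → ℝ} {c : ℝ} (hf : ℬ.Bdd f c) : ℬ.var f ≤ c ^ 2 := by
  refine hf.var_le_mean_sq.trans ((le_abs_self _).trans ?_)
  refine abs_integral_le_of_ae_abs_le ?_
  filter_upwards [ℬ.ae_joint hf.2] with z hz
  rw [abs_pow]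
  exact pow_le_pow_left₀ (abs_nonneg _) hz 2

end BayesModel

section Zip

variable {α β γ : Type*} [MeasurableSpace α] [MeasurableSpace β] [MeasurableSpace γ] {m : ℕ}

lemma measurePreserving_zip_fst (μ : Measure α) (ν : Measure β) (τ : Measure γ)
    [SigmaFinite μ] [SigmaFinite ν] [SigmaFinite τ] :
    MeasurePreserving (fun q : (Fin m → α) × ((Fin m → β) × γ) => (fun j => (q.1 j, q.2.1 j), q.2.2))
      ((Measure.pi fun _ => μ).prod ((Measure.pi fun _ => ν).prod τ))
      ((Measure.pi fun _ => μ.prod ν).prod τ) :=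
  ((measurePreserving_arrowProdEquivProdArrow α β (Fin m) (fun _ => μ) (fun _ => ν)).symm.prod
    (MeasurePreserving.id τ)).comp (measurePreserving_prodAssoc (Measure.pi fun _ => μ)
      (Measure.pi fun _ => ν) τ).symm

end Zip

instance (N K : ℕ) : IsProbabilityMeasure (gaussianRows N K) := by
  unfold gaussianRows; infer_instance

/-- The disorder of the interpolating model, arranged by observations. -/
def Disorder.toOmega {n m K : ℕ} (A : Matrix (Fin K) (Fin K) ℝ) (ω : Disorder n m K) :
    GLM.Omega n m K :=
  (ω.Wstar, fun μ => (ω.Ustar μ, ω.X μ, ω.V μ, ω.A μ, ω.Z μ), fun i => A *ᵥ ω.Z' i)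

/-- The data of the problem with explicit bounds. -/
structure OutputModel (K : ℕ) where
  φ : (Fin K → ℝ) → ℝ → ℝ
  Δ : ℝ
  PA : Measure ℝ
  P0 : Measure (Fin K → ℝ)
  L : ℝ
  M : ℝ
  prob_PA : IsProbabilityMeasure PA
  prob_P0 : IsProbabilityMeasure P0
  measurable_φ : Measurable (Function.uncurry φ)
  abs_φ_le : ∀ x a, |φ x a| ≤ L
  lipschitz_φ : ∀ x h a, |φ (x + h) a - φ x a| ≤ L * ‖h‖
  second_φ : ∀ x h a, |φ (x + h) a + φ (x - h) a - 2 * φ x a| ≤ L * ‖h‖ ^ 2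
  Δ_pos : 0 < Δ
  M_nonneg : 0 ≤ M
  ae_abs_le : ∀ᵐ w ∂P0, ∀ l, |w l| ≤ M

namespace OutputModel

variable {n m K : ℕ} (𝒪 : OutputModel K) {s t : ℝ}

instance : IsProbabilityMeasure 𝒪.PA := 𝒪.prob_PA
instance : IsProbabilityMeasure 𝒪.P0 := 𝒪.prob_P0

/-- The interpolating model at time `t`. -/
def glm (n : ℕ) (s : ℝ) (ht : 0 ≤ t) (R2 : SymMat K) : GLM n K where
  __ := 𝒪
  κ := √((1 - t) / n)
  M₂ := psdSqrt R2.toMatrix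
  M₃ := psdSqrt (t • secondMoment 𝒪.P0 - R2.toMatrix + (2 * s) • (1 : Matrix (Fin K) (Fin K) ℝ))
  κ_sq := by
    rcases le_total ((1 - t) / n) 0 with h | h
    · rw [Real.sqrt_eq_zero_of_nonpos h]; simp
    · rw [Real.sq_sqrt h]
      rcases n.eq_zero_or_pos with hn | hn
      · subst hn; simp
      · rw [div_mul_cancel₀ _ (Nat.cast_pos.2 hn).ne']
        linarith

/-- The posterior of the interpolating model. -/
abbrev bayes (n m : ℕ) (s : ℝ) (ht : 0 ≤ t) (R : SymMat K × SymMat K) :=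
  (𝒪.glm n s ht R.2).bayes m (psdSqrt R.1.toMatrix)

variable (ht : 0 ≤ t) (R : SymMat K × SymMat K)

lemma measurePreserving_toOmega (A : Matrix (Fin K) (Fin K) ℝ) (R2 : SymMat K) :
    MeasurePreserving (Disorder.toOmega A) (disorderLaw n m K 𝒪.P0 𝒪.PA)
      ((𝒪.glm n s ht R2).law m A) := by
  have h0 : MeasurePreserving (fun (g : Rows n K) i => A *ᵥ g i) (gaussianRows n K)
      (Measure.pi fun _ => colored A) :=
    measurePreserving_pi (fun _ : Fin n => gauss K) (fun _ => colored A)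
      fun _ => ⟨measurable_mulVec A, rfl⟩
  have h1 := measurePreserving_zip_fst (m := m) 𝒪.PA (gaussianReal 0 1) (gaussianRows n K)
  have h2 := (measurePreserving_zip_fst (m := m) (gauss K) (𝒪.PA.prod (gaussianReal 0 1))
    (gaussianRows n K)).comp ((MeasurePreserving.id (gaussianRows m K)).prod h1)
  have h3 := (measurePreserving_zip_fst (m := m) (gauss n)
    ((gauss K).prod (𝒪.PA.prod (gaussianReal 0 1)))
    (gaussianRows n K)).comp ((MeasurePreserving.id (gaussianRows m n)).prod h2)
  have h4 := (measurePreserving_zip_fst (m := m) (gauss K)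
    ((gauss n).prod ((gauss K).prod (𝒪.PA.prod (gaussianReal 0 1))))
    (gaussianRows n K)).comp ((MeasurePreserving.id (gaussianRows m K)).prod h3)
  have h5 := ((MeasurePreserving.id (Measure.pi fun _ : Fin m => (gauss K).prod ((gauss n).prod
    ((gauss K).prod (𝒪.PA.prod (gaussianReal 0 1)))))).prod h0).comp h4
  exact (MeasurePreserving.id (Measure.pi fun _ : Fin n => 𝒪.P0)).prod h5

lemma side_eq {A : Matrix (Fin K) (Fin K) ℝ} (hA : Aᵀ = A) (w W z : Fin K → ℝ) :
    -(1 / 2) * ∑ l, ((A *ᵥ W + z) l - (A *ᵥ w) l) ^ 2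
      = -(1 / 2) * ∑ l, (A *ᵥ W + z) l ^ 2
        + GLM.side (A * Aᵀ) w ((A * Aᵀ) *ᵥ W + A *ᵥ z) := by
  have h1 : ∀ y, w ⬝ᵥ (A *ᵥ y) = (A *ᵥ w) ⬝ᵥ y := fun y => by
    rw [Matrix.dotProduct_mulVec, ← Matrix.mulVec_transpose, hA]
  unfold GLM.side
  rw [hA, ← Matrix.mulVec_mulVec, ← Matrix.mulVec_mulVec, ← Matrix.mulVec_add, h1, h1]
  simp only [dotProduct, Finset.mul_sum, Finset.sum_div]
  rw [← Finset.sum_sub_distrib, ← Finset.sum_add_distrib]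
  refine Finset.sum_congr rfl fun l _ => ?_
  ring

lemma posteriorWeight_eq (ω : Disorder n m K) (p : Rows n K × Rows m K) :
    posteriorWeight 𝒪.φ 𝒪.Δ 𝒪.P0 𝒪.PA s t R ω p
      = Real.exp (∑ i, -(1 / 2) * ∑ l, obsY' R.1 ω i l ^ 2)
        * Real.exp ((𝒪.bayes n m s ht R).H (ω.toOmega (psdSqrt R.1.toMatrix)) p) := by
  have e1 : (𝒪.bayes n m s ht R).H (ω.toOmega (psdSqrt R.1.toMatrix)) p
      = ∑ μ, Real.log (outputKernel 𝒪.φ 𝒪.Δ 𝒪.PA (obsY 𝒪.φ 𝒪.Δ 𝒪.P0 s t R.2 ω μ)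
          (preActivation 𝒪.P0 s t R.2 ω.X ω.V p.1 p.2 μ))
        + ∑ i, GLM.side (psdSqrt R.1.toMatrix * (psdSqrt R.1.toMatrix)ᵀ) (p.1 i)
          ((psdSqrt R.1.toMatrix * (psdSqrt R.1.toMatrix)ᵀ) *ᵥ ω.Wstar i
            + psdSqrt R.1.toMatrix *ᵥ ω.Z' i) := rfl
  unfold posteriorWeight
  rw [← Real.exp_sum, e1, Real.exp_add, ← mul_assoc, mul_right_comm, ← Real.exp_add,
    ← Finset.sum_add_distrib, Real.exp_sum _ fun μ => Real.log _]
  congr 1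
  · congr 1
    refine Finset.sum_congr rfl fun i _ => ?_
    exact side_eq (psdSqrt_transpose _) _ _ _
  · refine Finset.prod_congr rfl fun μ _ => ?_
    exact (Real.exp_log ((𝒪.glm n s ht R.2).outputKernel_pos _ _)).symm

lemma gibbs_eq (ω : Disorder n m K) (g : Rows n K × Rows m K → ℝ) :
    gibbs 𝒪.φ 𝒪.Δ 𝒪.P0 𝒪.PA s t R ω g
      = (𝒪.bayes n m s ht R).br (ω.toOmega (psdSqrt R.1.toMatrix)) g := by
  unfold gibbs BayesModel.br
  rw [integral_tilted_eq_div]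
  simp only [𝒪.posteriorWeight_eq ht, mul_left_comm (g _) (Real.exp _)]
  rw [integral_const_mul, integral_const_mul, mul_div_mul_left _ _ (Real.exp_pos _).ne']
  rfl

/-- The fluctuation of a function of the hidden weights and of a posterior sample. -/
def fluct (n m : ℕ) (s t : ℝ) (f : Rows n K → Rows n K → ℝ) (R : SymMat K × SymMat K) : ℝ :=
  ∫ ω : Disorder n m K, gibbs 𝒪.φ 𝒪.Δ 𝒪.P0 𝒪.PA s t R ω (fun p => (f ω.Wstar p.1
      - ∫ ω : Disorder n m K, gibbs 𝒪.φ 𝒪.Δ 𝒪.P0 𝒪.PA s t R ω (fun p => f ω.Wstar p.1)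
        ∂(disorderLaw n m K 𝒪.P0 𝒪.PA)) ^ 2) ∂(disorderLaw n m K 𝒪.P0 𝒪.PA)

lemma integral_gibbs_eq {f : Rows n K → Rows n K → ℝ} {c : ℝ}
    (hf : (𝒪.bayes n m s ht R).Bdd (fun ω p => f ω.1 p.1) c) :
    ∫ ω : Disorder n m K, gibbs 𝒪.φ 𝒪.Δ 𝒪.P0 𝒪.PA s t R ω (fun p => f ω.Wstar p.1)
        ∂(disorderLaw n m K 𝒪.P0 𝒪.PA)
      = (𝒪.bayes n m s ht R).mean fun ω p => f ω.1 p.1 := by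
  simp only [𝒪.gibbs_eq ht]
  exact (𝒪.measurePreserving_toOmega ht (psdSqrt R.1.toMatrix) R.2).integral_comp_of_measurable
    hf.measurable_br

lemma fluct_eq {f : Rows n K → Rows n K → ℝ} {c : ℝ}
    (hf : (𝒪.bayes n m s ht R).Bdd (fun ω p => f ω.1 p.1) c) :
    𝒪.fluct n m s t f R = (𝒪.bayes n m s ht R).var fun ω p => f ω.1 p.1 := by
  unfold fluct BayesModel.var
  rw [𝒪.integral_gibbs_eq ht R hf]
  have h1 := hf.sub ((𝒪.bayes n m s ht R).bdd_const ((𝒪.bayes n m s ht R).mean fun ω p => f ω.1 p.1))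
  have h2 := h1.mul h1
  simp only [← sq] at h2
  exact 𝒪.integral_gibbs_eq ht R (f := fun W w => (f W w
    - (𝒪.bayes n m s ht R).mean fun ω p => f ω.1 p.1) ^ 2) h2

/-- The overlap of the components along `v` and `v'`. -/
def ovl (v v' : Fin K → ℝ) (W w : Rows n K) : ℝ := (1 / n) * ∑ i, (v ⬝ᵥ W i) * (v' ⬝ᵥ w i)

lemma ovl_single (l l' : Fin K) (W w : Rows n K) :
    ovl (Pi.single l 1) (Pi.single l' 1) W w = overlap W w l l' := by
  simp [ovl, overlap]

lemma bdd_ovl (hn : 0 < n) {v v' : Fin K → ℝ} (hv : ∑ l, |v l| ≤ 2) (hv' : ∑ l, |v' l| ≤ 2) :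
    (𝒪.bayes n m s ht R).Bdd (fun ω p => ovl v v' ω.1 p.1) (2 * 𝒪.M * (2 * 𝒪.M)) :=
  BayesModel.bdd_ovl _ (GLM.measurable_comp m v) (mul_nonneg zero_le_two 𝒪.M_nonneg)
    ((𝒪.glm n s ht R.2).abs_comp_le m hv) hn (GLM.measurable_comp m v')
    ((𝒪.glm n s ht R.2).abs_comp_le m hv')

lemma fluct_ovl_eq (hn : 0 < n) {v v' : Fin K → ℝ} (hv : ∑ l, |v l| ≤ 2) (hv' : ∑ l, |v' l| ≤ 2) :
    𝒪.fluct n m s t (ovl v v') R = (𝒪.bayes n m s ht R).var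
      ((𝒪.bayes n m s ht R).ovl (GLM.comp m v) (GLM.comp m v')) :=
  𝒪.fluct_eq ht R (𝒪.bdd_ovl ht R hn hv hv')

lemma sum_abs_single (l : Fin K) : ∑ j, |(Pi.single l (1 : ℝ) : Fin K → ℝ) j| = 1 := by
  simp [Pi.single_apply, apply_ite abs]

lemma sum_abs_single_add (l l' : Fin K) :
    ∑ j, |(Pi.single l (1 : ℝ) + Pi.single l' 1 : Fin K → ℝ) j| ≤ 2 := by
  refine (Finset.sum_le_sum fun j _ => abs_add_le _ _).trans ?_
  rw [Finset.sum_add_distrib, sum_abs_single, sum_abs_single]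
  norm_num

include ht in
lemma overlapFluctuation_eq (hn : 0 < n) :
    overlapFluctuation n m 𝒪.φ 𝒪.Δ 𝒪.P0 𝒪.PA s t R
      = ∑ l, ∑ l', 𝒪.fluct n m s t (ovl (Pi.single l 1) (Pi.single l' 1)) R := by
  have h2 : ∀ l : Fin K, ∑ j, |(Pi.single l (1 : ℝ) : Fin K → ℝ) j| ≤ 2 := fun l => by
    rw [sum_abs_single]; norm_num
  have hb := fun l l' => 𝒪.bdd_ovl (m := m) (s := s) ht R hn (h2 l) (h2 l')
  have hmean : ∀ l l', meanOverlap n m 𝒪.φ 𝒪.Δ 𝒪.P0 𝒪.PA s t R l l'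
      = (𝒪.bayes n m s ht R).mean fun ω p => ovl (Pi.single l 1) (Pi.single l' 1) ω.1 p.1 := by
    intro l l'
    rw [← 𝒪.integral_gibbs_eq ht R (hb l l')]
    simp only [ovl_single]
    rfl
  have hsq := fun l l' => ((hb l l').sub ((𝒪.bayes n m s ht R).bdd_const
    ((𝒪.bayes n m s ht R).mean fun ω p => ovl (Pi.single l 1) (Pi.single l' 1) ω.1 p.1))).mul
    ((hb l l').sub ((𝒪.bayes n m s ht R).bdd_const
    ((𝒪.bayes n m s ht R).mean fun ω p => ovl (Pi.single l 1) (Pi.single l' 1) ω.1 p.1)))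
  simp only [← sq] at hsq
  have hsum := fun l => BayesModel.Bdd.sum fun l' => hsq l l'
  unfold overlapFluctuation
  simp only [hmean, ← ovl_single]
  rw [𝒪.integral_gibbs_eq ht R (f := fun W w => ∑ l, ∑ l', (ovl (Pi.single l 1) (Pi.single l' 1) W w
    - (𝒪.bayes n m s ht R).mean fun ω p => ovl (Pi.single l 1) (Pi.single l' 1) ω.1 p.1) ^ 2)
    (BayesModel.Bdd.sum hsum)]
  rw [BayesModel.Bdd.mean_sum hsum]
  refine Finset.sum_congr rfl fun l _ => ?_
  rw [BayesModel.Bdd.mean_sum fun l' => hsq l l']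
  exact Finset.sum_congr rfl fun l' _ => (𝒪.fluct_eq ht R (hb l l')).symm

include ht in
lemma fluct_ovl_nonneg (hn : 0 < n) {v v' : Fin K → ℝ} (hv : ∑ l, |v l| ≤ 2)
    (hv' : ∑ l, |v' l| ≤ 2) : 0 ≤ 𝒪.fluct n m s t (ovl v v') R := by
  rw [𝒪.fluct_ovl_eq ht R hn hv hv']
  exact BayesModel.var_nonneg _ _

include ht in
lemma fluct_ovl_le (hn : 0 < n) {v v' : Fin K → ℝ} (hv : ∑ l, |v l| ≤ 2)
    (hv' : ∑ l, |v' l| ≤ 2) : 𝒪.fluct n m s t (ovl v v') R ≤ 16 * 𝒪.M ^ 4 := by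
  have h := 𝒪.bdd_ovl (m := m) (s := s) ht R hn hv hv'
  rw [𝒪.fluct_eq ht R h]
  exact h.var_le_sq.trans_eq (by ring)

include ht in
/-- The overlap fluctuation is controlled by the fluctuations along single directions. -/
lemma fluct_single_le (hn : 0 < n) (l l' : Fin K) {a : ℝ} (ha : 0 < a) :
    𝒪.fluct n m s t (ovl (Pi.single l 1) (Pi.single l' 1)) R
      ≤ 𝒪.fluct n m s t (ovl (Pi.single l 1 + Pi.single l' 1) (Pi.single l 1 + Pi.single l' 1)) R
        + (1 + 32 * 𝒪.M ^ 2 / a) * (𝒪.fluct n m s t (ovl (Pi.single l 1) (Pi.single l 1)) R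
          + 𝒪.fluct n m s t (ovl (Pi.single l' 1) (Pi.single l' 1)) R) + 64 * 𝒪.M ^ 2 * a := by
  have h2 : ∀ l : Fin K, ∑ j, |(Pi.single l (1 : ℝ) : Fin K → ℝ) j| ≤ 2 := fun l => by
    rw [sum_abs_single]; norm_num
  have hs := sum_abs_single_add l l'
  rw [𝒪.fluct_ovl_eq ht R hn (h2 l) (h2 l'), 𝒪.fluct_ovl_eq ht R hn hs hs,
    𝒪.fluct_ovl_eq ht R hn (h2 l) (h2 l), 𝒪.fluct_ovl_eq ht R hn (h2 l') (h2 l')]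
  have hM := mul_nonneg zero_le_two 𝒪.M_nonneg
  have key := (𝒪.bayes n m s ht R).var_ovl_le (GLM.measurable_comp m (Pi.single l 1)) hM
    ((𝒪.glm n s ht R.2).abs_comp_le m (h2 l)) hn (GLM.measurable_comp m (Pi.single l' 1))
    ((𝒪.glm n s ht R.2).abs_comp_le m (h2 l'))
  have e : (GLM.comp (n := n) m (Pi.single l 1 : Fin K → ℝ) + GLM.comp m (Pi.single l' 1))
      = GLM.comp m (Pi.single l 1 + Pi.single l' 1) := by
    funext p i
    simp only [Pi.add_apply, GLM.comp, add_dotProduct]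
  rw [e] at key
  have hsqrt : ∀ T : ℝ, 0 ≤ T → √T ≤ T / a + a := fun T hT => by
    rw [Real.sqrt_le_left (by positivity)]
    have : 0 ≤ (T / a) ^ 2 := sq_nonneg _
    have e2 : (T / a + a) ^ 2 = (T / a) ^ 2 + 2 * T + a ^ 2 := by field_simp; ring
    rw [e2]
    nlinarith [sq_nonneg a]
  have p1 := hsqrt _ ((𝒪.bayes n m s ht R).var_nonneg
    ((𝒪.bayes n m s ht R).ovl (GLM.comp m (Pi.single l 1)) (GLM.comp m (Pi.single l 1))))
  have p2 := hsqrt _ ((𝒪.bayes n m s ht R).var_nonneg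
    ((𝒪.bayes n m s ht R).ovl (GLM.comp m (Pi.single l' 1)) (GLM.comp m (Pi.single l' 1))))
  have hM2 : 0 ≤ 8 * (2 * 𝒪.M) ^ 2 := by positivity
  refine key.trans ?_
  refine (add_le_add_right (mul_le_mul_of_nonneg_left (add_le_add p1 p2) hM2) _).trans_eq ?_
  field_simp
  ring

end OutputModel

end

noncomputable section

lemma secondMoment_isHermitian {K : ℕ} (P0 : Measure (Fin K → ℝ)) :
    (secondMoment P0).IsHermitian := by
  ext i j
  rw [Matrix.conjTranspose_apply, star_trivial]
  simp only [secondMoment, Matrix.of_apply, mul_comm]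

lemma measurable_psdSqrt_comp {X : Type*} [TopologicalSpace X] [MeasurableSpace X]
    [OpensMeasurableSpace X] {K : ℕ} {A : X → Matrix (Fin K) (Fin K) ℝ} (hA : Continuous A)
    (hh : ∀ x, (A x).IsHermitian) (i j : Fin K) : Measurable fun x => psdSqrt (A x) i j :=
  ((continuous_psdSqrt.comp (hA.subtype_mk hh)).matrix_elem i j).measurable

namespace OutputModel

variable {n m K : ℕ} (𝒪 : OutputModel K) (s : ℝ)

lemma measurable_sqrt_fst (i j : Fin K) :
    Measurable fun y : ℝ × SymMat K × SymMat K => psdSqrt y.2.1.toMatrix i j :=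
  measurable_psdSqrt_comp (SymMat.continuous_toMatrix.comp (by fun_prop))
    (fun y => y.2.1.isHermitian) i j

lemma measurable_sqrt_snd (i j : Fin K) :
    Measurable fun y : ℝ × SymMat K × SymMat K => psdSqrt y.2.2.toMatrix i j :=
  measurable_psdSqrt_comp (SymMat.continuous_toMatrix.comp (by fun_prop))
    (fun y => y.2.2.isHermitian) i j

lemma measurable_sqrt_rest (i j : Fin K) :
    Measurable fun y : ℝ × SymMat K × SymMat K => psdSqrt (y.1 • secondMoment 𝒪.P0
      - y.2.2.toMatrix + (2 * s) • (1 : Matrix (Fin K) (Fin K) ℝ)) i j := by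
  have h : Continuous fun y : ℝ × SymMat K × SymMat K => y.2.2.toMatrix :=
    SymMat.continuous_toMatrix.comp (by fun_prop)
  refine measurable_psdSqrt_comp (by fun_prop) (fun y => ?_) i j
  refine (Matrix.IsHermitian.sub ?_ y.2.2.isHermitian).add ?_
  · exact (secondMoment_isHermitian _).smul (IsSelfAdjoint.all _)
  · exact Matrix.isHermitian_one.smul (IsSelfAdjoint.all _)

lemma measurable_mulVec_apply {X : Type*} [MeasurableSpace X] {A : X → Matrix (Fin K) (Fin K) ℝ}
    {v : X → Fin K → ℝ} (hA : ∀ i j, Measurable fun x => A x i j) (hv : Measurable v) (i : Fin K) :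
    Measurable fun x => (A x *ᵥ v x) i := by
  unfold Matrix.mulVec dotProduct
  exact Finset.measurable_sum _ fun j _ => (hA i j).mul ((measurable_pi_apply j).comp hv)

lemma measurable_preActivation : Measurable
    fun q : (ℝ × SymMat K × SymMat K) × Rows m n × Rows m K × Rows n K × Rows m K =>
      preActivation 𝒪.P0 s q.1.1 q.1.2.2 q.2.1 q.2.2.1 q.2.2.2.1 q.2.2.2.2 := by
  refine measurable_pi_lambda _ fun μ => measurable_pi_lambda _ fun l => ?_
  unfold preActivation
  refine Measurable.add (Measurable.add ?_ ?_) ?_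
  · have : Measurable fun q : (ℝ × SymMat K × SymMat K) × Rows m n × Rows m K × Rows n K × Rows m K =>
        √((1 - q.1.1) / n) • (∑ i, q.2.1 μ i • q.2.2.2.1 i) := by fun_prop
    exact (measurable_pi_apply l).comp this
  · exact measurable_mulVec_apply (A := fun q : (ℝ × SymMat K × SymMat K) × Rows m n × Rows m K ×
      Rows n K × Rows m K => psdSqrt q.1.2.2.toMatrix)
      (fun i j => (measurable_sqrt_snd i j).comp measurable_fst) (by fun_prop) l
  · exact measurable_mulVec_apply (A := fun q : (ℝ × SymMat K × SymMat K) × Rows m n × Rows m K ×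
      Rows n K × Rows m K => psdSqrt (q.1.1 • secondMoment 𝒪.P0
      - q.1.2.2.toMatrix + (2 * s) • (1 : Matrix (Fin K) (Fin K) ℝ)))
      (fun i j => (𝒪.measurable_sqrt_rest s i j).comp measurable_fst) (by fun_prop) l

lemma measurable_outputKernel :
    Measurable fun q : ℝ × (Fin K → ℝ) => outputKernel 𝒪.φ 𝒪.Δ 𝒪.PA q.1 q.2 :=
  (𝒪.glm 0 0 le_rfl 0).measurable_outputKernel

variable (n m) in
/-- The parameters, the disorder and a posterior sample. -/
abbrev Config (K : ℕ) : Type :=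
  ((ℝ × SymMat K × SymMat K) × Disorder n m K) × (Rows n K × Rows m K)

lemma measurable_posteriorWeight : Measurable fun q : Config n m K =>
    posteriorWeight 𝒪.φ 𝒪.Δ 𝒪.P0 𝒪.PA s q.1.1.1 q.1.1.2 q.1.2 q.2 := by
  unfold posteriorWeight
  refine Measurable.mul (Finset.measurable_prod _ fun i _ => Measurable.exp
    (measurable_const.mul (Finset.measurable_sum _ fun l _ => ?_)))
    (Finset.measurable_prod _ fun μ _ => ?_)
  · refine Measurable.pow_const (Measurable.sub ?_ ?_) 2
    · have h : Measurable fun q : Config n m K => q.1.2.Z' i l := by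
        unfold Disorder.Z'; fun_prop
      refine Measurable.add ?_ h
      exact measurable_mulVec_apply (A := fun q : Config n m K => psdSqrt q.1.1.2.1.toMatrix)
        (fun i j => (measurable_sqrt_fst i j).comp (measurable_fst.comp measurable_fst))
        (by unfold Disorder.Wstar; fun_prop) l
    · exact measurable_mulVec_apply (A := fun q : Config n m K => psdSqrt q.1.1.2.1.toMatrix)
        (fun i j => (measurable_sqrt_fst i j).comp (measurable_fst.comp measurable_fst))
        (by fun_prop) l
  · have hp := 𝒪.measurable_preActivation (n := n) (m := m) s
    have h1 : Measurable fun q : Config n m K => preActivation 𝒪.P0 s q.1.1.1 q.1.1.2.2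
        q.1.2.X q.1.2.V q.2.1 q.2.2 μ := by
      have := (measurable_pi_apply μ).comp (hp.comp (f := fun q : Config n m K =>
        (q.1.1, q.1.2.X, q.1.2.V, q.2.1, q.2.2)) (by
          unfold Disorder.X Disorder.V; fun_prop))
      simpa only [Function.comp_def] using this
    have h2 : Measurable fun q : Config n m K => preActivation 𝒪.P0 s q.1.1.1 q.1.1.2.2
        q.1.2.X q.1.2.V q.1.2.Wstar q.1.2.Ustar μ := by
      have := (measurable_pi_apply μ).comp (hp.comp (f := fun q : Config n m K =>
        (q.1.1, q.1.2.X, q.1.2.V, q.1.2.Wstar, q.1.2.Ustar)) (by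
          unfold Disorder.X Disorder.V Disorder.Wstar Disorder.Ustar; fun_prop))
      simpa only [Function.comp_def] using this
    have h3 : Measurable fun q : Config n m K =>
        obsY 𝒪.φ 𝒪.Δ 𝒪.P0 s q.1.1.1 q.1.1.2.2 q.1.2 μ := by
      unfold obsY
      have := 𝒪.measurable_φ.comp (h2.prodMk (by unfold Disorder.A; fun_prop :
        Measurable fun q : Config n m K => q.1.2.A μ))
      simp only [Function.comp_def, Function.uncurry] at this
      exact this.add (by unfold Disorder.Z; fun_prop)
    have := 𝒪.measurable_outputKernel.comp (h3.prodMk h1)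
    simpa only [Function.comp_def] using this

lemma measurable_gibbs {g : (ℝ × SymMat K × SymMat K) × Disorder n m K →
    Rows n K × Rows m K → ℝ} (hg : Measurable (Function.uncurry g)) :
    Measurable fun q : (ℝ × SymMat K × SymMat K) × Disorder n m K =>
      gibbs 𝒪.φ 𝒪.Δ 𝒪.P0 𝒪.PA s q.1.1 q.1.2 q.2 (g q) := by
  have hw := 𝒪.measurable_posteriorWeight (n := n) (m := m) s
  have h1 : Measurable fun q : Config n m K => g q.1 q.2
      * posteriorWeight 𝒪.φ 𝒪.Δ 𝒪.P0 𝒪.PA s q.1.1.1 q.1.1.2 q.1.2 q.2 := hg.mul hw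
  unfold gibbs
  exact (h1.stronglyMeasurable.integral_prod_right'
    (ν := (Measure.pi fun _ => 𝒪.P0).prod (gaussianRows m K))).measurable.div
    (hw.stronglyMeasurable.integral_prod_right'
    (ν := (Measure.pi fun _ => 𝒪.P0).prod (gaussianRows m K))).measurable

instance : IsProbabilityMeasure (disorderLaw n m K 𝒪.P0 𝒪.PA) := by
  unfold disorderLaw; infer_instance

lemma measurable_fluct {f : Rows n K → Rows n K → ℝ} (hf : Measurable (Function.uncurry f)) :
    Measurable fun y : ℝ × SymMat K × SymMat K => 𝒪.fluct n m s y.1 f y.2 := by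
  have h : Measurable fun q : Config n m K => f q.1.2.Wstar q.2.1 := by
    have := hf.comp (f := fun q : Config n m K => (q.1.2.Wstar, q.2.1)) (by
      unfold Disorder.Wstar; fun_prop)
    simpa only [Function.comp_def, Function.uncurry] using this
  have h1 : Measurable fun y : ℝ × SymMat K × SymMat K => ∫ ω : Disorder n m K,
      gibbs 𝒪.φ 𝒪.Δ 𝒪.P0 𝒪.PA s y.1 y.2 ω (fun p => f ω.Wstar p.1)
        ∂(disorderLaw n m K 𝒪.P0 𝒪.PA) := by
    exact ((𝒪.measurable_gibbs s (g := fun q p => f q.2.Wstar p.1) h).stronglyMeasurable.integral_prod_right'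
      (ν := disorderLaw n m K 𝒪.P0 𝒪.PA)).measurable
  have h2 : Measurable fun q : Config n m K => (f q.1.2.Wstar q.2.1 - ∫ ω : Disorder n m K,
      gibbs 𝒪.φ 𝒪.Δ 𝒪.P0 𝒪.PA s q.1.1.1 q.1.1.2 ω (fun p => f ω.Wstar p.1)
        ∂(disorderLaw n m K 𝒪.P0 𝒪.PA)) ^ 2 := by
    have := h1.comp (f := fun q : Config n m K => q.1.1) (by fun_prop)
    simp only [Function.comp_def] at this
    exact (h.sub this).pow_const 2
  exact ((𝒪.measurable_gibbs s (g := fun q p => (f q.2.Wstar p.1 - ∫ ω : Disorder n m K,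
      gibbs 𝒪.φ 𝒪.Δ 𝒪.P0 𝒪.PA s q.1.1 q.1.2 ω (fun p => f ω.Wstar p.1)
        ∂(disorderLaw n m K 𝒪.P0 𝒪.PA)) ^ 2) h2).stronglyMeasurable.integral_prod_right'
      (ν := disorderLaw n m K 𝒪.P0 𝒪.PA)).measurable

lemma measurable_fluct_ovl (v v' : Fin K → ℝ) :
    Measurable fun y : ℝ × SymMat K × SymMat K => 𝒪.fluct n m s y.1 (ovl v v') y.2 := by
  refine 𝒪.measurable_fluct s ?_
  unfold ovl Function.uncurry dotProduct
  fun_prop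

end OutputModel

end

noncomputable section

namespace SymMat

variable {K : ℕ}

lemma dotProduct_self_nonneg (x : Fin K → ℝ) : 0 ≤ x ⬝ᵥ x :=
  Finset.sum_nonneg fun _ _ => mul_self_nonneg _

lemma toMatrix_add (v w : SymMat K) : (v + w).toMatrix = v.toMatrix + w.toMatrix := by
  ext i j
  simp only [toMatrix, Matrix.of_apply, Matrix.add_apply, Pi.add_apply]
  split_ifs <;> rfl

lemma toMatrix_smul (c : ℝ) (v : SymMat K) : (c • v).toMatrix = c • v.toMatrix := by
  ext i j
  simp only [toMatrix, Matrix.of_apply, Matrix.smul_apply, Pi.smul_apply]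
  split_ifs <;> rfl

lemma toMatrix_apply_of_le (v : SymMat K) {i j : Fin K} (h : i ≤ j) :
    v.toMatrix i j = v ⟨(i, j), h⟩ := by
  simp [toMatrix, h]

lemma abs_toMatrix_le (v : SymMat K) (i j : Fin K) : |v.toMatrix i j| ≤ ‖v‖ := by
  simp only [toMatrix, Matrix.of_apply]
  split_ifs
  · exact norm_le_pi_norm v _
  · exact norm_le_pi_norm v _

/-- The quadratic form of a symmetric matrix, as a functional of the matrix. -/
def quad (x : Fin K → ℝ) : SymMat K →L[ℝ] ℝ :=
  LinearMap.toContinuousLinearMap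
    { toFun := fun v => x ⬝ᵥ (v.toMatrix *ᵥ x)
      map_add' := fun v w => by rw [toMatrix_add, Matrix.add_mulVec, dotProduct_add]
      map_smul' := fun c v => by
        rw [toMatrix_smul, Matrix.smul_mulVec, dotProduct_smul]; rfl }

lemma quad_apply (x : Fin K → ℝ) (v : SymMat K) : quad x v = x ⬝ᵥ (v.toMatrix *ᵥ x) := rfl

lemma posSemidef_iff (v : SymMat K) : v.toMatrix.PosSemidef ↔ ∀ x, 0 ≤ quad x v := by
  rw [Matrix.posSemidef_iff_dotProduct_mulVec]
  simp only [v.isHermitian, true_and, star_trivial, quad_apply]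

lemma posSemidef_sub_one_iff (v : SymMat K) :
    (v.toMatrix - 1).PosSemidef ↔ ∀ x, x ⬝ᵥ x ≤ quad x v := by
  rw [Matrix.posSemidef_iff_dotProduct_mulVec]
  simp only [v.isHermitian.sub Matrix.isHermitian_one, true_and, star_trivial, quad_apply,
    Matrix.sub_mulVec, Matrix.one_mulVec, dotProduct_sub, sub_nonneg]

lemma posSemidef_two_sub_iff (v : SymMat K) :
    ((2 : ℝ) • (1 : Matrix (Fin K) (Fin K) ℝ) - v.toMatrix).PosSemidef
      ↔ ∀ x, quad x v ≤ 2 * (x ⬝ᵥ x) := by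
  rw [Matrix.posSemidef_iff_dotProduct_mulVec]
  have h : ((2 : ℝ) • (1 : Matrix (Fin K) (Fin K) ℝ)).IsHermitian :=
    Matrix.isHermitian_one.smul (IsSelfAdjoint.all _)
  simp only [h.sub v.isHermitian, true_and, star_trivial, quad_apply, Matrix.sub_mulVec,
    Matrix.smul_mulVec, Matrix.one_mulVec, dotProduct_sub, dotProduct_smul, smul_eq_mul, sub_nonneg]

/-- The rank one matrix `v vᵀ`. -/
def rankOne (v : Fin K → ℝ) : SymMat K := fun p => v p.1.1 * v p.1.2

lemma toMatrix_rankOne (v : Fin K → ℝ) : (rankOne v).toMatrix = Matrix.vecMulVec v v := by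
  ext i j
  simp only [toMatrix, Matrix.of_apply, Matrix.vecMulVec_apply, rankOne]
  split_ifs
  · rfl
  · exact mul_comm _ _

lemma quad_rankOne (x v : Fin K → ℝ) : quad x (rankOne v) = (v ⬝ᵥ x) ^ 2 := by
  rw [quad_apply, toMatrix_rankOne, Matrix.vecMulVec_mulVec, op_smul_eq_smul, dotProduct_smul,
    smul_eq_mul, dotProduct_comm x v, sq]

lemma abs_le_of_sum_le {v : Fin K → ℝ} (hv : ∑ l, |v l| ≤ 2) (l : Fin K) : |v l| ≤ 2 :=
  (Finset.single_le_sum (f := fun l => |v l|) (fun _ _ => abs_nonneg _) (Finset.mem_univ l)).trans hv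

lemma norm_rankOne_le {v : Fin K → ℝ} (hv : ∑ l, |v l| ≤ 2) : ‖rankOne v‖ ≤ 4 := by
  rw [pi_norm_le_iff_of_nonneg (by norm_num)]
  intro p
  rw [rankOne, Real.norm_eq_abs, abs_mul]
  nlinarith [abs_le_of_sum_le hv p.1.1, abs_le_of_sum_le hv p.1.2, abs_nonneg (v p.1.1),
    abs_nonneg (v p.1.2)]

lemma dotProduct_sq_le {v : Fin K → ℝ} (hv : ∑ l, |v l| ≤ 2) (x : Fin K → ℝ) :
    (v ⬝ᵥ x) ^ 2 ≤ 4 * (x ⬝ᵥ x) := by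
  have h1 : (v ⬝ᵥ x) ^ 2 ≤ (v ⬝ᵥ v) * (x ⬝ᵥ x) := by
    have := Finset.sum_mul_sq_le_sq_mul_sq Finset.univ v x
    simpa only [dotProduct, sq] using this
  have h2 : v ⬝ᵥ v ≤ 4 := by
    have : v ⬝ᵥ v ≤ ∑ l, 2 * |v l| := Finset.sum_le_sum fun l _ => by
      rw [← abs_mul_abs_self]
      exact mul_le_mul_of_nonneg_right (abs_le_of_sum_le hv l) (abs_nonneg _)
    rw [← Finset.mul_sum] at this
    linarith
  have h3 : 0 ≤ x ⬝ᵥ x := dotProduct_self_nonneg x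
  nlinarith

lemma quad_single (v : SymMat K) (i : Fin K) : quad (Pi.single i 1) v = v.toMatrix i i := by
  simp [quad_apply]

lemma quad_single_add (v : SymMat K) (i j : Fin K) (c : ℝ) :
    quad (Pi.single i 1 + c • Pi.single j 1) v
      = v.toMatrix i i + 2 * c * v.toMatrix i j + c ^ 2 * v.toMatrix j j := by
  have h : v.toMatrix j i = v.toMatrix i j := by
    have := v.isHermitian.apply i j
    simpa using this
  simp [quad_apply, Matrix.mulVec_add, Matrix.mulVec_smul, h]
  ring

lemma norm_le_of_posSemidef {v : SymMat K} (hv : v.toMatrix.PosSemidef) {c : ℝ} (hc : 0 ≤ c)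
    (h : ∀ i, v.toMatrix i i ≤ c) : ‖v‖ ≤ c := by
  rw [pi_norm_le_iff_of_nonneg hc]
  rintro ⟨⟨i, j⟩, hij⟩
  rw [← v.toMatrix_apply_of_le hij, Real.norm_eq_abs, abs_le]
  have h1 := (posSemidef_iff v).1 hv (Pi.single i 1 + (1 : ℝ) • Pi.single j 1)
  have h2 := (posSemidef_iff v).1 hv (Pi.single i 1 + (-1 : ℝ) • Pi.single j 1)
  rw [quad_single_add] at h1 h2
  constructor <;> linarith [h i, h j]

lemma isClosed_posSemidef : IsClosed {v : SymMat K | v.toMatrix.PosSemidef} := by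
  simp only [posSemidef_iff, ofPred_forall]
  exact isClosed_iInter fun x => isClosed_le continuous_const (quad x).continuous

end SymMat

section SpectralBox

variable {K : ℕ}

open SymMat

lemma mem_spectralBox {v : SymMat K} :
    v ∈ spectralBox K ↔ (∀ x, x ⬝ᵥ x ≤ quad x v) ∧ ∀ x, quad x v ≤ 2 * (x ⬝ᵥ x) := by
  rw [spectralBox, mem_ofPred_eq, posSemidef_sub_one_iff, posSemidef_two_sub_iff]

lemma isClosed_spectralBox : IsClosed (spectralBox K) := by
  have : spectralBox K = (⋂ x, {v | x ⬝ᵥ x ≤ quad x v}) ∩ ⋂ x, {v | quad x v ≤ 2 * (x ⬝ᵥ x)} := by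
    ext v
    rw [mem_spectralBox, mem_inter_iff, mem_iInter, mem_iInter]
    rfl
  rw [this]
  exact (isClosed_iInter fun x => isClosed_le continuous_const (quad x).continuous).inter
    (isClosed_iInter fun x => isClosed_le (quad x).continuous continuous_const)

lemma posSemidef_of_mem_spectralBox {v : SymMat K} (hv : v ∈ spectralBox K) :
    v.toMatrix.PosSemidef :=
  (posSemidef_iff v).2 fun x => (dotProduct_self_nonneg x).trans ((mem_spectralBox.1 hv).1 x)

lemma norm_le_of_mem_spectralBox {v : SymMat K} (hv : v ∈ spectralBox K) : ‖v‖ ≤ 2 := by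
  refine norm_le_of_posSemidef (posSemidef_of_mem_spectralBox hv) zero_le_two fun i => ?_
  have := (mem_spectralBox.1 hv).2 (Pi.single i 1)
  rw [quad_single] at this
  simpa using this

lemma abs_quad_le (x : Fin K → ℝ) (v : SymMat K) : |quad x v| ≤ K * ‖v‖ * (x ⬝ᵥ x) := by
  have h1 : |quad x v| ≤ ∑ i, ∑ j, ‖v‖ * (|x i| * |x j|) := by
    rw [quad_apply]
    unfold dotProduct Matrix.mulVec dotProduct
    refine (Finset.abs_sum_le_sum_abs _ _).trans (Finset.sum_le_sum fun i _ => ?_)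
    rw [Finset.mul_sum]
    refine (Finset.abs_sum_le_sum_abs _ _).trans (Finset.sum_le_sum fun j _ => ?_)
    rw [abs_mul, abs_mul, mul_left_comm]
    exact mul_le_mul_of_nonneg_right (v.abs_toMatrix_le i j) (by positivity)
  have h2 : ∑ i, ∑ j, ‖v‖ * (|x i| * |x j|) = ‖v‖ * (∑ i, |x i|) ^ 2 := by
    rw [sq, Finset.sum_mul_sum]
    simp only [Finset.mul_sum]
  have h3 : (∑ i, |x i|) ^ 2 ≤ K * (x ⬝ᵥ x) := by
    have := sq_sum_le_card_mul_sum_sq (s := Finset.univ) (f := fun i => |x i|)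
    simpa [dotProduct, sq] using this
  rw [h2] at h1
  refine h1.trans ((mul_le_mul_of_nonneg_left h3 (norm_nonneg v)).trans_eq ?_)
  ring

lemma ball_subset_spectralBox :
    Metric.ball ((3 / 2 : ℝ) • ∑ i, rankOne (Pi.single i (1 : ℝ) : Fin K → ℝ)) (1 / (2 * (K + 1)))
      ⊆ spectralBox K := by
  intro v hv
  have hK : (0 : ℝ) ≤ K := Nat.cast_nonneg K
  set c := (3 / 2 : ℝ) • ∑ i, rankOne (Pi.single i (1 : ℝ) : Fin K → ℝ) with hc
  have h1 : ∀ x, quad x c = 3 / 2 * (x ⬝ᵥ x) := fun x => by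
    rw [hc, map_smul, map_sum, smul_eq_mul]
    simp only [quad_rankOne, single_one_dotProduct]
    simp only [dotProduct, sq]
  have h2 : ∀ x, |quad x v - 3 / 2 * (x ⬝ᵥ x)| ≤ 1 / 2 * (x ⬝ᵥ x) := fun x => by
    rw [← h1, ← map_sub]
    refine (abs_quad_le x _).trans ?_
    have h3 : 0 ≤ x ⬝ᵥ x := dotProduct_self_nonneg x
    refine mul_le_mul_of_nonneg_right ?_ h3
    have h4 : ‖v - c‖ ≤ 1 / (2 * (K + 1)) := (mem_ball_iff_norm.1 hv).le
    refine (mul_le_mul_of_nonneg_left h4 hK).trans ?_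
    rw [mul_one_div, div_le_div_iff₀ (by positivity) two_pos]
    linarith
  rw [mem_spectralBox]
  constructor <;> intro x <;> have := abs_le.1 (h2 x) <;> linarith [this.1, this.2]

lemma volume_spectralBox_pos : 0 < volume (spectralBox K) :=
  (Metric.measure_ball_pos volume _ (by positivity)).trans_le (measure_mono ball_subset_spectralBox)

lemma volume_spectralBox_lt_top : volume (spectralBox K) < ⊤ := by
  refine Metric.isBounded_iff_subset_closedBall 0 |>.2 ⟨2, fun v hv => ?_⟩ |>.measure_lt_top
  rw [mem_closedBall_zero_iff]
  exact norm_le_of_mem_spectralBox hv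

lemma isClosed_perturbationSet {s : ℝ} (hs : s ≠ 0) : IsClosed (perturbationSet K s) :=
  (isClosed_spectralBox.smul_of_ne_zero hs).prod (isClosed_spectralBox.smul_of_ne_zero hs)

lemma volume_perturbationSet {s : ℝ} (hs : 0 ≤ s) : (volume (perturbationSet K s)).toReal
    = (s ^ Fintype.card (UpperIdx K) * (volume (spectralBox K)).toReal) ^ 2 := by
  unfold perturbationSet
  rw [Measure.volume_eq_prod, Measure.prod_prod, Measure.addHaar_smul_of_nonneg _ hs,
    ENNReal.toReal_mul, ENNReal.toReal_mul, ENNReal.toReal_ofReal (by positivity),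
    Module.finrank_fintype_fun_eq_card, sq]

lemma volume_perturbationSet_lt_top (s : ℝ) : volume (perturbationSet K s) < ⊤ := by
  unfold perturbationSet
  rw [Measure.volume_eq_prod, Measure.prod_prod, Measure.addHaar_smul]
  exact ENNReal.mul_lt_top (ENNReal.mul_lt_top ENNReal.ofReal_lt_top volume_spectralBox_lt_top)
    (ENNReal.mul_lt_top ENNReal.ofReal_lt_top volume_spectralBox_lt_top)

/-- The image of the perturbations under the interpolation. -/
lemma interpolationMap_mem {P0 : Measure (Fin K → ℝ)} {s B M : ℝ} (hs : 0 < s) (hs2 : s ≤ 1 / 2)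
    (hM : ∀ i, secondMoment P0 i i ≤ M ^ 2) {r q : ℝ → SymMat K × SymMat K → SymMat K}
    (h : IsInterpolation P0 s B r q) {t : ℝ} (ht : t ∈ Icc (0 : ℝ) 1) {ε : SymMat K × SymMat K}
    (hε : ε ∈ perturbationSet K s) :
    ((∀ x, s * (x ⬝ᵥ x) ≤ quad x (interpolationMap r q t ε).1)
        ∧ ‖(interpolationMap r q t ε).1‖ ≤ 1 + |B|)
      ∧ ‖(interpolationMap r q t ε).2‖ ≤ 1 + M ^ 2 := by
  have hsub : ∀ v ∈ Icc 0 t, v ∈ Icc (0 : ℝ) 1 := fun v hv => ⟨hv.1, hv.2.trans ht.2⟩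
  have hbox : ∀ w ∈ s • spectralBox K, (∀ x, s * (x ⬝ᵥ x) ≤ quad x w) ∧ ‖w‖ ≤ 1 := by
    rintro _ ⟨w, hw, rfl⟩
    refine ⟨fun x => ?_, ?_⟩
    · simp only [map_smul, smul_eq_mul]
      exact mul_le_mul_of_nonneg_left ((mem_spectralBox.1 hw).1 x) hs.le
    · simp only [norm_smul, Real.norm_eq_abs, abs_of_pos hs]
      nlinarith [norm_le_of_mem_spectralBox hw, norm_nonneg w]
  have hint : ∀ (f : ℝ → SymMat K) (c : ℝ), 0 ≤ c → (∀ v ∈ Icc (0 : ℝ) 1, ‖f v‖ ≤ c) →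
      ‖∫ v in (0 : ℝ)..t, f v‖ ≤ c := fun f c hc hf => by
    refine (intervalIntegral.norm_integral_le_of_norm_le_const (C := c) fun v hv => ?_).trans ?_
    · rw [uIoc_of_le ht.1] at hv
      exact hf v (hsub v ⟨hv.1.le, hv.2⟩)
    · rw [sub_zero, abs_of_nonneg ht.1]
      exact mul_le_of_le_one_right hc ht.2
  have hi : IntervalIntegrable (fun v => r v ε) volume 0 t :=
    (h.r_integrable ε hε).mono_set (by
      rw [uIcc_of_le ht.1, uIcc_of_le zero_le_one]; exact Icc_subset_Icc_right ht.2)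
  have h1 := hbox _ hε.1
  have h2 := hbox _ hε.2
  refine ⟨⟨fun x => ?_, ?_⟩, ?_⟩
  · change _ ≤ quad x (ε.1 + ∫ v in (0 : ℝ)..t, r v ε)
    rw [map_add, ← ContinuousLinearMap.intervalIntegral_comp_comm _ hi]
    refine le_add_of_le_of_nonneg (h1.1 x) (intervalIntegral.integral_nonneg ht.1 fun v hv => ?_)
    exact (posSemidef_iff _).1 (h.r_posSemidef v (hsub v hv) ε hε) x
  · refine (norm_add_le _ _).trans (add_le_add h1.2 (hint _ _ (abs_nonneg B) fun v hv => ?_))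
    exact (h.r_bounded v hv ε hε).trans (le_abs_self B)
  · refine (norm_add_le _ _).trans (add_le_add h2.2 (hint _ _ (sq_nonneg M) fun v hv => ?_))
    refine norm_le_of_posSemidef (h.q_posSemidef v hv ε hε) (sq_nonneg M) fun i => ?_
    have := (h.q_le v hv ε hε).diag_nonneg (i := i)
    rw [Matrix.sub_apply, sub_nonneg] at this
    exact this.trans (hM i)

end SpectralBox

end

noncomputable section

/-- The constant in the concentration of the free entropy. -/
def freeConst (K : ℕ) (L Δ M α b : ℝ) : ℝ :=
  4 * (M ^ 2 * K ^ 3 * b)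
    + 4 * α * ∫ z, ((2 * L + √Δ * |z|) ^ 2 / (2 * Δ)) ^ 2 ∂(gaussianReal 0 1)
    + (α * (M ^ 2 * ∫ z, ((4 * L ^ 2 + 2 * L * (2 * L + √Δ * |z|)) / Δ
        + 8 * (2 * L * (2 * L + √Δ * |z|) / Δ) ^ 2) ∂(gaussianReal 0 1)) + 2 * K ^ 2 * b * M ^ 2) ^ 2

/-- The constant in the averaged concentration of the overlap in one direction. -/
def dirConst (K : ℕ) (L Δ M α b : ℝ) : ℝ :=
  16 * M ^ 2 + 8 * M ^ 2 * (6 * (√(freeConst K L Δ M α b) + 4 * M) + 2 * M + 6 * M ^ 2 + 2 * M)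

lemma dirConst_nonneg (K : ℕ) {M : ℝ} (L Δ α b : ℝ) (hM : 0 ≤ M) : 0 ≤ dirConst K L Δ M α b := by
  unfold dirConst; positivity

namespace OutputModel

variable {n m K : ℕ} (𝒪 : OutputModel K) {s t : ℝ} (ht : 0 ≤ t)

lemma variance_bound_le {α b : ℝ} (hα : 0 ≤ α) (hb : 0 ≤ b) (hm : (m : ℝ) ≤ α * n)
    (R2 : SymMat K) :
    4 * n * ((𝒪.glm n s ht R2).M ^ 2 * K ^ 3 * b) + 4 * m * (𝒪.glm n s ht R2).rowConst
        + n * (m * ((𝒪.glm n s ht R2).κ ^ 2 * (𝒪.glm n s ht R2).M ^ 2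
          * (𝒪.glm n s ht R2).curvConst) + 2 * K ^ 2 * b * (𝒪.glm n s ht R2).M ^ 2) ^ 2
      ≤ n * freeConst K 𝒪.L 𝒪.Δ 𝒪.M α b := by
  have e : freeConst K 𝒪.L 𝒪.Δ 𝒪.M α b = 4 * (𝒪.M ^ 2 * K ^ 3 * b)
      + 4 * α * (𝒪.glm n s ht R2).rowConst
      + (α * (𝒪.M ^ 2 * (𝒪.glm n s ht R2).curvConst) + 2 * K ^ 2 * b * 𝒪.M ^ 2) ^ 2 := rfl
  have h1 : 0 ≤ (𝒪.glm n s ht R2).rowConst := integral_nonneg fun z => sq_nonneg _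
  have h2 := (𝒪.glm n s ht R2).curvConst_nonneg
  have h3 : (m : ℝ) * (𝒪.glm n s ht R2).κ ^ 2 ≤ α := by
    have := (𝒪.glm n s ht R2).κ_sq
    calc (m : ℝ) * (𝒪.glm n s ht R2).κ ^ 2 ≤ α * n * (𝒪.glm n s ht R2).κ ^ 2 :=
          mul_le_mul_of_nonneg_right hm (sq_nonneg _)
      _ = α * ((𝒪.glm n s ht R2).κ ^ 2 * n) := by ring
      _ ≤ α * 1 := mul_le_mul_of_nonneg_left this hα
      _ = α := mul_one α
  have h4 : (m : ℝ) * ((𝒪.glm n s ht R2).κ ^ 2 * 𝒪.M ^ 2 * (𝒪.glm n s ht R2).curvConst)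
      ≤ α * (𝒪.M ^ 2 * (𝒪.glm n s ht R2).curvConst) := by
    rw [mul_assoc, ← mul_assoc]
    exact mul_le_mul_of_nonneg_right h3 (by positivity)
  have hn : (0 : ℝ) ≤ n := Nat.cast_nonneg n
  rw [e, mul_add, mul_add]
  refine add_le_add (add_le_add (le_of_eq ?_) ?_) ?_
  · change 4 * n * (𝒪.M ^ 2 * K ^ 3 * b) = _
    ring
  · have := mul_le_mul_of_nonneg_right hm h1
    linarith
  · refine mul_le_mul_of_nonneg_left (pow_le_pow_left₀ ?_ (add_le_add_left h4 _) 2) hn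
    change 0 ≤ (m : ℝ) * ((𝒪.glm n s ht R2).κ ^ 2 * 𝒪.M ^ 2 * (𝒪.glm n s ht R2).curvConst)
      + 2 * K ^ 2 * b * 𝒪.M ^ 2
    positivity

/-- The optimized right-hand side of the scalar bound. -/
lemma scalar_bound_le {x d M C : ℝ} (hx : 1 ≤ x) (hd : 0 < d) (hd1 : 3 * d ≤ 1) (hM : 0 ≤ M) :
    4 * (2 * M) ^ 2 + 2 * (2 * M) ^ 2 *
      (d * (3 * (x ^ 2 * C + √(3 * d) * (2 * (2 * M) * x ^ 2)) / (d / (2 * x))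
        + 2 * M * x ^ 2 / √d)
      + 2 * (d / (2 * x)) * (x ^ 4 * (3 / 2 * (2 * M) ^ 2) + 2 * M * x ^ 4 / √(d / 2)))
      ≤ x ^ 3 * (16 * M ^ 2 + 8 * M ^ 2 * (6 * (C + 4 * M) + 2 * M + 6 * M ^ 2 + 2 * M)) := by
  have hx0 : 0 < x := by linarith
  have hx3 : 1 ≤ x ^ 3 := one_le_pow₀ hx
  have hx2 : x ^ 2 ≤ x ^ 3 := pow_le_pow_right₀ hx (by norm_num)
  have e1 : d * (3 * (x ^ 2 * C + √(3 * d) * (2 * (2 * M) * x ^ 2)) / (d / (2 * x)))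
      = x ^ 3 * (6 * (C + 4 * M * √(3 * d))) := by
    field_simp; ring
  have e2 : d * (2 * M * x ^ 2 / √d) = 2 * M * x ^ 2 * √d := by
    have := Real.sq_sqrt hd.le
    have h0 := Real.sqrt_pos.2 hd
    field_simp
    rw [this, mul_comm]
  have e3 : 2 * (d / (2 * x)) * (x ^ 4 * (3 / 2 * (2 * M) ^ 2) + 2 * M * x ^ 4 / √(d / 2))
      = x ^ 3 * (6 * M ^ 2 * d + 2 * M * (d / √(d / 2))) := by
    have h0 := Real.sqrt_pos.2 (half_pos hd)
    field_simp; ring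
  have e4 : d / √(d / 2) = 2 * √(d / 2) := by
    have h0 := Real.sqrt_pos.2 (half_pos hd)
    rw [div_eq_iff h0.ne']
    have := Real.sq_sqrt (half_pos hd).le
    nlinarith
  have h1 : √(3 * d) ≤ 1 := Real.sqrt_le_one.2 hd1
  have h2 : √d ≤ 1 := Real.sqrt_le_one.2 (by linarith)
  have h3 : 2 * √(d / 2) ≤ 1 := by
    have : √(d / 2) ≤ 1 / 2 := Real.sqrt_le_iff.2 ⟨by norm_num, by linarith⟩
    linarith
  rw [mul_add d, e1, e2, e3, e4]
  have p1 : x ^ 3 * (6 * (C + 4 * M * √(3 * d))) ≤ x ^ 3 * (6 * (C + 4 * M)) := by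
    refine mul_le_mul_of_nonneg_left ?_ (by positivity)
    nlinarith
  have p2 : 2 * M * x ^ 2 * √d ≤ x ^ 3 * (2 * M) := by
    calc 2 * M * x ^ 2 * √d ≤ 2 * M * x ^ 2 * 1 := mul_le_mul_of_nonneg_left h2 (by positivity)
      _ ≤ x ^ 3 * (2 * M) := by nlinarith
  have p3 : x ^ 3 * (6 * M ^ 2 * d + 2 * M * (2 * √(d / 2))) ≤ x ^ 3 * (6 * M ^ 2 + 2 * M) := by
    refine mul_le_mul_of_nonneg_left ?_ (by positivity)
    have : 6 * M ^ 2 * d ≤ 6 * M ^ 2 * 1 := mul_le_mul_of_nonneg_left (by linarith) (by positivity)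
    nlinarith
  have p4 : 2 * (2 * M) ^ 2 * (x ^ 3 * (6 * (C + 4 * M * √(3 * d))) + 2 * M * x ^ 2 * √d
      + x ^ 3 * (6 * M ^ 2 * d + 2 * M * (2 * √(d / 2))))
      ≤ 2 * (2 * M) ^ 2 * (x ^ 3 * (6 * (C + 4 * M)) + x ^ 3 * (2 * M)
        + x ^ 3 * (6 * M ^ 2 + 2 * M)) :=
    mul_le_mul_of_nonneg_left (by linarith) (by positivity)
  have p5 : 4 * (2 * M) ^ 2 ≤ x ^ 3 * (16 * M ^ 2) := by nlinarith [sq_nonneg M]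
  refine (add_le_add p5 p4).trans_eq ?_
  ring

include ht in
/-- The fluctuation in one direction, averaged over the strength of a rank one perturbation. -/
lemma integral_fluct_dir_le (hn : 0 < n) {α b d : ℝ} (hα : 0 ≤ α) (hm : (m : ℝ) ≤ α * n)
    (hd : 0 < d) (hd1 : 12 * d ≤ 1) {v : Fin K → ℝ} (hv : ∑ l, |v l| ≤ 2) {R1 : SymMat K}
    (hR1 : R1.toMatrix.PosSemidef) (hb : ‖R1‖ + 1 ≤ b) (R2 : SymMat K) :
    ∫⁻ l in Ioc d (2 * d), ENNReal.ofReal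
        (𝒪.fluct n m s t (ovl v v) (R1 + l • SymMat.rankOne v, R2))
      ≤ ENNReal.ofReal (dirConst K 𝒪.L 𝒪.Δ 𝒪.M α b / (n : ℝ) ^ (1 / 4 : ℝ)) := by
  set x : ℝ := (n : ℝ) ^ (1 / 4 : ℝ) with hxdef
  have hn1 : (1 : ℝ) ≤ n := by exact_mod_cast hn
  have hx : 1 ≤ x := Real.one_le_rpow hn1 (by norm_num)
  have hx0 : 0 < x := by linarith
  have hx4 : x ^ 4 = n := by
    rw [hxdef, ← Real.rpow_natCast, ← Real.rpow_mul (Nat.cast_nonneg n)]; norm_num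
  have hxs : √(n : ℝ) = x ^ 2 := by
    rw [← hx4, show x ^ 4 = (x ^ 2) ^ 2 by ring]
    exact Real.sqrt_sq (by positivity)
  have hb0 : 0 ≤ b := by linarith [norm_nonneg R1]
  set F : ℝ → Matrix (Fin K) (Fin K) ℝ := fun l => psdSqrt (R1 + l • SymMat.rankOne v).toMatrix
  have hpsd : ∀ l : ℝ, 0 ≤ l → (R1 + l • SymMat.rankOne v).toMatrix.PosSemidef := fun l hl => by
    rw [SymMat.posSemidef_iff]
    intro y
    rw [map_add, map_smul, SymMat.quad_rankOne, smul_eq_mul]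
    have := (SymMat.posSemidef_iff R1).1 hR1 y
    positivity
  have hFF : ∀ l : ℝ, 0 ≤ l → F l * (F l)ᵀ = (R1 + l • SymMat.rankOne v).toMatrix :=
    fun l hl => psdSqrt_mul_transpose (hpsd l hl)
  have hpos : ∀ l ∈ Icc (d / 2) (3 * d), 0 ≤ l := fun l hl => by linarith [hl.1]
  have hV := 𝒪.variance_bound_le (n := n) (m := m) (s := s) ht hα hb0 hm R2
  obtain ⟨hint, key⟩ := (𝒪.glm n s ht R2).integral_varComp_le m (A := psdSqrt R1.toMatrix) (v := v)
    hn hv (d := d) (h := d / (2 * x)) (b := b) hd (by positivity)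
    (div_le_div_of_nonneg_left hd.le two_pos (by linarith)) hb0 F
    (fun l hl => by
      rw [hFF l (hpos l hl), psdSqrt_mul_transpose hR1, SymMat.toMatrix_add, SymMat.toMatrix_smul,
        SymMat.toMatrix_rankOne])
    (fun l hl i j => by
      rw [hFF l (hpos l hl)]
      refine (SymMat.abs_toMatrix_le _ i j).trans ((norm_add_le _ _).trans (le_trans ?_ hb))
      rw [norm_smul, Real.norm_eq_abs, abs_of_nonneg (hpos l hl)]
      nlinarith [SymMat.norm_rankOne_le hv, hl.2, hpos l hl, norm_nonneg (SymMat.rankOne v)])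
    hV
  rw [Real.sqrt_mul (Nat.cast_nonneg n), hxs, ← hx4] at key
  have key2 := key.trans (scalar_bound_le hx hd (by linarith) 𝒪.M_nonneg)
  have e1 : ∀ l ∈ Ioc d (2 * d), 𝒪.fluct n m s t (ovl v v) (R1 + l • SymMat.rankOne v, R2)
      = (𝒪.glm n s ht R2).varComp m (F l) v := fun l _ => 𝒪.fluct_ovl_eq ht _ hn hv hv
  have hd2 : d ≤ 2 * d := by linarith
  rw [setLIntegral_congr_fun measurableSet_Ioc fun l hl => by rw [e1 l hl]]
  rw [intervalIntegrable_iff_integrableOn_Ioc_of_le hd2] at hint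
  rw [← ofReal_integral_eq_lintegral_ofReal hint (Eventually.of_forall fun l =>
    BayesModel.var_nonneg _ _), ← intervalIntegral.integral_of_le hd2]
  refine ENNReal.ofReal_le_ofReal ?_
  rw [le_div_iff₀ hx0]
  have hx3 : 0 < x ^ 3 := by positivity
  refine le_of_mul_le_mul_left ?_ hx3
  refine le_of_eq_of_le ?_ key2
  ring

end OutputModel

end

noncomputable section

namespace OutputModel

variable {n m K : ℕ} (𝒪 : OutputModel K) {s t : ℝ}

/-- The fluctuation in one direction, integrated over the first perturbed matrix. -/
lemma lintegral_fluct_fst_le (hn : 0 < n) {α b : ℝ} (ht : 0 ≤ t) (hα : 0 ≤ α)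
    (hm : (m : ℝ) ≤ α * n) (hs : 0 < s) (hs2 : s ≤ 1 / 2) (hb : 0 ≤ b)
    {v : Fin K → ℝ} (hv : ∑ l, |v l| ≤ 2) (R2 : SymMat K) :
    ∫⁻ R1 in {R : SymMat K | (∀ x, s * (x ⬝ᵥ x) ≤ SymMat.quad x R) ∧ ‖R‖ ≤ b},
        ENNReal.ofReal (𝒪.fluct n m s t (ovl v v) (R1, R2))
      ≤ ENNReal.ofReal (dirConst K 𝒪.L 𝒪.Δ 𝒪.M α (b + 2) / (n : ℝ) ^ (1 / 4 : ℝ) / (s / 8)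
        * (2 * (b + 1)) ^ Fintype.card (UpperIdx K)) := by
  set τ := dirConst K 𝒪.L 𝒪.Δ 𝒪.M α (b + 2) / (n : ℝ) ^ (1 / 4 : ℝ) with hτ
  have hτ0 : 0 ≤ τ := div_nonneg (dirConst_nonneg K _ _ _ _ 𝒪.M_nonneg) (by positivity)
  set d := s / 8 with hd
  have hd0 : 0 < d := by positivity
  set V := SymMat.rankOne v with hV
  set f : SymMat K → ENNReal := fun R => ENNReal.ofReal (𝒪.fluct n m s t (ovl v v) (R, R2)) with hf
  have hfm : Measurable f := by
    have := (𝒪.measurable_fluct_ovl (n := n) (m := m) s v v).comp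
      (f := fun R : SymMat K => (t, R, R2)) (by fun_prop)
    exact this.ennreal_ofReal
  set E' := {R : SymMat K | (∀ x, s * (x ⬝ᵥ x) ≤ SymMat.quad x R) ∧ ‖R‖ ≤ b} with hE'
  set E := {R : SymMat K | R.toMatrix.PosSemidef ∧ ‖R‖ ≤ b + 1} with hE
  have hE'm : MeasurableSet E' := by
    have : E' = (⋂ x, {R | s * (x ⬝ᵥ x) ≤ SymMat.quad x R}) ∩ {R | ‖R‖ ≤ b} := by
      ext R; rw [mem_inter_iff, mem_iInter]; rfl
    rw [this]
    exact ((isClosed_iInter fun x => isClosed_le continuous_const (SymMat.quad x).continuous).inter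
      (isClosed_le continuous_norm continuous_const)).measurableSet
  have hEm : MeasurableSet E :=
    (SymMat.isClosed_posSemidef.inter (isClosed_le continuous_norm continuous_const)).measurableSet
  have hEvol : volume E ≤ ENNReal.ofReal ((2 * (b + 1)) ^ Fintype.card (UpperIdx K)) := by
    rw [← Real.volume_pi_closedBall 0 (by positivity)]
    exact measure_mono fun R hR => mem_closedBall_zero_iff.2 hR.2
  have hshift : ∀ l ∈ Ioc d (2 * d), ∫⁻ R in E', f R ≤ ∫⁻ R in E, f (R + l • V) := by
    intro l hl
    have hl0 : 0 < l := hd0.trans hl.1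
    rw [← lintegral_indicator hE'm, ← lintegral_indicator hEm,
      ← lintegral_add_right_eq_self (E'.indicator f) (l • V)]
    refine lintegral_mono fun R => ?_
    by_cases h : R + l • V ∈ E'
    · have hR : R ∈ E := by
        refine ⟨(SymMat.posSemidef_iff R).2 fun x => ?_, ?_⟩
        · have h1 := h.1 x
          rw [map_add, map_smul, smul_eq_mul, SymMat.quad_rankOne] at h1
          have h2 := SymMat.dotProduct_sq_le hv x
          have h3 := SymMat.dotProduct_self_nonneg x
          have h4 : l * (v ⬝ᵥ x) ^ 2 ≤ (2 * d) * (4 * (x ⬝ᵥ x)) :=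
            mul_le_mul hl.2 h2 (sq_nonneg _) (by positivity)
          have h5 : (2 * d) * (4 * (x ⬝ᵥ x)) = s * (x ⬝ᵥ x) := by rw [hd]; ring
          linarith
        · have h1 : ‖R‖ ≤ ‖R + l • V‖ + ‖l • V‖ := by
            simpa using norm_sub_le (R + l • V) (l • V)
          have h2 : ‖l • V‖ ≤ 1 := by
            rw [norm_smul, Real.norm_eq_abs, abs_of_pos hl0]
            nlinarith [SymMat.norm_rankOne_le hv, hl.2, norm_nonneg V]
          linarith [h.2]
      rw [indicator_of_mem h, indicator_of_mem hR]
    · rw [indicator_of_notMem h]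
      exact bot_le
  have hvol : volume (Ioc d (2 * d)) = ENNReal.ofReal d := by
    rw [Real.volume_Ioc]; congr 1; ring
  have hswap : ENNReal.ofReal d * ∫⁻ R in E', f R
      ≤ ENNReal.ofReal τ * ENNReal.ofReal ((2 * (b + 1)) ^ Fintype.card (UpperIdx K)) := by
    calc ENNReal.ofReal d * ∫⁻ R in E', f R
        = ∫⁻ _ in Ioc d (2 * d), ∫⁻ R in E', f R := by rw [setLIntegral_const, hvol, mul_comm]
      _ ≤ ∫⁻ l in Ioc d (2 * d), ∫⁻ R in E, f (R + l • V) :=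
          setLIntegral_mono' measurableSet_Ioc hshift
      _ = ∫⁻ R in E, ∫⁻ l in Ioc d (2 * d), f (R + l • V) := by
          refine lintegral_lintegral_swap (Measurable.aemeasurable ?_)
          exact hfm.comp (by fun_prop)
      _ ≤ ∫⁻ _ in E, ENNReal.ofReal τ :=
          setLIntegral_mono' hEm fun R hR => 𝒪.integral_fluct_dir_le ht hn hα hm hd0
            (by rw [hd]; linarith) hv hR.1 (by linarith [hR.2]) R2
      _ = ENNReal.ofReal τ * volume E := setLIntegral_const _ _
      _ ≤ _ := by gcongr
  have hd1 : ENNReal.ofReal d ≠ 0 := by simpa using hd0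
  have hfin := (ENNReal.mul_le_iff_le_inv hd1 ENNReal.ofReal_ne_top).1 hswap
  refine hfin.trans_eq ?_
  rw [← ENNReal.ofReal_inv_of_pos hd0, ← ENNReal.ofReal_mul hτ0, ← ENNReal.ofReal_mul (by positivity)]
  congr 1
  rw [div_eq_mul_inv τ d]
  ring

/-- The bound for the integral over all perturbations of the fluctuation in one direction. -/
def pertBound (𝒪 : OutputModel K) (n : ℕ) (α s B : ℝ) : ℝ :=
  dirConst K 𝒪.L 𝒪.Δ 𝒪.M α (1 + |B| + 2) / (n : ℝ) ^ (1 / 4 : ℝ) / (s / 8)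
    * (2 * (1 + |B| + 1)) ^ Fintype.card (UpperIdx K)
    * (2 * (1 + 𝒪.M ^ 2)) ^ Fintype.card (UpperIdx K)

lemma secondMoment_diag_le (i : Fin K) : secondMoment 𝒪.P0 i i ≤ 𝒪.M ^ 2 := by
  have hM := 𝒪.M_nonneg
  refine (le_abs_self _).trans (abs_integral_le_of_ae_abs_le ?_)
  filter_upwards [𝒪.ae_abs_le] with w hw
  rw [← sq, abs_pow]
  exact pow_le_pow_left₀ (abs_nonneg _) (hw i) 2

section ChangeOfVariables

variable {B : ℝ} {r q : ℝ → SymMat K × SymMat K → SymMat K}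

lemma lintegral_fluct_comp_le (hn : 0 < n) {α : ℝ} (hα : 0 ≤ α) (hm : (m : ℝ) ≤ α * n)
    (hs : 0 < s) (hs2 : s ≤ 1 / 2) (hI : IsInterpolation 𝒪.P0 s B r q) (ht : t ∈ Ioo (0 : ℝ) 1)
    (hF : IsExpandingDiffeo (interpolationMap r q t) (perturbationSet K s))
    {v : Fin K → ℝ} (hv : ∑ l, |v l| ≤ 2) :
    ∫⁻ ε in perturbationSet K s,
        ENNReal.ofReal (𝒪.fluct n m s t (ovl v v) (interpolationMap r q t ε))
      ≤ ENNReal.ofReal (𝒪.pertBound n α s B) := by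
  set F := interpolationMap r q t with hFdef
  set D := perturbationSet K s with hD
  set g : SymMat K × SymMat K → ENNReal := fun R =>
    ENNReal.ofReal (𝒪.fluct n m s t (ovl v v) R) with hg
  have hgm : Measurable g := by
    have := (𝒪.measurable_fluct_ovl (n := n) (m := m) s v v).comp
      (f := fun R : SymMat K × SymMat K => (t, R)) (by fun_prop)
    exact this.ennreal_ofReal
  have hDm : MeasurableSet D := (isClosed_perturbationSet hs.ne').measurableSet
  have ht' : t ∈ Icc (0 : ℝ) 1 := Ioo_subset_Icc_self ht
  set E1 := {R : SymMat K | (∀ x, s * (x ⬝ᵥ x) ≤ SymMat.quad x R) ∧ ‖R‖ ≤ 1 + |B|}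
  set E2 : Set (SymMat K) := Metric.closedBall 0 (1 + 𝒪.M ^ 2)
  have himg : F '' D ⊆ E1 ×ˢ E2 := by
    rintro _ ⟨ε, hε, rfl⟩
    have := interpolationMap_mem hs hs2 𝒪.secondMoment_diag_le hI ht' hε
    exact ⟨this.1, mem_closedBall_zero_iff.2 this.2⟩
  have hderiv : ∀ ε ∈ D, HasFDerivWithinAt F (fderivWithin ℝ F D ε) D ε := fun ε hε =>
    ((hF.contDiffOn.differentiableOn one_ne_zero) ε hε).hasFDerivWithinAt
  have : (volume : Measure (SymMat K × SymMat K)).IsAddHaarMeasure :=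
    Measure.prod.instIsAddHaarMeasure _ _
  have hcov := lintegral_image_eq_lintegral_abs_det_fderiv_mul volume hDm hderiv hF.injOn g
  have hE2 : volume E2 = ENNReal.ofReal ((2 * (1 + 𝒪.M ^ 2)) ^ Fintype.card (UpperIdx K)) :=
    Real.volume_pi_closedBall 0 (by positivity)
  calc ∫⁻ ε in D, g (F ε)
      ≤ ∫⁻ ε in D, ENNReal.ofReal |(fderivWithin ℝ F D ε).det| * g (F ε) := by
        refine setLIntegral_mono' hDm fun ε hε => ?_
        refine le_mul_of_one_le_left bot_le ?_
        rw [ENNReal.one_le_ofReal]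
        exact (hF.one_le_jacobian ε hε).trans (le_abs_self _)
    _ = ∫⁻ R in F '' D, g R := hcov.symm
    _ ≤ ∫⁻ R in E1 ×ˢ E2, g R := lintegral_mono_set himg
    _ = ∫⁻ R2 in E2, ∫⁻ R1 in E1, g (R1, R2) := by
        rw [Measure.volume_eq_prod, ← Measure.prod_restrict, lintegral_prod_symm _ hgm.aemeasurable]
    _ ≤ ∫⁻ _ in E2, ENNReal.ofReal
          (dirConst K 𝒪.L 𝒪.Δ 𝒪.M α (1 + |B| + 2) / (n : ℝ) ^ (1 / 4 : ℝ) / (s / 8)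
            * (2 * (1 + |B| + 1)) ^ Fintype.card (UpperIdx K)) :=
        lintegral_mono fun R2 => 𝒪.lintegral_fluct_fst_le hn ht.1.le hα hm hs hs2
          (by positivity) hv R2
    _ = ENNReal.ofReal (𝒪.pertBound n α s B) := by
        rw [setLIntegral_const, hE2, ← ENNReal.ofReal_mul]
        · rfl
        · have := dirConst_nonneg K 𝒪.L 𝒪.Δ α (1 + |B| + 2) 𝒪.M_nonneg
          positivity

lemma integrableOn_fluct_comp (hn : 0 < n) (hs : 0 < s) (ht : t ∈ Ioo (0 : ℝ) 1)
    (hF : IsExpandingDiffeo (interpolationMap r q t) (perturbationSet K s))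
    {v v' : Fin K → ℝ} (hv : ∑ l, |v l| ≤ 2) (hv' : ∑ l, |v' l| ≤ 2) :
    IntegrableOn (fun ε => 𝒪.fluct n m s t (ovl v v') (interpolationMap r q t ε))
      (perturbationSet K s) := by
  have hDm : MeasurableSet (perturbationSet K s) := (isClosed_perturbationSet hs.ne').measurableSet
  have hFm := hF.contDiffOn.continuousOn.aemeasurable (μ := volume) hDm
  have hgm : Measurable fun R : SymMat K × SymMat K => 𝒪.fluct n m s t (ovl v v') R := by
    have := (𝒪.measurable_fluct_ovl (n := n) (m := m) s v v').comp
      (f := fun R : SymMat K × SymMat K => (t, R)) (by fun_prop)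
    exact this
  have : IsFiniteMeasure (volume.restrict (perturbationSet K s)) :=
    ⟨by rw [Measure.restrict_apply_univ]; exact volume_perturbationSet_lt_top s⟩
  refine Integrable.of_bound (hgm.comp_aemeasurable hFm).aestronglyMeasurable (16 * 𝒪.M ^ 4)
    (Eventually.of_forall fun ε => ?_)
  rw [Real.norm_eq_abs, abs_of_nonneg (𝒪.fluct_ovl_nonneg ht.1.le _ hn hv hv')]
  exact 𝒪.fluct_ovl_le ht.1.le _ hn hv hv'

lemma pertBound_nonneg {α : ℝ} (hs : 0 < s) : 0 ≤ 𝒪.pertBound n α s B := by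
  have := dirConst_nonneg K 𝒪.L 𝒪.Δ α (1 + |B| + 2) 𝒪.M_nonneg
  unfold pertBound
  positivity

lemma integral_fluct_comp_le (hn : 0 < n) {α : ℝ} (hα : 0 ≤ α) (hm : (m : ℝ) ≤ α * n)
    (hs : 0 < s) (hs2 : s ≤ 1 / 2) (hI : IsInterpolation 𝒪.P0 s B r q) (ht : t ∈ Ioo (0 : ℝ) 1)
    (hF : IsExpandingDiffeo (interpolationMap r q t) (perturbationSet K s))
    {v : Fin K → ℝ} (hv : ∑ l, |v l| ≤ 2) :
    ∫ ε in perturbationSet K s, 𝒪.fluct n m s t (ovl v v) (interpolationMap r q t ε)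
      ≤ 𝒪.pertBound n α s B := by
  have hi := 𝒪.integrableOn_fluct_comp (m := m) hn hs ht hF hv hv
  rw [← ENNReal.ofReal_le_ofReal_iff (𝒪.pertBound_nonneg hs), ofReal_integral_eq_lintegral_ofReal hi
    (Eventually.of_forall fun ε => 𝒪.fluct_ovl_nonneg ht.1.le _ hn hv hv)]
  exact 𝒪.lintegral_fluct_comp_le hn hα hm hs hs2 hI ht hF hv

/-- The overlap fluctuation at a fixed time, integrated over the perturbations. -/
lemma integral_overlapFluctuation_le (hn : 0 < n) {α : ℝ} (hα : 0 ≤ α) (hm : (m : ℝ) ≤ α * n)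
    (hs : 0 < s) (hs2 : s ≤ 1 / 2) (hI : IsInterpolation 𝒪.P0 s B r q) (ht : t ∈ Ioo (0 : ℝ) 1)
    (hF : IsExpandingDiffeo (interpolationMap r q t) (perturbationSet K s)) {a : ℝ} (ha : 0 < a) :
    ∫ ε in perturbationSet K s, overlapFluctuation n m 𝒪.φ 𝒪.Δ 𝒪.P0 𝒪.PA s t
        (interpolationMap r q t ε)
      ≤ K ^ 2 * ((3 + 64 * 𝒪.M ^ 2 / a) * 𝒪.pertBound n α s B
        + 64 * 𝒪.M ^ 2 * a * (volume (perturbationSet K s)).toReal) := by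
  have h2 : ∀ l : Fin K, ∑ j, |(Pi.single l (1 : ℝ) : Fin K → ℝ) j| ≤ 2 := fun l => by
    rw [sum_abs_single]; norm_num
  have hss := fun l l' : Fin K => sum_abs_single_add l l'
  simp only [𝒪.overlapFluctuation_eq ht.1.le _ hn]
  have hi := fun l l' => 𝒪.integrableOn_fluct_comp (m := m) hn hs ht hF (h2 l) (h2 l')
  have hi2 := fun l l' => 𝒪.integrableOn_fluct_comp (m := m) hn hs ht hF (hss l l') (hss l l')
  have hb := fun l => 𝒪.integral_fluct_comp_le hn hα hm hs hs2 hI ht hF (h2 l)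
  have hb2 := fun l l' => 𝒪.integral_fluct_comp_le hn hα hm hs hs2 hI ht hF (hss l l')
  have hterm : ∀ l l' : Fin K, ∫ ε in perturbationSet K s, 𝒪.fluct n m s t
      (ovl (Pi.single l 1) (Pi.single l' 1)) (interpolationMap r q t ε)
      ≤ (3 + 64 * 𝒪.M ^ 2 / a) * 𝒪.pertBound n α s B
        + 64 * 𝒪.M ^ 2 * a * (volume (perturbationSet K s)).toReal := by
    intro l l'
    have hc : IntegrableOn (fun _ : SymMat K × SymMat K => 64 * 𝒪.M ^ 2 * a)
        (perturbationSet K s) := integrableOn_const (volume_perturbationSet_lt_top s).ne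
    have i1 : IntegrableOn (fun ε => 𝒪.fluct n m s t (ovl (Pi.single l 1) (Pi.single l 1))
        (interpolationMap r q t ε) + 𝒪.fluct n m s t (ovl (Pi.single l' 1) (Pi.single l' 1))
        (interpolationMap r q t ε)) (perturbationSet K s) := (hi l l).add (hi l' l')
    have i2 : IntegrableOn (fun ε => (1 + 32 * 𝒪.M ^ 2 / a)
        * (𝒪.fluct n m s t (ovl (Pi.single l 1) (Pi.single l 1))
        (interpolationMap r q t ε) + 𝒪.fluct n m s t (ovl (Pi.single l' 1) (Pi.single l' 1))
        (interpolationMap r q t ε))) (perturbationSet K s) := i1.const_mul _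
    have i3 : IntegrableOn (fun ε => 𝒪.fluct n m s t (ovl (Pi.single l 1 + Pi.single l' 1)
        (Pi.single l 1 + Pi.single l' 1)) (interpolationMap r q t ε) + (1 + 32 * 𝒪.M ^ 2 / a)
        * (𝒪.fluct n m s t (ovl (Pi.single l 1) (Pi.single l 1))
        (interpolationMap r q t ε) + 𝒪.fluct n m s t (ovl (Pi.single l' 1) (Pi.single l' 1))
        (interpolationMap r q t ε))) (perturbationSet K s) := (hi2 l l').add i2
    refine (integral_mono (hi l l') (i3.add hc) fun ε =>
      𝒪.fluct_single_le ht.1.le _ hn l l' ha).trans ?_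
    simp only [Pi.add_apply]
    rw [integral_add i3 hc, integral_add (hi2 l l') i2, integral_const_mul,
      integral_add (hi l l) (hi l' l'), setIntegral_const, smul_eq_mul]
    have hpos : 0 ≤ 1 + 32 * 𝒪.M ^ 2 / a := by positivity
    have := mul_le_mul_of_nonneg_left (add_le_add (hb l) (hb l')) hpos
    refine (add_le_add (add_le_add (hb2 l l') this) le_rfl).trans_eq ?_
    rw [measureReal_def]
    ring
  have i4 : ∀ l, IntegrableOn (fun ε => ∑ l', 𝒪.fluct n m s t
      (ovl (Pi.single l 1) (Pi.single l' 1)) (interpolationMap r q t ε)) (perturbationSet K s) :=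
    fun l => integrable_finsetSum _ fun l' _ => hi l l'
  rw [integral_finsetSum _ fun l _ => i4 l]
  have e : ∀ l, ∫ ε in perturbationSet K s, ∑ l', 𝒪.fluct n m s t
      (ovl (Pi.single l 1) (Pi.single l' 1)) (interpolationMap r q t ε)
      = ∑ l', ∫ ε in perturbationSet K s, 𝒪.fluct n m s t
      (ovl (Pi.single l 1) (Pi.single l' 1)) (interpolationMap r q t ε) :=
    fun l => integral_finsetSum _ fun l' _ => hi l l'
  simp only [e]
  refine (Finset.sum_le_sum fun l _ => Finset.sum_le_sum fun l' _ => hterm l l').trans_eq ?_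
  simp only [Finset.sum_const, Finset.card_univ, Fintype.card_fin, nsmul_eq_mul]
  ring

end ChangeOfVariables

end OutputModel

end

noncomputable section

lemma continuousOn_primitive {E : Type*} [NormedAddCommGroup E] [NormedSpace ℝ E] {f : ℝ → E}
    (h : IntervalIntegrable f volume 0 1) :
    ContinuousOn (fun t => ∫ v in (0 : ℝ)..t, f v) (Ioo 0 1) := by
  have := intervalIntegral.continuousOn_primitive_interval ((intervalIntegrable_iff' (by simp)).1 h)
  rw [uIcc_of_le zero_le_one] at this
  exact this.mono Ioo_subset_Icc_self

lemma aemeasurable_interpolationMap {K : ℕ} {P0 : Measure (Fin K → ℝ)} {s B : ℝ} (hs : 0 < s)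
    {r q : ℝ → SymMat K × SymMat K → SymMat K} (hI : IsInterpolation P0 s B r q)
    (hF : ∀ t ∈ Ioo (0 : ℝ) 1, IsExpandingDiffeo (interpolationMap r q t) (perturbationSet K s)) :
    AEMeasurable (fun x : (SymMat K × SymMat K) × ℝ => interpolationMap r q x.2 x.1)
      (volume.restrict (perturbationSet K s ×ˢ Ioo (0 : ℝ) 1)) := by
  have hDm : MeasurableSet (perturbationSet K s) := (isClosed_perturbationSet hs.ne').measurableSet
  have hu : Measurable (Function.uncurry fun (t : Ioo (0 : ℝ) 1) (ε : perturbationSet K s) =>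
      interpolationMap r q t ε) := by
    refine measurable_uncurry_of_continuous_of_measurable (fun ε => ?_) fun t => ?_
    · have h1 := continuousOn_primitive (hI.r_integrable ε ε.2)
      have h2 := continuousOn_primitive (hI.q_integrable ε ε.2)
      exact (continuousOn_iff_continuous_domRestrict.1
        ((continuousOn_const.add h1).prodMk (continuousOn_const.add h2)))
    · exact (continuousOn_iff_continuous_domRestrict.1 (hF t t.2).contDiffOn.continuousOn).measurable
  refine aemeasurable_restrict_of_measurable_subtype (hDm.prod measurableSet_Ioo) ?_
  have hc : Measurable fun x : ↥(perturbationSet K s ×ˢ Ioo (0 : ℝ) 1) =>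
      ((⟨x.1.2, x.2.2⟩, ⟨x.1.1, x.2.1⟩) : Ioo (0 : ℝ) 1 × perturbationSet K s) :=
    ((measurable_snd.comp measurable_subtype_coe).subtype_mk).prodMk
      ((measurable_fst.comp measurable_subtype_coe).subtype_mk)
  exact hu.comp hc

namespace OutputModel

variable {n m K : ℕ} (𝒪 : OutputModel K) {s B : ℝ} {r q : ℝ → SymMat K × SymMat K → SymMat K}

lemma overlapFluctuation_nonneg (s : ℝ) {t : ℝ} (ht : 0 ≤ t) (hn : 0 < n)
    (R : SymMat K × SymMat K) : 0 ≤ overlapFluctuation n m 𝒪.φ 𝒪.Δ 𝒪.P0 𝒪.PA s t R := by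
  have h2 : ∀ l : Fin K, ∑ j, |(Pi.single l (1 : ℝ) : Fin K → ℝ) j| ≤ 2 := fun l => by
    rw [sum_abs_single]; norm_num
  rw [𝒪.overlapFluctuation_eq ht _ hn]
  exact Finset.sum_nonneg fun l _ => Finset.sum_nonneg fun l' _ =>
    𝒪.fluct_ovl_nonneg ht _ hn (h2 l) (h2 l')

lemma overlapFluctuation_le (s : ℝ) {t : ℝ} (ht : 0 ≤ t) (hn : 0 < n) (R : SymMat K × SymMat K) :
    overlapFluctuation n m 𝒪.φ 𝒪.Δ 𝒪.P0 𝒪.PA s t R ≤ K ^ 2 * (16 * 𝒪.M ^ 4) := by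
  have h2 : ∀ l : Fin K, ∑ j, |(Pi.single l (1 : ℝ) : Fin K → ℝ) j| ≤ 2 := fun l => by
    rw [sum_abs_single]; norm_num
  rw [𝒪.overlapFluctuation_eq ht _ hn]
  refine (Finset.sum_le_sum fun l _ => Finset.sum_le_sum fun l' _ =>
    𝒪.fluct_ovl_le ht _ hn (h2 l) (h2 l')).trans_eq ?_
  simp only [Finset.sum_const, Finset.card_univ, Fintype.card_fin, nsmul_eq_mul]
  ring

lemma restrict_prod_Ioo (D : Set (SymMat K × SymMat K)) {I : Set ℝ}
    (hI : Ioo (0 : ℝ) 1 =ᵐ[volume] I) :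
    (volume : Measure ((SymMat K × SymMat K) × ℝ)).restrict (D ×ˢ I)
      = volume.restrict (D ×ˢ Ioo (0 : ℝ) 1) :=
  Measure.restrict_congr_set (Measure.set_prod_ae_eq (ae_eq_refl D) hI.symm)

/-- The overlap fluctuation along the interpolation is integrable. -/
lemma integrableOn_overlapFluctuation (hn : 0 < n) (hs : 0 < s)
    (hI : IsInterpolation 𝒪.P0 s B r q)
    (hF : ∀ t ∈ Ioo (0 : ℝ) 1, IsExpandingDiffeo (interpolationMap r q t) (perturbationSet K s)) :
    IntegrableOn (fun x : (SymMat K × SymMat K) × ℝ =>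
        overlapFluctuation n m 𝒪.φ 𝒪.Δ 𝒪.P0 𝒪.PA s x.2 (interpolationMap r q x.2 x.1))
      (perturbationSet K s ×ˢ Ioo (0 : ℝ) 1) := by
  have hDm : MeasurableSet (perturbationSet K s ×ˢ Ioo (0 : ℝ) 1) :=
    (isClosed_perturbationSet hs.ne').measurableSet.prod measurableSet_Ioo
  have hfin : IsFiniteMeasure ((volume : Measure ((SymMat K × SymMat K) × ℝ)).restrict
      (perturbationSet K s ×ˢ Ioo (0 : ℝ) 1)) := ⟨by
    rw [Measure.restrict_apply_univ, Measure.volume_eq_prod, Measure.prod_prod, Real.volume_Ioo]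
    exact ENNReal.mul_lt_top (volume_perturbationSet_lt_top s) ENNReal.ofReal_lt_top⟩
  have hm : Measurable fun y : ℝ × SymMat K × SymMat K => ∑ l, ∑ l',
      𝒪.fluct n m s y.1 (ovl (Pi.single l 1) (Pi.single l' 1)) y.2 :=
    Finset.measurable_sum _ fun l _ => Finset.measurable_sum _ fun l' _ =>
      𝒪.measurable_fluct_ovl s _ _
  have hpair : AEMeasurable (fun x : (SymMat K × SymMat K) × ℝ =>
      (x.2, interpolationMap r q x.2 x.1)) (volume.restrict (perturbationSet K s ×ˢ Ioo (0 : ℝ) 1)) :=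
    measurable_snd.aemeasurable.prodMk (aemeasurable_interpolationMap hs hI hF)
  have hae : AEMeasurable (fun x : (SymMat K × SymMat K) × ℝ =>
        overlapFluctuation n m 𝒪.φ 𝒪.Δ 𝒪.P0 𝒪.PA s x.2 (interpolationMap r q x.2 x.1))
      (volume.restrict (perturbationSet K s ×ˢ Ioo (0 : ℝ) 1)) := by
    refine (hm.comp_aemeasurable hpair).congr ?_
    filter_upwards [ae_restrict_mem hDm] with x hx
    exact (𝒪.overlapFluctuation_eq hx.2.1.le _ hn).symm
  refine Integrable.of_bound hae.aestronglyMeasurable (K ^ 2 * (16 * 𝒪.M ^ 4)) ?_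
  filter_upwards [ae_restrict_mem hDm] with x hx
  rw [Real.norm_eq_abs, abs_of_nonneg (𝒪.overlapFluctuation_nonneg s hx.2.1.le hn _)]
  exact 𝒪.overlapFluctuation_le s hx.2.1.le hn _

/-- An average over perturbations and time is bounded by a bound on the integrals over
perturbations. -/
lemma average_overlapFluctuation_le (hn : 0 < n) (hs : 0 < s)
    (hI : IsInterpolation 𝒪.P0 s B r q)
    (hF : ∀ t ∈ Ioo (0 : ℝ) 1, IsExpandingDiffeo (interpolationMap r q t) (perturbationSet K s))
    {c : ℝ} (hc : ∀ t ∈ Ioo (0 : ℝ) 1, ∫ ε in perturbationSet K s,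
      overlapFluctuation n m 𝒪.φ 𝒪.Δ 𝒪.P0 𝒪.PA s t (interpolationMap r q t ε) ≤ c) :
    ⨍ ε in perturbationSet K s, ∫ t in (0 : ℝ)..1,
        overlapFluctuation n m 𝒪.φ 𝒪.Δ 𝒪.P0 𝒪.PA s t (interpolationMap r q t ε)
      ≤ (volume (perturbationSet K s)).toReal⁻¹ * c := by
  have hint := 𝒪.integrableOn_overlapFluctuation (m := m) hn hs hI hF
  unfold IntegrableOn at hint
  rw [Measure.volume_eq_prod, ← Measure.prod_restrict] at hint
  rw [setAverage_eq, smul_eq_mul, measureReal_def]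
  refine mul_le_mul_of_nonneg_left ?_ (by positivity)
  simp only [intervalIntegral.integral_of_le zero_le_one, integral_Ioc_eq_integral_Ioo]
  rw [integral_integral_swap hint]
  have h1 := hint.integral_prod_right
  refine (setIntegral_mono_on h1 (integrableOn_const (by simp)) measurableSet_Ioo hc).trans_eq ?_
  rw [setIntegral_const]
  simp [measureReal_def]

end OutputModel

end

noncomputable section

/-- The exponent in the interpolation between a trivial bound and a decaying bound. -/
def interpExponent (D : ℝ) : ℝ := Real.log 2 / (Real.log 2 + Real.log (1 + D))

lemma interpExponent_pos {D : ℝ} (hD : 0 ≤ D) : 0 < interpExponent D := by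
  have h1 := Real.log_pos one_lt_two
  have h2 := Real.log_nonneg (by linarith : 1 ≤ 1 + D)
  exact div_pos h1 (by linarith)

lemma le_of_le_of_le_div {X C D x : ℝ} (hC : 0 ≤ C) (hD : 0 ≤ D) (hx : 1 ≤ x) (h1 : X ≤ C)
    (h2 : X ≤ D / x) : X ≤ 2 * (C + 1) / x ^ interpExponent D := by
  have hx0 : 0 < x := by linarith
  set θ := interpExponent D with hθ
  have hlog := Real.log_pos one_lt_two
  have hlogD := Real.log_nonneg (by linarith : 1 ≤ 1 + D)
  have hθ0 : 0 < θ := interpExponent_pos hD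
  have hθ1 : θ ≤ 1 := (div_le_one (by linarith)).2 (by linarith)
  rcases le_or_gt X 0 with hX | hX
  · exact hX.trans (by positivity)
  have h3 : (1 + D) ^ θ ≤ 2 := by
    rw [Real.rpow_def_of_pos (by linarith)]
    refine (Real.exp_le_exp.2 ?_).trans (Real.exp_log two_pos).le
    rw [hθ, interpExponent, mul_div_assoc', div_le_iff₀ (by linarith)]
    nlinarith
  have h4 : X ^ (1 - θ) ≤ C + 1 := by
    refine (Real.rpow_le_rpow hX.le (by linarith : X ≤ C + 1) (by linarith)).trans ?_
    refine (Real.rpow_le_rpow_of_exponent_le (by linarith) (by linarith : 1 - θ ≤ 1)).trans ?_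
    rw [Real.rpow_one]
  have h5 : X ^ θ ≤ 2 / x ^ θ := by
    have : X ≤ (1 + D) / x := h2.trans (by gcongr; linarith)
    refine (Real.rpow_le_rpow hX.le this hθ0.le).trans ?_
    rw [Real.div_rpow (by linarith) hx0.le]
    gcongr
  calc X = X ^ (1 - θ) * X ^ θ := by rw [← Real.rpow_add hX]; simp
    _ ≤ (C + 1) * (2 / x ^ θ) := mul_le_mul h4 h5 (by positivity) (by linarith)
    _ = 2 * (C + 1) / x ^ θ := by ring

/-- The perturbation level. -/
def pertLevel (N n : ℕ) : ℝ := 1 / 2 * ((n : ℝ) + 1) ^ (-(1 / (16 * (2 * N + 1)) : ℝ))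

lemma pertLevel_pos (N n : ℕ) : 0 < pertLevel N n := by unfold pertLevel; positivity

lemma pertLevel_le (N n : ℕ) : pertLevel N n ≤ 1 / 2 := by
  unfold pertLevel
  refine mul_le_of_le_one_right (by norm_num) (Real.rpow_le_one_of_one_le_of_nonpos ?_ ?_)
  · linarith [(Nat.cast_nonneg n : (0 : ℝ) ≤ n)]
  · exact neg_nonpos.2 (by positivity)

lemma tendsto_pertLevel (N : ℕ) : Tendsto (pertLevel N) atTop (𝓝 0) := by
  have h1 := (tendsto_rpow_neg_atTop (by positivity : 0 < (1 / (16 * (2 * N + 1)) : ℝ))).comp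
    (tendsto_atTop_add_const_right _ (1 : ℝ) tendsto_natCast_atTop_atTop)
  have h2 := h1.const_mul (1 / 2)
  rwa [mul_zero] at h2

lemma inv_pertLevel_pow_le (N : ℕ) {n : ℕ} (hn : 1 ≤ n) :
    (pertLevel N n ^ (2 * N + 1))⁻¹ ≤ 2 ^ (2 * N + 2) * (n : ℝ) ^ (1 / 16 : ℝ) := by
  have hn1 : (1 : ℝ) ≤ n := by exact_mod_cast hn
  have e : (((n : ℝ) + 1) ^ (-(1 / (16 * (2 * N + 1)) : ℝ))) ^ (2 * N + 1)
      = (((n : ℝ) + 1) ^ (1 / 16 : ℝ))⁻¹ := by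
    rw [← Real.rpow_natCast, ← Real.rpow_mul (by positivity), ← Real.rpow_neg (by positivity)]
    congr 1
    push_cast
    have : (2 * (N : ℝ) + 1) ≠ 0 := by positivity
    field_simp
  have h1 : ((n : ℝ) + 1) ^ (1 / 16 : ℝ) ≤ 2 * (n : ℝ) ^ (1 / 16 : ℝ) := by
    calc ((n : ℝ) + 1) ^ (1 / 16 : ℝ) ≤ (2 * n) ^ (1 / 16 : ℝ) :=
          Real.rpow_le_rpow (by positivity) (by linarith) (by norm_num)
      _ = 2 ^ (1 / 16 : ℝ) * (n : ℝ) ^ (1 / 16 : ℝ) := Real.mul_rpow (by norm_num) (by positivity)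
      _ ≤ 2 * (n : ℝ) ^ (1 / 16 : ℝ) := by
          refine mul_le_mul_of_nonneg_right ?_ (by positivity)
          exact Real.rpow_le_self_of_one_le one_le_two (by norm_num)
  rw [pertLevel, mul_pow, e, mul_inv, inv_inv, one_div, inv_pow, inv_inv]
  refine (mul_le_mul_of_nonneg_left h1 (by positivity)).trans_eq ?_
  ring

/-- The constant in front of the decaying bound. -/
def decayConst (K : ℕ) (L Δ M α B : ℝ) : ℝ :=
  K ^ 2 * ((3 + 64 * M ^ 2) * (dirConst K L Δ M α (1 + |B| + 2) * 8
    * (2 * (1 + |B| + 1)) ^ Fintype.card (UpperIdx K) * (2 * (1 + M ^ 2)) ^ Fintype.card (UpperIdx K)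
    / (volume (spectralBox K)).toReal ^ 2 * 2 ^ (2 * Fintype.card (UpperIdx K) + 2)) + 64 * M ^ 2)

lemma decayConst_nonneg (K : ℕ) {M : ℝ} (L Δ α B : ℝ) (hM : 0 ≤ M) :
    0 ≤ decayConst K L Δ M α B := by
  have := dirConst_nonneg K L Δ α (1 + |B| + 2) hM
  unfold decayConst
  positivity

namespace OutputModel

variable {n m K : ℕ} (𝒪 : OutputModel K) {B : ℝ} {r q : ℝ → SymMat K × SymMat K → SymMat K}

lemma pertBound_div_le {α : ℝ} (hn : 1 ≤ n) :
    (volume (perturbationSet K (pertLevel (Fintype.card (UpperIdx K)) n))).toReal⁻¹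
      * 𝒪.pertBound n α (pertLevel (Fintype.card (UpperIdx K)) n) B
      ≤ dirConst K 𝒪.L 𝒪.Δ 𝒪.M α (1 + |B| + 2) * 8
    * (2 * (1 + |B| + 1)) ^ Fintype.card (UpperIdx K)
    * (2 * (1 + 𝒪.M ^ 2)) ^ Fintype.card (UpperIdx K)
    / (volume (spectralBox K)).toReal ^ 2 * 2 ^ (2 * Fintype.card (UpperIdx K) + 2)
      * ((n : ℝ) ^ (1 / 16 : ℝ) / (n : ℝ) ^ (1 / 4 : ℝ)) := by
  set N := Fintype.card (UpperIdx K)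
  have hs := pertLevel_pos N n
  have hV : 0 < (volume (spectralBox K)).toReal :=
    ENNReal.toReal_pos volume_spectralBox_pos.ne' volume_spectralBox_lt_top.ne
  have h := inv_pertLevel_pow_le N hn
  have hd := dirConst_nonneg K 𝒪.L 𝒪.Δ α (1 + |B| + 2) 𝒪.M_nonneg
  have hn0 : (0 : ℝ) < n := by exact_mod_cast hn
  rw [volume_perturbationSet hs.le]
  unfold pertBound
  set s := pertLevel N n
  set V := (volume (spectralBox K)).toReal
  set d := dirConst K 𝒪.L 𝒪.Δ 𝒪.M α (1 + |B| + 2)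
  set y := (n : ℝ) ^ (1 / 4 : ℝ)
  have hy : 0 < y := Real.rpow_pos_of_pos hn0 _
  calc ((s ^ N * V) ^ 2)⁻¹ * (d / y / (s / 8) * (2 * (1 + |B| + 1)) ^ N * (2 * (1 + 𝒪.M ^ 2)) ^ N)
      = d * 8 * (2 * (1 + |B| + 1)) ^ N * (2 * (1 + 𝒪.M ^ 2)) ^ N / V ^ 2 / y
        * (s ^ (2 * N + 1))⁻¹ := by
        field_simp
        ring
    _ ≤ d * 8 * (2 * (1 + |B| + 1)) ^ N * (2 * (1 + 𝒪.M ^ 2)) ^ N / V ^ 2 / y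
        * (2 ^ (2 * N + 2) * (n : ℝ) ^ (1 / 16 : ℝ)) :=
        mul_le_mul_of_nonneg_left h (by positivity)
    _ = _ := by ring

/-- The averaged overlap fluctuation decays. -/
lemma average_overlapFluctuation_le_decay (hn : 1 ≤ n) {α : ℝ} (hα : 0 ≤ α) (hm : (m : ℝ) ≤ α * n)
    (hI : IsInterpolation 𝒪.P0 (pertLevel (Fintype.card (UpperIdx K)) n) B r q)
    (hF : ∀ t ∈ Ioo (0 : ℝ) 1, IsExpandingDiffeo (interpolationMap r q t)
      (perturbationSet K (pertLevel (Fintype.card (UpperIdx K)) n))) :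
    ⨍ ε in perturbationSet K (pertLevel (Fintype.card (UpperIdx K)) n), ∫ t in (0 : ℝ)..1,
        overlapFluctuation n m 𝒪.φ 𝒪.Δ 𝒪.P0 𝒪.PA (pertLevel (Fintype.card (UpperIdx K)) n) t
          (interpolationMap r q t ε)
      ≤ decayConst K 𝒪.L 𝒪.Δ 𝒪.M α B / (n : ℝ) ^ (1 / 16 : ℝ) := by
  have hpb := 𝒪.pertBound_div_le (B := B) (α := α) hn
  unfold decayConst
  set N := Fintype.card (UpperIdx K)
  set s := pertLevel N n
  have hs : 0 < s := pertLevel_pos N n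
  have hn1 : (1 : ℝ) ≤ n := by exact_mod_cast hn
  set x := (n : ℝ) ^ (1 / 16 : ℝ) with hx
  have hx1 : 1 ≤ x := Real.one_le_rpow hn1 (by norm_num)
  have hx0 : 0 < x := by linarith
  have hx4 : (n : ℝ) ^ (1 / 4 : ℝ) = x ^ 4 := by
    rw [hx, ← Real.rpow_natCast, ← Real.rpow_mul (Nat.cast_nonneg n)]; norm_num
  have hvol : 0 < (volume (perturbationSet K s)).toReal := by
    rw [volume_perturbationSet hs.le]
    have : 0 < (volume (spectralBox K)).toReal :=
      ENNReal.toReal_pos volume_spectralBox_pos.ne' volume_spectralBox_lt_top.ne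
    positivity
  have hd := dirConst_nonneg K 𝒪.L 𝒪.Δ α (1 + |B| + 2) 𝒪.M_nonneg
  have h := 𝒪.average_overlapFluctuation_le (m := m) hn hs hI hF fun t ht =>
    𝒪.integral_overlapFluctuation_le hn hα hm hs (pertLevel_le N n) hI ht (hF t ht)
      (a := x⁻¹) (by positivity)
  refine h.trans ?_
  rw [hx4] at hpb
  set c := dirConst K 𝒪.L 𝒪.Δ 𝒪.M α (1 + |B| + 2) * 8 * (2 * (1 + |B| + 1)) ^ N
    * (2 * (1 + 𝒪.M ^ 2)) ^ N / (volume (spectralBox K)).toReal ^ 2 * 2 ^ (2 * N + 2)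
  have hc : 0 ≤ c := by positivity
  set v := (volume (perturbationSet K s)).toReal
  set P := 𝒪.pertBound n α s B
  have e1 : v⁻¹ * (K ^ 2 * ((3 + 64 * 𝒪.M ^ 2 / x⁻¹) * P + 64 * 𝒪.M ^ 2 * x⁻¹ * v))
      = K ^ 2 * ((3 + 64 * 𝒪.M ^ 2 * x) * (v⁻¹ * P) + 64 * 𝒪.M ^ 2 / x) := by
    field_simp
  have e2 : c * (x / x ^ 4) = c / x ^ 3 := by field_simp
  rw [e1, mul_div_assoc (K ^ 2 : ℝ), add_div]
  rw [e2] at hpb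
  refine mul_le_mul_of_nonneg_left (add_le_add_left ?_ _) (by positivity)
  have h1 : (3 + 64 * 𝒪.M ^ 2 * x) ≤ (3 + 64 * 𝒪.M ^ 2) * x := by nlinarith
  calc (3 + 64 * 𝒪.M ^ 2 * x) * (v⁻¹ * P) ≤ ((3 + 64 * 𝒪.M ^ 2) * x) * (c / x ^ 3) :=
        mul_le_mul h1 hpb (mul_nonneg (by positivity) (𝒪.pertBound_nonneg hs)) (by positivity)
    _ = (3 + 64 * 𝒪.M ^ 2) * c / x ^ 2 := by field_simp
    _ ≤ (3 + 64 * 𝒪.M ^ 2) * c / x :=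
        div_le_div_of_nonneg_left (by positivity) hx0 (by nlinarith)

end OutputModel

end

theorem mainTheorem2 (K : ℕ) (φ : (Fin K → ℝ) → ℝ → ℝ) (hφ : RegularActivation φ)
    (S : Set (Fin K → ℝ)) (hS : Bornology.IsBounded S) (α : ℝ) (hα : 0 < α) :
    ∃ C : ℝ, 0 < C ∧
      ∀ (Δ : ℝ), 0 < Δ → ∀ (B : ℝ),
        ∃ s : ℕ → ℝ, (∀ n, 0 < s n ∧ s n ≤ 1 / 2) ∧ Tendsto s atTop (𝓝 0) ∧
        ∃ γ : ℝ, 0 < γ ∧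
          ∀ (P0 : Measure (Fin K → ℝ)) [IsProbabilityMeasure P0], P0.support = S →
          ∀ (PA : Measure ℝ) [IsProbabilityMeasure PA],
          ∀ (n m : ℕ), 1 ≤ n → (m : ℝ) ≤ α * n →
          ∀ (r q : ℝ → SymMat K × SymMat K → SymMat K),
            IsInterpolation P0 (s n) B r q →
            (∀ t ∈ Ioo (0 : ℝ) 1,
              IsExpandingDiffeo (interpolationMap r q t) (perturbationSet K (s n))) →
            IntegrableOn
              (fun x : (SymMat K × SymMat K) × ℝ =>
                overlapFluctuation n m φ Δ P0 PA (s n) x.2 (interpolationMap r q x.2 x.1))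
              (perturbationSet K (s n) ×ˢ Icc (0 : ℝ) 1) ∧
            (⨍ ε in perturbationSet K (s n), ∫ t in (0 : ℝ)..1,
                overlapFluctuation n m φ Δ P0 PA (s n) t (interpolationMap r q t ε))
              ≤ C / (n : ℝ) ^ γ := by
  obtain ⟨L, hL1, hL2, hL3⟩ := hφ.exists_bound
  obtain ⟨M, hM⟩ := hS.exists_norm_le
  have hM0 : 0 ≤ |M| := abs_nonneg M
  refine ⟨2 * (K ^ 2 * (16 * |M| ^ 4) + 1), by positivity, fun Δ hΔ B => ?_⟩
  set N := Fintype.card (UpperIdx K)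
  have hD := decayConst_nonneg K L Δ α B hM0
  refine ⟨pertLevel N, fun n => ⟨pertLevel_pos N n, pertLevel_le N n⟩, tendsto_pertLevel N,
    1 / 16 * interpExponent (decayConst K L Δ |M| α B),
    mul_pos (by norm_num) (interpExponent_pos hD), ?_⟩
  intro P0 _ hP0 PA _ n m hn hm r q hI hF
  let 𝒪 : OutputModel K :=
    { φ := φ, Δ := Δ, PA := PA, P0 := P0, L := L, M := |M|
      prob_PA := inferInstance, prob_P0 := inferInstance
      measurable_φ := hφ.1, abs_φ_le := hL1, lipschitz_φ := hL2, second_φ := hL3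
      Δ_pos := hΔ, M_nonneg := hM0
      ae_abs_le := by
        filter_upwards [P0.support_mem_ae] with w hw l
        rw [hP0] at hw
        exact (norm_le_pi_norm w l).trans ((hM w hw).trans (le_abs_self M)) }
  have hs := pertLevel_pos N n
  have hint := 𝒪.integrableOn_overlapFluctuation (m := m) hn hs hI hF
  refine ⟨?_, ?_⟩
  · unfold IntegrableOn
    rw [OutputModel.restrict_prod_Ioo _ Ioo_ae_eq_Icc]
    exact hint
  · have hn1 : (1 : ℝ) ≤ n := by exact_mod_cast hn
    have h1 := 𝒪.average_overlapFluctuation_le_decay hn hα.le hm hI hF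
    have hvol : 0 < (volume (perturbationSet K (pertLevel N n))).toReal := by
      rw [volume_perturbationSet hs.le]
      have : 0 < (volume (spectralBox K)).toReal :=
        ENNReal.toReal_pos volume_spectralBox_pos.ne' volume_spectralBox_lt_top.ne
      positivity
    have h2 := 𝒪.average_overlapFluctuation_le (m := m) hn hs hI hF
      (c := K ^ 2 * (16 * |M| ^ 4) * (volume (perturbationSet K (pertLevel N n))).toReal)
      fun t ht => by
        refine (le_abs_self _).trans (norm_setIntegral_le_of_norm_le_const
          (f := fun ε => overlapFluctuation n m 𝒪.φ 𝒪.Δ 𝒪.P0 𝒪.PA (pertLevel N n) t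
            (interpolationMap r q t ε)) (s := perturbationSet K (pertLevel N n))
          (volume_perturbationSet_lt_top _) (C := K ^ 2 * (16 * |M| ^ 4)) fun ε _ => ?_)
        rw [Real.norm_eq_abs, abs_of_nonneg (𝒪.overlapFluctuation_nonneg _ ht.1.le hn _)]
        exact 𝒪.overlapFluctuation_le _ ht.1.le hn _
    rw [mul_comm, mul_inv_cancel_right₀ hvol.ne'] at h2
    have h3 := le_of_le_of_le_div (by positivity) hD
      (Real.one_le_rpow hn1 (by norm_num : (0 : ℝ) ≤ 1 / 16)) h2 h1
    rwa [← Real.rpow_mul (Nat.cast_nonneg n)] at h3
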